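/- Let $\nu,\kappa,m\ge 0$ be fixed integers and $\alpha,q>0$ fixed. For $N\ge 1$ let $M=N+\nu$, $L=N+\kappa$, let $q_1^{(N)},\dots,q_M^{(N)}>0$ with $q_l^{(N)}=q$ for $l>m$, and assume that for each $k\le m$ the limit $\hat\theta_k=\lim_{N\to\infty}\frac1N\bigl(1-q_k^{(N)}/q\bigr)$ exists in $\mathbb R$ (then $\hat\theta_k\le 0$). Let $K_N^{(2)}$ be the correlation kernel of the squared singular values of $GX$, where the $L\times M$ matrix $G$ and the $M\times N$ matrix $X$ are complex and independent with density proportional to $\exp[-\alpha\,\mathrm{Tr}\,GG^*-\mathrm{Tr}\,QXX^*]$ and $Q$ has eigenvalues $q_l^{(N)}$, in the form $$K_N^{(2)}(x,y)=\Bigl(\frac xy\Bigr)^{\kappa/2}2\oint_{\gamma_0}\frac{d\eta}{2\pi i}\oint_{\gamma_q}\frac{d\zeta}{2\pi i}\Bigl(\frac\zeta\eta\Bigr)^{N+\kappa/2}\frac{I_\kappa(2\sqrt{\eta x})K_\kappa(2\sqrt{\zeta y})}{\eta-\zeta}\prod_{l=1}^{M}\frac{\eta-\alpha q_l^{(N)}}{\zeta-\alpha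 q_l^{(N)}},$$ where $\gamma_0$ encircles $0$, $\gamma_q$ encircles all $\alpha q_l^{(N)}$ inside the right half-plane, the two do not intersect, and all contours here and below are counter-clockwise circles. Let $$\mathbb K_{\rm III}^{(0,m)}(x,y)=\oint_{\Gamma_{\rm out}}\frac{dv}{2\pi i}\oint_{\Gamma_{\rm in}}\frac{du}{2\pi i}\,\frac{e^{-xv+yu}}{u-v}\,e^{-\frac1u+\frac1v}\Bigl(\frac vu\Bigr)^{\nu-m}\prod_{k=1}^m\frac{v-\hat\theta_k}{u-\hat\theta_k},$$ where $\Gamma_{\rm in}$ encircles $0,\hat\theta_1,\dots,\hat\theta_m$ and $\Gamma_{\rm out}$ encircles $\Gamma_{\rm in}$. Then there is a function $\mathbb K_{\rm I}^{(m)}$ on $(0,\infty)^2$ such that for all $x,y>0$ $$\mathbb K_{\rm I}^{(m)}(x,y)=\lim_{N\to\infty}\frac1{\alpha qN}K_N^{(2)}\Bigl(\frac x{\alpha qN},\frac y{\alpha qN}\Bigr)\Bigl(\frac xy\Bigr)^{-\kappa}=\oint_{|s|=\rho}\frac{ds}{2\pi i}\int_0^\infty dt\,s^{-\kappa-1}t^{\kappa-1}e^{s-t}\,\mathbb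 K_{\rm III}^{(0,m)}\Bigl(\frac xs,\frac yt\Bigr)$$ for every $\rho>0$. Here, if $\nu-m+\#\{k:\hat\theta_k=0\}\le 2\kappa+1$, the $t$-integral converges absolutely for every $s$ on the circle; for general parameters the right-hand side is understood as the limit, as $\varepsilon\downarrow0$, of the same expression with the factor $e^{-\varepsilon/t}$ inserted in the (then absolutely convergent) $t$-integral. Moreover $\mathbb K_{\rm I}^{(m)}$ is a Meijer $G$-kernel with finite rank perturbations: there are functions $f_1,\dots,f_m,g_1,\dots,g_m$ on $(0,\infty)$ with $$\mathbb K_{\rm I}^{(m)}(x,y)=\int_0^1dw\;G^{1,0}_{0,3}\left(\left.{-\atop 0,-\nu,-\kappa}\right|wx\right)G^{2,0}_{0,3}\left(\left.{-\atop \nu,\kappa,0}\right|wy\right)+\sum_{i=1}^m f_i(x)g_i(y),\qquad x,y>0 .$$ -/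

import Mathlib

open Filter Topology MeasureTheory Set

noncomputable section

/-- The modified Bessel function of the first kind `I_κ(z)`, for an integer order `κ ≥ 0`. -/
def besselI (κ : ℕ) (z : ℂ) : ℂ :=
  ∑' k : ℕ, (z / 2) ^ (2 * k + κ) / ((k.factorial : ℂ) * ((k + κ).factorial : ℂ))

/-- The modified Bessel function of the second kind `K_κ(z)`, for `Re z > 0`
(the only arguments at which it is used). -/
def besselK (κ : ℕ) (z : ℂ) : ℂ :=
  ∫ t in Ioi (0 : ℝ), Complex.exp (-z * (Real.cosh t : ℂ)) * (Real.cosh (κ * t) : ℂ)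

/-- The normalised contour integral `∮ dz / (2πi) f(z)` over the circle `|z - c| = R`,
counter-clockwise. -/
def contourInt (c : ℂ) (R : ℝ) (f : ℂ → ℂ) : ℂ :=
  (2 * Real.pi * Complex.I)⁻¹ * ∮ z in C(c, R), f z

/-- Admissible contours for the finite-size kernel: `γ₀ = {|η| = r}` encircles the origin,
`γ_q = {|ζ - c| = R}` encircles all the points `α q_l`, `l < M`, lies with its interior in the open
right half-plane (so it excludes the origin and avoids the cut `(-∞, 0]`), and the two circles do
not meet (nested or side by side). -/
def AdmissibleContours (α : ℝ) (q : ℕ → ℝ) (M : ℕ) (r c R : ℝ) : Prop :=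
  0 < r ∧ 0 < R ∧ R < c ∧ (∀ l, l < M → |α * q l - c| < R) ∧ (r < c - R ∨ c + R < r)

/-- The correlation kernel `K_N^{(2)}(x,y)` of the squared singular values of `G X`, with `G` of
size `(N + κ) × M`, `X` of size `M × N`, density `∝ exp(-α Tr G G* - Tr Q X X*)`, and `q 0, …,
q (M-1)` the eigenvalues of `Q`, as a double contour integral. -/
def kernelIndep (κ N M : ℕ) (α : ℝ) (q : ℕ → ℝ) (r c R : ℝ) (x y : ℝ) : ℂ :=
  (((x / y) ^ ((κ : ℝ) / 2) : ℝ) : ℂ) * 2 *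
    contourInt 0 r fun η => contourInt (c : ℂ) R fun ζ =>
      (ζ / η) ^ N * (ζ ^ ((κ : ℂ) / 2) / η ^ ((κ : ℂ) / 2)) *
        (besselI κ (2 * (η * (x : ℂ)) ^ (1 / 2 : ℂ)) * besselK κ (2 * (ζ * (y : ℂ)) ^ (1 / 2 : ℂ))
          / (η - ζ)) *
        ∏ l ∈ Finset.range M, (η - (α : ℂ) * (q l : ℂ)) / (ζ - (α : ℂ) * (q l : ℂ))

/-- The Bessel kernel with finite rank perturbations `K_III^{(0,m)}(x,y)`, with
`Γ_in = {|u| = a}` and `Γ_out = {|v| = b}`; used for `max |θ_k| < a < b`. -/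
def kernelIII (ν : ℕ) {m : ℕ} (θ : Fin m → ℝ) (a b : ℝ) (x y : ℂ) : ℂ :=
  contourInt 0 b fun v => contourInt 0 a fun u =>
    Complex.exp (-x * v + y * u) / (u - v) * Complex.exp (-1 / u + 1 / v) *
      (v / u) ^ ((ν : ℤ) - (m : ℤ)) * ∏ k : Fin m, (v - (θ k : ℂ)) / (u - (θ k : ℂ))

/-- The `t`-integrand `t^{κ-1} e^{-t} K_III^{(0,m)}(x/s, y/t)`, multiplied by the
regularising factor `e^{-ε/t}` (absent at `ε = 0`). -/
def integrandI (κ ν : ℕ) {m : ℕ} (θ : Fin m → ℝ) (a b ε x y : ℝ) (s : ℂ) (t : ℝ) : ℂ :=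
  (t : ℂ) ^ ((κ : ℤ) - 1) * Complex.exp (-(t : ℂ)) * Complex.exp (-(ε : ℂ) / (t : ℂ)) *
    kernelIII ν θ a b ((x : ℂ) / s) ((y : ℂ) / (t : ℂ))

/-- The `s`- and `t`-integral transform of `K_III^{(0,m)}(x/s, y/t)` (with the regularising factor
`e^{-ε/t}`; the transform itself at `ε = 0`), the contour in `s` being the circle `|s| = ρ`. -/
def transformI (κ ν : ℕ) {m : ℕ} (θ : Fin m → ℝ) (ρ a b ε x y : ℝ) : ℂ :=
  contourInt 0 ρ fun s => s ^ (-(κ : ℤ) - 1) * Complex.exp s *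
    ∫ t in Ioi (0 : ℝ), integrandI κ ν θ a b ε x y s t

/-- The integrand `∏_{i} Γ(b_i + s) / ∏_{j} Γ(1 - b'_j - s) z^{-s}` of the Mellin–Barnes integral
of `G^{m,0}_{0,m+k}`. -/
def meijerIntegrand {m k : ℕ} (b : Fin m → ℝ) (b' : Fin k → ℝ) (z : ℝ) (s : ℂ) : ℂ :=
  (∏ i, Complex.Gamma ((b i : ℂ) + s)) / (∏ j, Complex.Gamma (1 - (b' j : ℂ) - s)) *
    (z : ℂ) ^ (-s)

/-- The Meijer `G`-function `G^{m,0}_{0,m+k}(- ; b, b' | z)` for `z > 0`, with the standard loop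
contour that starts at `-∞ - i`, ends at `-∞ + i`, and encircles all poles of the numerator
counter-clockwise: two horizontal half-lines joined by a segment on `Re s = 1 + ∑ |b_i|`. -/
def meijerG {m k : ℕ} (b : Fin m → ℝ) (b' : Fin k → ℝ) (z : ℝ) : ℂ :=
  (2 * Real.pi * Complex.I)⁻¹ *
    ((∫ σ in Iic (1 + ∑ i, |b i|), meijerIntegrand b b' z ((σ : ℂ) - Complex.I))
      + Complex.I * (∫ τ in (-1 : ℝ)..1,
          meijerIntegrand b b' z (((1 + ∑ i, |b i| : ℝ) : ℂ) + (τ : ℂ) * Complex.I))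
      - ∫ σ in Iic (1 + ∑ i, |b i|), meijerIntegrand b b' z ((σ : ℂ) + Complex.I))

/-- The Meijer `G`-kernel
`∫₀¹ G^{1,0}_{0,3}(- ; 0, -ν, -κ | w x) G^{2,0}_{0,3}(- ; ν, κ, 0 | w y) dw`. -/
def kernelMeijer (ν κ : ℕ) (x y : ℝ) : ℂ :=
  ∫ w in (0 : ℝ)..1,
    meijerG ![0] ![-(ν : ℝ), -(κ : ℝ)] (w * x) * meijerG ![(ν : ℝ), (κ : ℝ)] ![0] (w * y)

end

/-! Put λ = αqN, u = η/λ, v = ζ/λ. The half-integral powers and the Bessel functions combine into an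
entire function F (`besselF`) and H(z) = 2 z^(κ/2) K_κ(2√z) (`besselH`). The rescaled kernel becomes
the double integral of F(ux) Φ_N(u) H(vy) / (Φ_N(v) (u - v)), where Φ_N(u) = u^(-N) ∏ (u - w_l)
converges off the origin to Φ(u) = e^(-1/u) u^(ν-m) ∏ (u + θ_k). The difficulty is that the points
1/N enclosed by the v-circle run into 0, the branch point of H, so that no fixed circle serves for
all N.

The cure is to move the v-integral to one fixed curve through the origin, v = X ω^(3/2) with |ω -
1/2| = 1/2, which meets 0 in the directions ±3π/4. A Mellin–Barnes integral continues H to the slit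
plane with the bound O(|z|^(-1/4)) in that sector (`norm_mellinH_le`), which the Jacobian of the
parametrisation absorbs. Near 0 the curve lies in Re v ≤ -|v|/2, where |v/(v - 1/N)|^N is bounded,
uniformly in large N, by a multiple of any prescribed power of |v| (`norm_div_sub_pow_le`).
Dominated convergence then yields the limit `xiKernel`. The u-integral is carried along as a Cauchy
transform over a fixed large circle; enlarging the u-circle costs only the integral of F(vx) H(vy),
which vanishes (`contourInt_contourInt_eq_xiInt`).

For the transform, a change of sign writes K_III(X, Y) as the integral of e^(-Yw) / Φ(w) times the
Cauchy transform of e^(Xu) Φ(u). The t-integral turns e^(-yw/t) into H(wy + ε) and the s-integral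
turns e^(xu/s) into F(ux) (`transformI_eq`). Translation by ε/y brings the integral to the same
curve, and ε ↓ 0 reproduces `xiKernel` (`tendsto_transformI`). Absolute convergence without ε needs
decay of K_III at Y = δ^(-2): on circles adapted to δ the two exponentials have a real nonpositive
exponent in modulus, and a subtraction at the origin together with a stationary phase estimate gives
O(δ^(-2κ + 1/8)) (`exists_kernelIII_bound`).

For the finite rank statement, (u + θ) v / (u (v + θ)) - 1 = -θ (u - v) / (u (v + θ)) cancels the
Cauchy denominator, so every parameter adds a function of x times a function of y
(`xiKernel_castSucc`). Without parameters, e^(-1/u + 1/v) - 1 is an integral over w in [0, 1] of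
e^(-w/u) e^(w/v), again with the factor u - v split off. The u-integral is a hypergeometric series,
that is G^{1,0}; the v-integral becomes, by Hankel's formula for 1/Γ, the Mellin–Barnes integral of
G^{2,0} over a vertical line (`xiInt_mellinH_mul_exp`). What remains is to match the loop contour
that defines the Meijer functions: by residues for the first (`meijerG_one_two_eq`), by bending the
line for the second (`meijerG_two_one_eq`). -/

/-! ### Holomorphic parameter integrals and homotopy invariance -/

/-- An integral depending holomorphically on a parameter, with locally uniform integrable bounds, is
holomorphic. -/
theorem differentiableOn_integral_of_dominated {α : Type*} [MeasurableSpace α] {μ : Measure α}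
    {F : ℂ → α → ℂ} {U : Set ℂ} (hU : IsOpen U)
    (hmeas : ∀ z ∈ U, AEStronglyMeasurable (F z) μ)
    (hdiff : ∀ᵐ a ∂μ, DifferentiableOn ℂ (fun z => F z a) U)
    (hbound : ∀ z ∈ U, ∃ V ∈ 𝓝 z, ∃ g : α → ℝ, Integrable g μ ∧
      ∀ᵐ a ∂μ, ∀ w ∈ V, ‖F w a‖ ≤ g a) :
    DifferentiableOn ℂ (fun z => ∫ a, F z a ∂μ) U := by
  intro z₀ hz₀
  obtain ⟨V, hV, g, hg, hFg⟩ := hbound z₀ hz₀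
  obtain ⟨r, hr, hrV⟩ := Metric.nhds_basis_closedBall.mem_iff.1 (inter_mem hV (hU.mem_nhds hz₀))
  have hr2 : 0 < r / 2 := by positivity
  have hsub : ∀ w ∈ Metric.ball z₀ (r / 2), Metric.closedBall w (r / 2) ⊆ V ∩ U := by
    intro w hw
    refine Subset.trans (fun v hv => ?_) hrV
    rw [Metric.mem_closedBall] at *
    have h1 := Metric.mem_ball.1 hw
    have h2 := dist_triangle v w z₀
    linarith
  have hmemU : ∀ w ∈ Metric.ball z₀ (r / 2), w ∈ U := fun w hw =>
    (hsub w hw (Metric.mem_closedBall_self hr2.le)).2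
  set F' : ℂ → α → ℂ := fun z a => deriv (fun z => F z a) z with hF'
  have hderiv : ∀ᵐ a ∂μ, ∀ w ∈ Metric.ball z₀ (r / 2), HasDerivAt (F · a) (F' w a) w := by
    filter_upwards [hdiff] with a ha w hw
    exact ((ha w (hmemU w hw)).differentiableAt (hU.mem_nhds (hmemU w hw))).hasDerivAt
  -- The derivative in the parameter is measurable as a pointwise limit of difference quotients
  -- along a sequence tending to 0.
  have hF'meas : AEStronglyMeasurable (F' z₀) μ := by
    set h : ℕ → ℂ := fun n => ((r / 2) / (n + 1) / 2 : ℝ)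
    have hne : ∀ n, h n ≠ 0 := by
      intro n
      simp only [h, ne_eq, Complex.ofReal_eq_zero]
      positivity
    have hmem : ∀ n, z₀ + h n ∈ U := by
      intro n
      apply hmemU
      simp only [h, Metric.mem_ball, dist_self_add_left, Complex.norm_real, Real.norm_eq_abs]
      rw [abs_of_nonneg (by positivity)]
      have : (r / 2) / (n + 1) ≤ r / 2 := div_le_self hr2.le (by linarith [n.cast_nonneg (α := ℝ)])
      linarith
    have hlim : Tendsto h atTop (𝓝[≠] 0) := by
      rw [tendsto_nhdsWithin_iff]
      refine ⟨?_, Eventually.of_forall fun n => by simpa using hne n⟩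
      have h1 : Tendsto (fun n : ℕ => (r / 2) / ((n : ℝ) + 1) / 2) atTop (𝓝 0) := by
        have h2 : Tendsto (fun n : ℕ => (n : ℝ) + 1) atTop atTop :=
          tendsto_atTop_add_const_right _ _ tendsto_natCast_atTop_atTop
        simpa using (h2.const_div_atTop (r / 2)).div_const 2
      have h3 := (Complex.continuous_ofReal.tendsto 0).comp h1
      simpa [h, Function.comp_def] using h3
    refine aestronglyMeasurable_of_tendsto_ae atTop
      (f := fun n a => (h n)⁻¹ • (F (z₀ + h n) a - F z₀ a)) (fun n => ?_) ?_
    · exact ((hmeas _ (hmem n)).sub (hmeas _ hz₀)).const_smul ((h n)⁻¹)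
    · filter_upwards [hderiv] with a ha
      exact (ha z₀ (Metric.mem_ball_self hr2)).tendsto_slope_zero.comp hlim
  have hint : Integrable (F z₀) μ := by
    refine hg.mono' (hmeas z₀ hz₀) ?_
    filter_upwards [hFg] with a ha
    exact ha z₀ (hrV (Metric.mem_closedBall_self hr.le)).1
  -- Cauchy's estimate on discs of radius r / 2 turns the bound g for the integrand into the bound g
  -- / (r / 2) for its derivative.
  have key := hasDerivAt_integral_of_dominated_loc_of_deriv_le (μ := μ) (F := F) (F' := F')
    (bound := fun a => g a / (r / 2)) (Metric.ball_mem_nhds z₀ hr2)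
    (by filter_upwards [hU.mem_nhds hz₀] with w hw using hmeas w hw)
    hint hF'meas ?_ (hg.div_const _) hderiv
  · exact key.2.differentiableAt.differentiableWithinAt
  · filter_upwards [hFg, hdiff] with a ha hd w hw
    refine Complex.norm_deriv_le_of_forall_mem_sphere_norm_le hr2 ?_ ?_
    · refine DifferentiableOn.diffContOnCl ?_
      rw [closure_ball _ hr2.ne']
      exact hd.mono fun v hv => (hsub w hw hv).2
    · exact fun v hv => ha v (hsub w hw (Metric.sphere_subset_closedBall hv)).1

/-- The integral of a holomorphic function along a closed curve is invariant under `C²`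
homotopies of closed curves. -/
theorem integral_closedCurve_homotopy {f : ℂ → ℂ} {U : Set ℂ} (hU : IsOpen U)
    (hf : DifferentiableOn ℂ f U) {γ : ℝ × ℝ → ℂ} (hγ : ContDiff ℝ 2 γ) {T : ℝ}
    (hmem : ∀ τ ∈ Icc (0 : ℝ) 1, ∀ θ : ℝ, γ (τ, θ) ∈ U) (hper : ∀ τ, γ (τ, T) = γ (τ, 0)) :
    (∫ θ in (0 : ℝ)..T, f (γ (0, θ)) * fderiv ℝ γ (0, θ) (0, 1)) =
      ∫ θ in (0 : ℝ)..T, f (γ (1, θ)) * fderiv ℝ γ (1, θ) (0, 1) := by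
  have hfc : ContinuousOn f U := hf.continuousOn
  have hγd : ∀ p, HasFDerivAt γ (fderiv ℝ γ p) p := fun p =>
    (hγ.differentiable (by norm_num) p).hasFDerivAt
  have hγ1 : ContDiff ℝ 1 (fderiv ℝ γ) := hγ.fderiv_right (by norm_num)
  have hγ1c : Continuous (fderiv ℝ γ) := hγ1.continuous
  have hγ2 : ∀ p, HasFDerivAt (fderiv ℝ γ) (fderiv ℝ (fderiv ℝ γ) p) p := fun p =>
    (hγ1.differentiable (by norm_num) p).hasFDerivAt
  have hγ2c : Continuous (fderiv ℝ (fderiv ℝ γ)) := hγ1.continuous_fderiv (by norm_num)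
  have hsymm : ∀ p, fderiv ℝ (fderiv ℝ γ) p (1, 0) (0, 1) = fderiv ℝ (fderiv ℝ γ) p (0, 1) (1, 0) :=
    fun p => (hγ.contDiffAt.isSymmSndFDerivAt (by simp)) _ _
  have hmaps : MapsTo γ (uIcc (0 : ℝ) 1 ×ˢ uIcc (0 : ℝ) T) U := by
    rintro ⟨τ, θ⟩ ⟨h1, -⟩
    exact hmem τ (by simpa [uIcc_of_le] using h1) θ
  have hfd : ∀ p ∈ (uIcc (0 : ℝ) 1 ×ˢ uIcc (0 : ℝ) T), HasFDerivAt (fun p => f (γ p))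
      (deriv f (γ p) • fderiv ℝ γ p) p := by
    intro p hp
    have h1 : HasDerivAt f (deriv f (γ p)) (γ p) :=
      ((hf _ (hmaps hp)).differentiableAt (hU.mem_nhds (hmaps hp))).hasDerivAt
    exact h1.comp_hasFDerivAt p (hγd p)
  have hsecond : ∀ (v : ℝ × ℝ) (p : ℝ × ℝ), HasFDerivAt (fun p => fderiv ℝ γ p v)
      ((fderiv ℝ (fderiv ℝ γ) p).flip v) p := by
    intro v p
    have h1 := (hγ2 p).clm_apply (hasFDerivAt_const v p)
    exact h1.congr_fderiv (by ext <;> simp)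
  have hprod : ∀ (v : ℝ × ℝ), ∀ p ∈ (uIcc (0 : ℝ) 1 ×ˢ uIcc (0 : ℝ) T),
      HasFDerivAt (fun p => f (γ p) * fderiv ℝ γ p v)
      (f (γ p) • (fderiv ℝ (fderiv ℝ γ) p).flip v + fderiv ℝ γ p v •
        (deriv f (γ p) • fderiv ℝ γ p)) p := fun v p hp => (hfd p hp).mul (hsecond v p)
  have hoo : ∀ p ∈ Ioo (min (0 : ℝ) 1) (max 0 1) ×ˢ Ioo (min (0 : ℝ) T) (max 0 T),
      p ∈ (uIcc (0 : ℝ) 1 ×ˢ uIcc (0 : ℝ) T) := fun p hp =>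
    ⟨Ioo_subset_Icc_self hp.1, Ioo_subset_Icc_self hp.2⟩
  have hcont : ∀ v : ℝ × ℝ, ContinuousOn (fun p => f (γ p) * fderiv ℝ γ p v)
      (uIcc (0 : ℝ) 1 ×ˢ uIcc (0 : ℝ) T) := fun v p hp =>
    (hprod v p hp).continuousAt.continuousWithinAt
  -- The pulled-back form f(γ) dγ is closed: the terms with f' cancel because complex multiplication
  -- commutes, those with second derivatives because mixed partials agree.
  have hdiv : ∀ p : ℝ × ℝ, (f (γ p) • (fderiv ℝ (fderiv ℝ γ) p).flip (0, 1) + fderiv ℝ γ p (0, 1) •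
        (deriv f (γ p) • fderiv ℝ γ p)) (1, 0) +
      (-(f (γ p) • (fderiv ℝ (fderiv ℝ γ) p).flip (1, 0) + fderiv ℝ γ p (1, 0) •
        (deriv f (γ p) • fderiv ℝ γ p))) (0, 1) = 0 := by
    intro p
    simp only [add_apply, smul_apply, neg_apply, ContinuousLinearMap.flip_apply, smul_eq_mul, hsymm p]
    ring
  have key := integral2_divergence_prod_of_hasFDerivAt (fun p => f (γ p) * fderiv ℝ γ p (0, 1))
    (fun p => -(f (γ p) * fderiv ℝ γ p (1, 0))) _ _ 0 0 1 T (hcont _) (hcont _).neg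
    (fun p hp => hprod (0, 1) p (hoo p hp)) (fun p hp => (hprod (1, 0) p (hoo p hp)).neg)
    (by simp only [hdiv]; exact integrableOn_zero)
  simp only [hdiv] at key
  -- Closedness of every intermediate curve also identifies the derivatives in τ at both ends, so
  -- the two lateral sides of the rectangle cancel.
  have hperd : ∀ τ, fderiv ℝ γ (τ, T) (1, 0) = fderiv ℝ γ (τ, 0) (1, 0) := by
    have aux : ∀ τ θ : ℝ, HasDerivAt (fun τ => γ (τ, θ)) (fderiv ℝ γ (τ, θ) (1, 0)) τ := by
      intro τ θ
      have h1 : HasDerivAt (fun τ : ℝ => (τ, θ)) ((1 : ℝ), (0 : ℝ)) τ :=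
        (hasDerivAt_id τ).prodMk (hasDerivAt_const τ θ)
      exact (hγd (τ, θ)).comp_hasDerivAt τ h1
    intro τ
    have h2 := aux τ T
    simp only [hper] at h2
    exact h2.unique (aux τ 0)
  simp only [hper, hperd, intervalIntegral.integral_zero, sub_self, zero_add] at key
  exact (sub_eq_zero.1 key.symm).symm

/-! ### Calculus of normalised circle integrals -/

theorem contourInt_eq_intervalIntegral (c : ℂ) (R : ℝ) (f : ℂ → ℂ) :
    contourInt c R f = (2 * Real.pi : ℂ)⁻¹ *
      ∫ θ in (0 : ℝ)..2 * Real.pi, circleMap 0 R θ * f (circleMap c R θ) := by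
  have h : ∀ θ : ℝ, deriv (circleMap c R) θ • f (circleMap c R θ) =
      Complex.I * (circleMap 0 R θ * f (circleMap c R θ)) := by
    intro θ
    rw [deriv_circleMap, smul_eq_mul]
    ring
  simp only [contourInt, circleIntegral, h, intervalIntegral.integral_const_mul]
  have := Complex.I_ne_zero
  have := Real.pi_ne_zero
  field_simp

theorem contourInt_congr {c : ℂ} {R : ℝ} (hR : 0 ≤ R) {f g : ℂ → ℂ}
    (h : ∀ z ∈ Metric.sphere c R, f z = g z) : contourInt c R f = contourInt c R g := by
  rw [contourInt, contourInt, circleIntegral.integral_congr hR h]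

theorem contourInt_const_mul (a : ℂ) (c : ℂ) (R : ℝ) (f : ℂ → ℂ) :
    contourInt c R (fun z => a * f z) = a * contourInt c R f := by
  rw [contourInt, contourInt, circleIntegral.integral_const_mul]
  ring

theorem contourInt_mul_const (a : ℂ) (c : ℂ) (R : ℝ) (f : ℂ → ℂ) :
    contourInt c R (fun z => f z * a) = contourInt c R f * a := by
  simp_rw [mul_comm _ a]
  exact contourInt_const_mul a c R f

theorem contourInt_add {c : ℂ} {R : ℝ} {f g : ℂ → ℂ} (hf : CircleIntegrable f c R)
    (hg : CircleIntegrable g c R) :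
    contourInt c R (fun z => f z + g z) = contourInt c R f + contourInt c R g := by
  rw [contourInt, circleIntegral.integral_add hf hg, mul_add]
  rfl

theorem contourInt_sub {c : ℂ} {R : ℝ} {f g : ℂ → ℂ} (hf : CircleIntegrable f c R)
    (hg : CircleIntegrable g c R) :
    contourInt c R (fun z => f z - g z) = contourInt c R f - contourInt c R g := by
  rw [contourInt, circleIntegral.integral_sub hf hg, mul_sub]
  rfl

theorem norm_contourInt_le {c : ℂ} {R C : ℝ} (hR : 0 ≤ R) {f : ℂ → ℂ}
    (h : ∀ z ∈ Metric.sphere c R, ‖f z‖ ≤ C) : ‖contourInt c R f‖ ≤ R * C := by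
  have := circleIntegral.norm_two_pi_i_inv_smul_integral_le_of_norm_le_const hR h
  simpa [contourInt] using this

theorem circleMap_smul (c : ℂ) (R k θ : ℝ) :
    circleMap (k * c) (k * R) θ = k * circleMap c R θ := by
  simp [circleMap]
  ring

theorem contourInt_scale (c : ℂ) (R k : ℝ) (f : ℂ → ℂ) :
    contourInt (k * c) (k * R) f = k * contourInt c R (fun z => f (k * z)) := by
  rw [contourInt_eq_intervalIntegral, contourInt_eq_intervalIntegral]
  have h : ∀ θ : ℝ, circleMap 0 (k * R) θ * f (circleMap (k * c) (k * R) θ) =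
      k * (circleMap 0 R θ * f (k * circleMap c R θ)) := by
    intro θ
    rw [circleMap_smul]
    have := circleMap_smul 0 R k θ
    rw [mul_zero] at this
    rw [this]
    ring
  simp only [h, intervalIntegral.integral_const_mul]
  ring

theorem contourInt_translate (c d : ℂ) (R : ℝ) (f : ℂ → ℂ) :
    contourInt (c + d) R f = contourInt c R (fun z => f (z + d)) := by
  rw [contourInt_eq_intervalIntegral, contourInt_eq_intervalIntegral]
  congr 2
  ext θ
  congr 2
  simp [circleMap]
  ring

/-- The reflection z ↦ -z rotates the circle by a half-turn and keeps its orientation, while dz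
changes sign. -/
theorem contourInt_neg (R : ℝ) (f : ℂ → ℂ) :
    contourInt 0 R f = -contourInt 0 R (fun z => f (-z)) := by
  have hpi : ∀ θ : ℝ, circleMap 0 R (θ + Real.pi) = -circleMap 0 R θ := by
    intro θ
    simp [circleMap, add_mul, Complex.exp_add, Complex.exp_pi_mul_I]
  rw [contourInt_eq_intervalIntegral, contourInt_eq_intervalIntegral, ← mul_neg,
    ← intervalIntegral.integral_neg]
  congr 1
  have h1 : ∀ θ : ℝ, -(circleMap 0 R θ * f (-circleMap 0 R θ)) =
      (fun θ => circleMap 0 R θ * f (circleMap 0 R θ)) (θ + Real.pi) := by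
    intro θ
    simp only [hpi]
    ring
  simp only [h1]
  have hp : Function.Periodic (fun θ => circleMap 0 R θ * f (circleMap 0 R θ)) (2 * Real.pi) := by
    intro θ
    simp only [periodic_circleMap 0 R θ]
  rw [intervalIntegral.integral_comp_add_right
    (fun θ => circleMap 0 R θ * f (circleMap 0 R θ)), add_comm (2 * Real.pi),
    zero_add, hp.intervalIntegral_add_eq Real.pi 0, zero_add]

/-- One point of a circle is negligible. This lets the later estimates ignore the parameter value 0,
where the curve meets the branch point. -/
theorem ae_circleMap_ne {c p : ℂ} {R : ℝ} (hR : R ≠ 0) : ∀ᵐ θ : ℝ, circleMap c R θ ≠ p := by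
  have h : (circleMap c R ⁻¹' {p}).Countable := (countable_singleton p).preimage_circleMap c hR
  exact h.ae_notMem volume

theorem circleMap_mem_sphere_diff {c p : ℂ} {R θ : ℝ} (hR : 0 ≤ R) (h : circleMap c R θ ≠ p) :
    circleMap c R θ ∈ Metric.sphere c R \ {p} :=
  ⟨circleMap_mem_sphere c hR θ, h⟩

theorem aestronglyMeasurable_comp_circleMap {c p : ℂ} {R : ℝ} (hR : 0 < R) {f : ℂ → ℂ}
    (hf : ContinuousOn f (Metric.sphere c R \ {p})) :
    AEStronglyMeasurable (fun θ => f (circleMap c R θ)) volume := by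
  have hm : MeasurableSet {θ : ℝ | circleMap c R θ ≠ p} :=
    (measurable_circleMap c R) (measurableSet_singleton p).compl
  have h1 : AEStronglyMeasurable (fun θ => f (circleMap c R θ))
      (volume.restrict {θ : ℝ | circleMap c R θ ≠ p}) := by
    refine ContinuousOn.aestronglyMeasurable ?_ hm
    exact hf.comp (continuous_circleMap c R).continuousOn
      fun θ hθ => circleMap_mem_sphere_diff hR.le hθ
  rwa [Measure.restrict_eq_self_of_ae_mem (s := {θ : ℝ | circleMap c R θ ≠ p})
    (ae_circleMap_ne hR.ne')] at h1

theorem circleIntegrable_of_continuousOn_diff {c p : ℂ} {R C : ℝ} (hR : 0 < R) {f : ℂ → ℂ}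
    (hf : ContinuousOn f (Metric.sphere c R \ {p}))
    (hC : ∀ z ∈ Metric.sphere c R \ {p}, ‖f z‖ ≤ C) : CircleIntegrable f c R := by
  rw [CircleIntegrable, intervalIntegrable_iff]
  refine Measure.integrableOn_of_bounded (M := C) measure_Ioc_lt_top.ne
    (aestronglyMeasurable_comp_circleMap hR hf) ?_
  filter_upwards [ae_restrict_of_ae (ae_circleMap_ne (c := c) (p := p) hR.ne')] with θ hθ
  exact hC _ (circleMap_mem_sphere_diff hR.le hθ)

/-- Dominated convergence for contour integrals; one point of the circle may be ignored. -/
theorem tendsto_contourInt {ι : Type*} {l : Filter ι} [l.IsCountablyGenerated] {c p : ℂ} {R C : ℝ}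
    (hR : 0 < R) {F : ι → ℂ → ℂ} {f : ℂ → ℂ}
    (hF : ∀ᶠ n in l, ContinuousOn (F n) (Metric.sphere c R \ {p}))
    (hC : ∀ᶠ n in l, ∀ z ∈ Metric.sphere c R \ {p}, ‖F n z‖ ≤ C)
    (hlim : ∀ z ∈ Metric.sphere c R \ {p}, Tendsto (fun n => F n z) l (𝓝 (f z))) :
    Tendsto (fun n => contourInt c R (F n)) l (𝓝 (contourInt c R f)) := by
  simp only [contourInt_eq_intervalIntegral]
  refine Tendsto.const_mul _ ?_
  refine intervalIntegral.tendsto_integral_filter_of_dominated_convergence (fun _ => R * C) ?_ ?_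
    (by simp) ?_
  · filter_upwards [hF] with n hn
    exact ((continuous_circleMap 0 R).aestronglyMeasurable.mul
      (aestronglyMeasurable_comp_circleMap hR hn)).restrict
  · filter_upwards [hC] with n hn
    filter_upwards [ae_circleMap_ne (c := c) (p := p) hR.ne'] with θ hθ _
    rw [norm_mul, norm_circleMap_zero, abs_of_pos hR]
    exact mul_le_mul_of_nonneg_left (hn _ (circleMap_mem_sphere_diff hR.le hθ)) hR.le
  · filter_upwards [ae_circleMap_ne (c := c) (p := p) hR.ne'] with θ hθ _
    exact (hlim _ (circleMap_mem_sphere_diff hR.le hθ)).const_mul _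

/-- Interchange of a contour integral and an integral over a subset of the line, under an integrable
bound; one point of the circle may be ignored. -/
theorem contourInt_integral_swap {c p : ℂ} {R : ℝ} (hR : 0 < R) {S : Set ℝ} (hS : MeasurableSet S)
    {f : ℂ → ℝ → ℂ} {g : ℝ → ℝ}
    (hf : ContinuousOn (Function.uncurry f) ((Metric.sphere c R \ {p}) ×ˢ S))
    (hg : IntegrableOn g S) (hfg : ∀ z ∈ Metric.sphere c R \ {p}, ∀ t ∈ S, ‖f z t‖ ≤ g t) :
    contourInt c R (fun z => ∫ t in S, f z t) = ∫ t in S, contourInt c R (fun z => f z t) := by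
  simp only [contourInt_eq_intervalIntegral]
  rw [integral_const_mul]
  congr 1
  simp only [← integral_const_mul, intervalIntegral.integral_of_le Real.two_pi_pos.le]
  refine integral_integral_swap ?_
  have hm : MeasurableSet {θ : ℝ | circleMap c R θ ≠ p} :=
    (measurable_circleMap c R) (measurableSet_singleton p).compl
  have hres : (volume.restrict (Ioc 0 (2 * Real.pi))).prod (volume.restrict S) =
      ((volume : Measure ℝ).prod volume).restrict
        ((Ioc 0 (2 * Real.pi) ∩ {θ : ℝ | circleMap c R θ ≠ p}) ×ˢ S) := by
    rw [← Measure.prod_restrict]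
    congr 1
    refine Measure.restrict_congr_set ?_
    filter_upwards [ae_circleMap_ne (c := c) (p := p) hR.ne'] with θ hθ
    exact propext ⟨fun h => ⟨h, hθ⟩, fun h => h.1⟩
  have hmeas : AEStronglyMeasurable (Function.uncurry fun (θ : ℝ) (t : ℝ) =>
      circleMap 0 R θ * f (circleMap c R θ) t)
      ((volume.restrict (Ioc 0 (2 * Real.pi))).prod (volume.restrict S)) := by
    rw [hres]
    refine ContinuousOn.aestronglyMeasurable ?_ ((measurableSet_Ioc.inter hm).prod hS)
    refine ContinuousOn.mul ((continuous_circleMap 0 R).comp continuous_fst).continuousOn ?_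
    refine hf.comp (f := fun q : ℝ × ℝ => (circleMap c R q.1, q.2))
      (by fun_prop) ?_
    rintro ⟨θ, t⟩ ⟨⟨-, hθ⟩, ht⟩
    exact ⟨circleMap_mem_sphere_diff hR.le hθ, ht⟩
  have hb : Integrable (Function.uncurry fun (_ : ℝ) (t : ℝ) => R * g t)
      ((volume.restrict (Ioc 0 (2 * Real.pi))).prod (volume.restrict S)) := by
    have h1 : Integrable (fun _ : ℝ => R) (volume.restrict (Ioc 0 (2 * Real.pi))) := by simp
    exact h1.mul_prod hg
  refine hb.mono' hmeas ?_
  rw [hres]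
  refine (ae_restrict_iff' ((measurableSet_Ioc.inter hm).prod hS)).2 (Eventually.of_forall ?_)
  rintro ⟨θ, t⟩ ⟨⟨-, hθ⟩, ht⟩
  simp only [Function.uncurry_apply_pair, norm_mul, norm_circleMap_zero, abs_of_pos hR]
  exact mul_le_mul_of_nonneg_left (hfg _ (circleMap_mem_sphere_diff hR.le hθ) t ht) hR.le

/-- Interchange of two contour integrals. -/
theorem contourInt_swap {c c' : ℂ} {R R' : ℝ} (hR : 0 < R) (hR' : 0 < R') {f : ℂ → ℂ → ℂ}
    (hf : ContinuousOn (Function.uncurry f) (Metric.sphere c R ×ˢ Metric.sphere c' R')) :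
    contourInt c R (fun z => contourInt c' R' (fun w => f z w)) =
      contourInt c' R' (fun w => contourInt c R (fun z => f z w)) := by
  obtain ⟨C, hC⟩ := ((isCompact_sphere c R).prod (isCompact_sphere c' R')).exists_bound_of_continuousOn hf
  -- The second circle is unrolled to an interval. The exempted point is the centre, which is not on
  -- the circle, so nothing is lost.
  have h := contourInt_integral_swap (c := c) (p := c) hR (S := Ioc 0 (2 * Real.pi)) measurableSet_Ioc
    (f := fun z θ => circleMap 0 R' θ * f z (circleMap c' R' θ)) (g := fun _ => R' * C) ?_
    (integrableOn_const measure_Ioc_lt_top.ne) ?_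
  · simp only [contourInt_const_mul] at h
    simp only [contourInt_eq_intervalIntegral c' R', intervalIntegral.integral_of_le
      Real.two_pi_pos.le, contourInt_const_mul, h]
  · refine ContinuousOn.mul ((continuous_circleMap 0 R').comp continuous_snd).continuousOn ?_
    refine hf.comp (f := fun q : ℂ × ℝ => (q.1, circleMap c' R' q.2)) (by fun_prop) ?_
    rintro ⟨z, t⟩ ⟨⟨hz, -⟩, -⟩
    exact ⟨hz, circleMap_mem_sphere c' hR'.le t⟩
  · intro z hz t _
    rw [norm_mul, norm_circleMap_zero, abs_of_pos hR']
    exact mul_le_mul_of_nonneg_left (hC (z, _) ⟨hz.1, circleMap_mem_sphere c' hR'.le t⟩) hR'.le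

/-! ### Deformation of circles -/

/-- Deformation of one circle into another through the interpolating circles. -/
theorem contourInt_deform_circle {f : ℂ → ℂ} {U : Set ℂ} (hU : IsOpen U)
    (hf : DifferentiableOn ℂ f U) {c₀ c₁ : ℂ} {R₀ R₁ : ℝ}
    (hmem : ∀ τ ∈ Icc (0 : ℝ) 1, ∀ θ : ℝ,
      circleMap (c₀ + τ * (c₁ - c₀)) (R₀ + τ * (R₁ - R₀)) θ ∈ U) :
    contourInt c₀ R₀ f = contourInt c₁ R₁ f := by
  set γ : ℝ × ℝ → ℂ := fun p => (c₀ + p.1 * (c₁ - c₀)) +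
    ((R₀ + p.1 * (R₁ - R₀) : ℝ) : ℂ) * Complex.exp (p.2 * Complex.I) with hγdef
  have hofReal : ContDiff ℝ 2 (fun x : ℝ => (x : ℂ)) := Complex.ofRealCLM.contDiff
  have hγ : ContDiff ℝ 2 γ := by
    have h1 : ContDiff ℝ 2 (fun p : ℝ × ℝ => (p.1 : ℂ)) := hofReal.comp contDiff_fst
    have h2 : ContDiff ℝ 2 (fun p : ℝ × ℝ => (p.2 : ℂ)) := hofReal.comp contDiff_snd
    have h3 : ContDiff ℝ 2 (fun p : ℝ × ℝ => ((R₀ + p.1 * (R₁ - R₀) : ℝ) : ℂ)) := by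
      refine hofReal.comp ?_
      fun_prop
    refine ContDiff.add (contDiff_const.add (h1.mul contDiff_const)) (h3.mul ?_)
    exact (h2.mul contDiff_const).cexp
  have hγmap : ∀ τ θ : ℝ, γ (τ, θ) = circleMap (c₀ + τ * (c₁ - c₀)) (R₀ + τ * (R₁ - R₀)) θ :=
    fun τ θ => rfl
  have hγd : ∀ τ θ : ℝ, fderiv ℝ γ (τ, θ) (0, 1) =
      circleMap 0 (R₀ + τ * (R₁ - R₀)) θ * Complex.I := by
    intro τ θ
    have h1 : HasDerivAt (fun θ : ℝ => (τ, θ)) ((0 : ℝ), (1 : ℝ)) θ :=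
      (hasDerivAt_const θ τ).prodMk (hasDerivAt_id θ)
    have h2 := ((hγ.differentiable (by norm_num) (τ, θ)).hasFDerivAt).comp_hasDerivAt θ h1
    exact h2.unique (hasDerivAt_circleMap (c₀ + τ * (c₁ - c₀)) (R₀ + τ * (R₁ - R₀)) θ)
  have key := integral_closedCurve_homotopy hU hf hγ (T := 2 * Real.pi)
    (fun τ hτ θ => by rw [hγmap]; exact hmem τ hτ θ)
    (fun τ => by rw [hγmap, hγmap]; simpa using periodic_circleMap _ _ 0)
  simp only [hγd] at key
  simp only [hγmap] at key
  rw [contourInt, contourInt]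
  congr 1
  simp only [circleIntegral, deriv_circleMap, smul_eq_mul]
  have e0 : ∀ θ : ℝ, circleMap 0 R₀ θ * Complex.I * f (circleMap c₀ R₀ θ) =
    f (circleMap c₀ R₀ θ) * (circleMap 0 R₀ θ * Complex.I) := fun θ => by ring
  have e1 : ∀ θ : ℝ, circleMap 0 R₁ θ * Complex.I * f (circleMap c₁ R₁ θ) =
    f (circleMap c₁ R₁ θ) * (circleMap 0 R₁ θ * Complex.I) := fun θ => by ring
  simpa [e0, e1] using key

theorem re_pos_of_mem_sphere_half {r : ℝ} (hr : r < 1 / 2) {ω : ℂ}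
    (hω : ω ∈ Metric.sphere (1 / 2 : ℂ) r) : 0 < ω.re := by
  have h1 : |(ω - 1 / 2).re| ≤ r := (Complex.abs_re_le_norm _).trans (mem_sphere_iff_norm.1 hω).le
  have h2 := (abs_le.1 h1).1
  simp at h2
  linarith

/-- Deformation of a circle in the right half-plane into its image under the power map
`ω ↦ ω ^ (3 / 2)`. -/
theorem contourInt_deform_pow {f : ℂ → ℂ} {U : Set ℂ} (hU : IsOpen U)
    (hf : DifferentiableOn ℂ f U) {X r : ℝ} (hr0 : 0 ≤ r) (hr : r < 1 / 2)
    (hmem : ∀ τ ∈ Icc (0 : ℝ) 1, ∀ ω ∈ Metric.sphere (1 / 2 : ℂ) r,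
      X * ω ^ ((1 + τ / 2 : ℝ) : ℂ) ∈ U) :
    contourInt (X * (1 / 2)) (X * r) f =
      contourInt (1 / 2) r (fun ω => f (X * ω ^ (3 / 2 : ℂ)) * (X * (3 / 2) * ω ^ (1 / 2 : ℂ))) := by
  have hre : ∀ θ : ℝ, 0 < (circleMap (1 / 2 : ℂ) r θ).re := fun θ =>
    re_pos_of_mem_sphere_half hr (circleMap_mem_sphere _ hr0 θ)
  have hslit : ∀ θ : ℝ, circleMap (1 / 2 : ℂ) r θ ∈ Complex.slitPlane := fun θ =>
    Or.inl (hre θ)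
  have hne : ∀ θ : ℝ, circleMap (1 / 2 : ℂ) r θ ≠ 0 := fun θ =>
    Complex.slitPlane_ne_zero (hslit θ)
  -- The homotopy raises ω to an exponent running from 1 to 3/2; writing it through exp and log
  -- makes it C² in both variables.
  set γ : ℝ × ℝ → ℂ := fun p => X * Complex.exp (Complex.log (circleMap (1 / 2) r p.2) *
    ((1 + p.1 / 2 : ℝ) : ℂ)) with hγdef
  have hγ : ContDiff ℝ 2 γ := by
    refine contDiff_const.mul (ContDiff.cexp (ContDiff.mul ?_ ?_))
    · refine contDiff_iff_contDiffAt.2 fun p => ?_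
      have h1 : ContDiffAt ℝ 2 Complex.log (circleMap (1 / 2) r p.2) :=
        (Complex.contDiffAt_log (hslit p.2)).restrict_scalars ℝ
      exact h1.comp p ((contDiff_circleMap _ _).comp contDiff_snd).contDiffAt
    · have h2 : ContDiff ℝ 2 (fun p : ℝ × ℝ => 1 + p.1 / 2) := by fun_prop
      exact Complex.ofRealCLM.contDiff.comp h2
  have hγpow : ∀ τ θ : ℝ, γ (τ, θ) = X * (circleMap (1 / 2 : ℂ) r θ) ^ ((1 + τ / 2 : ℝ) : ℂ) := by
    intro τ θ
    simp only [hγdef]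
    rw [Complex.cpow_def_of_ne_zero (hne θ)]
  have hγd : ∀ τ θ : ℝ, fderiv ℝ γ (τ, θ) (0, 1) =
      X * (((1 + τ / 2 : ℝ) : ℂ) * (circleMap (1 / 2 : ℂ) r θ) ^ (((1 + τ / 2 : ℝ) : ℂ) - 1) *
        (circleMap 0 r θ * Complex.I)) := by
    intro τ θ
    have h1 : HasDerivAt (fun θ : ℝ => (τ, θ)) ((0 : ℝ), (1 : ℝ)) θ :=
      (hasDerivAt_const θ τ).prodMk (hasDerivAt_id θ)
    have h2 := ((hγ.differentiable (by norm_num) (τ, θ)).hasFDerivAt).comp_hasDerivAt θ h1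
    have h3 : HasDerivAt (fun θ : ℝ => X * (circleMap (1 / 2 : ℂ) r θ) ^ ((1 + τ / 2 : ℝ) : ℂ))
        (X * (((1 + τ / 2 : ℝ) : ℂ) * (circleMap (1 / 2 : ℂ) r θ) ^ (((1 + τ / 2 : ℝ) : ℂ) - 1) *
        (circleMap 0 r θ * Complex.I))) θ := by
      have h4 := (hasStrictDerivAt_id (circleMap (1 / 2 : ℂ) r θ)).cpow_const
        (c := ((1 + τ / 2 : ℝ) : ℂ)) (hslit θ)
      have h5 := h4.hasDerivAt.comp_of_eq θ (hasDerivAt_circleMap (1 / 2 : ℂ) r θ) rfl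
      simpa using h5.const_mul (X : ℂ)
    have e : γ ∘ Prod.mk τ =
        fun θ : ℝ => X * (circleMap (1 / 2 : ℂ) r θ) ^ ((1 + τ / 2 : ℝ) : ℂ) := funext (hγpow τ)
    rw [e] at h2
    exact h2.unique h3
  have key := integral_closedCurve_homotopy hU hf hγ (T := 2 * Real.pi)
    (fun τ hτ θ => by rw [hγpow]; exact hmem τ hτ _ (circleMap_mem_sphere _ hr0 θ))
    (fun τ => by
      have h := periodic_circleMap (1 / 2 : ℂ) r 0
      rw [zero_add] at h
      rw [hγpow, hγpow, h])
  rw [contourInt_scale, contourInt_eq_intervalIntegral, contourInt_eq_intervalIntegral]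
  have e0 : ∀ θ : ℝ, f (γ (0, θ)) * fderiv ℝ γ (0, θ) (0, 1) = Complex.I * X *
      (circleMap 0 r θ * f (X * circleMap (1 / 2) r θ)) := by
    intro θ
    rw [hγpow, hγd]
    simp
    ring
  have e1 : ∀ θ : ℝ, f (γ (1, θ)) * fderiv ℝ γ (1, θ) (0, 1) = Complex.I *
      (circleMap 0 r θ * (f (X * circleMap (1 / 2) r θ ^ (3 / 2 : ℂ)) *
        (X * (3 / 2) * circleMap (1 / 2) r θ ^ (1 / 2 : ℂ)))) := by
    intro θ
    have hexp : (((1 + 1 / 2 : ℝ) : ℂ)) = 3 / 2 := by push_cast; norm_num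
    rw [hγpow, hγd, hexp, show (3 / 2 - 1 : ℂ) = 1 / 2 by norm_num]
    ring
  simp only [e0, e1, intervalIntegral.integral_const_mul] at key
  have hI := Complex.I_ne_zero
  have key2 := mul_left_cancel₀ hI ((mul_assoc _ _ _).symm.trans key)
  rw [← key2]
  ring

/-! ### The entire factor, the identity principle and decay of Γ -/

/-- The entire function `∑ z ^ k / (k! (k + κ)!)`, with `I_κ(2 √z) = z ^ (κ / 2) besselF κ z`. -/
noncomputable def besselF (κ : ℕ) (z : ℂ) : ℂ :=
  ∑' k : ℕ, z ^ k / ((k.factorial : ℂ) * ((k + κ).factorial : ℂ))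

theorem norm_besselF_term_le (κ k : ℕ) (z : ℂ) :
    ‖z ^ k / ((k.factorial : ℂ) * ((k + κ).factorial : ℂ))‖ ≤ ‖z‖ ^ k / (k.factorial : ℝ) := by
  rw [norm_div, norm_pow, norm_mul, Complex.norm_natCast, Complex.norm_natCast]
  have h1 : (1 : ℝ) ≤ ((k + κ).factorial : ℝ) := by exact_mod_cast (k + κ).factorial_pos
  have h2 : (0 : ℝ) < (k.factorial : ℝ) := by exact_mod_cast k.factorial_pos
  gcongr
  exact le_mul_of_one_le_right h2.le h1

theorem hasSum_besselF (κ : ℕ) (z : ℂ) :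
    HasSum (fun k : ℕ => z ^ k / ((k.factorial : ℂ) * ((k + κ).factorial : ℂ))) (besselF κ z) :=
  (Summable.of_norm_bounded (Real.summable_pow_div_factorial ‖z‖)
    fun k => norm_besselF_term_le κ k z).hasSum

theorem differentiable_besselF (κ : ℕ) : Differentiable ℂ (besselF κ) := by
  intro z
  have h : DifferentiableOn ℂ (besselF κ) (Metric.ball 0 (‖z‖ + 1)) := by
    refine Complex.differentiableOn_tsum_of_summable_norm (u := fun k : ℕ => (‖z‖ + 1) ^ k / (k.factorial : ℝ))
      (Real.summable_pow_div_factorial _) (fun k => ?_) Metric.isOpen_ball fun k w hw => ?_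
    · exact ((differentiable_id.pow k).div_const _).differentiableOn
    · refine (norm_besselF_term_le κ k w).trans ?_
      have : ‖w‖ ≤ ‖z‖ + 1 := (mem_ball_zero_iff.1 hw).le
      gcongr
  exact h.differentiableAt (Metric.isOpen_ball.mem_nhds (by simp))

/-- Functions holomorphic on the right half-plane are determined by their values on the positive
half-line; the domain may be larger. -/
theorem eqOn_of_eq_on_pos {U : Set ℂ} (hU : IsOpen U) (hc : IsPreconnected U)
    (hsub : ∀ x : ℝ, 0 < x → (x : ℂ) ∈ U) {f g : ℂ → ℂ} (hf : DifferentiableOn ℂ f U)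
    (hg : DifferentiableOn ℂ g U) (h : ∀ x : ℝ, 0 < x → f x = g x) : EqOn f g U := by
  have h1 : (1 : ℂ) ∈ U := by simpa using hsub 1 one_pos
  refine (hf.analyticOnNhd hU).eqOn_of_preconnected_of_frequently_eq (hg.analyticOnNhd hU) hc h1 ?_
  have hlim : Tendsto (fun n : ℕ => ((1 + 1 / ((n : ℝ) + 1) : ℝ) : ℂ)) atTop (𝓝[≠] 1) := by
    rw [tendsto_nhdsWithin_iff]
    constructor
    · have h2 : Tendsto (fun n : ℕ => 1 + 1 / ((n : ℝ) + 1)) atTop (𝓝 (1 + 0)) :=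
        tendsto_const_nhds.add tendsto_one_div_add_atTop_nhds_zero_nat
      have h3 := (Complex.continuous_ofReal.tendsto (1 + 0)).comp h2
      simpa only [Function.comp_def, add_zero, Complex.ofReal_one] using h3
    · refine Eventually.of_forall fun n => ?_
      simp only [mem_compl_iff, mem_singleton_iff]
      have : (1 + 1 / ((n : ℝ) + 1)) ≠ 1 := by
        have : (0 : ℝ) < 1 / ((n : ℝ) + 1) := by positivity
        linarith
      exact_mod_cast this
  exact hlim.frequently (Eventually.of_forall fun n => h _ (by positivity)).frequently

theorem isOpen_rightHalfPlane : IsOpen {z : ℂ | 0 < z.re} :=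
  isOpen_lt continuous_const Complex.continuous_re

theorem isPreconnected_rightHalfPlane : IsPreconnected {z : ℂ | 0 < z.re} :=
  (convex_halfSpace_re_gt 0).isPreconnected

theorem integrableOn_rpow_mul_exp_neg_mul {a b : ℝ} (ha : 0 < a) (hb : 0 < b) :
    IntegrableOn (fun t : ℝ => t ^ (a - 1) * Real.exp (-(b * t))) (Ioi 0) := by
  have := integrableOn_rpow_mul_exp_neg_mul_rpow (p := 1) (s := a - 1) (b := b) (by linarith) one_pos hb
  simpa using this

theorem norm_cpow_ofReal_sub_one {t : ℝ} (ht : 0 < t) (a : ℂ) :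
    ‖(t : ℂ) ^ (a - 1)‖ = t ^ (a.re - 1) := by
  rw [Complex.norm_cpow_eq_rpow_re_of_pos ht]
  simp

theorem continuousOn_ofReal_cpow (a : ℂ) : ContinuousOn (fun t : ℝ => (t : ℂ) ^ a) (Ioi 0) :=
  fun t ht => (Complex.continuousAt_ofReal_cpow_const t a
    (Or.inr (ne_of_gt ht))).continuousWithinAt

/-- Euler's integral for `Γ`, rotated to a complex scale in the right half-plane. -/
theorem integral_cpow_mul_exp_neg_mul_of_re_pos {a r : ℂ} (ha : 0 < a.re) (hr : 0 < r.re) :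
    ∫ t : ℝ in Ioi 0, (t : ℂ) ^ (a - 1) * Complex.exp (-(r * t)) = r ^ (-a) * Complex.Gamma a := by
  refine eqOn_of_eq_on_pos (U := {z : ℂ | 0 < z.re})
    (f := fun r => ∫ t : ℝ in Ioi 0, (t : ℂ) ^ (a - 1) * Complex.exp (-(r * t)))
    (g := fun r => r ^ (-a) * Complex.Gamma a) isOpen_rightHalfPlane isPreconnected_rightHalfPlane
    (fun x hx => by simpa using hx) ?_ ?_ ?_ hr
  · refine differentiableOn_integral_of_dominated isOpen_rightHalfPlane (fun z _ => ?_) ?_ ?_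
    · refine ContinuousOn.aestronglyMeasurable ?_ measurableSet_Ioi
      exact (continuousOn_ofReal_cpow _).mul (by fun_prop)
    · refine Eventually.of_forall fun t => ?_
      fun_prop
    · intro z hz
      refine ⟨{w | z.re / 2 < w.re}, (isOpen_lt continuous_const Complex.continuous_re).mem_nhds
        (by simp only [mem_ofPred_eq] at *; linarith), _,
        integrableOn_rpow_mul_exp_neg_mul ha (half_pos hz), ?_⟩
      refine (ae_restrict_iff' measurableSet_Ioi).2 (Eventually.of_forall fun t ht w hw => ?_)
      rw [norm_mul, norm_cpow_ofReal_sub_one ht, Complex.norm_exp]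
      have ht' : 0 < t := ht
      have hw' : z.re / 2 < w.re := hw
      gcongr
      simp only [Complex.neg_re, Complex.mul_re, Complex.ofReal_re, Complex.ofReal_im, mul_zero,
        sub_zero, neg_le_neg_iff]
      gcongr
  · intro z hz
    exact (((hasStrictDerivAt_id z).cpow_const (Or.inl hz)).hasDerivAt.differentiableAt.mul_const
      _).differentiableWithinAt
  · intro x hx
    have h := Complex.integral_cpow_mul_exp_neg_mul_Ioi ha hx
    simp only [h]
    rw [one_div, Complex.inv_cpow _ _ (by rw [Complex.arg_ofReal_of_nonneg hx.le]; exact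
      Real.pi_pos.ne), Complex.cpow_neg]

theorem norm_cpow_eq {z : ℂ} (hz : z ≠ 0) (s : ℂ) :
    ‖z ^ s‖ = ‖z‖ ^ s.re * Real.exp (-(z.arg * s.im)) := by
  rw [Complex.norm_cpow_of_ne_zero hz, div_eq_mul_inv, Real.exp_neg]

/-- Exponential decay of `Γ` along vertical lines in the right half-plane. -/
theorem norm_Gamma_le_exp {s : ℂ} (hs : 0 < s.re) {φ : ℝ} (h0 : 0 ≤ φ) (h1 : φ < Real.pi / 2) :
    ‖Complex.Gamma s‖ ≤
      Real.cos φ ^ (-s.re) * Real.Gamma s.re * Real.exp (-(φ * |s.im|)) := by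
  have hcos : 0 < Real.cos φ := Real.cos_pos_of_mem_Ioo ⟨by linarith [Real.pi_pos], h1⟩
  -- Euler's integral is rotated to the ray of angle ψ = ±φ, with the sign of Im s. The factor r ^
  -- (-s) then has modulus e^(φ|Im s|), while the rotated integral stays bounded through Re r = cos
  -- φ.
  obtain ⟨ψ, hψ, hψs, hψc⟩ : ∃ ψ : ℝ, ψ ∈ Ioc (-Real.pi) Real.pi ∧ ψ * s.im = φ * |s.im| ∧
      Real.cos ψ = Real.cos φ := by
    rcases le_total 0 s.im with h | h
    · exact ⟨φ, ⟨by linarith [Real.pi_pos], by linarith [Real.pi_pos]⟩, by rw [abs_of_nonneg h], rfl⟩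
    · exact ⟨-φ, ⟨by linarith [Real.pi_pos], by linarith [Real.pi_pos]⟩,
        by rw [abs_of_nonpos h]; ring, Real.cos_neg φ⟩
  set r : ℂ := Complex.exp (ψ * Complex.I) with hr
  have hrre : r.re = Real.cos φ := by rw [hr, Complex.exp_ofReal_mul_I_re, hψc]
  have hrarg : r.arg = ψ := by
    rw [hr, Complex.arg_exp_mul_I]
    exact (toIocMod_eq_self _).2 ⟨hψ.1, by linarith [hψ.2]⟩
  have hrnorm : ‖r‖ = 1 := Complex.norm_exp_ofReal_mul_I ψ
  have hr0 : r ≠ 0 := Complex.exp_ne_zero _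
  have key := integral_cpow_mul_exp_neg_mul_of_re_pos hs (r := r) (by rw [hrre]; exact hcos)
  have hnorm : ‖r ^ (-s)‖ = Real.exp (φ * |s.im|) := by
    rw [norm_cpow_eq hr0, hrnorm, Real.one_rpow, one_mul, hrarg, Complex.neg_im, mul_neg, neg_neg,
      hψs]
  have hreal := Real.integral_rpow_mul_exp_neg_mul_Ioi hs hcos
  have hle : ‖r ^ (-s) * Complex.Gamma s‖ ≤ (1 / Real.cos φ) ^ s.re * Real.Gamma s.re := by
    rw [← key, ← hreal]
    refine (norm_integral_le_integral_norm _).trans (le_of_eq ?_)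
    refine setIntegral_congr_fun measurableSet_Ioi fun t ht => ?_
    rw [norm_mul, norm_cpow_ofReal_sub_one ht, Complex.norm_exp]
    simp [hrre]
  rw [norm_mul, hnorm] at hle
  rw [Real.exp_neg, ← div_eq_mul_inv, le_div_iff₀ (Real.exp_pos _), mul_comm, Real.rpow_neg hcos.le,
    ← Real.inv_rpow hcos.le, ← one_div]
  exact hle

/-! ### The Laplace-type integral H -/

/-- The Laplace-type integral `∫₀^∞ t ^ (κ - 1) exp (-t - z / t) dt = 2 z ^ (κ / 2) K_κ(2 √z)`. -/
noncomputable def besselH (κ : ℕ) (z : ℂ) : ℂ :=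
  ∫ t in Ioi (0 : ℝ), (t : ℂ) ^ ((κ : ℤ) - 1) * Complex.exp (-(t : ℂ)) * Complex.exp (-z / (t : ℂ))

/-- A single term of the exponential series bounds e^(δ/t) from below; this trades e^(-δ/t) for any
desired power of t. -/
theorem exp_neg_div_le {δ t : ℝ} (hδ : 0 < δ) (ht : 0 < t) (j : ℕ) :
    Real.exp (-δ / t) ≤ j.factorial * (δ⁻¹ ^ j * t ^ j) := by
  have h := Real.pow_div_factorial_le_exp (δ / t) (by positivity) j
  have hj : (0 : ℝ) < j.factorial := by exact_mod_cast j.factorial_pos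
  rw [neg_div, Real.exp_neg]
  have hpos : 0 < (δ / t) ^ j / j.factorial := by positivity
  calc (Real.exp (δ / t))⁻¹ ≤ ((δ / t) ^ j / j.factorial)⁻¹ := by gcongr
    _ = j.factorial * (δ⁻¹ ^ j * t ^ j) := by
      rw [inv_div, div_pow, inv_pow]
      field_simp

theorem integrableOn_pow_mul_exp_neg (k : ℕ) :
    IntegrableOn (fun t : ℝ => t ^ k * Real.exp (-t)) (Ioi 0) := by
  have h := integrableOn_rpow_mul_exp_neg_mul (a := k + 1) (b := 1) (by positivity) one_pos
  simpa using h

theorem integrableOn_zpow_mul_exp (n : ℤ) {δ : ℝ} (hδ : 0 < δ) :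
    IntegrableOn (fun t : ℝ => t ^ n * Real.exp (-t) * Real.exp (-δ / t)) (Ioi 0) := by
  -- The factor e^(-δ/t) supplies |n| further powers of t, after which the exponent n + |n| is a
  -- natural number.
  obtain ⟨k, hk⟩ : ∃ k : ℕ, (k : ℤ) = n + n.natAbs := by
    refine ⟨(n + n.natAbs).toNat, ?_⟩
    omega
  refine Integrable.mono' (((integrableOn_pow_mul_exp_neg k).const_mul
    (n.natAbs.factorial * δ⁻¹ ^ n.natAbs))) ?_ ?_
  · refine ContinuousOn.aestronglyMeasurable (fun t ht => ?_) measurableSet_Ioi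
    have ht0 : t ≠ 0 := ne_of_gt ht
    refine ContinuousAt.continuousWithinAt ?_
    exact ((continuousAt_zpow₀ t n (Or.inl ht0)).mul (by fun_prop)).mul
      (by fun_prop (disch := assumption))
  · refine (ae_restrict_iff' measurableSet_Ioi).2 (Eventually.of_forall fun t ht => ?_)
    have ht0 : 0 < t := ht
    rw [Real.norm_of_nonneg (by positivity)]
    calc t ^ n * Real.exp (-t) * Real.exp (-δ / t)
        ≤ t ^ n * Real.exp (-t) * (n.natAbs.factorial * (δ⁻¹ ^ n.natAbs * t ^ n.natAbs)) := by
          gcongr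
          exact exp_neg_div_le hδ ht0 _
      _ = n.natAbs.factorial * δ⁻¹ ^ n.natAbs * ((t ^ n * t ^ (n.natAbs : ℤ)) * Real.exp (-t)) := by
          rw [zpow_natCast]; ring
      _ = _ := by rw [← zpow_add₀ ht0.ne', ← hk, zpow_natCast]

theorem norm_besselH_integrand {t : ℝ} (ht : 0 < t) (n : ℤ) (z : ℂ) :
    ‖(t : ℂ) ^ n * Complex.exp (-(t : ℂ)) * Complex.exp (-z / (t : ℂ))‖ =
      t ^ n * Real.exp (-t) * Real.exp (-z.re / t) := by
  rw [norm_mul, norm_mul, norm_zpow, Complex.norm_real, Real.norm_of_nonneg ht.le,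
    Complex.norm_exp, Complex.norm_exp, Complex.div_ofReal_re]
  simp

theorem continuousOn_besselH_integrand (n : ℤ) (z : ℂ) :
    ContinuousOn (fun t : ℝ => (t : ℂ) ^ n * Complex.exp (-(t : ℂ)) * Complex.exp (-z / (t : ℂ)))
      (Ioi 0) := by
  intro t ht
  have ht0 : (t : ℂ) ≠ 0 := by exact_mod_cast ne_of_gt ht
  refine ContinuousAt.continuousWithinAt ?_
  have h1 : ContinuousAt (fun t : ℝ => (t : ℂ) ^ n) t :=
    (continuousAt_zpow₀ (t : ℂ) n (Or.inl ht0)).comp Complex.continuous_ofReal.continuousAt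
  exact (h1.mul (by fun_prop)).mul (by fun_prop (disch := assumption))

theorem differentiableOn_besselH (κ : ℕ) : DifferentiableOn ℂ (besselH κ) {z | 0 < z.re} := by
  refine differentiableOn_integral_of_dominated isOpen_rightHalfPlane (fun z _ =>
    (continuousOn_besselH_integrand _ z).aestronglyMeasurable measurableSet_Ioi) ?_ ?_
  · refine Eventually.of_forall fun t => ?_
    fun_prop
  · intro z hz
    refine ⟨{w | z.re / 2 < w.re}, (isOpen_lt continuous_const Complex.continuous_re).mem_nhds
      (by simp only [mem_ofPred_eq] at *; linarith), _,
      integrableOn_zpow_mul_exp ((κ : ℤ) - 1) (half_pos hz), ?_⟩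
    refine (ae_restrict_iff' measurableSet_Ioi).2 (Eventually.of_forall fun t ht w hw => ?_)
    have ht' : 0 < t := ht
    have hw' : z.re / 2 < w.re := hw
    rw [norm_besselH_integrand ht]
    gcongr

theorem integrable_exp_neg_mul_abs {b : ℝ} (hb : 0 < b) :
    Integrable (fun y : ℝ => Real.exp (-(b * |y|))) := by
  have h1 : IntegrableOn (fun y : ℝ => Real.exp (-(b * |y|))) (Ioi 0) := by
    refine (exp_neg_integrableOn_Ioi 0 hb).congr_fun (fun y hy => ?_) measurableSet_Ioi
    simp only
    rw [abs_of_pos hy, neg_mul]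
  have h2 : IntegrableOn (fun y : ℝ => Real.exp (-(b * |y|))) (Iic 0) := by
    have h3 := (integrableOn_Ici_iff_integrableOn_Ioi).2 h1
    have h4 := (integrable_indicator_iff measurableSet_Ici).2 h3
    refine (integrable_indicator_iff measurableSet_Iic).1 (h4.comp_neg.congr
      (Eventually.of_forall fun y => ?_))
    simp [indicator, abs_neg]
  rw [← integrableOn_univ, ← Iic_union_Ioi (a := (0 : ℝ))]
  exact h2.union h1

/-! ### Continuation of H to the slit plane -/

/-- The Mellin–Barnes integral `(2πi)⁻¹ ∫_{Re s = σ} Γ(s) Γ(s + κ) z ^ (-s) ds`, which continues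
`besselH κ` to the slit plane. -/
noncomputable def mellinH (σ : ℝ) (κ : ℕ) (z : ℂ) : ℂ :=
  (2 * Real.pi : ℂ)⁻¹ * ∫ y : ℝ, Complex.Gamma (σ + y * Complex.I) *
    Complex.Gamma (σ + y * Complex.I + κ) * z ^ (-(σ + y * Complex.I))

theorem norm_cpow_vertical {z : ℂ} (hz : z ≠ 0) (σ y : ℝ) :
    ‖z ^ (-(σ + y * Complex.I))‖ = ‖z‖ ^ (-σ) * Real.exp (z.arg * y) := by
  rw [norm_cpow_eq hz]
  simp

theorem continuous_Gamma_vertical {σ : ℝ} (hσ : 0 < σ) :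
    Continuous fun y : ℝ => Complex.Gamma (σ + y * Complex.I) := by
  refine continuous_iff_continuousAt.2 fun y => ?_
  have h1 : DifferentiableAt ℂ Complex.Gamma (σ + y * Complex.I) := by
    refine Complex.differentiableAt_Gamma _ fun m hm => ?_
    have := congrArg Complex.re hm
    simp at this
    linarith [m.cast_nonneg (α := ℝ)]
  exact ContinuousAt.comp (f := fun y : ℝ => (σ + y * Complex.I : ℂ)) h1.continuousAt
    (by fun_prop)

/-- The exponential decay of `Γ` on a vertical line, with an unspecified constant. -/
theorem exists_norm_Gamma_vertical_le {σ : ℝ} (hσ : 0 < σ) {φ : ℝ} (h0 : 0 ≤ φ)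
    (h1 : φ < Real.pi / 2) :
    ∃ C : ℝ, 0 < C ∧ ∀ y : ℝ, ‖Complex.Gamma (σ + y * Complex.I)‖ ≤ C * Real.exp (-(φ * |y|)) := by
  have hcos : 0 < Real.cos φ := Real.cos_pos_of_mem_Ioo ⟨by linarith [Real.pi_pos], h1⟩
  refine ⟨Real.cos φ ^ (-σ) * Real.Gamma σ, by
    have := Real.Gamma_pos_of_pos hσ
    positivity, fun y => ?_⟩
  have h := norm_Gamma_le_exp (s := σ + y * Complex.I) (by simpa using hσ) h0 h1
  simpa using h

/-- The two Gamma factors decay together like e^(-2φ|y|) for any φ < π/2, and the power of z grows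
at most like e^(ψ|y|) with ψ < π. Choosing φ between ψ/2 and π/2 leaves the rate 2φ - ψ > 0, so the
integral converges in every closed sector inside the slit plane. -/
theorem exists_norm_mellinH_integrand_le {σ : ℝ} (hσ : 0 < σ) (κ : ℕ) {ψ : ℝ} (h0 : 0 ≤ ψ)
    (h1 : ψ < Real.pi) :
    ∃ C b : ℝ, 0 < C ∧ 0 < b ∧ ∀ z : ℂ, z ≠ 0 → |z.arg| ≤ ψ → ∀ y : ℝ,
      ‖Complex.Gamma (σ + y * Complex.I) * Complex.Gamma (σ + y * Complex.I + κ) *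
        z ^ (-(σ + y * Complex.I))‖ ≤ ‖z‖ ^ (-σ) * (C * Real.exp (-(b * |y|))) := by
  obtain ⟨φ, hφ1, hφ2⟩ := exists_between (show ψ / 2 < Real.pi / 2 by linarith)
  obtain ⟨C1, hC1, h2⟩ := exists_norm_Gamma_vertical_le hσ (by linarith : 0 ≤ φ) hφ2
  obtain ⟨C2, hC2, h3⟩ := exists_norm_Gamma_vertical_le (by positivity : 0 < σ + κ)
    (by linarith : 0 ≤ φ) hφ2
  refine ⟨C1 * C2, 2 * φ - ψ, by positivity, by linarith, fun z hz harg y => ?_⟩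
  rw [norm_mul, norm_mul, norm_cpow_vertical hz]
  have h3' := h3 y
  rw [show (((σ + κ : ℝ) : ℂ) + y * Complex.I) = σ + y * Complex.I + κ by push_cast; ring] at h3'
  have h4 : Real.exp (z.arg * y) ≤ Real.exp (ψ * |y|) := by
    refine Real.exp_le_exp.2 ?_
    calc z.arg * y ≤ |z.arg * y| := le_abs_self _
      _ = |z.arg| * |y| := abs_mul _ _
      _ ≤ ψ * |y| := by gcongr
  calc _ ≤ (C1 * Real.exp (-(φ * |y|))) * (C2 * Real.exp (-(φ * |y|))) *
        (‖z‖ ^ (-σ) * Real.exp (ψ * |y|)) := by gcongr; exact h2 y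
    _ = ‖z‖ ^ (-σ) * (C1 * C2 * (Real.exp (-(φ * |y|)) * Real.exp (-(φ * |y|)) *
        Real.exp (ψ * |y|))) := by ring
    _ = _ := by
      rw [← Real.exp_add, ← Real.exp_add]
      ring_nf

theorem continuous_mellinH_integrand {σ : ℝ} (hσ : 0 < σ) (κ : ℕ) {z : ℂ} (hz : z ≠ 0) :
    Continuous fun y : ℝ => Complex.Gamma (σ + y * Complex.I) *
      Complex.Gamma (σ + y * Complex.I + κ) * z ^ (-(σ + y * Complex.I)) := by
  have h1 := continuous_Gamma_vertical hσ
  have h2 := continuous_Gamma_vertical (show 0 < σ + κ by positivity)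
  have h3 : (fun y : ℝ => Complex.Gamma (((σ + κ : ℝ) : ℂ) + y * Complex.I)) =
      fun y : ℝ => Complex.Gamma (σ + y * Complex.I + κ) := by
    ext y
    congr 1
    push_cast
    ring
  rw [h3] at h2
  refine (h1.mul h2).mul ?_
  exact Continuous.const_cpow (by fun_prop) (Or.inl hz)

/-- The exponent σ > 0 is free. A small one makes the singularity at the origin, logarithmic for κ =
0, harmless on the curve used later. -/
theorem norm_mellinH_le {σ : ℝ} (hσ : 0 < σ) (κ : ℕ) {ψ : ℝ} (h0 : 0 ≤ ψ) (h1 : ψ < Real.pi) :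
    ∃ C : ℝ, 0 < C ∧ ∀ z : ℂ, z ≠ 0 → |z.arg| ≤ ψ → ‖mellinH σ κ z‖ ≤ C * ‖z‖ ^ (-σ) := by
  obtain ⟨C, b, hC, hb, h⟩ := exists_norm_mellinH_integrand_le hσ κ h0 h1
  refine ⟨(2 * Real.pi)⁻¹ * (∫ y : ℝ, C * Real.exp (-(b * |y|))) + 1, ?_, fun z hz harg => ?_⟩
  · have : 0 ≤ ∫ y : ℝ, C * Real.exp (-(b * |y|)) := integral_nonneg fun y => by positivity
    positivity
  · have h2 : ‖mellinH σ κ z‖ ≤ (2 * Real.pi)⁻¹ *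
        ∫ y : ℝ, ‖z‖ ^ (-σ) * (C * Real.exp (-(b * |y|))) := by
      rw [mellinH, norm_mul]
      have : ‖(2 * Real.pi : ℂ)⁻¹‖ = (2 * Real.pi)⁻¹ := by
        rw [norm_inv, norm_mul, Complex.norm_real, Real.norm_of_nonneg Real.pi_pos.le]
        simp
      rw [this]
      gcongr
      exact norm_integral_le_of_norm_le
        (((integrable_exp_neg_mul_abs hb).const_mul C).const_mul _)
        (Eventually.of_forall fun y => h z hz harg y)
    rw [integral_const_mul] at h2
    have : 0 ≤ ‖z‖ ^ (-σ) := by positivity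
    linarith

theorem differentiableOn_mellinH {σ : ℝ} (hσ : 0 < σ) (κ : ℕ) :
    DifferentiableOn ℂ (mellinH σ κ) Complex.slitPlane := by
  refine (differentiableOn_integral_of_dominated Complex.isOpen_slitPlane (fun z hz =>
    (continuous_mellinH_integrand hσ κ (Complex.slitPlane_ne_zero hz)).aestronglyMeasurable)
    ?_ ?_).const_mul _
  · refine Eventually.of_forall fun y z hz => ?_
    exact (((hasStrictDerivAt_id z).cpow_const hz).hasDerivAt.differentiableAt.const_mul
      _).differentiableWithinAt
  · intro z hz
    have hz0 := Complex.slitPlane_ne_zero hz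
    have harg : |z.arg| < Real.pi := (Complex.abs_arg_le_pi z).lt_of_ne fun h => by
      have h1 := (Complex.mem_slitPlane_iff_arg.1 hz).1
      rcases abs_eq Real.pi_pos.le |>.1 h with h | h
      · exact h1 h
      · exact absurd h (Complex.neg_pi_lt_arg z).ne'
    obtain ⟨ψ, hψ1, hψ2⟩ := exists_between harg
    obtain ⟨C, b, hC, hb, h⟩ := exists_norm_mellinH_integrand_le hσ κ
      ((abs_nonneg _).trans hψ1.le) hψ2
    have hV1 : ∀ᶠ w in 𝓝 z, |w.arg| < ψ :=
      ((Complex.continuousAt_arg hz).abs).eventually_lt continuousAt_const hψ1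
    have hn : ContinuousAt (fun w : ℂ => ‖w‖ ^ (-σ)) z :=
      (continuous_norm.continuousAt).rpow_const (Or.inl (by simpa using hz0))
    have hV2 : ∀ᶠ w in 𝓝 z, ‖w‖ ^ (-σ) < ‖z‖ ^ (-σ) + 1 :=
      hn.eventually_lt continuousAt_const (by simp)
    have hV3 : ∀ᶠ w in 𝓝 z, w ≠ 0 := eventually_ne_nhds hz0
    refine ⟨{w | |w.arg| < ψ ∧ ‖w‖ ^ (-σ) < ‖z‖ ^ (-σ) + 1 ∧ w ≠ 0},
      hV1.and (hV2.and hV3), fun y => (‖z‖ ^ (-σ) + 1) * (C * Real.exp (-(b * |y|))),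
      ((integrable_exp_neg_mul_abs hb).const_mul C).const_mul _, ?_⟩
    refine Eventually.of_forall fun y w hw => ?_
    refine (h w hw.2.2 hw.1.le y).trans ?_
    exact mul_le_mul_of_nonneg_right hw.2.1.le (by positivity)

theorem mellin_cexp_neg_mul {z s : ℂ} (hz : 0 < z.re) (hs : 0 < s.re) :
    mellin (fun X : ℝ => Complex.exp (-(z * X))) s = z ^ (-s) * Complex.Gamma s := by
  rw [mellin, ← integral_cpow_mul_exp_neg_mul_of_re_pos hs hz]
  simp only [smul_eq_mul]

/-- Mellin inversion for the exponential. -/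
theorem cexp_neg_mul_eq_mellinInv {σ : ℝ} (hσ : 0 < σ) {z : ℂ} (hz : 0 < z.re) {X : ℝ}
    (hX : 0 < X) :
    Complex.exp (-(z * X)) = (2 * Real.pi : ℂ)⁻¹ * ∫ y : ℝ, (X : ℂ) ^ (-(σ + y * Complex.I)) *
      (z ^ (-(σ + y * Complex.I)) * Complex.Gamma (σ + y * Complex.I)) := by
  have hz0 : z ≠ 0 := fun h => by simp [h] at hz
  have harg : |z.arg| < Real.pi / 2 := Complex.abs_arg_lt_pi_div_two_iff.2 (Or.inl hz)
  have hm : ∀ y : ℝ, mellin (fun X : ℝ => Complex.exp (-(z * X))) (σ + y * Complex.I) =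
      z ^ (-(σ + y * Complex.I)) * Complex.Gamma (σ + y * Complex.I) := fun y =>
    mellin_cexp_neg_mul hz (by simpa using hσ)
  have h := mellinInv_mellin_eq σ (fun X : ℝ => Complex.exp (-(z * X))) hX ?_ ?_ (by fun_prop)
  · simp only [mellinInv, hm] at h
    rw [← h, Complex.real_smul]
    push_cast
    rw [one_div]
    rfl
  · rw [MellinConvergent]
    refine Integrable.mono' (integrableOn_rpow_mul_exp_neg_mul hσ hz) ?_ ?_
    · refine ContinuousOn.aestronglyMeasurable ?_ measurableSet_Ioi
      exact (continuousOn_ofReal_cpow _).smul (by fun_prop)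
    · refine (ae_restrict_iff' measurableSet_Ioi).2 (Eventually.of_forall fun t ht => ?_)
      rw [norm_smul, norm_cpow_ofReal_sub_one ht, Complex.norm_exp]
      simp
  · rw [Complex.VerticalIntegrable]
    simp only [hm]
    obtain ⟨φ, hφ1, hφ2⟩ := exists_between harg
    obtain ⟨C, hC, h2⟩ := exists_norm_Gamma_vertical_le hσ ((abs_nonneg _).trans hφ1.le) hφ2
    refine Integrable.mono' (g := fun y => ‖z‖ ^ (-σ) * C * Real.exp (-((φ - |z.arg|) * |y|)))
      ((integrable_exp_neg_mul_abs (sub_pos.2 hφ1)).const_mul _) ?_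
      (Eventually.of_forall fun y => ?_)
    · refine Continuous.aestronglyMeasurable (Continuous.mul ?_ (continuous_Gamma_vertical hσ))
      exact Continuous.const_cpow (by fun_prop) (Or.inl hz0)
    · rw [norm_mul, norm_cpow_vertical hz0]
      have h4 : Real.exp (z.arg * y) ≤ Real.exp (|z.arg| * |y|) :=
        Real.exp_le_exp.2 ((le_abs_self _).trans (abs_mul _ _).le)
      calc _ ≤ ‖z‖ ^ (-σ) * Real.exp (|z.arg| * |y|) * (C * Real.exp (-(φ * |y|))) := by
            gcongr
            exact h2 y
        _ = ‖z‖ ^ (-σ) * C * (Real.exp (|z.arg| * |y|) * Real.exp (-(φ * |y|))) := by ring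
        _ = _ := by rw [← Real.exp_add]; ring_nf

/-- Mellin inversion of e^(-z/t) is inserted into the Laplace integral. After Fubini the t-integral
of t^(s+κ-1) e^(-t) is Γ(s + κ); the joint integrand is dominated by a function of t times a
function of y. -/
theorem mellinH_eq_besselH {σ : ℝ} (hσ : 0 < σ) (κ : ℕ) {z : ℂ} (hz : 0 < z.re) :
    mellinH σ κ z = besselH κ z := by
  have hz0 : z ≠ 0 := fun h => by simp [h] at hz
  have harg : |z.arg| < Real.pi / 2 := Complex.abs_arg_lt_pi_div_two_iff.2 (Or.inl hz)
  obtain ⟨φ, hφ1, hφ2⟩ := exists_between harg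
  obtain ⟨C, hC, h2⟩ := exists_norm_Gamma_vertical_le hσ ((abs_nonneg _).trans hφ1.le) hφ2
  set f : ℝ → ℝ → ℂ := fun t y => (t : ℂ) ^ ((σ + y * Complex.I + κ) - 1) *
    Complex.exp (-(t : ℂ)) * (z ^ (-(σ + y * Complex.I)) * Complex.Gamma (σ + y * Complex.I))
    with hf
  have hH : besselH κ z = ∫ t in Ioi (0 : ℝ), (2 * Real.pi : ℂ)⁻¹ * ∫ y : ℝ, f t y := by
    refine setIntegral_congr_fun measurableSet_Ioi fun t ht => ?_
    have ht' : 0 < t := ht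
    have htc : (t : ℂ) ≠ 0 := by exact_mod_cast ht'.ne'
    have h := cexp_neg_mul_eq_mellinInv hσ hz (inv_pos.2 ht')
    have e1 : -z / (t : ℂ) = -(z * ((t⁻¹ : ℝ) : ℂ)) := by
      push_cast
      rw [neg_div, div_eq_mul_inv]
    rw [e1, h, mul_left_comm, ← integral_const_mul]
    congr 2
    ext y
    have e2 : (((t⁻¹ : ℝ) : ℂ)) ^ (-(σ + y * Complex.I)) = (t : ℂ) ^ (σ + y * Complex.I) := by
      rw [Complex.ofReal_inv, Complex.inv_cpow _ _ (by
        rw [Complex.arg_ofReal_of_nonneg ht'.le]; exact Real.pi_pos.ne), ← Complex.cpow_neg, neg_neg]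
    rw [e2, hf]
    simp only
    rw [show (σ + y * Complex.I + κ - 1 : ℂ) = (((κ : ℤ) - 1 : ℤ) : ℂ) + (σ + y * Complex.I) by
      push_cast; ring, Complex.cpow_add (((κ : ℤ) - 1 : ℤ) : ℂ) _ htc, Complex.cpow_intCast]
    ring
  rw [hH, integral_const_mul, mellinH]
  congr 1
  rw [integral_integral_swap]
  · congr 1
    ext y
    rw [hf]
    simp only
    rw [integral_mul_const]
    have h := integral_cpow_mul_exp_neg_mul_of_re_pos (a := σ + y * Complex.I + κ) (r := 1)
      (by simp; positivity) (by simp)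
    simp only [one_mul, Complex.one_cpow] at h
    rw [h]
    ring
  · have hb1 : Integrable (fun t : ℝ => t ^ (σ + κ - 1) * Real.exp (-(1 * t)))
        (volume.restrict (Ioi 0)) := integrableOn_rpow_mul_exp_neg_mul (by positivity) one_pos
    have hb2 : Integrable (fun y : ℝ => ‖z‖ ^ (-σ) * C * Real.exp (-((φ - |z.arg|) * |y|))) :=
      (integrable_exp_neg_mul_abs (sub_pos.2 hφ1)).const_mul _
    have hres : (volume.restrict (Ioi (0 : ℝ))).prod (volume : Measure ℝ) =
        ((volume : Measure ℝ).prod volume).restrict (Ioi 0 ×ˢ univ) := by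
      rw [← Measure.prod_restrict, Measure.restrict_univ]
    refine (hb1.mul_prod hb2).mono' ?_ ?_
    · rw [hres]
      refine ContinuousOn.aestronglyMeasurable ?_ (measurableSet_Ioi.prod MeasurableSet.univ)
      simp only [hf, Function.uncurry_def]
      refine ContinuousOn.mul (ContinuousOn.mul ?_ (by fun_prop)) (Continuous.continuousOn ?_)
      · refine ContinuousOn.cpow (by fun_prop) (by fun_prop) ?_
        rintro ⟨t, y⟩ ⟨ht, -⟩
        exact Or.inl (by simpa using ht)
      · exact (Continuous.const_cpow (by fun_prop) (Or.inl hz0)).mul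
          ((continuous_Gamma_vertical hσ).comp continuous_snd)
    · rw [hres]
      refine (ae_restrict_iff' (measurableSet_Ioi.prod MeasurableSet.univ)).2
        (Eventually.of_forall ?_)
      rintro ⟨t, y⟩ ⟨ht, -⟩
      simp only [hf, Function.uncurry_apply_pair]
      have ht' : 0 < t := ht
      rw [norm_mul, norm_mul, norm_mul, norm_cpow_ofReal_sub_one ht', norm_cpow_vertical hz0,
        Complex.norm_exp]
      have h4 : Real.exp (z.arg * y) ≤ Real.exp (|z.arg| * |y|) :=
        Real.exp_le_exp.2 ((le_abs_self _).trans (abs_mul _ _).le)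
      have e3 : (σ + y * Complex.I + κ : ℂ).re = σ + κ := by simp
      have e4 : (-(t : ℂ)).re = -(1 * t) := by simp
      rw [e3, e4]
      calc _ ≤ t ^ (σ + κ - 1) * Real.exp (-(1 * t)) *
            (‖z‖ ^ (-σ) * Real.exp (|z.arg| * |y|) * (C * Real.exp (-(φ * |y|)))) := by
            gcongr
            exact h2 y
        _ = t ^ (σ + κ - 1) * Real.exp (-(1 * t)) *
            (‖z‖ ^ (-σ) * C * (Real.exp (|z.arg| * |y|) * Real.exp (-(φ * |y|)))) := by ring
        _ = _ := by rw [← Real.exp_add]; ring_nf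

theorem isPreconnected_slitPlane : IsPreconnected Complex.slitPlane :=
  (Complex.starConvex_one_slitPlane.isPathConnected Complex.one_mem_slitPlane).isConnected.isPreconnected

/-- No contour has to be shifted: both sides agree with H on the positive axis, and the identity
theorem extends this to the slit plane. -/
theorem mellinH_congr {σ σ' : ℝ} (hσ : 0 < σ) (hσ' : 0 < σ') (κ : ℕ) {z : ℂ}
    (hz : z ∈ Complex.slitPlane) : mellinH σ κ z = mellinH σ' κ z := by
  refine eqOn_of_eq_on_pos Complex.isOpen_slitPlane isPreconnected_slitPlane (fun x hx => Or.inl hx)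
    (differentiableOn_mellinH hσ κ) (differentiableOn_mellinH hσ' κ) (fun x hx => ?_) hz
  rw [mellinH_eq_besselH hσ κ (by simpa using hx), mellinH_eq_besselH hσ' κ (by simpa using hx)]

/-! ### Identification with the modified Bessel functions -/

theorem integral_Ioi_eq_integral_exp (g : ℝ → ℂ) :
    ∫ t in Ioi (0 : ℝ), g t = ∫ x : ℝ, Real.exp x • g (Real.exp x) := by
  have h := integral_image_eq_integral_abs_deriv_smul (f := Real.exp) (f' := Real.exp)
    MeasurableSet.univ (fun x _ => (Real.hasDerivAt_exp x).hasDerivWithinAt)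
    Real.exp_injective.injOn g
  rw [image_univ, Real.range_exp] at h
  simpa [abs_of_pos (Real.exp_pos _)] using h

theorem exp_neg_cosh_mul_cosh_le {δ : ℝ} (hδ : 0 < δ) (κ : ℕ) :
    ∃ C : ℝ, 0 < C ∧ ∀ t : ℝ, 0 < t →
      Real.exp (-(δ * Real.cosh t)) * Real.cosh (κ * t) ≤ C * Real.exp (-t) := by
  refine ⟨(κ + 1).factorial * (δ / 2)⁻¹ ^ (κ + 1), by positivity, fun t ht => ?_⟩
  have h1 := exp_neg_div_le (half_pos hδ) (Real.exp_pos (-t)) (κ + 1)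
  have h2 : Real.exp (-(δ * Real.cosh t)) ≤ Real.exp (-(δ / 2) / Real.exp (-t)) := by
    refine Real.exp_le_exp.2 ?_
    rw [Real.exp_neg, div_inv_eq_mul, Real.cosh_eq]
    nlinarith [Real.exp_pos (-t)]
  have h3 : Real.cosh (κ * t) ≤ Real.exp (κ * t) := by
    rw [Real.cosh_eq]
    have : Real.exp (-(κ * t)) ≤ Real.exp (κ * t) := by
      refine Real.exp_le_exp.2 ?_
      have : 0 ≤ κ * t := by positivity
      linarith
    linarith
  calc _ ≤ ((κ + 1).factorial * ((δ / 2)⁻¹ ^ (κ + 1) * Real.exp (-t) ^ (κ + 1))) *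
        Real.exp (κ * t) := by
        gcongr
        exact h2.trans h1
    _ = (κ + 1).factorial * (δ / 2)⁻¹ ^ (κ + 1) * (Real.exp (-t) ^ (κ + 1) * Real.exp (κ * t)) := by
        ring
    _ = _ := by
        rw [← Real.exp_nat_mul, ← Real.exp_add]
        push_cast
        ring_nf

theorem norm_besselK_integrand (κ : ℕ) (z : ℂ) (t : ℝ) :
    ‖Complex.exp (-z * (Real.cosh t : ℂ)) * (Real.cosh (κ * t) : ℂ)‖ =
      Real.exp (-(z.re * Real.cosh t)) * Real.cosh (κ * t) := by
  rw [norm_mul, Complex.norm_exp, Complex.norm_real, Real.norm_of_nonneg (Real.cosh_pos _).le,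
    Complex.re_mul_ofReal]
  simp

theorem differentiableOn_besselK (κ : ℕ) : DifferentiableOn ℂ (besselK κ) {z | 0 < z.re} := by
  refine differentiableOn_integral_of_dominated isOpen_rightHalfPlane (fun z _ => ?_) ?_ ?_
  · refine Continuous.aestronglyMeasurable ?_
    fun_prop
  · exact Eventually.of_forall fun t => by fun_prop
  · intro z hz
    obtain ⟨C, hC, h⟩ := exp_neg_cosh_mul_cosh_le (half_pos hz) κ
    refine ⟨{w | z.re / 2 < w.re}, (isOpen_lt continuous_const Complex.continuous_re).mem_nhds
      (by simp only [mem_ofPred_eq] at *; linarith), fun t => C * Real.exp (-1 * t),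
      (exp_neg_integrableOn_Ioi 0 one_pos).const_mul C, ?_⟩
    refine (ae_restrict_iff' measurableSet_Ioi).2 (Eventually.of_forall fun t ht w hw => ?_)
    have hw' : z.re / 2 < w.re := hw
    simp only [norm_besselK_integrand, neg_one_mul]
    refine le_trans ?_ (h t ht)
    have := Real.cosh_pos t
    have := Real.cosh_pos (κ * t)
    gcongr

/-- With t = √w e^x the exponent -t - w/t becomes -2√w cosh x, which is even in x. Folding the line
at 0 leaves the even part cosh(κx) of e^(κx). -/
theorem besselH_ofReal (κ : ℕ) {w : ℝ} (hw : 0 < w) :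
    besselH κ w = 2 * (Real.sqrt w : ℂ) ^ κ * besselK κ (2 * Real.sqrt w) := by
  set r := Real.sqrt w with hr
  have hr0 : 0 < r := Real.sqrt_pos.2 hw
  have hrw : w = r * r := (Real.mul_self_sqrt hw.le).symm
  have hrc : (r : ℂ) ≠ 0 := by exact_mod_cast hr0.ne'
  set F : ℝ → ℂ := fun x => Complex.exp (-(2 * r) * (Real.cosh x : ℂ)) * Complex.exp (κ * x)
    with hF
  have h1 : besselH κ w = (r : ℂ) ^ κ * ∫ x : ℝ, F x := by
    rw [besselH]
    have hs := integral_comp_mul_left_Ioi (fun t : ℝ => (t : ℂ) ^ ((κ : ℤ) - 1) *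
      Complex.exp (-(t : ℂ)) * Complex.exp (-(w : ℂ) / (t : ℂ))) 0 hr0
    rw [mul_zero] at hs
    have hs' : ∫ t in Ioi (0 : ℝ), (t : ℂ) ^ ((κ : ℤ) - 1) * Complex.exp (-(t : ℂ)) *
        Complex.exp (-(w : ℂ) / (t : ℂ)) = r • ∫ t in Ioi (0 : ℝ), ((r * t : ℝ) : ℂ) ^ ((κ : ℤ) - 1) *
        Complex.exp (-((r * t : ℝ) : ℂ)) * Complex.exp (-(w : ℂ) / ((r * t : ℝ) : ℂ)) := by
      rw [hs, smul_smul, mul_inv_cancel₀ hr0.ne', one_smul]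
    rw [hs', integral_Ioi_eq_integral_exp, ← integral_smul, ← integral_const_mul]
    congr 1
    ext x
    have hx : Complex.exp x ≠ 0 := Complex.exp_ne_zero _
    simp only [hF, Complex.real_smul]
    push_cast
    rw [zpow_sub₀ (mul_ne_zero hrc hx), zpow_natCast, zpow_one, mul_pow, ← Complex.exp_nat_mul]
    have e1 : Complex.exp (-(r * Complex.exp x)) * Complex.exp (-(w : ℂ) / (r * Complex.exp x)) =
        Complex.exp (-(2 * r) * Complex.cosh x) := by
      rw [← Complex.exp_add, Complex.cosh, Complex.exp_neg, hrw]
      congr 1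
      push_cast
      field_simp
      ring
    rw [mul_assoc, ← e1]
    field_simp
  have hint : Integrable F := by
    obtain ⟨C, hC, h⟩ := exp_neg_cosh_mul_cosh_le (show 0 < 2 * r by positivity) κ
    have hbd : ∀ x : ℝ, x ≠ 0 → ‖F x‖ ≤ 2 * C * Real.exp (-(1 * |x|)) := by
      intro x hx
      have h2 := h |x| (abs_pos.2 hx)
      rw [Real.cosh_abs] at h2
      have h3 : Real.cosh (κ * |x|) = Real.cosh (κ * x) := by
        rw [← Real.cosh_abs (κ * x), abs_mul, Nat.abs_cast]
      rw [h3] at h2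
      have h4 : ‖F x‖ = Real.exp (-(2 * r * Real.cosh x)) * Real.exp (κ * x) := by
        rw [hF]
        simp only
        rw [norm_mul, Complex.norm_exp, Complex.norm_exp, Complex.re_mul_ofReal]
        simp
      have h5 : Real.exp (κ * x) ≤ 2 * Real.cosh (κ * x) := by
        rw [Real.cosh_eq]
        linarith [Real.exp_pos (-(κ * x))]
      rw [h4, one_mul]
      nlinarith [Real.exp_pos (-(2 * r * Real.cosh x))]
    refine ((integrable_exp_neg_mul_abs one_pos).const_mul (2 * C)).mono' ?_ ?_
    · refine Continuous.aestronglyMeasurable ?_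
      rw [hF]
      fun_prop
    · have h0 : ∀ᵐ x : ℝ, x ≠ 0 := (countable_singleton (0 : ℝ)).ae_notMem volume
      filter_upwards [h0] with x hx using hbd x hx
  have h2 : ∫ x : ℝ, F x = 2 * besselK κ (2 * r) := by
    rw [← intervalIntegral.integral_Iic_add_Ioi (b := 0) hint.integrableOn hint.integrableOn,
      ← neg_zero, ← integral_comp_neg_Ioi, neg_zero, besselK, ← integral_const_mul,
      ← integral_add hint.comp_neg.integrableOn hint.integrableOn]
    refine setIntegral_congr_fun measurableSet_Ioi fun x _ => ?_
    simp only [hF, Real.cosh_neg]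
    have : ((Real.cosh (κ * x) : ℝ) : ℂ) = (Complex.exp (κ * x) + Complex.exp (-(κ * x))) / 2 := by
      push_cast
      rw [Complex.cosh]
    rw [this]
    push_cast
    ring_nf
  rw [h1, h2]
  ring

/-- `z ^ (κ / 2) K_κ(2 √z)` as a Laplace-type integral. -/
theorem cpow_mul_besselK (κ : ℕ) {z : ℂ} (hz : 0 < z.re) :
    2 * (z ^ (1 / 2 : ℂ)) ^ κ * besselK κ (2 * z ^ (1 / 2 : ℂ)) = besselH κ z := by
  have hsqrt : ∀ w : ℂ, 0 < w.re → 0 < (2 * w ^ (1 / 2 : ℂ)).re := by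
    intro w hw
    have hw0 : w ≠ 0 := fun h => by simp [h] at hw
    have harg : |w.arg| < Real.pi / 2 := Complex.abs_arg_lt_pi_div_two_iff.2 (Or.inl hw)
    have h1 : (Complex.log w * (1 / 2)).im = w.arg / 2 := by
      simp [Complex.mul_im, Complex.log_im]
      ring
    have h2 : ∀ v : ℂ, (2 * v).re = 2 * v.re := fun v => by simp
    rw [Complex.cpow_def_of_ne_zero hw0, h2, Complex.exp_re, h1]
    have := Real.cos_pos_of_mem_Ioo (x := w.arg / 2)
      ⟨by linarith [(abs_lt.1 harg).1, Real.pi_pos], by linarith [(abs_lt.1 harg).2, Real.pi_pos]⟩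
    positivity
  have hroot : DifferentiableOn ℂ (fun z : ℂ => z ^ (1 / 2 : ℂ)) {z | 0 < z.re} := fun w hw =>
    ((hasStrictDerivAt_id w).cpow_const (Or.inl hw)).hasDerivAt.differentiableAt.differentiableWithinAt
  refine eqOn_of_eq_on_pos (U := {z : ℂ | 0 < z.re})
    (f := fun z => 2 * (z ^ (1 / 2 : ℂ)) ^ κ * besselK κ (2 * z ^ (1 / 2 : ℂ))) (g := besselH κ)
    isOpen_rightHalfPlane isPreconnected_rightHalfPlane (fun x hx => by simpa using hx) ?_
    (differentiableOn_besselH κ) (fun x hx => ?_) hz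
  · exact ((hroot.pow κ).const_mul 2).mul
      ((differentiableOn_besselK κ).comp (hroot.const_mul 2) fun w hw => hsqrt w hw)
  · have h1 : ((x : ℂ) ^ (1 / 2 : ℂ)) = (Real.sqrt x : ℂ) := by
      rw [Real.sqrt_eq_rpow, Complex.ofReal_cpow hx.le]
      push_cast
      rfl
    rw [besselH_ofReal κ hx]
    simp only [h1]

theorem besselI_two_mul (κ : ℕ) (s : ℂ) : besselI κ (2 * s) = s ^ κ * besselF κ (s ^ 2) := by
  rw [besselI, besselF, ← tsum_mul_left]
  congr 1
  ext k
  rw [mul_div_cancel_left₀ s two_ne_zero, pow_add, pow_mul]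
  ring

/-! ### The curve through the origin -/

/-- For Re ω > 0 and exponents up to 3/2 the multiplied argument stays within ±3π/4, so no multiple
of 2π is subtracted. -/
theorem arg_cpow_of_re_pos {ω : ℂ} (hω : 0 < ω.re) {β : ℝ} (h0 : 0 ≤ β) (h1 : β ≤ 3 / 2) :
    (ω ^ (β : ℂ)).arg = β * ω.arg := by
  have hω0 : ω ≠ 0 := fun h => by simp [h] at hω
  have harg := abs_lt.1 (Complex.abs_arg_lt_pi_div_two_iff.2 (Or.inl hω))
  have him : (Complex.log ω * β).im = β * ω.arg := by
    rw [Complex.im_mul_ofReal, Complex.log_im, mul_comm]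
  have hb : -Real.pi < β * ω.arg ∧ β * ω.arg ≤ Real.pi := by
    constructor <;> nlinarith [harg.1, harg.2, Real.pi_pos]
  rw [Complex.cpow_def_of_ne_zero hω0, ← Complex.log_im, Complex.log_exp (by rw [him]; exact hb.1)
    (by rw [him]; exact hb.2), him]

theorem arg_eq_zero_or_pi {z : ℂ} (h : z.im = 0) : z.arg = 0 ∨ z.arg = Real.pi := by
  rcases le_or_gt 0 z.re with h0 | h0
  · exact Or.inl (Complex.arg_eq_zero_iff.2 ⟨h0, h⟩)
  · exact Or.inr (Complex.arg_eq_pi_iff.2 ⟨h0, h⟩)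

theorem norm_cpow_ofReal {ω : ℂ} (hω : ω ≠ 0) (β : ℝ) : ‖ω ^ (β : ℂ)‖ = ‖ω‖ ^ β := by
  rw [norm_cpow_eq hω]
  simp

theorem cast_three_halves : ((3 / 2 : ℝ) : ℂ) = 3 / 2 := by push_cast; rfl

theorem cast_one_half : ((1 / 2 : ℝ) : ℂ) = 1 / 2 := by push_cast; rfl

/-- The part of the slit disc `‖z‖ < B` off the segment `[lo, hi]`. -/
def slitRegion (lo hi B : ℝ) : Set ℂ :=
  {z | z ∈ Complex.slitPlane ∧ ‖z‖ < B ∧ ¬(z.im = 0 ∧ z.re ∈ Icc lo hi)}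

theorem isOpen_slitRegion (lo hi B : ℝ) : IsOpen (slitRegion lo hi B) := by
  refine Complex.isOpen_slitPlane.inter ((isOpen_lt continuous_norm continuous_const).inter ?_)
  have h : IsClosed {z : ℂ | z.im = 0 ∧ z.re ∈ Icc lo hi} :=
    (isClosed_eq Complex.continuous_im continuous_const).inter
      (isClosed_Icc.preimage Complex.continuous_re)
  exact h.isOpen_compl

theorem mem_slitRegion_of_circle {lo hi B c R : ℝ} (hR : 0 < R) (hRc : R < c) (h1 : c - R < lo)
    (h2 : hi < c + R) (h3 : c + R < B) (θ : ℝ) : circleMap c R θ ∈ slitRegion lo hi B := by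
  have hnorm : ‖circleMap (c : ℂ) R θ - c‖ = R := by
    rw [circleMap_sub_center, norm_circleMap_zero, abs_of_pos hR]
  have hre : |(circleMap (c : ℂ) R θ - c).re| ≤ R := (Complex.abs_re_le_norm _).trans hnorm.le
  rw [Complex.sub_re, Complex.ofReal_re, abs_le] at hre
  refine ⟨Or.inl (by linarith), ?_, ?_⟩
  · have h4 := norm_sub_norm_le (circleMap (c : ℂ) R θ) c
    rw [hnorm, Complex.norm_real, Real.norm_of_nonneg (by linarith)] at h4
    linarith
  · rintro ⟨him, hre1, hre2⟩
    have h5 : (circleMap (c : ℂ) R θ - c) = (((circleMap (c : ℂ) R θ).re - c : ℝ) : ℂ) := by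
      apply Complex.ext
      · rw [Complex.sub_re, Complex.ofReal_re, Complex.ofReal_re]
      · rw [Complex.sub_im, him, Complex.ofReal_im, Complex.ofReal_im, sub_zero]
    rw [h5, Complex.norm_real, Real.norm_eq_abs] at hnorm
    rcases (abs_eq hR.le).1 hnorm with h | h <;> linarith

/-- Since the argument is (1 + τ/2) arg ω and stays below 3π/4 in modulus, the image is real only
for real ω, that is for ω = 1/2 ± r. Both values lie in (0, 1), so an exponent between 1 and 3/2 is
worst at 1 for the lower end and at 3/2 for the upper end of the segment. -/
theorem mem_slitRegion_of_pow {lo hi B X r : ℝ} (hX : 0 < X) (hr0 : 0 < r) (hr : r < 1 / 2)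
    (h1 : X * (1 / 2 - r) < lo) (h2 : hi < X * (1 / 2 + r) ^ (3 / 2 : ℝ)) (h3 : X < B)
    {τ : ℝ} (hτ : τ ∈ Icc (0 : ℝ) 1) {ω : ℂ} (hω : ω ∈ Metric.sphere (1 / 2 : ℂ) r) :
    X * ω ^ ((1 + τ / 2 : ℝ) : ℂ) ∈ slitRegion lo hi B := by
  have hre := re_pos_of_mem_sphere_half hr hω
  have hω0 : ω ≠ 0 := fun h => by simp [h] at hre
  obtain ⟨hτ0, hτ1⟩ := hτ
  have harg : (X * ω ^ ((1 + τ / 2 : ℝ) : ℂ)).arg = (1 + τ / 2) * ω.arg := by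
    rw [Complex.arg_real_mul _ hX, arg_cpow_of_re_pos hre (by linarith) (by linarith)]
  have hlt := abs_lt.1 (Complex.abs_arg_lt_pi_div_two_iff.2 (Or.inl hre))
  have hne : X * ω ^ ((1 + τ / 2 : ℝ) : ℂ) ≠ 0 := by
    refine mul_ne_zero (by exact_mod_cast hX.ne') ?_
    simp [Complex.cpow_eq_zero_iff, hω0]
  have hargpi : (X * ω ^ ((1 + τ / 2 : ℝ) : ℂ)).arg < Real.pi := by
    rw [harg]
    nlinarith [hlt.1, hlt.2, Real.pi_pos]
  have hnorm : ‖X * ω ^ ((1 + τ / 2 : ℝ) : ℂ)‖ = X * ‖ω‖ ^ (1 + τ / 2) := by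
    rw [norm_mul, Complex.norm_real, Real.norm_of_nonneg hX.le, norm_cpow_ofReal hω0]
  have hωn : ‖ω‖ ≤ 1 / 2 + r := by
    have h4 := norm_sub_norm_le ω (1 / 2)
    rw [mem_sphere_iff_norm.1 hω] at h4
    have : ‖(1 / 2 : ℂ)‖ = 1 / 2 := by norm_num
    linarith
  refine ⟨Complex.mem_slitPlane_iff_arg.2 ⟨hargpi.ne, hne⟩, ?_, ?_⟩
  · rw [hnorm]
    have : ‖ω‖ ^ (1 + τ / 2) ≤ 1 :=
      Real.rpow_le_one (norm_nonneg _) (by linarith) (by linarith)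
    nlinarith
  · rintro ⟨him, hlo, hhi⟩
    have harg0 : ω.arg = 0 := by
      have h5 : (X * ω ^ ((1 + τ / 2 : ℝ) : ℂ)).arg = 0 ∨
          (X * ω ^ ((1 + τ / 2 : ℝ) : ℂ)).arg = Real.pi := arg_eq_zero_or_pi him
      rcases h5 with h5 | h5
      · rw [harg] at h5
        exact (mul_eq_zero.1 h5).resolve_left (by linarith)
      · exact absurd h5 hargpi.ne
    have hωreal : ω = ((ω.re : ℝ) : ℂ) := by
      have := Complex.arg_eq_zero_iff.1 harg0
      apply Complex.ext <;> simp [this.2]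
    have hωnorm : ‖ω‖ = ω.re := by
      rw [hωreal, Complex.norm_real, Real.norm_of_nonneg (by simpa using hre.le)]
      simp
    have hval : (X * ω ^ ((1 + τ / 2 : ℝ) : ℂ)).re = X * ω.re ^ (1 + τ / 2) := by
      rw [← hωnorm, ← hnorm]
      conv_rhs => rw [← Complex.abs_re_eq_norm.2 him]
      exact (abs_of_nonneg (by
        have := Complex.arg_eq_zero_iff.1 (by rw [harg, harg0, mul_zero] :
          (X * ω ^ ((1 + τ / 2 : ℝ) : ℂ)).arg = 0)
        exact this.1)).symm
    rw [hval] at hlo hhi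
    have h6 : |ω.re - 1 / 2| = r := by
      have h7 := mem_sphere_iff_norm.1 hω
      have h8 : ω - 1 / 2 = ((ω.re - 1 / 2 : ℝ) : ℂ) := by
        conv_lhs => rw [hωreal]
        push_cast
        ring
      rwa [h8, Complex.norm_real, Real.norm_eq_abs] at h7
    rcases (abs_eq hr0.le).1 h6 with h | h
    · have h9 : ω.re = 1 / 2 + r := by linarith
      rw [h9] at hhi
      have : (1 / 2 + r) ^ (3 / 2 : ℝ) ≤ (1 / 2 + r) ^ (1 + τ / 2) :=
        Real.rpow_le_rpow_of_exponent_ge (by linarith) (by linarith) (by linarith)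
      nlinarith
    · have h9 : ω.re = 1 / 2 - r := by linarith
      rw [h9] at hlo
      have : (1 / 2 - r) ^ (1 + τ / 2) ≤ (1 / 2 - r) ^ (1 : ℝ) :=
        Real.rpow_le_rpow_of_exponent_ge (by linarith) (by linarith) (by linarith)
      rw [Real.rpow_one] at this
      nlinarith

/-- The integral over the closed curve `v = X ω ^ (3 / 2)`, `|ω - 1 / 2| = 1 / 2`, which passes
through the origin in the directions `± 3 π / 4`. -/
noncomputable def xiInt (X : ℝ) (f : ℂ → ℂ) : ℂ :=
  contourInt (1 / 2) (1 / 2) fun ω => f (X * ω ^ (3 / 2 : ℂ)) * (X * (3 / 2) * ω ^ (1 / 2 : ℂ))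

theorem re_pos_of_mem_closedBall_half {ω : ℂ} (hω : ‖ω - 1 / 2‖ ≤ 1 / 2) (h0 : ω ≠ 0) :
    0 < ω.re := by
  have h1 : ‖ω - 1 / 2‖ ^ 2 ≤ (1 / 2) ^ 2 := by gcongr
  rw [← Complex.normSq_eq_norm_sq, Complex.normSq_apply] at h1
  have h2 : 0 < Complex.normSq ω := Complex.normSq_pos.2 h0
  rw [Complex.normSq_apply] at h2
  simp at h1
  nlinarith

theorem exists_radius_lt_half {lo hi X : ℝ} (hlo : 0 < lo) (hhi : hi < X) :
    ∃ r₀ : ℝ, 0 < r₀ ∧ r₀ < 1 / 2 ∧ X * (1 / 2 - r₀) < lo ∧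
      hi < X * (1 / 2 + r₀) ^ (3 / 2 : ℝ) := by
  have e1 : ∀ᶠ r : ℝ in 𝓝[<] (1 / 2), X * (1 / 2 - r) < lo := by
    refine nhdsWithin_le_nhds (ContinuousAt.eventually_lt (by fun_prop) continuousAt_const ?_)
    simpa using hlo
  have e2 : ∀ᶠ r : ℝ in 𝓝[<] (1 / 2), hi < X * (1 / 2 + r) ^ (3 / 2 : ℝ) := by
    refine nhdsWithin_le_nhds (ContinuousAt.eventually_lt continuousAt_const ?_ ?_)
    · exact continuousAt_const.mul (ContinuousAt.rpow_const (by fun_prop) (Or.inl (by norm_num)))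
    · norm_num
      exact hhi
  have e3 : ∀ᶠ r : ℝ in 𝓝[<] (1 / 2), r ∈ Ioo 0 (1 / 2) := Ioo_mem_nhdsLT (by norm_num)
  obtain ⟨r, ⟨h4, h5⟩, h6, h7⟩ := (e3.and (e1.and e2)).exists
  exact ⟨r, h4, h5, h6, h7⟩

/-- Two deformations avoiding the segment and the cut: first to the circle of centre X/2 and radius
Xr, then to its image under the power map. -/
theorem contourInt_eq_contourInt_pow {f : ℂ → ℂ} {lo hi B X c R r : ℝ}
    (hf : DifferentiableOn ℂ f (slitRegion lo hi B)) (hX : 0 < X) (hXB : X < B) (hR : 0 < R)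
    (hRc : R < c) (h1 : c - R < lo) (h2 : hi < c + R) (h3 : c + R < B) (hr0 : 0 < r)
    (hr2 : r < 1 / 2) (g1 : X * (1 / 2 - r) < lo) (g2 : hi < X * (1 / 2 + r) ^ (3 / 2 : ℝ)) :
    contourInt c R f = contourInt (1 / 2) r
      fun ω => f (X * ω ^ (3 / 2 : ℂ)) * (X * (3 / 2) * ω ^ (1 / 2 : ℂ)) := by
  have g3 : (1 / 2 + r) ^ (3 / 2 : ℝ) ≤ (1 / 2 + r) ^ (1 : ℝ) :=
    Real.rpow_le_rpow_of_exponent_ge (by linarith) (by linarith) (by norm_num)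
  rw [Real.rpow_one] at g3
  rw [← contourInt_deform_pow (isOpen_slitRegion lo hi B) hf hr0.le hr2
    fun τ hτ ω hω => mem_slitRegion_of_pow hX hr0 hr2 g1 g2 hXB hτ hω]
  refine contourInt_deform_circle (isOpen_slitRegion lo hi B) hf fun τ hτ θ => ?_
  obtain ⟨hτ0, hτ1⟩ := hτ
  have e1 : ((c : ℂ) + τ * (X * (1 / 2) - c)) = ((c + τ * (X * (1 / 2) - c) : ℝ) : ℂ) := by
    push_cast
    ring
  rw [e1]
  -- Every inequality required of the interpolating circles is affine in τ, so it suffices to have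
  -- it at both ends.
  have hcx : ∀ a b : ℝ, 0 < a → 0 < b → 0 < a + τ * (b - a) := by
    intro a b ha hb
    rcases eq_or_lt_of_le hτ1 with h | h
    · rw [h]; linarith
    · nlinarith
  have hXr : 0 < X * r := mul_pos hX hr0
  have hXr2 : X * r < X * (1 / 2) := mul_lt_mul_of_pos_left hr2 hX
  have hg3 : X * (1 / 2 + r) ^ (3 / 2 : ℝ) ≤ X * (1 / 2 + r) := mul_le_mul_of_nonneg_left g3 hX.le
  have k1 := hcx (c - R) (X * (1 / 2) - X * r) (by linarith) (by linarith)
  have k2 := hcx R (X * r) hR hXr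
  have k3 := hcx (lo - (c - R)) (lo - (X * (1 / 2) - X * r)) (by linarith) (by linarith)
  have k4 := hcx (c + R - hi) (X * (1 / 2) + X * r - hi) (by linarith) (by linarith)
  have k5 := hcx (B - (c + R)) (B - (X * (1 / 2) + X * r)) (by linarith) (by linarith)
  apply mem_slitRegion_of_circle <;> linarith

theorem norm_xi {X : ℝ} (hX : 0 < X) {ω : ℂ} (hω : ω ≠ 0) :
    ‖X * ω ^ (3 / 2 : ℂ)‖ = X * ‖ω‖ ^ (3 / 2 : ℝ) := by
  rw [norm_mul, Complex.norm_real, Real.norm_of_nonneg hX.le, ← cast_three_halves,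
    norm_cpow_ofReal hω]

theorem arg_xi {X : ℝ} (hX : 0 < X) {ω : ℂ} (hω : 0 < ω.re) :
    (X * ω ^ (3 / 2 : ℂ)).arg = 3 / 2 * ω.arg := by
  rw [← cast_three_halves, Complex.arg_real_mul _ hX,
    arg_cpow_of_re_pos hω (by norm_num) (by norm_num)]

theorem norm_le_one_of_half {ω : ℂ} (hω : ‖ω - 1 / 2‖ ≤ 1 / 2) : ‖ω‖ ≤ 1 := by
  have h4 := norm_sub_norm_le ω (1 / 2)
  have : ‖(1 / 2 : ℂ)‖ = 1 / 2 := by norm_num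
  linarith

theorem xi_ne_zero {X : ℝ} (hX : 0 < X) {ω : ℂ} (hω : ω ≠ 0) : X * ω ^ (3 / 2 : ℂ) ≠ 0 := by
  rw [← norm_ne_zero_iff, norm_xi hX hω]
  have := norm_pos_iff.2 hω
  positivity

/-- The factor 3/2 opens the right half-plane to the sector of half-angle 3π/4: wide enough for the
curve to enter the left half-plane near 0, narrow enough to stay off the cut of H. -/
theorem abs_arg_xi_lt {X : ℝ} (hX : 0 < X) {ω : ℂ} (hω : 0 < ω.re) :
    |(X * ω ^ (3 / 2 : ℂ)).arg| < 3 * Real.pi / 4 := by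
  have hlt := Complex.abs_arg_lt_pi_div_two_iff.2 (Or.inl hω)
  rw [arg_xi hX hω, abs_mul, abs_of_pos (by norm_num : (0 : ℝ) < 3 / 2)]
  linarith

theorem eq_one_of_arg_eq_zero {ω : ℂ} (hω : ‖ω - 1 / 2‖ = 1 / 2) (h0 : ω ≠ 0) (h : ω.arg = 0) :
    ω = 1 := by
  obtain ⟨hre, him⟩ := Complex.arg_eq_zero_iff.1 h
  have h1 : ω = ((ω.re : ℝ) : ℂ) := by apply Complex.ext <;> simp [him]
  have h2 : ω - 1 / 2 = ((ω.re - 1 / 2 : ℝ) : ℂ) := by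
    conv_lhs => rw [h1]
    push_cast
    ring
  rw [h2, Complex.norm_real, Real.norm_eq_abs] at hω
  rcases (abs_eq (by norm_num)).1 hω with h3 | h3
  · rw [h1, show ω.re = 1 by linarith]
    simp
  · exact absurd (by rw [h1, show ω.re = 0 by linarith]; simp) h0

/-- The limiting radius 1/2 has only one real point besides the origin, ω = 1, whose image X lies to
the right of the segment. -/
theorem xi_mem_slitRegion {lo hi B X : ℝ} (hX : 0 < X) (hhi : hi < X) (hXB : X < B) {ω : ℂ}
    (hω : ‖ω - 1 / 2‖ = 1 / 2) (h0 : ω ≠ 0) : X * ω ^ (3 / 2 : ℂ) ∈ slitRegion lo hi B := by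
  have hre := re_pos_of_mem_closedBall_half hω.le h0
  have hpi := Real.pi_pos
  have hlt := abs_lt.1 (abs_arg_xi_lt hX hre)
  have hargpi : (X * ω ^ (3 / 2 : ℂ)).arg ≠ Real.pi := by
    intro h
    rw [h] at hlt
    linarith [hlt.2]
  refine ⟨Complex.mem_slitPlane_iff_arg.2 ⟨hargpi, xi_ne_zero hX h0⟩, ?_, ?_⟩
  · have hle1 : ‖ω‖ ^ (3 / 2 : ℝ) ≤ 1 :=
      Real.rpow_le_one (norm_nonneg _) (norm_le_one_of_half hω.le) (by norm_num)
    rw [norm_xi hX h0]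
    exact (mul_le_of_le_one_right hX.le hle1).trans_lt hXB
  · rintro ⟨him, -, hhi'⟩
    have harg0 : ω.arg = 0 := by
      have h5 := (arg_eq_zero_or_pi him).resolve_right hargpi
      rw [arg_xi hX hre] at h5
      linarith
    rw [eq_one_of_arg_eq_zero hω h0 harg0] at hhi'
    simp at hhi'
    linarith

theorem xi_mem_slitRegion_of_le {lo hi B X r₀ : ℝ} (hX : 0 < X) (hhi : hi < X) (hXB : X < B)
    (hr₀ : 0 < r₀) (h1 : X * (1 / 2 - r₀) < lo) (h2 : hi < X * (1 / 2 + r₀) ^ (3 / 2 : ℝ)) {ω : ℂ}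
    (hω0 : r₀ ≤ ‖ω - 1 / 2‖) (hω : ‖ω - 1 / 2‖ ≤ 1 / 2) (h0 : ω ≠ 0) :
    X * ω ^ (3 / 2 : ℂ) ∈ slitRegion lo hi B := by
  rcases lt_or_eq_of_le hω with hr | hr
  · have hω' : ω ∈ Metric.sphere (1 / 2 : ℂ) ‖ω - 1 / 2‖ := by simp
    have g1 : X * (1 / 2 - ‖ω - 1 / 2‖) < lo :=
      (mul_le_mul_of_nonneg_left (by linarith) hX.le).trans_lt h1
    have g2 : hi < X * (1 / 2 + ‖ω - 1 / 2‖) ^ (3 / 2 : ℝ) :=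
      h2.trans_le (mul_le_mul_of_nonneg_left (by gcongr) hX.le)
    have := mem_slitRegion_of_pow hX (hr₀.trans_le hω0) hr g1 g2 hXB
      (τ := 1) ⟨zero_le_one, le_rfl⟩ hω'
    rwa [show (1 + 1 / 2 : ℝ) = 3 / 2 by norm_num, cast_three_halves] at this
  · exact xi_mem_slitRegion hX hhi hXB hr h0

theorem norm_xi_jacobian {X : ℝ} (hX : 0 < X) {ω : ℂ} (hω : ω ≠ 0) :
    ‖X * (3 / 2) * ω ^ (1 / 2 : ℂ)‖ = X * (3 / 2) * ‖ω‖ ^ (1 / 2 : ℝ) := by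
  rw [norm_mul, norm_mul, Complex.norm_real, Real.norm_of_nonneg hX.le, ← cast_one_half,
    norm_cpow_ofReal hω]
  norm_num

/-- A singularity |v|^(-p) becomes |ω|^(-3p/2), and the Jacobian contributes |ω|^(1/2). For p ≤ 1/3
the product is bounded; this is the tolerance on which all later estimates over the curve rest. -/
theorem norm_xi_integrand_le {f : ℂ → ℂ} {X C p : ℝ} (hX : 0 < X) (hp : p ≤ 1 / 3) {ω : ℂ}
    (hω : ‖ω - 1 / 2‖ ≤ 1 / 2) (h0 : ω ≠ 0)
    (hf : ‖f (X * ω ^ (3 / 2 : ℂ))‖ ≤ C * ‖X * ω ^ (3 / 2 : ℂ)‖ ^ (-p)) :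
    ‖f (X * ω ^ (3 / 2 : ℂ)) * (X * (3 / 2) * ω ^ (1 / 2 : ℂ))‖ ≤
      |C| * X ^ (-p) * (X * (3 / 2)) := by
  have hωpos := norm_pos_iff.2 h0
  rw [norm_xi hX h0] at hf
  rw [norm_mul, norm_xi_jacobian hX h0]
  calc _ ≤ |C| * (X * ‖ω‖ ^ (3 / 2 : ℝ)) ^ (-p) * (X * (3 / 2) * ‖ω‖ ^ (1 / 2 : ℝ)) := by
        gcongr
        exact hf.trans (by gcongr; exact le_abs_self C)
    _ = |C| * X ^ (-p) * (X * (3 / 2)) * ((‖ω‖ ^ (3 / 2 : ℝ)) ^ (-p) * ‖ω‖ ^ (1 / 2 : ℝ)) := by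
        rw [Real.mul_rpow hX.le (by positivity)]
        ring
    _ ≤ |C| * X ^ (-p) * (X * (3 / 2)) * 1 := by
        gcongr
        rw [← Real.rpow_mul hωpos.le, ← Real.rpow_add hωpos]
        exact Real.rpow_le_one hωpos.le (norm_le_one_of_half hω) (by linarith)
    _ = _ := mul_one _

theorem continuousOn_xi_integrand {f : ℂ → ℂ} {U S : Set ℂ} {X : ℝ} (hf : ContinuousOn f U)
    (hre : ∀ ω ∈ S, 0 < ω.re) (hS : ∀ ω ∈ S, X * ω ^ (3 / 2 : ℂ) ∈ U) :
    ContinuousOn (fun ω : ℂ => f (X * ω ^ (3 / 2 : ℂ)) * (X * (3 / 2) * ω ^ (1 / 2 : ℂ))) S := by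
  have hroot : ∀ (a : ℂ), ContinuousOn (fun ω : ℂ => ω ^ a) S := fun a ω hω =>
    (continuousAt_cpow_const (Or.inl (hre ω hω))).continuousWithinAt
  exact ContinuousOn.mul (hf.comp (continuousOn_const.mul (hroot _)) hS)
    (continuousOn_const.mul (hroot _))

theorem exists_bound_xi_integrand {f : ℂ → ℂ} {U S : Set ℂ} {X C δ : ℝ} (hX : 0 < X)
    (hf : ContinuousOn f U) (hS : IsCompact S) (hSle : ∀ ω ∈ S, ‖ω - 1 / 2‖ ≤ 1 / 2)
    (hSU : ∀ ω ∈ S \ {0}, X * ω ^ (3 / 2 : ℂ) ∈ U) (hδ : 0 < δ)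
    (hnear : ∀ v : ℂ, v ≠ 0 → ‖v‖ < δ → |v.arg| ≤ 3 * Real.pi / 4 →
      ‖f v‖ ≤ C * ‖v‖ ^ (-(1 / 4) : ℝ)) :
    ∃ M : ℝ, ∀ ω ∈ S \ {0},
      ‖f (X * ω ^ (3 / 2 : ℂ)) * (X * (3 / 2) * ω ^ (1 / 2 : ℂ))‖ ≤ M := by
  have hre : ∀ ω ∈ S \ {0}, 0 < ω.re := fun ω hω =>
    re_pos_of_mem_closedBall_half (hSle ω hω.1) hω.2
  -- The near-origin bound applies for |ω| < η; the rest of the parameter set is compact and avoids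
  -- 0.
  obtain ⟨η, hη0, hη⟩ : ∃ η : ℝ, 0 < η ∧ X * η ^ (3 / 2 : ℝ) < δ := by
    have h4 : Tendsto (fun η : ℝ => X * η ^ (3 / 2 : ℝ)) (𝓝[>] 0) (𝓝 (X * 0 ^ (3 / 2 : ℝ))) := by
      refine (Tendsto.const_mul X ?_)
      exact ((Real.continuousAt_rpow_const 0 (3 / 2) (Or.inr (by norm_num))).tendsto).mono_left
        nhdsWithin_le_nhds
    rw [Real.zero_rpow (by norm_num), mul_zero] at h4
    obtain ⟨η, h5, h6⟩ := ((h4.eventually (gt_mem_nhds hδ)).and self_mem_nhdsWithin).exists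
    exact ⟨η, h6, h5⟩
  have hK : IsCompact (S ∩ {ω : ℂ | η ≤ ‖ω‖}) :=
    hS.inter_right (isClosed_le continuous_const continuous_norm)
  obtain ⟨M, hM⟩ := hK.exists_bound_of_continuousOn
    ((continuousOn_xi_integrand hf hre hSU).mono fun ω hω => ⟨hω.1, fun h => by
      have h7 : η ≤ ‖ω‖ := hω.2
      rw [mem_singleton_iff.1 h, norm_zero] at h7
      linarith⟩)
  refine ⟨max M (|C| * X ^ (-(1 / 4) : ℝ) * (X * (3 / 2))), fun ω hω => ?_⟩
  rcases le_or_gt η ‖ω‖ with h | h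
  · exact (hM ω ⟨hω.1, h⟩).trans (le_max_left _ _)
  · refine le_trans (norm_xi_integrand_le hX (by norm_num) (hSle ω hω.1) hω.2 ?_) (le_max_right _ _)
    refine hnear _ (xi_ne_zero hX hω.2) ?_ (abs_arg_xi_lt hX (hre ω hω)).le
    rw [norm_xi hX hω.2]
    exact lt_of_le_of_lt (by gcongr) hη

theorem tendsto_contourInt_radius {G : ℂ → ℂ} {r₀ M : ℝ} (hr₀0 : 0 < r₀) (hr₀h : r₀ < 1 / 2)
    (hG : ContinuousOn G ({ω : ℂ | r₀ ≤ ‖ω - 1 / 2‖ ∧ ‖ω - 1 / 2‖ ≤ 1 / 2} \ {0}))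
    (hM : ∀ ω ∈ {ω : ℂ | r₀ ≤ ‖ω - 1 / 2‖ ∧ ‖ω - 1 / 2‖ ≤ 1 / 2} \ {0}, ‖G ω‖ ≤ M) :
    Tendsto (fun r : ℝ => contourInt (1 / 2) r G) (𝓝[<] (1 / 2))
      (𝓝 (contourInt (1 / 2) (1 / 2) G)) := by
  simp only [contourInt_eq_intervalIntegral]
  refine Tendsto.const_mul _ ?_
  have hIoo : ∀ᶠ r : ℝ in 𝓝[<] (1 / 2), r ∈ Ioo r₀ (1 / 2) := Ioo_mem_nhdsLT hr₀h
  have hmemS : ∀ r : ℝ, r₀ ≤ r → r ≤ 1 / 2 → ∀ θ : ℝ, circleMap (1 / 2 : ℂ) r θ ∈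
      {ω : ℂ | r₀ ≤ ‖ω - 1 / 2‖ ∧ ‖ω - 1 / 2‖ ≤ 1 / 2} := by
    intro r h4 h5 θ
    have : ‖circleMap (1 / 2 : ℂ) r θ - 1 / 2‖ = r := by
      rw [circleMap_sub_center, norm_circleMap_zero, abs_of_pos (hr₀0.trans_le h4)]
    exact ⟨by rw [this]; exact h4, by rw [this]; exact h5⟩
  refine intervalIntegral.tendsto_integral_filter_of_dominated_convergence (fun _ => 1 / 2 * M)
    ?_ ?_ (by simp) ?_
  · filter_upwards [hIoo] with r hr
    have hrpos : 0 < r := hr₀0.trans hr.1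
    refine ((continuous_circleMap 0 r).aestronglyMeasurable.mul
      (aestronglyMeasurable_comp_circleMap (p := 0) hrpos (hG.mono fun ω hω => ⟨?_, hω.2⟩))).restrict
    have : ‖ω - 1 / 2‖ = r := mem_sphere_iff_norm.1 hω.1
    exact ⟨by rw [this]; exact hr.1.le, by rw [this]; exact hr.2.le⟩
  · filter_upwards [hIoo] with r hr
    have hrpos : 0 < r := hr₀0.trans hr.1
    filter_upwards [ae_circleMap_ne (c := 1 / 2) (p := 0) hrpos.ne'] with θ hθ _
    rw [norm_mul, norm_circleMap_zero, abs_of_pos hrpos]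
    exact mul_le_mul hr.2.le (hM _ ⟨hmemS r hr.1.le hr.2.le θ, hθ⟩) (norm_nonneg _) (by norm_num)
  · filter_upwards [ae_circleMap_ne (c := 1 / 2) (p := 0) (R := 1 / 2) (by norm_num)] with θ hθ _
    have hcr : ∀ c : ℂ, Tendsto (fun r : ℝ => circleMap c r θ) (𝓝[<] (1 / 2))
        (𝓝 (circleMap c (1 / 2) θ)) := by
      intro c
      have : Continuous fun r : ℝ => circleMap c r θ := by
        simp only [circleMap]
        fun_prop
      exact (this.tendsto _).mono_left nhdsWithin_le_nhds
    refine (hcr 0).mul ?_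
    have h14 := hG _ ⟨hmemS (1 / 2) hr₀h.le le_rfl θ, hθ⟩
    refine h14.tendsto.comp (tendsto_nhdsWithin_iff.2 ⟨hcr _, ?_⟩)
    filter_upwards [hIoo, (hcr (1 / 2)).eventually_ne hθ] with r hr hne
    exact ⟨hmemS r hr.1.le hr.2.le θ, hne⟩

/-- A circle integral around the segment `[lo, hi]` in the right half-plane equals the integral over
the curve through the origin, if the integrand is `O(‖v‖ ^ (-1 / 4))` there. -/
theorem contourInt_eq_xiInt {f : ℂ → ℂ} {lo hi B X c R : ℝ}
    (hf : DifferentiableOn ℂ f (slitRegion lo hi B)) (hlo : 0 < lo) (hX : 0 < X) (hhi : hi < X)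
    (hXB : X < B) (hR : 0 < R) (hRc : R < c) (h1 : c - R < lo) (h2 : hi < c + R)
    (h3 : c + R < B) {C δ : ℝ} (hδ : 0 < δ)
    (hnear : ∀ v : ℂ, v ≠ 0 → ‖v‖ < δ → |v.arg| ≤ 3 * Real.pi / 4 →
      ‖f v‖ ≤ C * ‖v‖ ^ (-(1 / 4) : ℝ)) :
    contourInt c R f = xiInt X f := by
  obtain ⟨r₀, hr₀0, hr₀h, hr₀1, hr₀2⟩ := exists_radius_lt_half hlo hhi
  set S : Set ℂ := {ω | r₀ ≤ ‖ω - 1 / 2‖ ∧ ‖ω - 1 / 2‖ ≤ 1 / 2} with hS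
  have hScompact : IsCompact S := by
    have : S = Metric.closedBall (1 / 2) (1 / 2) ∩ {ω : ℂ | r₀ ≤ ‖ω - 1 / 2‖} := by
      ext ω
      simp [hS, dist_eq_norm, and_comm]
    rw [this]
    exact (isCompact_closedBall _ _).inter_right (isClosed_le continuous_const (by fun_prop))
  have hSU : ∀ ω ∈ S \ {0}, X * ω ^ (3 / 2 : ℂ) ∈ slitRegion lo hi B := fun ω hω =>
    xi_mem_slitRegion_of_le hX hhi hXB hr₀0 hr₀1 hr₀2 hω.1.1 hω.1.2 hω.2
  obtain ⟨M, hM⟩ := exists_bound_xi_integrand hX hf.continuousOn hScompact (fun ω hω => hω.2) hSU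
    hδ hnear
  have hlim := tendsto_contourInt_radius hr₀0 hr₀h
    (continuousOn_xi_integrand hf.continuousOn
      (fun ω hω => re_pos_of_mem_closedBall_half hω.1.2 hω.2) hSU) hM
  refine tendsto_nhds_unique (tendsto_const_nhds.congr' ?_) hlim
  -- For radii r in (r₀, 1/2) the power-map integral equals the circle integral, so the limit as r →
  -- 1/2 is the limit of a constant.
  filter_upwards [Ioo_mem_nhdsLT hr₀h] with r hr
  refine contourInt_eq_contourInt_pow hf hX hXB hR hRc h1 h2 h3 (hr₀0.trans hr.1) hr.2 ?_ ?_
  · exact (mul_le_mul_of_nonneg_left (by linarith [hr.1]) hX.le).trans_lt hr₀1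
  · refine hr₀2.trans_le (mul_le_mul_of_nonneg_left ?_ hX.le)
    have := hr.1.le
    gcongr

/-- The curve over which `xiInt X` integrates, without the origin. -/
def xiCurve (X : ℝ) : Set ℂ :=
  (fun ω : ℂ => X * ω ^ (3 / 2 : ℂ)) '' (Metric.sphere (1 / 2) (1 / 2) \ {0})

theorem sphere_half_norm {ω : ℂ} (hω : ω ∈ Metric.sphere (1 / 2 : ℂ) (1 / 2)) :
    ‖ω - 1 / 2‖ = 1 / 2 := mem_sphere_iff_norm.1 hω

theorem re_pos_of_mem_sphere_diff {ω : ℂ} (hω : ω ∈ Metric.sphere (1 / 2 : ℂ) (1 / 2) \ {0}) :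
    0 < ω.re :=
  re_pos_of_mem_closedBall_half (sphere_half_norm hω.1).le hω.2

theorem xiCurve_ne_zero {X : ℝ} (hX : 0 < X) {v : ℂ} (hv : v ∈ xiCurve X) : v ≠ 0 := by
  obtain ⟨ω, hω, rfl⟩ := hv
  exact xi_ne_zero hX hω.2

theorem norm_le_of_mem_xiCurve {X : ℝ} (hX : 0 < X) {v : ℂ} (hv : v ∈ xiCurve X) : ‖v‖ ≤ X := by
  obtain ⟨ω, hω, rfl⟩ := hv
  simp only
  rw [norm_xi hX hω.2]
  exact mul_le_of_le_one_right hX.le (Real.rpow_le_one (norm_nonneg _)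
    (norm_le_one_of_half (sphere_half_norm hω.1).le) (by norm_num))

theorem abs_arg_lt_of_mem_xiCurve {X : ℝ} (hX : 0 < X) {v : ℂ} (hv : v ∈ xiCurve X) :
    |v.arg| < 3 * Real.pi / 4 := by
  obtain ⟨ω, hω, rfl⟩ := hv
  exact abs_arg_xi_lt hX (re_pos_of_mem_sphere_diff hω)

theorem mem_slitRegion_of_mem_xiCurve {lo hi B X : ℝ} (hX : 0 < X) (hhi : hi < X) (hXB : X < B)
    {v : ℂ} (hv : v ∈ xiCurve X) : v ∈ slitRegion lo hi B := by
  obtain ⟨ω, hω, rfl⟩ := hv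
  exact xi_mem_slitRegion hX hhi hXB (sphere_half_norm hω.1) hω.2

theorem mem_slitPlane_of_mem_xiCurve {X : ℝ} (hX : 0 < X) {v : ℂ} (hv : v ∈ xiCurve X) :
    v ∈ Complex.slitPlane :=
  (mem_slitRegion_of_mem_xiCurve (lo := 0) (hi := 0) hX hX (lt_add_one X) hv).1

/-- This is the polar equation of the circle with diameter [0, 1]. -/
theorem cos_arg_eq_norm {ω : ℂ} (hω : ω ∈ Metric.sphere (1 / 2 : ℂ) (1 / 2) \ {0}) :
    Real.cos ω.arg = ‖ω‖ := by
  have h0 : ω ≠ 0 := hω.2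
  have h1 : ‖ω - 1 / 2‖ ^ 2 = (1 / 2) ^ 2 := by rw [sphere_half_norm hω.1]
  have h2 : ‖ω‖ ^ 2 = ω.re := by
    rw [← Complex.normSq_eq_norm_sq, Complex.normSq_apply] at h1 ⊢
    simp at h1
    linarith
  rw [Complex.cos_arg h0, ← h2, sq, mul_div_cancel_right₀ _ (norm_ne_zero_iff.2 h0)]

/-- The threshold is (2/3) of 2π/3: by the polar equation small |ω| forces |arg ω| ≥ 4π/9, hence
|arg v| ≥ 2π/3, where the cosine is at most -1/2. -/
theorem xi_re_le {X : ℝ} (hX : 0 < X) {ω : ℂ}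
    (hω : ω ∈ Metric.sphere (1 / 2 : ℂ) (1 / 2) \ {0}) (h : ‖ω‖ ≤ Real.cos (4 * Real.pi / 9)) :
    (X * ω ^ (3 / 2 : ℂ)).re ≤ -(‖X * ω ^ (3 / 2 : ℂ)‖ / 2) := by
  have hpi := Real.pi_pos
  have hre := re_pos_of_mem_sphere_diff hω
  have h1 : 4 * Real.pi / 9 ≤ |ω.arg| := by
    by_contra! hlt
    have h2 := Real.cos_lt_cos_of_nonneg_of_le_pi (abs_nonneg ω.arg) (by linarith) hlt
    rw [Real.cos_abs, cos_arg_eq_norm hω] at h2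
    linarith
  have h3 := abs_arg_xi_lt hX hre
  have h4 : 2 * Real.pi / 3 ≤ |(X * ω ^ (3 / 2 : ℂ)).arg| := by
    rw [arg_xi hX hre, abs_mul, abs_of_pos (by norm_num : (0 : ℝ) < 3 / 2)]
    linarith
  have h5 : Real.cos (X * ω ^ (3 / 2 : ℂ)).arg ≤ -(1 / 2) := by
    rw [← Real.cos_abs]
    have h6 := Real.cos_le_cos_of_nonneg_of_le_pi (by positivity) (by linarith) h4
    have h7 : Real.cos (2 * Real.pi / 3) = -(1 / 2) := by
      rw [show 2 * Real.pi / 3 = Real.pi - Real.pi / 3 by ring, Real.cos_pi_sub,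
        Real.cos_pi_div_three]
    linarith
  rw [← Complex.norm_mul_cos_arg]
  nlinarith [norm_nonneg (X * ω ^ (3 / 2 : ℂ))]

theorem xi_continuousOn (X : ℝ) : ContinuousOn (fun ω : ℂ => X * ω ^ (3 / 2 : ℂ))
    (Metric.sphere (1 / 2 : ℂ) (1 / 2) \ {0}) := fun _ hω =>
  (continuousAt_const.mul (continuousAt_cpow_const
    (Or.inl (re_pos_of_mem_sphere_diff hω)))).continuousWithinAt

/-- Each point of the curve either lies well inside the left half-plane or keeps a distance from the
segment `[0, Θ]`. -/
theorem exists_xiCurve_dichotomy {X Θ : ℝ} (hX : 0 < X) (hΘ : Θ < X) :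
    ∃ d : ℝ, 0 < d ∧ ∀ v ∈ xiCurve X, v.re ≤ -(‖v‖ / 2) ∨ ∀ w ∈ Icc 0 Θ, d ≤ ‖v - (w : ℂ)‖ := by
  have hcos : 0 < Real.cos (4 * Real.pi / 9) :=
    Real.cos_pos_of_mem_Ioo ⟨by linarith [Real.pi_pos], by linarith [Real.pi_pos]⟩
  set S : Set ℂ := Metric.sphere (1 / 2 : ℂ) (1 / 2) ∩ {ω | Real.cos (4 * Real.pi / 9) ≤ ‖ω‖}
  have hS : IsCompact S :=
    (isCompact_sphere _ _).inter_right (isClosed_le continuous_const continuous_norm)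
  have hS0 : ∀ ω ∈ S, ω ∈ Metric.sphere (1 / 2 : ℂ) (1 / 2) \ {0} := fun ω hω =>
    ⟨hω.1, fun h => by
      have h7 : Real.cos (4 * Real.pi / 9) ≤ ‖ω‖ := hω.2
      rw [mem_singleton_iff.1 h, norm_zero] at h7
      linarith⟩
  have hcont : ContinuousOn (fun p : ℂ × ℝ => ‖(X * p.1 ^ (3 / 2 : ℂ) - (p.2 : ℂ))‖)
      (S ×ˢ Icc 0 Θ) := by
    refine (ContinuousOn.sub ?_ (by fun_prop)).norm
    exact ((xi_continuousOn X).mono hS0).comp continuousOn_fst fun p hp => hp.1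
  -- The remaining part of the curve is compact and disjoint from [0, Θ], so the distance has a
  -- positive minimum.
  obtain ⟨d, hd0, hd⟩ := (hS.prod isCompact_Icc).exists_forall_le' hcont (a := 0) (by
    rintro ⟨ω, w⟩ ⟨hω, hw⟩
    refine norm_pos_iff.2 fun h => ?_
    have h1 := xi_mem_slitRegion (lo := 0) (hi := Θ) hX hΘ (lt_add_one X)
      (sphere_half_norm hω.1) (hS0 ω hω).2
    simp only at h
    rw [sub_eq_zero.1 h] at h1
    exact h1.2.2 ⟨Complex.ofReal_im w, hw⟩)
  refine ⟨d, hd0, ?_⟩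
  rintro v ⟨ω, hω, rfl⟩
  rcases le_total ‖ω‖ (Real.cos (4 * Real.pi / 9)) with h | h
  · exact Or.inl (xi_re_le hX hω h)
  · exact Or.inr fun w hw => hd (ω, w) ⟨⟨hω.1, h⟩, hw⟩

/-- In the left half-plane the origin is the nearest point of [0, ∞); all factors v - w_l are then
controlled by |v| alone. -/
theorem norm_le_norm_sub_of_re_nonpos {v : ℂ} (hv : v.re ≤ 0) {w : ℝ} (hw : 0 ≤ w) :
    ‖v‖ ≤ ‖v - (w : ℂ)‖ := by
  rw [← abs_of_nonneg (norm_nonneg v), ← abs_of_nonneg (norm_nonneg (v - (w : ℂ))), ← sq_le_sq,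
    ← Complex.normSq_eq_norm_sq, ← Complex.normSq_eq_norm_sq, Complex.normSq_apply,
    Complex.normSq_apply]
  simp
  nlinarith

theorem xiInt_congr {X : ℝ} {f g : ℂ → ℂ} (h : ∀ v ∈ xiCurve X, f v = g v) :
    xiInt X f = xiInt X g := by
  unfold xiInt
  refine contourInt_congr (by norm_num) fun ω hω => ?_
  rcases eq_or_ne ω 0 with rfl | h0
  · rw [Complex.zero_cpow (x := 1 / 2) (by norm_num)]
    simp
  · rw [h _ ⟨ω, ⟨hω, h0⟩, rfl⟩]

theorem xiInt_const_mul (X : ℝ) (a : ℂ) (f : ℂ → ℂ) :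
    xiInt X (fun v => a * f v) = a * xiInt X f := by
  unfold xiInt
  rw [← contourInt_const_mul]
  simp only [mul_assoc]

theorem xi_integrand_continuousOn {X : ℝ} {f : ℂ → ℂ} (hf : ContinuousOn f (xiCurve X)) :
    ContinuousOn (fun ω : ℂ => f (X * ω ^ (3 / 2 : ℂ)) * (X * (3 / 2) * ω ^ (1 / 2 : ℂ)))
      (Metric.sphere (1 / 2) (1 / 2) \ {0}) :=
  continuousOn_xi_integrand hf (fun _ hω => re_pos_of_mem_sphere_diff hω)
    fun ω hω => ⟨ω, hω, rfl⟩

theorem xi_integrand_bound {X C p : ℝ} (hX : 0 < X) (hp : p ≤ 1 / 3) {f : ℂ → ℂ}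
    (hf : ∀ v ∈ xiCurve X, ‖f v‖ ≤ C * ‖v‖ ^ (-p)) :
    ∀ ω ∈ Metric.sphere (1 / 2 : ℂ) (1 / 2) \ {0},
      ‖f (X * ω ^ (3 / 2 : ℂ)) * (X * (3 / 2) * ω ^ (1 / 2 : ℂ))‖ ≤
        |C| * X ^ (-p) * (X * (3 / 2)) := fun ω hω =>
  norm_xi_integrand_le hX hp (sphere_half_norm hω.1).le hω.2 (hf _ ⟨ω, hω, rfl⟩)

theorem xiInt_circleIntegrable {X C p : ℝ} (hX : 0 < X) (hp : p ≤ 1 / 3) {f : ℂ → ℂ}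
    (hfc : ContinuousOn f (xiCurve X)) (hf : ∀ v ∈ xiCurve X, ‖f v‖ ≤ C * ‖v‖ ^ (-p)) :
    CircleIntegrable (fun ω : ℂ => f (X * ω ^ (3 / 2 : ℂ)) * (X * (3 / 2) * ω ^ (1 / 2 : ℂ)))
      (1 / 2) (1 / 2) :=
  circleIntegrable_of_continuousOn_diff (by norm_num) (xi_integrand_continuousOn hfc)
    (xi_integrand_bound hX hp hf)

theorem xiInt_add {X C C' p : ℝ} (hX : 0 < X) (hp : p ≤ 1 / 3) {f g : ℂ → ℂ}
    (hfc : ContinuousOn f (xiCurve X)) (hf : ∀ v ∈ xiCurve X, ‖f v‖ ≤ C * ‖v‖ ^ (-p))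
    (hgc : ContinuousOn g (xiCurve X)) (hg : ∀ v ∈ xiCurve X, ‖g v‖ ≤ C' * ‖v‖ ^ (-p)) :
    xiInt X (fun v => f v + g v) = xiInt X f + xiInt X g := by
  unfold xiInt
  rw [← contourInt_add (xiInt_circleIntegrable hX hp hfc hf) (xiInt_circleIntegrable hX hp hgc hg)]
  simp only [add_mul]

theorem tendsto_xiInt {ι : Type*} {l : Filter ι} [l.IsCountablyGenerated] {X C p : ℝ} (hX : 0 < X)
    (hp : p ≤ 1 / 3) {F : ι → ℂ → ℂ} {f : ℂ → ℂ}
    (hF : ∀ᶠ n in l, ContinuousOn (F n) (xiCurve X))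
    (hC : ∀ᶠ n in l, ∀ v ∈ xiCurve X, ‖F n v‖ ≤ C * ‖v‖ ^ (-p))
    (hlim : ∀ v ∈ xiCurve X, Tendsto (fun n => F n v) l (𝓝 (f v))) :
    Tendsto (fun n => xiInt X (F n)) l (𝓝 (xiInt X f)) := by
  unfold xiInt
  refine tendsto_contourInt (p := 0) (C := |C| * X ^ (-p) * (X * (3 / 2))) (by norm_num) ?_ ?_ ?_
  · filter_upwards [hF] with n hn using xi_integrand_continuousOn hn
  · filter_upwards [hC] with n hn using xi_integrand_bound hX hp hn
  · intro ω hω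
    exact (hlim _ ⟨ω, hω, rfl⟩).mul_const _

theorem xiInt_integral_swap {X C p : ℝ} (hX : 0 < X) (hp : p ≤ 1 / 3) {S : Set ℝ}
    (hS : MeasurableSet S) {f : ℂ → ℝ → ℂ} {g : ℝ → ℝ}
    (hf : ContinuousOn (Function.uncurry f) (xiCurve X ×ˢ S)) (hg : IntegrableOn g S)
    (hfg : ∀ v ∈ xiCurve X, ∀ t ∈ S, ‖f v t‖ ≤ C * g t * ‖v‖ ^ (-p)) (hC : 0 ≤ C)
    (hg0 : ∀ t ∈ S, 0 ≤ g t) :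
    xiInt X (fun v => ∫ t in S, f v t) = ∫ t in S, xiInt X (fun v => f v t) := by
  unfold xiInt
  simp only [← integral_mul_const]
  refine contourInt_integral_swap (p := 0) (by norm_num) hS
    (g := fun t => C * X ^ (-p) * (X * (3 / 2)) * g t) ?_ (hg.const_mul _) ?_
  · refine ContinuousOn.mul (hf.comp (f := fun q : ℂ × ℝ => ((X * q.1 ^ (3 / 2 : ℂ) : ℂ), q.2))
      ?_ ?_) ?_
    · exact ((xi_continuousOn X).comp continuousOn_fst fun q hq => hq.1).prodMk continuousOn_snd
    · rintro ⟨ω, t⟩ ⟨hω, ht⟩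
      exact ⟨⟨ω, hω, rfl⟩, ht⟩
    · refine continuousOn_const.mul ?_
      intro q hq
      exact ((continuousAt_cpow_const (Or.inl (re_pos_of_mem_sphere_diff hq.1))).comp
        continuousAt_fst).continuousWithinAt
  · intro ω hω t ht
    have := norm_xi_integrand_le (f := fun v => f v t) (C := C * g t) hX hp
      (sphere_half_norm hω.1).le hω.2 (hfg _ ⟨ω, hω, rfl⟩ t ht)
    refine this.trans_eq ?_
    rw [abs_of_nonneg (mul_nonneg hC (hg0 t ht))]
    ring

/-! ### The Cauchy transform and removal of the pinched contour -/

/-- The Cauchy transform of `P` over the circle `|u| = b`. -/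
noncomputable def cauchyTransform (b : ℝ) (P : ℂ → ℂ) (v : ℂ) : ℂ :=
  contourInt 0 b fun u => P u / (u - v)

theorem differentiableOn_cauchyTransform {b : ℝ} (hb : 0 < b) {P : ℂ → ℂ}
    (hP : ContinuousOn P (Metric.sphere 0 b)) :
    DifferentiableOn ℂ (cauchyTransform b P) (Metric.ball 0 b) := by
  lift b to NNReal using hb.le
  have h := (hasFPowerSeriesOn_cauchy_integral (hP.circleIntegrable b.2) hb).differentiableOn
  rw [← Metric.eball_coe]
  refine h.congr fun v _ => ?_
  simp only [cauchyTransform, contourInt, smul_eq_mul, div_eq_mul_inv, mul_comm]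

theorem norm_cauchyTransform_le {b C : ℝ} (hb : 0 < b) {P : ℂ → ℂ}
    (hP : ∀ u ∈ Metric.sphere (0 : ℂ) b, ‖P u‖ ≤ C) {X : ℝ} (hX : X < b) {v : ℂ} (hv : ‖v‖ ≤ X) :
    ‖cauchyTransform b P v‖ ≤ b * (C / (b - X)) := by
  refine norm_contourInt_le hb.le fun u hu => ?_
  rw [norm_div]
  have h1 := norm_sub_norm_le u v
  rw [mem_sphere_zero_iff_norm.1 hu] at h1
  have h2 := hP u hu
  have h3 := (norm_nonneg _).trans h2
  exact div_le_div₀ h3 h2 (by linarith) (by linarith)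

theorem norm_circleMap_zero_add {r r' τ : ℝ} (hτ : τ ∈ Icc (0 : ℝ) 1)
    (θ : ℝ) : min r r' ≤ ‖circleMap ((0 : ℂ) + τ * (0 - 0)) (r + τ * (r' - r)) θ‖ := by
  rw [sub_zero, mul_zero, add_zero, norm_circleMap_zero]
  refine le_trans ?_ (le_abs_self _)
  obtain ⟨h0, h1⟩ := hτ
  rcases le_total r r' with h | h
  · rw [min_eq_left h]; nlinarith
  · rw [min_eq_right h]; nlinarith

theorem contourInt_zero_congr_radius {f : ℂ → ℂ} {s r r' : ℝ}
    (hf : DifferentiableOn ℂ f {u | s < ‖u‖}) (hr : s < r) (hr' : s < r') :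
    contourInt 0 r f = contourInt 0 r' f := by
  refine contourInt_deform_circle (isOpen_lt continuous_const continuous_norm) hf fun τ hτ θ => ?_
  exact (lt_min hr hr').trans_le
    (norm_circleMap_zero_add hτ θ)

theorem cauchyTransform_congr_radius {P : ℂ → ℂ} (hP : DifferentiableOn ℂ P {0}ᶜ) {v : ℂ}
    {b b' : ℝ} (h : ‖v‖ < b) (h' : ‖v‖ < b') : cauchyTransform b P v = cauchyTransform b' P v := by
  refine contourInt_zero_congr_radius ?_ h h'
  refine (hP.mono fun u hu => ?_).div (by fun_prop) fun u hu h0 => ?_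
  · exact norm_pos_iff.1 ((norm_nonneg v).trans_lt hu)
  · rw [sub_eq_zero.1 h0] at hu
    exact lt_irrefl ‖v‖ hu

/-- The residue at u = v. With P(u) = P(v) + (u - v) · `dslope P v u`, the slope is holomorphic off
the origin and sees no difference between the radii; only the integral of 1 / (u - v) jumps from 0
to 1. -/
theorem cauchyTransform_eq_add {P : ℂ → ℂ} (hP : DifferentiableOn ℂ P {0}ᶜ) {v : ℂ} {r r' : ℝ}
    (hr : 0 < r) (hrv : r < ‖v‖) (hvr' : ‖v‖ < r') :
    cauchyTransform r' P v = cauchyTransform r P v + P v := by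
  have hv0 : v ≠ 0 := norm_pos_iff.1 (hr.trans hrv)
  have hr' : 0 < r' := (hr.trans hrv).trans hvr'
  have hd : DifferentiableOn ℂ (dslope P v) {0}ᶜ :=
    (Complex.differentiableOn_dslope (isOpen_compl_singleton.mem_nhds hv0)).2 hP
  have hinv : ∀ s : ℝ, 0 < s → s ≠ ‖v‖ →
      ContinuousOn (fun u : ℂ => (u - v)⁻¹) (Metric.sphere 0 s) := by
    intro s hs hsv
    refine ContinuousOn.inv₀ (by fun_prop) fun u hu h0 => hsv ?_
    rw [← sub_eq_zero.1 h0, mem_sphere_zero_iff_norm.1 hu]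
  have hsub : ∀ s : ℝ, 0 < s → Metric.sphere (0 : ℂ) s ⊆ {0}ᶜ := fun s hs u hu => by
    have : ‖u‖ = s := mem_sphere_zero_iff_norm.1 hu
    exact norm_pos_iff.1 (this ▸ hs)
  have hsplit : ∀ s : ℝ, 0 < s → s ≠ ‖v‖ → cauchyTransform s P v =
      contourInt 0 s (dslope P v) + contourInt 0 s (fun u => (u - v)⁻¹) * P v := by
    intro s hs hsv
    rw [← contourInt_mul_const, ← contourInt_add]
    · refine contourInt_congr hs.le fun u hu => ?_
      have huv : u ≠ v := fun h => hsv (by rw [← h, mem_sphere_zero_iff_norm.1 hu])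
      rw [dslope_of_ne _ huv, slope_def_field]
      field_simp [sub_ne_zero.2 huv]
      ring
    · exact (hd.continuousOn.mono (hsub s hs)).circleIntegrable hs.le
    · exact ((hinv s hs hsv).mul continuousOn_const).circleIntegrable hs.le
  rw [hsplit r' hr' hvr'.ne', hsplit r hr hrv.ne]
  have e1 : contourInt 0 r (dslope P v) = contourInt 0 r' (dslope P v) :=
    contourInt_zero_congr_radius (hd.mono fun u hu => norm_pos_iff.1 hu) hr hr'
  have e2 : contourInt 0 r' (fun u => (u - v)⁻¹) = 1 := by
    rw [contourInt, circleIntegral.integral_sub_inv_of_mem_ball (by simpa using hvr')]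
    exact inv_mul_cancel₀ Complex.two_pi_I_ne_zero
  have e3 : contourInt 0 r (fun u => (u - v)⁻¹) = 0 := by
    rw [contourInt, Complex.circleIntegral_eq_zero_of_differentiable_on_off_countable hr.le
      countable_empty, mul_zero]
    · refine ContinuousOn.inv₀ (by fun_prop) fun u hu h0 => ?_
      rw [← sub_eq_zero.1 h0] at hrv
      exact absurd (mem_closedBall_zero_iff.1 hu) hrv.not_ge
    · intro u hu
      refine DifferentiableAt.inv (by fun_prop) fun h0 => ?_
      rw [← sub_eq_zero.1 h0] at hrv
      exact absurd (mem_ball_zero_iff.1 hu.1) hrv.le.not_gt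
  rw [e1, e2, e3]
  ring

/-- A product with `mellinH` is `O(‖v‖ ^ (-1 / 4))` at the origin, so that the circle integral may
be moved to the curve through the origin. -/
theorem contourInt_besselH_mul_eq_xiInt (κ : ℕ) {y : ℝ} (hy : 0 < y) {g : ℂ → ℂ}
    {lo hi B X c R : ℝ} (hg : DifferentiableOn ℂ g (slitRegion lo hi B)) (hg0 : ContinuousAt g 0)
    (hlo : 0 < lo) (hX : 0 < X) (hhi : hi < X) (hXB : X < B) (hR : 0 < R) (hRc : R < c)
    (h1 : c - R < lo) (h2 : hi < c + R) (h3 : c + R < B) :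
    contourInt c R (fun v => besselH κ (v * y) * g v) =
      xiInt X (fun v => mellinH (1 / 4) κ (v * y) * g v) := by
  have hsp : ∀ v ∈ Complex.slitPlane, v * (y : ℂ) ∈ Complex.slitPlane := by
    intro v hv
    rcases hv with h | h
    · left
      rw [Complex.re_mul_ofReal]
      exact mul_pos h hy
    · right
      rw [Complex.im_mul_ofReal]
      exact mul_ne_zero h hy.ne'
  obtain ⟨C, hC0, hC⟩ := norm_mellinH_le (σ := 1 / 4) (by norm_num) κ (ψ := 3 * Real.pi / 4)
    (by positivity) (by linarith [Real.pi_pos])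
  obtain ⟨δ, hδ0, hδ⟩ := Metric.eventually_nhds_iff.1
    (hg0.norm.eventually (gt_mem_nhds (lt_add_one ‖g 0‖)))
  rw [← contourInt_eq_xiInt (f := fun v => mellinH (1 / 4) κ (v * y) * g v)
    (C := C * y ^ (-(1 / 4) : ℝ) * (‖g 0‖ + 1)) (δ := δ) ?_ hlo hX hhi hXB hR hRc h1 h2 h3 hδ0]
  · refine contourInt_congr hR.le fun v hv => ?_
    have hre : 0 < v.re := by
      have h4 := (Complex.abs_re_le_norm (v - c)).trans_eq (mem_sphere_iff_norm.1 hv)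
      rw [Complex.sub_re, Complex.ofReal_re, abs_le] at h4
      linarith
    rw [mellinH_eq_besselH (by norm_num)]
    rw [Complex.re_mul_ofReal]
    exact mul_pos hre hy
  · intro v hv0 hvδ harg
    rw [norm_mul]
    have h5 := hC (v * y) (mul_ne_zero hv0 (by exact_mod_cast hy.ne')) (by
      rwa [mul_comm, Complex.arg_real_mul _ hy])
    rw [norm_mul, Complex.norm_real, Real.norm_of_nonneg hy.le,
      Real.mul_rpow (norm_nonneg _) hy.le] at h5
    have h6 : ‖g v‖ ≤ ‖g 0‖ + 1 := (hδ (by simpa using hvδ)).le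
    calc _ ≤ (C * (‖v‖ ^ (-(1 / 4) : ℝ) * y ^ (-(1 / 4) : ℝ))) * (‖g 0‖ + 1) := by gcongr
      _ = _ := by ring
  · refine DifferentiableOn.mul ?_ hg
    exact (differentiableOn_mellinH (by norm_num) κ).comp (by fun_prop) fun v hv => hsp v hv.1

theorem isOpen_compl_segment (lo hi : ℝ) : IsOpen {z : ℂ | ¬(z.im = 0 ∧ z.re ∈ Icc lo hi)} := by
  have h : IsClosed {z : ℂ | z.im = 0 ∧ z.re ∈ Icc lo hi} :=
    (isClosed_eq Complex.continuous_im continuous_const).inter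
      (isClosed_Icc.preimage Complex.continuous_re)
  exact h.isOpen_compl

theorem sphere_subset_slitRegion {lo hi B c R : ℝ} (hR : 0 < R) (hRc : R < c) (h1 : c - R < lo)
    (h2 : hi < c + R) (h3 : c + R < B) : Metric.sphere (c : ℂ) R ⊆ slitRegion lo hi B := by
  intro v hv
  rw [← abs_of_pos hR, ← range_circleMap] at hv
  obtain ⟨θ, rfl⟩ := hv
  exact mem_slitRegion_of_circle hR hRc h1 h2 h3 θ

theorem re_pos_of_mem_sphere {c R : ℝ} (hRc : R < c) {v : ℂ} (hv : v ∈ Metric.sphere (c : ℂ) R) :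
    0 < v.re := by
  have h4 := (Complex.abs_re_le_norm (v - c)).trans_eq (mem_sphere_iff_norm.1 hv)
  rw [Complex.sub_re, Complex.ofReal_re, abs_le] at h4
  linarith

theorem re_pos_of_mem_closedBall {c R : ℝ} (hRc : R < c) {v : ℂ}
    (hv : v ∈ Metric.closedBall (c : ℂ) R) : 0 < v.re := by
  have h4 := (Complex.abs_re_le_norm (v - c)).trans (mem_closedBall_iff_norm.1 hv)
  rw [Complex.sub_re, Complex.ofReal_re, abs_le] at h4
  linarith

theorem differentiableOn_besselH_mul (κ : ℕ) {y : ℝ} (hy : 0 < y) :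
    DifferentiableOn ℂ (fun v : ℂ => besselH κ (v * y)) {v | 0 < v.re} := by
  refine (differentiableOn_besselH κ).comp (by fun_prop) fun v hv => ?_
  rw [mem_ofPred_eq, Complex.re_mul_ofReal]
  exact mul_pos hv hy

theorem contourInt_eq_zero_of_re_pos {f : ℂ → ℂ} (hf : DifferentiableOn ℂ f {v | 0 < v.re})
    {c R : ℝ} (hR : 0 ≤ R) (hRc : R < c) : contourInt c R f = 0 := by
  rw [contourInt, Complex.circleIntegral_eq_zero_of_differentiable_on_off_countable hR
    countable_empty, mul_zero]
  · exact hf.continuousOn.mono fun v hv => re_pos_of_mem_closedBall hRc hv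
  · intro v hv
    exact hf.differentiableAt (isOpen_rightHalfPlane.mem_nhds
      (re_pos_of_mem_closedBall hRc (Metric.ball_subset_closedBall hv.1)))

/-- Performing the u-integral first leaves a Cauchy transform in v. Replacing its circle by a larger
one adds at most the residue P(v) g(v) = E(v), and H(vy) E(v) is holomorphic in the right
half-plane, so its circle integral is zero. The enlarged transform is holomorphic at the origin, and
the v-circle may be moved to the curve. -/
theorem contourInt_contourInt_eq_xiInt (κ : ℕ) {y : ℝ} (hy : 0 < y) {P g E : ℂ → ℂ}
    {lo hi b X r c R : ℝ} (hP : DifferentiableOn ℂ P {0}ᶜ)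
    (hg : DifferentiableOn ℂ g {z : ℂ | ¬(z.im = 0 ∧ z.re ∈ Icc lo hi)})
    (hE : Differentiable ℂ E) (hPg : ∀ z : ℂ, z ≠ 0 → ¬(z.im = 0 ∧ z.re ∈ Icc lo hi) →
      P z * g z = E z) (hlo : 0 < lo) (hX : 0 < X) (hhi : hi < X) (hXb : X < b) (hr : 0 < r)
    (hR : 0 < R) (hRc : R < c) (h1 : c - R < lo) (h2 : hi < c + R)
    (hsep : r < c - R ∨ c + R < r) :
    contourInt 0 r (fun u => contourInt c R fun v => P u * (besselH κ (v * y) * g v) / (u - v)) =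
      xiInt X (fun v => mellinH (1 / 4) κ (v * y) * (cauchyTransform b P v * g v)) := by
  -- A radius beyond both the given v-circle and b, so that the transform is holomorphic on
  -- everything the deformation sweeps; it is returned to b at the end.
  set b' : ℝ := max (c + R) b + 1 with hb'
  have hb1 : c + R < b' := (le_max_left _ _).trans_lt (lt_add_one _)
  have hb2 : b < b' := (le_max_right _ _).trans_lt (lt_add_one _)
  have hsph := sphere_subset_slitRegion hR hRc h1 h2 hb1
  have hsphere0 : ∀ s : ℝ, 0 < s → Metric.sphere (0 : ℂ) s ⊆ {0}ᶜ := fun s hs u hu => by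
    have : ‖u‖ = s := mem_sphere_zero_iff_norm.1 hu
    exact norm_pos_iff.1 (this ▸ hs)
  have hnorm : ∀ v ∈ Metric.sphere (c : ℂ) R, c - R ≤ ‖v‖ ∧ ‖v‖ ≤ c + R := by
    intro v hv
    have hc : ‖(c : ℂ)‖ = c := by rw [Complex.norm_real, Real.norm_of_nonneg (by linarith)]
    have h4 := norm_sub_norm_le v c
    have h5 := norm_sub_norm_le (c : ℂ) v
    rw [norm_sub_rev] at h5
    rw [mem_sphere_iff_norm.1 hv, hc] at h4 h5
    exact ⟨by linarith, by linarith⟩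
  have hgS : ContinuousOn g (Metric.sphere c R) := hg.continuousOn.mono fun v hv => (hsph hv).2.2
  have hHS : ContinuousOn (fun v : ℂ => besselH κ (v * y)) (Metric.sphere c R) :=
    (differentiableOn_besselH_mul κ hy).continuousOn.mono fun v hv => re_pos_of_mem_sphere hRc hv
  have hne : ∀ u ∈ Metric.sphere (0 : ℂ) r, ∀ v ∈ Metric.sphere (c : ℂ) R, u - v ≠ 0 := by
    intro u hu v hv h0
    have h4 := hnorm v hv
    rw [← sub_eq_zero.1 h0, mem_sphere_zero_iff_norm.1 hu] at h4
    rcases hsep with h | h <;> linarith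
  rw [contourInt_swap hr hR]
  swap
  · refine ContinuousOn.div (ContinuousOn.mul ?_ (ContinuousOn.mul ?_ ?_)) (by fun_prop)
      fun q hq => hne _ hq.1 _ hq.2
    · exact (hP.continuousOn.mono (hsphere0 r hr)).comp continuousOn_fst fun q hq => hq.1
    · exact hHS.comp continuousOn_snd fun q hq => hq.2
    · exact hgS.comp continuousOn_snd fun q hq => hq.2
  have hinner : ∀ v : ℂ, contourInt 0 r (fun u => P u * (besselH κ (v * y) * g v) / (u - v)) =
      besselH κ (v * y) * (cauchyTransform r P v * g v) := by
    intro v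
    rw [cauchyTransform, mul_comm (contourInt _ _ _), ← mul_assoc, ← contourInt_const_mul]
    congr 1
    ext u
    ring
  simp only [hinner]
  have hPb : ContinuousOn P (Metric.sphere 0 b') :=
    hP.continuousOn.mono (hsphere0 b' (by linarith))
  have hT := differentiableOn_cauchyTransform (b := b') (by linarith) hPb
  have key : contourInt c R (fun v => besselH κ (v * y) * (cauchyTransform r P v * g v)) =
      contourInt c R (fun v => besselH κ (v * y) * (cauchyTransform b' P v * g v)) := by
    rcases hsep with h | h
    -- The u-circle lies to the left of the v-circle: enlarging it crosses every v, and the residue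
    -- term integrates to zero.
    · have hzero : contourInt c R (fun v => besselH κ (v * y) * E v) = 0 :=
        contourInt_eq_zero_of_re_pos
          ((differentiableOn_besselH_mul κ hy).mul hE.differentiableOn) hR.le hRc
      rw [← sub_zero (contourInt c R fun v => besselH κ (v * y) * (cauchyTransform b' P v * g v)),
        ← hzero, ← contourInt_sub]
      · refine contourInt_congr hR.le fun v hv => ?_
        have h4 := hnorm v hv
        have hv0 : v ≠ 0 := fun h0 => by
          have := re_pos_of_mem_sphere hRc hv
          simp [h0] at this
        rw [cauchyTransform_eq_add hP hr (by linarith) (by linarith : ‖v‖ < b'),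
          ← hPg v hv0 (hsph hv).2.2]
        ring
      · refine (hHS.mul (ContinuousOn.mul ?_ hgS)).circleIntegrable hR.le
        exact hT.continuousOn.mono fun v hv => by
          have := hnorm v hv
          exact mem_ball_zero_iff.2 (by linarith)
      · exact (hHS.mul hE.continuous.continuousOn).circleIntegrable hR.le
    -- The u-circle already encloses the v-circle: only the radius changes and no pole is crossed.
    · refine contourInt_congr hR.le fun v hv => ?_
      have h4 := hnorm v hv
      rw [cauchyTransform_congr_radius hP (by linarith : ‖v‖ < r) (by linarith : ‖v‖ < b')]
  rw [key, contourInt_besselH_mul_eq_xiInt κ hy (g := fun v => cauchyTransform b' P v * g v) (lo := lo)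
    (hi := hi) (B := b') ?_ ?_ hlo hX hhi (hXb.trans hb2) hR hRc h1 h2 hb1]
  · refine xiInt_congr fun v hv => ?_
    have h4 := norm_le_of_mem_xiCurve hX hv
    rw [cauchyTransform_congr_radius hP (by linarith : ‖v‖ < b) (by linarith : ‖v‖ < b')]
  · exact (hT.mono fun v hv => mem_ball_zero_iff.2 hv.2.1).mul (hg.mono fun v hv => hv.2.2)
  · refine ContinuousAt.mul ?_ ?_
    · exact (hT.differentiableAt (Metric.isOpen_ball.mem_nhds (by simp; linarith))).continuousAt
    · refine (hg.differentiableAt ((isOpen_compl_segment lo hi).mem_nhds ?_)).continuousAt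
      rintro ⟨-, h5, -⟩
      simp at h5
      linarith

/-! ### The finite-size kernel in rescaled variables -/

theorem ofReal_mul_cpow {x : ℝ} (hx : 0 < x) {z : ℂ} (hz : z ≠ 0) (s : ℂ) :
    ((x : ℂ) * z) ^ s = (x : ℂ) ^ s * z ^ s := by
  have hx0 : (x : ℂ) ≠ 0 := by exact_mod_cast hx.ne'
  rw [Complex.cpow_def_of_ne_zero (mul_ne_zero hx0 hz), Complex.cpow_def_of_ne_zero hx0,
    Complex.cpow_def_of_ne_zero hz, Complex.log_ofReal_mul hx hz, ← Complex.exp_add,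
    Complex.ofReal_log hx.le]
  ring_nf

theorem cpow_half_pow (z : ℂ) (κ : ℕ) : (z ^ (1 / 2 : ℂ)) ^ κ = z ^ ((κ : ℂ) / 2) := by
  rw [← Complex.cpow_nat_mul]
  ring_nf

theorem cpow_half_sq (z : ℂ) : (z ^ (1 / 2 : ℂ)) ^ 2 = z := by
  rw [← Complex.cpow_nat_mul]
  simp

/-- The half-integral powers of the correlation kernel combine with the Bessel functions into entire
functions of `η` and analytic functions of `ζ`. -/
theorem bessel_integrand_eq (κ N M : ℕ) (α : ℝ) (q : ℕ → ℝ) {x y : ℝ} (hx : 0 < x) (hy : 0 < y)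
    {η ζ : ℂ} (hη : η ≠ 0) (hζ : 0 < ζ.re) :
    (((x / y) ^ ((κ : ℝ) / 2) : ℝ) : ℂ) * 2 *
      ((ζ / η) ^ N * (ζ ^ ((κ : ℂ) / 2) / η ^ ((κ : ℂ) / 2)) *
        (besselI κ (2 * (η * (x : ℂ)) ^ (1 / 2 : ℂ)) * besselK κ (2 * (ζ * (y : ℂ)) ^ (1 / 2 : ℂ))
          / (η - ζ)) *
        ∏ l ∈ Finset.range M, (η - (α : ℂ) * (q l : ℂ)) / (ζ - (α : ℂ) * (q l : ℂ))) =
    ((x / y : ℝ) : ℂ) ^ κ * ((ζ / η) ^ N * (besselF κ (η * x) * besselH κ (ζ * y) / (η - ζ)) *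
        ∏ l ∈ Finset.range M, (η - (α : ℂ) * (q l : ℂ)) / (ζ - (α : ℂ) * (q l : ℂ))) := by
  have hζ0 : ζ ≠ 0 := fun h => by simp [h] at hζ
  have hx0 : (x : ℂ) ≠ 0 := by exact_mod_cast hx.ne'
  have hy0 : (y : ℂ) ≠ 0 := by exact_mod_cast hy.ne'
  have hI : besselI κ (2 * (η * (x : ℂ)) ^ (1 / 2 : ℂ)) =
      (x : ℂ) ^ ((κ : ℂ) / 2) * η ^ ((κ : ℂ) / 2) * besselF κ (η * x) := by
    rw [besselI_two_mul, cpow_half_pow, cpow_half_sq, mul_comm η, ofReal_mul_cpow hx hη]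
  have hK : besselH κ (ζ * y) = 2 * ((y : ℂ) ^ ((κ : ℂ) / 2) * ζ ^ ((κ : ℂ) / 2)) *
      besselK κ (2 * (ζ * (y : ℂ)) ^ (1 / 2 : ℂ)) := by
    rw [← cpow_mul_besselK κ (z := ζ * y) (by rw [Complex.re_mul_ofReal]; exact mul_pos hζ hy),
      cpow_half_pow, mul_comm ζ (y : ℂ), ofReal_mul_cpow hy hζ0]
  have hηk : η ^ ((κ : ℂ) / 2) ≠ 0 := by simp [Complex.cpow_eq_zero_iff, hη]
  have hyk : (y : ℂ) ^ ((κ : ℂ) / 2) ≠ 0 := by simp [Complex.cpow_eq_zero_iff, hy0]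
  have hxsq : (x : ℂ) ^ ((κ : ℂ) / 2) * (x : ℂ) ^ ((κ : ℂ) / 2) = (x : ℂ) ^ κ := by
    rw [← Complex.cpow_add _ _ hx0, add_halves, Complex.cpow_natCast]
  have hysq : (y : ℂ) ^ ((κ : ℂ) / 2) * (y : ℂ) ^ ((κ : ℂ) / 2) = (y : ℂ) ^ κ := by
    rw [← Complex.cpow_add _ _ hy0, add_halves, Complex.cpow_natCast]
  have hxy : (((x / y) ^ ((κ : ℝ) / 2) : ℝ) : ℂ) =
      (x : ℂ) ^ ((κ : ℂ) / 2) / (y : ℂ) ^ ((κ : ℂ) / 2) := by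
    rw [Real.div_rpow hx.le hy.le, Complex.ofReal_div, Complex.ofReal_cpow hx.le,
      Complex.ofReal_cpow hy.le]
    push_cast
    rfl
  rw [hI, hK, hxy, Complex.ofReal_div, div_pow (x : ℂ) (y : ℂ), ← hxsq, ← hysq]
  field_simp

theorem kernelIndep_eq (κ N M : ℕ) {α : ℝ} {q : ℕ → ℝ} {r c R x y : ℝ} (hx : 0 < x) (hy : 0 < y)
    (hr : 0 < r) (hR : 0 < R) (hRc : R < c) :
    kernelIndep κ N M α q r c R x y = ((x / y : ℝ) : ℂ) ^ κ *
      contourInt 0 r fun η => contourInt (c : ℂ) R fun ζ =>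
        (ζ / η) ^ N * (besselF κ (η * x) * besselH κ (ζ * y) / (η - ζ)) *
        ∏ l ∈ Finset.range M, (η - (α : ℂ) * (q l : ℂ)) / (ζ - (α : ℂ) * (q l : ℂ)) := by
  rw [kernelIndep, ← contourInt_const_mul, ← contourInt_const_mul]
  refine contourInt_congr hr.le fun η hη => ?_
  rw [← contourInt_const_mul, ← contourInt_const_mul]
  refine contourInt_congr hR.le fun ζ hζ => ?_
  refine bessel_integrand_eq κ N M α q hx hy ?_ (re_pos_of_mem_sphere hRc hζ)
  exact norm_pos_iff.1 ((mem_sphere_zero_iff_norm.1 hη).symm ▸ hr)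

/-- The weight of the correlation kernel in rescaled variables. -/
noncomputable def prelimitWeight (N M : ℕ) (w : ℕ → ℝ) (u : ℂ) : ℂ :=
  (u ^ N)⁻¹ * ∏ l ∈ Finset.range M, (u - (w l : ℂ))

/-- Under η = λu, ζ = λv the two differentials give λ², and 1/(η - ζ) together with the prefactor
gives λ^(-2). The powers λ^M of the two products cancel, and (x/y)^κ is removed by the last factor
on the left. -/
theorem rescaled_kernelIndep_eq (κ N M : ℕ) {α lam : ℝ} {q w : ℕ → ℝ} {r c R x y : ℝ} (hx : 0 < x)
    (hy : 0 < y) (hlam : 0 < lam) (hr : 0 < r) (hR : 0 < R) (hRc : R < c)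
    (hw : ∀ l, l < M → α * q l = lam * w l) :
    ((1 / lam : ℝ) : ℂ) * kernelIndep κ N M α q r c R (x / lam) (y / lam) *
        ((x / y : ℝ) : ℂ) ^ (-(κ : ℤ)) =
      contourInt 0 (r / lam) fun u => contourInt ((c / lam : ℝ) : ℂ) (R / lam) fun v =>
        (besselF κ (u * x) * prelimitWeight N M w u) *
          (besselH κ (v * y) * (prelimitWeight N M w v)⁻¹) / (u - v) := by
  have hl0 : (lam : ℂ) ≠ 0 := by exact_mod_cast hlam.ne'
  have hxy : ((x / y : ℝ) : ℂ) ≠ 0 := by exact_mod_cast (div_pos hx hy).ne'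
  have e1 : (0 : ℂ) = (lam : ℂ) * 0 := by simp
  have e2 : r = lam * (r / lam) := by field_simp
  have e3 : (c : ℂ) = (lam : ℂ) * ((c / lam : ℝ) : ℂ) := by push_cast; field_simp
  have e4 : R = lam * (R / lam) := by field_simp
  rw [kernelIndep_eq κ N M (div_pos hx hlam) (div_pos hy hlam) hr hR hRc,
    div_div_div_cancel_right₀ hlam.ne', zpow_neg, zpow_natCast]
  conv_lhs =>
    enter [1, 2, 2]
    rw [e1, e2, contourInt_scale]
    enter [2, 3, u]
    rw [e3, e4, contourInt_scale]
  rw [contourInt_const_mul]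
  have e5 : ∀ A : ℂ, ((1 / lam : ℝ) : ℂ) * (((x / y : ℝ) : ℂ) ^ κ * ((lam : ℂ) * ((lam : ℂ) * A))) *
      (((x / y : ℝ) : ℂ) ^ κ)⁻¹ = (lam : ℂ) * A := by
    intro A
    push_cast
    push_cast at hxy
    have := pow_ne_zero κ hxy
    field_simp
  rw [e5, ← contourInt_const_mul]
  refine contourInt_congr (div_pos hr hlam).le fun u hu => ?_
  rw [← contourInt_const_mul]
  refine contourInt_congr (div_pos hR hlam).le fun v hv => ?_
  have hprod : ∀ z : ℂ, ∏ l ∈ Finset.range M, ((lam : ℂ) * z - (α : ℂ) * (q l : ℂ)) =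
      (lam : ℂ) ^ M * ∏ l ∈ Finset.range M, (z - (w l : ℂ)) := by
    intro z
    rw [← Finset.card_range M, ← Finset.prod_const, Finset.card_range, ← Finset.prod_mul_distrib]
    refine Finset.prod_congr rfl fun l hl => ?_
    have := hw l (Finset.mem_range.1 hl)
    have h6 : (α : ℂ) * (q l : ℂ) = lam * w l := by exact_mod_cast this
    rw [h6]
    ring
  rw [Finset.prod_div_distrib, hprod, hprod, mul_div_mul_left _ _ (pow_ne_zero M hl0),
    mul_div_mul_left _ _ hl0, prelimitWeight, prelimitWeight]
  have e6 : (lam : ℂ) * u * ((x / lam : ℝ) : ℂ) = u * x := by push_cast; field_simp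
  have e7 : (lam : ℂ) * v * ((y / lam : ℝ) : ℂ) = v * y := by push_cast; field_simp
  rw [e6, e7, ← mul_sub, div_pow, mul_inv, inv_inv]
  have e8 : (besselF κ (u * x) * besselH κ (v * y)) / ((lam : ℂ) * (u - v)) =
      (lam : ℂ)⁻¹ * (besselF κ (u * x) * besselH κ (v * y) / (u - v)) := by
    rw [div_mul_eq_div_div, div_right_comm, div_eq_inv_mul]
  rw [e8]
  simp only [div_eq_mul_inv]
  have e9 : (lam : ℂ) * (lam : ℂ)⁻¹ = 1 := mul_inv_cancel₀ hl0
  linear_combination (v ^ N * (u ^ N)⁻¹ * (besselF κ (u * x) * besselH κ (v * y) * (u - v)⁻¹) *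
    ((∏ l ∈ Finset.range M, (u - (w l : ℂ))) * (∏ l ∈ Finset.range M, (v - (w l : ℂ)))⁻¹)) * e9

/-! ### Convergence of the weights and uniform bounds -/

/-- The limit of the weights `prelimitWeight`. -/
noncomputable def limitWeight (ν : ℕ) {m : ℕ} (θ : Fin m → ℝ) (u : ℂ) : ℂ :=
  Complex.exp (-1 / u) * (u ^ ν / u ^ m) * ∏ k, (u + (θ k : ℂ))

/-- The exponent ν - m may be negative, so it appears as a quotient of natural powers. This isolates
the N-th power whose limit is e^(-1/u). -/
theorem prelimitWeight_eq {N ν m : ℕ} {w : ℕ → ℝ} (hm : m ≤ N + ν)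
    (hw : ∀ l, m ≤ l → l < N + ν → w l = 1 / N) {u : ℂ} (hu : u - ((1 / N : ℝ) : ℂ) ≠ 0) :
    prelimitWeight N (N + ν) w u = ((u - ((1 / N : ℝ) : ℂ)) / u) ^ N *
      ((u - ((1 / N : ℝ) : ℂ)) ^ ν / (u - ((1 / N : ℝ) : ℂ)) ^ m) *
      ∏ k : Fin m, (u - (w k : ℂ)) := by
  have h1 : ∏ l ∈ Finset.range (N + ν), (u - (w l : ℂ)) =
      (∏ l ∈ Finset.range m, (u - (w l : ℂ))) * (u - ((1 / N : ℝ) : ℂ)) ^ (N + ν - m) := by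
    rw [← Finset.prod_range_mul_prod_Ico _ hm]
    congr 1
    rw [Finset.prod_congr rfl fun l hl => by
      rw [hw l (Finset.mem_Ico.1 hl).1 (Finset.mem_Ico.1 hl).2], Finset.prod_const, Nat.card_Ico]
  have h2 : (u - ((1 / N : ℝ) : ℂ)) ^ (N + ν - m) =
      (u - ((1 / N : ℝ) : ℂ)) ^ N * ((u - ((1 / N : ℝ) : ℂ)) ^ ν / (u - ((1 / N : ℝ) : ℂ)) ^ m) := by
    rw [← mul_div_assoc, ← pow_add, eq_div_iff (pow_ne_zero m hu), ← pow_add, Nat.sub_add_cancel hm]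
  rw [prelimitWeight, h1, h2, Finset.prod_range fun l => u - (w l : ℂ), div_pow]
  ring

theorem tendsto_inv_natCast_ofReal : Tendsto (fun N : ℕ => ((1 / N : ℝ) : ℂ)) atTop (𝓝 0) := by
  have := (Complex.continuous_ofReal.tendsto 0).comp tendsto_one_div_atTop_nhds_zero_nat
  rwa [Complex.ofReal_zero] at this

theorem eventually_sub_inv_ne_zero {u : ℂ} (hu : u ≠ 0) :
    ∀ᶠ N : ℕ in atTop, u - ((1 / N : ℝ) : ℂ) ≠ 0 := by
  have h : Tendsto (fun N : ℕ => u - ((1 / N : ℝ) : ℂ)) atTop (𝓝 (u - 0)) :=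
    tendsto_const_nhds.sub tendsto_inv_natCast_ofReal
  rw [sub_zero] at h
  exact h.eventually_ne hu

theorem tendsto_prelimitWeight {ν m : ℕ} {w : ℕ → ℕ → ℝ} {θ : Fin m → ℝ}
    (hw : ∀ N l, m ≤ l → l < N + ν → w N l = 1 / N)
    (hθ : ∀ k : Fin m, Tendsto (fun N => w N k) atTop (𝓝 (-θ k))) {u : ℂ} (hu : u ≠ 0) :
    Tendsto (fun N => prelimitWeight N (N + ν) (w N) u) atTop (𝓝 (limitWeight ν θ u)) := by
  have h0 : Tendsto (fun N : ℕ => u - ((1 / N : ℝ) : ℂ)) atTop (𝓝 u) := by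
    simpa using tendsto_const_nhds.sub tendsto_inv_natCast_ofReal (a := u)
  have h1 : Tendsto (fun N : ℕ => ((u - ((1 / N : ℝ) : ℂ)) / u) ^ N) atTop
      (𝓝 (Complex.exp (-1 / u))) := by
    refine (Complex.tendsto_one_add_div_pow_exp (-1 / u)).congr fun N => ?_
    congr 1
    push_cast
    rcases eq_or_ne (N : ℂ) 0 with h | h
    · simp [h, hu]
    · field_simp
      ring
  have h2 : Tendsto (fun N : ℕ => ∏ k : Fin m, (u - (w N k : ℂ))) atTop
      (𝓝 (∏ k, (u + (θ k : ℂ)))) := by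
    refine tendsto_finsetProd _ fun k _ => ?_
    have := tendsto_const_nhds.sub ((Complex.continuous_ofReal.tendsto _).comp (hθ k)) (a := u)
    simpa using this
  refine Tendsto.congr' ?_ ((h1.mul ((h0.pow ν).div (h0.pow m) (pow_ne_zero m hu))).mul h2)
  filter_upwards [eventually_sub_inv_ne_zero hu, eventually_ge_atTop m] with N hN hm
  exact (prelimitWeight_eq (by omega) (hw N) hN).symm

theorem one_add_div_pow_le_exp {t : ℝ} (ht : 0 ≤ t) (N : ℕ) : (1 + t / N) ^ N ≤ Real.exp t := by
  rcases Nat.eq_zero_or_pos N with rfl | hN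
  · simpa using ht
  have h : (1 + t / N) ^ N ≤ Real.exp (t / N) ^ N := by
    have : 0 ≤ t / N := by positivity
    exact pow_le_pow_left₀ (by linarith) (by linarith [Real.add_one_le_exp (t / N)]) N
  rwa [← Real.exp_nat_mul, mul_div_cancel₀ _ (by positivity)] at h

theorem exists_prelimitWeight_bound {ν m : ℕ} {w : ℕ → ℕ → ℝ} {Θ b : ℝ} (hb : 0 < b)
    (hw : ∀ N l, m ≤ l → l < N + ν → w N l = 1 / N)
    (hwΘ : ∀ᶠ N : ℕ in atTop, ∀ k : Fin m, w N k ∈ Icc 0 Θ) :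
    ∃ C : ℝ, ∀ᶠ N : ℕ in atTop, ∀ u ∈ Metric.sphere (0 : ℂ) b,
      ‖prelimitWeight N (N + ν) (w N) u‖ ≤ C := by
  refine ⟨Real.exp (1 / b) * ((2 * b) ^ ν / (b / 2) ^ m) * (b + Θ) ^ m, ?_⟩
  have hinv : ∀ᶠ N : ℕ in atTop, (1 / N : ℝ) < b / 2 :=
    tendsto_one_div_atTop_nhds_zero_nat.eventually (gt_mem_nhds (by positivity))
  filter_upwards [hwΘ, eventually_ge_atTop m, hinv] with N hN hm hNb u hu
  have hub : ‖u‖ = b := mem_sphere_zero_iff_norm.1 hu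
  have hn : ‖((1 / N : ℝ) : ℂ)‖ = 1 / N := by
    rw [Complex.norm_real, Real.norm_of_nonneg (by positivity)]
  have h1 : b / 2 ≤ ‖u - ((1 / N : ℝ) : ℂ)‖ := by
    have := norm_sub_norm_le u ((1 / N : ℝ) : ℂ)
    rw [hub, hn] at this
    linarith
  have h2 : ‖u - ((1 / N : ℝ) : ℂ)‖ ≤ b + 1 / N := by
    have := norm_sub_le u ((1 / N : ℝ) : ℂ)
    rwa [hub, hn] at this
  have h3 : u - ((1 / N : ℝ) : ℂ) ≠ 0 := norm_pos_iff.1 (by linarith)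
  rw [prelimitWeight_eq (by omega) (hw N) h3, norm_mul, norm_mul, norm_pow, norm_div, norm_div,
    norm_pow, norm_pow, hub, norm_prod]
  gcongr
  · calc (‖u - ((1 / N : ℝ) : ℂ)‖ / b) ^ N ≤ (1 + (1 / b) / N) ^ N := by
          gcongr
          rw [div_le_iff₀ hb]
          refine h2.trans_eq ?_
          field_simp
      _ ≤ _ := one_add_div_pow_le_exp (by positivity) N
  · linarith
  · calc ∏ k : Fin m, ‖u - (w N k : ℂ)‖ ≤ ∏ _k : Fin m, (b + Θ) := by
          refine Finset.prod_le_prod (fun _ _ => norm_nonneg _) fun k _ => ?_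
          have := norm_sub_le u (w N k : ℂ)
          rw [hub, Complex.norm_real, Real.norm_of_nonneg (hN k).1] at this
          linarith [(hN k).2]
      _ = _ := by simp

/-- Bernoulli's inequality with the exponent N/k ≥ 1. It replaces e^t ≥ (t/k)^k by a statement
uniform in N ≥ k. -/
theorem div_pow_le_one_add_div_pow {t : ℝ} (ht : 0 ≤ t) {k N : ℕ} (hk : 0 < k) (hkN : k ≤ N) :
    (t / k) ^ k ≤ (1 + t / N) ^ N := by
  have hN : 0 < N := hk.trans_le hkN
  have h1 : 1 + ((N : ℝ) / k) * (t / N) ≤ (1 + t / N) ^ ((N : ℝ) / k) := by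
    refine one_add_mul_self_le_rpow_one_add ?_ ?_
    · have : 0 ≤ t / N := by positivity
      linarith
    · rw [le_div_iff₀ (by positivity), one_mul]
      exact_mod_cast hkN
  have h2 : ((N : ℝ) / k) * (t / N) = t / k := by field_simp
  rw [h2] at h1
  have hpos : 0 ≤ 1 + t / N := by positivity
  calc (t / k) ^ k ≤ ((1 + t / N) ^ ((N : ℝ) / k)) ^ k := by
        gcongr
        linarith
    _ = _ := by
        rw [← Real.rpow_natCast (_ ^ _), ← Real.rpow_mul hpos, div_mul_cancel₀ _ (by positivity),
          Real.rpow_natCast]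

/-- For Re v ≤ -|v|/2 one has |v - 1/N|² ≥ |v|² + |v|/N, so (|v - 1/N|/|v|)² ≥ 1 + 1/(|v|N). The
preceding Bernoulli bound with k = 2(j + 1), followed by a square root, gives j + 1 powers of |v|
uniformly in N. -/
theorem norm_div_sub_pow_le {v : ℂ} (hv0 : v ≠ 0) (hv : v.re ≤ -(‖v‖ / 2)) (j : ℕ) {N : ℕ}
    (hN : 2 * (j + 1) ≤ N) :
    ‖v / (v - ((1 / N : ℝ) : ℂ))‖ ^ N ≤ (2 * (j + 1) * ‖v‖) ^ (j + 1) := by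
  have hs : 0 < ‖v‖ := norm_pos_iff.2 hv0
  have hN0 : (0 : ℝ) < N := by exact_mod_cast (by omega : 0 < N)
  have hsq : ‖v‖ ^ 2 + ‖v‖ * (1 / N) ≤ ‖v - ((1 / N : ℝ) : ℂ)‖ ^ 2 := by
    have e1 : ‖v - ((1 / N : ℝ) : ℂ)‖ ^ 2 = ‖v‖ ^ 2 - 2 * (1 / N) * v.re + (1 / N) ^ 2 := by
      rw [← Complex.normSq_eq_norm_sq, ← Complex.normSq_eq_norm_sq, Complex.normSq_apply,
        Complex.normSq_apply, Complex.sub_re, Complex.sub_im, Complex.ofReal_re, Complex.ofReal_im]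
      ring
    have hp : (0 : ℝ) < 1 / N := by positivity
    rw [e1]
    nlinarith
  have hpos : 0 < ‖v - ((1 / N : ℝ) : ℂ)‖ := by
    by_contra! h
    have h0 : ‖v - ((1 / N : ℝ) : ℂ)‖ = 0 := le_antisymm h (norm_nonneg _)
    rw [h0] at hsq
    have : 0 < ‖v‖ ^ 2 + ‖v‖ * (1 / N) := by positivity
    linarith
  have h1 := div_pow_le_one_add_div_pow (t := 1 / ‖v‖) (by positivity) (by omega) hN
  have h2 : (1 + 1 / ‖v‖ / N) ≤ (‖v - ((1 / N : ℝ) : ℂ)‖ / ‖v‖) ^ 2 := by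
    rw [div_pow, le_div_iff₀ (by positivity)]
    refine le_trans (le_of_eq ?_) hsq
    field_simp
  have h3 : (1 / ‖v‖ / ((2 * (j + 1) : ℕ) : ℝ)) ^ (2 * (j + 1)) ≤
      ((‖v - ((1 / N : ℝ) : ℂ)‖ / ‖v‖) ^ 2) ^ N :=
    h1.trans (pow_le_pow_left₀ (by positivity) h2 N)
  have e2 : ∀ (a : ℝ) (n : ℕ), a ^ (2 * n) = (a ^ n) ^ 2 := fun a n => by rw [← pow_mul, mul_comm]
  rw [← pow_mul, e2, e2, pow_le_pow_iff_left₀ (by positivity) (by positivity) two_ne_zero] at h3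
  rw [norm_div]
  have h4 := inv_anti₀ (by positivity) h3
  rw [← inv_pow, ← inv_pow, inv_div] at h4
  refine h4.trans_eq ?_
  congr 1
  push_cast
  field_simp

/-- At distance at least d from 1/N the ratio exceeds 1 by at most 1/(dN), and (1 + t/N)^N ≤ e^t. -/
theorem norm_div_sub_pow_le_exp {v : ℂ} {d : ℝ} (hd : 0 < d) {N : ℕ}
    (hv : d ≤ ‖v - ((1 / N : ℝ) : ℂ)‖) :
    ‖v / (v - ((1 / N : ℝ) : ℂ))‖ ^ N ≤ Real.exp (1 / d) := by
  refine le_trans ?_ (one_add_div_pow_le_exp (by positivity) N)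
  gcongr
  rw [norm_div, div_le_iff₀ (hd.trans_le hv)]
  have h1 := norm_add_le (v - ((1 / N : ℝ) : ℂ)) ((1 / N : ℝ) : ℂ)
  rw [sub_add_cancel, Complex.norm_real, Real.norm_of_nonneg (by positivity)] at h1
  have h2 : (1 / N : ℝ) ≤ 1 / d / N * ‖v - ((1 / N : ℝ) : ℂ)‖ := by
    calc (1 / N : ℝ) = 1 / d / N * d := by field_simp
      _ ≤ _ := by gcongr
  linarith

/-- Near the origin the finitely many other factors cost at most j = ν + m powers of 1/|v|, and the
N-th power supplies j + 1 powers of |v|. Elsewhere on the curve all distances to the points w_l are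
bounded below. -/
theorem exists_inv_prelimitWeight_bound {ν m : ℕ} {w : ℕ → ℕ → ℝ} {Θ X : ℝ} (hX : 0 < X)
    (hΘ0 : 0 < Θ) (hΘX : Θ < X) (hw : ∀ N l, m ≤ l → l < N + ν → w N l = 1 / N)
    (hwΘ : ∀ᶠ N : ℕ in atTop, ∀ k : Fin m, w N k ∈ Icc 0 Θ) :
    ∃ C : ℝ, ∀ᶠ N : ℕ in atTop, ∀ v ∈ xiCurve X, ‖(prelimitWeight N (N + ν) (w N) v)⁻¹‖ ≤ C := by
  obtain ⟨d, hd0, hd⟩ := exists_xiCurve_dichotomy hX hΘX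
  set j := ν + m with hj
  refine ⟨max ((2 * (j + 1)) ^ (j + 1) * X * (2 * X) ^ m)
    (Real.exp (1 / d) * (2 * X) ^ m * (1 / d) ^ j), ?_⟩
  have hinv : ∀ᶠ N : ℕ in atTop, (1 / N : ℝ) < Θ :=
    tendsto_one_div_atTop_nhds_zero_nat.eventually (gt_mem_nhds hΘ0)
  filter_upwards [hwΘ, eventually_ge_atTop m, hinv, eventually_ge_atTop (2 * (j + 1))] with
    N hN hm hNΘ hNj v hv
  have hv0 : v ≠ 0 := xiCurve_ne_zero hX hv
  have hvX := norm_le_of_mem_xiCurve hX hv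
  have hs : 0 < ‖v‖ := norm_pos_iff.2 hv0
  have hmem : (1 / N : ℝ) ∈ Icc 0 Θ := ⟨by positivity, hNΘ.le⟩
  have hup : ‖v - ((1 / N : ℝ) : ℂ)‖ ≤ 2 * X := by
    have := norm_sub_le v ((1 / N : ℝ) : ℂ)
    rw [Complex.norm_real, Real.norm_of_nonneg hmem.1] at this
    linarith
  -- One estimate for both regions: D is a common lower bound of the distances, E a bound of the
  -- N-th power.
  have hkey : ∀ D E : ℝ, 0 < D → D ≤ ‖v - ((1 / N : ℝ) : ℂ)‖ →
      (∀ k : Fin m, D ≤ ‖v - (w N k : ℂ)‖) → ‖v / (v - ((1 / N : ℝ) : ℂ))‖ ^ N ≤ E →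
      ‖(prelimitWeight N (N + ν) (w N) v)⁻¹‖ ≤ E * (2 * X) ^ m * (1 / D) ^ j := by
    intro D E hD h1 h2 h3
    have h4 : v - ((1 / N : ℝ) : ℂ) ≠ 0 := norm_pos_iff.1 (hD.trans_le h1)
    have h5 : ∏ k : Fin m, ‖v - (w N k : ℂ)‖⁻¹ ≤ (1 / D) ^ m := by
      calc _ ≤ ∏ _k : Fin m, (1 / D) := by
            refine Finset.prod_le_prod (fun _ _ => by positivity) fun k _ => ?_
            rw [one_div]
            exact inv_anti₀ hD (h2 k)
        _ = _ := by simp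
    rw [prelimitWeight_eq (by omega) (hw N) h4, mul_inv, mul_inv, ← inv_pow, inv_div, inv_div,
      norm_mul, norm_mul, norm_pow (v / _), norm_inv, norm_prod, ← Finset.prod_inv_distrib,
      norm_div (_ ^ m), norm_pow, norm_pow]
    have h6 : ‖v - ((1 / N : ℝ) : ℂ)‖ ^ m / ‖v - ((1 / N : ℝ) : ℂ)‖ ^ ν ≤
        (2 * X) ^ m * (1 / D) ^ ν := by
      rw [div_eq_mul_inv, ← inv_pow, one_div D]
      exact mul_le_mul (pow_le_pow_left₀ (norm_nonneg _) hup _)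
        (pow_le_pow_left₀ (by positivity) (inv_anti₀ hD h1) _) (by positivity) (by positivity)
    calc _ ≤ E * ((2 * X) ^ m * (1 / D) ^ ν) * (1 / D) ^ m := by
          have : 0 ≤ E := le_trans (by positivity) h3
          gcongr
      _ = _ := by rw [hj, pow_add]; ring
  rcases hd v hv with h | h
  · refine le_trans ?_ (le_max_left _ _)
    have hre : v.re ≤ 0 := by linarith
    refine (hkey ‖v‖ _ hs (norm_le_norm_sub_of_re_nonpos hre hmem.1)
      (fun k => norm_le_norm_sub_of_re_nonpos hre (hN k).1)
      (norm_div_sub_pow_le hv0 h j hNj)).trans ?_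
    have e1 : (2 * ((j : ℝ) + 1) * ‖v‖) ^ (j + 1) * (2 * X) ^ m * (1 / ‖v‖) ^ j =
        (2 * ((j : ℝ) + 1)) ^ (j + 1) * ‖v‖ * (2 * X) ^ m := by
      rw [mul_pow, pow_succ ‖v‖, one_div, inv_pow]
      field_simp
    rw [e1]
    gcongr
  · refine le_trans ?_ (le_max_right _ _)
    exact hkey d _ hd0 (h _ hmem) (fun k => h _ (hN k)) (norm_div_sub_pow_le_exp hd0 (h _ hmem))

/-! ### The limit of the rescaled kernel -/

/-- The limiting kernel, as an integral over the curve through the origin. -/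
noncomputable def xiKernel (κ ν : ℕ) {m : ℕ} (θ : Fin m → ℝ) (b X x y : ℝ) : ℂ :=
  xiInt X fun v => mellinH (1 / 4) κ (v * y) *
    (cauchyTransform b (fun u => besselF κ (u * x) * limitWeight ν θ u) v *
      (limitWeight ν θ v)⁻¹)

theorem differentiable_besselF_mul (κ : ℕ) (x : ℝ) :
    Differentiable ℂ fun u : ℂ => besselF κ (u * x) :=
  (differentiable_besselF κ).comp (by fun_prop)

theorem differentiableOn_prelimitWeight (N M : ℕ) (w : ℕ → ℝ) :
    DifferentiableOn ℂ (prelimitWeight N M w) {0}ᶜ := by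
  refine DifferentiableOn.mul (DifferentiableOn.inv (by fun_prop) fun u hu => pow_ne_zero _ hu) ?_
  fun_prop

theorem ofReal_mem_segment_of_sub_eq_zero {lo hi t : ℝ} {v : ℂ} (ht : t ∈ Icc lo hi)
    (h : v - (t : ℂ) = 0) : v.im = 0 ∧ v.re ∈ Icc lo hi := by
  rw [sub_eq_zero.1 h]
  exact ⟨Complex.ofReal_im t, ht⟩

theorem prelimitWeight_inv_eq (N M : ℕ) (w : ℕ → ℝ) (v : ℂ) :
    (prelimitWeight N M w v)⁻¹ = v ^ N * (∏ l ∈ Finset.range M, (v - (w l : ℂ)))⁻¹ := by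
  rw [prelimitWeight, mul_inv, inv_inv]

theorem differentiableOn_inv_prelimitWeight (N M : ℕ) {w : ℕ → ℝ} {lo hi : ℝ}
    (hw : ∀ l, l < M → w l ∈ Icc lo hi) :
    DifferentiableOn ℂ (fun v => (prelimitWeight N M w v)⁻¹)
      {z : ℂ | ¬(z.im = 0 ∧ z.re ∈ Icc lo hi)} := by
  simp only [prelimitWeight_inv_eq]
  refine DifferentiableOn.mul (by fun_prop) (DifferentiableOn.inv (by fun_prop) fun v hv h0 => ?_)
  obtain ⟨l, hl, hl0⟩ := Finset.prod_eq_zero_iff.1 h0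
  exact hv (ofReal_mem_segment_of_sub_eq_zero (hw l (Finset.mem_range.1 hl)) hl0)

theorem prelimitWeight_ne_zero (N M : ℕ) {w : ℕ → ℝ} {lo hi : ℝ}
    (hw : ∀ l, l < M → w l ∈ Icc lo hi) {v : ℂ} (hv0 : v ≠ 0)
    (hv : ¬(v.im = 0 ∧ v.re ∈ Icc lo hi)) : prelimitWeight N M w v ≠ 0 := by
  refine mul_ne_zero (inv_ne_zero (pow_ne_zero _ hv0)) fun h0 => ?_
  obtain ⟨l, hl, hl0⟩ := Finset.prod_eq_zero_iff.1 h0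
  exact hv (ofReal_mem_segment_of_sub_eq_zero (hw l (Finset.mem_range.1 hl)) hl0)

theorem exists_mellinH_bound_xiCurve (κ : ℕ) {X y : ℝ} (hX : 0 < X) (hy : 0 < y) :
    ∃ C : ℝ, 0 < C ∧ ∀ v ∈ xiCurve X, ‖mellinH (1 / 4) κ (v * y)‖ ≤ C * ‖v‖ ^ (-(1 / 4) : ℝ) := by
  obtain ⟨C, hC0, hC⟩ := norm_mellinH_le (σ := 1 / 4) (by norm_num) κ (ψ := 3 * Real.pi / 4)
    (by positivity) (by linarith [Real.pi_pos])
  refine ⟨C * y ^ (-(1 / 4) : ℝ), by positivity, fun v hv => ?_⟩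
  have h5 := hC (v * y) (mul_ne_zero (xiCurve_ne_zero hX hv) (by exact_mod_cast hy.ne')) (by
    rw [mul_comm, Complex.arg_real_mul _ hy]
    exact (abs_arg_lt_of_mem_xiCurve hX hv).le)
  rw [norm_mul, Complex.norm_real, Real.norm_of_nonneg hy.le,
    Real.mul_rpow (norm_nonneg _) hy.le] at h5
  refine h5.trans_eq ?_
  ring

theorem mul_ofReal_mem_slitPlane {v : ℂ} (hv : v ∈ Complex.slitPlane) {y : ℝ} (hy : 0 < y) :
    v * (y : ℂ) ∈ Complex.slitPlane := by
  rcases hv with h | h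
  · left
    rw [Complex.re_mul_ofReal]
    exact mul_pos h hy
  · right
    rw [Complex.im_mul_ofReal]
    exact mul_ne_zero h hy.ne'

theorem differentiableOn_mellinH_mul {σ : ℝ} (hσ : 0 < σ) (κ : ℕ) {y : ℝ} (hy : 0 < y) :
    DifferentiableOn ℂ (fun v : ℂ => mellinH σ κ (v * y)) Complex.slitPlane :=
  (differentiableOn_mellinH hσ κ).comp (by fun_prop) fun _ hv => mul_ofReal_mem_slitPlane hv hy

theorem sphere_zero_subset_compl {s : ℝ} (hs : 0 < s) : Metric.sphere (0 : ℂ) s ⊆ {0}ᶜ :=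
  fun _ hu => norm_pos_iff.1 ((mem_sphere_zero_iff_norm.1 hu).symm ▸ hs)

theorem limitWeight_ne_zero {ν m : ℕ} {θ : Fin m → ℝ} {Θ : ℝ} (hθ : ∀ k, -θ k ∈ Icc 0 Θ) {v : ℂ}
    (hv : ¬(v.im = 0 ∧ v.re ∈ Icc 0 Θ)) (hΘ : 0 ≤ Θ) : limitWeight ν θ v ≠ 0 := by
  have hv0 : v ≠ 0 := fun h => hv (by simp [h, hΘ])
  refine mul_ne_zero (mul_ne_zero (Complex.exp_ne_zero _)
    (div_ne_zero (pow_ne_zero _ hv0) (pow_ne_zero _ hv0))) fun h0 => ?_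
  obtain ⟨k, -, hk0⟩ := Finset.prod_eq_zero_iff.1 h0
  refine hv (ofReal_mem_segment_of_sub_eq_zero (hθ k) ?_)
  push_cast
  rwa [sub_neg_eq_add]

/-- Dominated convergence over the fixed curve. The weights are bounded uniformly in large N and H
contributes |v|^(-1/4), within the tolerance 1/3. -/
theorem tendsto_prelimit_xiInt (κ : ℕ) {ν m : ℕ} {w : ℕ → ℕ → ℝ} {θ : Fin m → ℝ} {Θ X b : ℝ}
    (hX : 0 < X) (hΘ0 : 0 < Θ) (hΘX : Θ < X) (hXb : X < b)
    (hw : ∀ N l, m ≤ l → l < N + ν → w N l = 1 / N)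
    (hθ : ∀ k : Fin m, Tendsto (fun N => w N k) atTop (𝓝 (-θ k)))
    (hwΘ : ∀ᶠ N : ℕ in atTop, ∀ l, l < N + ν → w N l ∈ Icc 0 Θ) {x y : ℝ} (hy : 0 < y) :
    Tendsto (fun N : ℕ => xiInt X fun v => mellinH (1 / 4) κ (v * y) *
      (cauchyTransform b (fun u => besselF κ (u * x) * prelimitWeight N (N + ν) (w N) u) v *
        (prelimitWeight N (N + ν) (w N) v)⁻¹)) atTop (𝓝 (xiKernel κ ν θ b X x y)) := by
  have hb : 0 < b := hX.trans hXb
  have hwk : ∀ᶠ N : ℕ in atTop, ∀ k : Fin m, w N k ∈ Icc 0 Θ := by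
    filter_upwards [hwΘ, eventually_ge_atTop m] with N hN hm k
    exact hN k (by have := k.2; omega)
  have hθΘ : ∀ k, -θ k ∈ Icc 0 Θ := fun k =>
    isClosed_Icc.mem_of_tendsto (hθ k) (hwk.mono fun N hN => hN k)
  obtain ⟨C₁, hC₁⟩ := exists_prelimitWeight_bound hb hw hwk
  obtain ⟨C₂, hC₂⟩ := exists_inv_prelimitWeight_bound hX hΘ0 hΘX hw hwk
  obtain ⟨C₃, hC₃0, hC₃⟩ := exists_mellinH_bound_xiCurve κ hX hy
  obtain ⟨C₄, hC₄⟩ := (isCompact_sphere (0 : ℂ) b).exists_bound_of_continuousOn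
    (differentiable_besselF_mul κ x).continuous.continuousOn
  have hPb : ∀ᶠ N : ℕ in atTop, ∀ u ∈ Metric.sphere (0 : ℂ) b,
      ‖besselF κ (u * x) * prelimitWeight N (N + ν) (w N) u‖ ≤ C₄ * C₁ := by
    filter_upwards [hC₁] with N hN u hu
    rw [norm_mul]
    exact mul_le_mul (hC₄ u hu) (hN u hu) (norm_nonneg _) ((norm_nonneg _).trans (hC₄ u hu))
  have hPd : ∀ N : ℕ, DifferentiableOn ℂ
      (fun u => besselF κ (u * x) * prelimitWeight N (N + ν) (w N) u) {0}ᶜ := fun N =>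
    (differentiable_besselF_mul κ x).differentiableOn.mul (differentiableOn_prelimitWeight _ _ _)
  have hball : xiCurve X ⊆ Metric.ball 0 b := fun v hv =>
    mem_ball_zero_iff.2 ((norm_le_of_mem_xiCurve hX hv).trans_lt hXb)
  have hseg : ∀ v ∈ xiCurve X, ¬(v.im = 0 ∧ v.re ∈ Icc 0 Θ) := fun v hv =>
    (mem_slitRegion_of_mem_xiCurve hX hΘX hXb hv).2.2
  have hub : ∀ v ∈ xiCurve X, ∀ u ∈ Metric.sphere (0 : ℂ) b, b - X ≤ ‖u - v‖ := by
    intro v hv u hu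
    have h1 := norm_sub_norm_le u v
    rw [mem_sphere_zero_iff_norm.1 hu] at h1
    linarith [norm_le_of_mem_xiCurve hX hv]
  refine tendsto_xiInt (p := 1 / 4) (C := C₃ * (b * (C₄ * C₁ / (b - X)) * C₂)) hX (by norm_num)
    ?_ ?_ ?_
  · filter_upwards [hwΘ] with N hN
    refine ContinuousOn.mul ?_ (ContinuousOn.mul ?_ ?_)
    · exact (differentiableOn_mellinH_mul (by norm_num) κ hy).continuousOn.mono fun v hv =>
        mem_slitPlane_of_mem_xiCurve hX hv
    · exact (differentiableOn_cauchyTransform hb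
        ((hPd N).continuousOn.mono (sphere_zero_subset_compl hb))).continuousOn.mono hball
    · exact (differentiableOn_inv_prelimitWeight N (N + ν) hN).continuousOn.mono hseg
  · filter_upwards [hPb, hC₂] with N hN1 hN2 v hv
    rw [norm_mul, norm_mul]
    have h1 := norm_cauchyTransform_le hb hN1 hXb (norm_le_of_mem_xiCurve hX hv)
    have h2 := hN2 v hv
    calc _ ≤ (C₃ * ‖v‖ ^ (-(1 / 4) : ℝ)) * (b * (C₄ * C₁ / (b - X)) * C₂) := by
          refine mul_le_mul (hC₃ v hv) (mul_le_mul h1 h2 (norm_nonneg _)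
            ((norm_nonneg _).trans h1)) (by positivity) (by positivity)
      _ = _ := by ring
  · intro v hv
    refine Tendsto.const_mul _ (Tendsto.mul ?_ ?_)
    -- The exempted point v satisfies |v| ≤ X < b and is not on the circle; naming it merely
    -- supplies u ≠ v.
    · refine tendsto_contourInt (p := v) (C := C₄ * C₁ / (b - X)) hb ?_ ?_ ?_
      · refine Eventually.of_forall fun N => ContinuousOn.div ?_ (by fun_prop) fun u hu =>
          sub_ne_zero.2 hu.2
        exact (hPd N).continuousOn.mono fun u hu => sphere_zero_subset_compl hb hu.1
      · filter_upwards [hPb] with N hN u hu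
        rw [norm_div]
        have h1 := hN u hu.1
        exact div_le_div₀ ((norm_nonneg _).trans h1) h1 (by linarith) (hub v hv u hu.1)
      · intro u hu
        refine Tendsto.div_const (Tendsto.const_mul _ ?_) _
        exact tendsto_prelimitWeight hw hθ (sphere_zero_subset_compl hb hu.1)
    · exact (tendsto_prelimitWeight hw hθ (xiCurve_ne_zero hX hv)).inv₀
        (limitWeight_ne_zero hθΘ (hseg v hv) hΘ0.le)

/-- For each N the segment from the smallest to the largest w_l lies in (0, X) and inside the
v-circle. Its left end may tend to 0, but the curve does not depend on it, so all admissible circles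
give the same integrals. -/
theorem tendsto_rescaled_kernelIndep (ν κ m : ℕ) {α q₀ : ℝ} (hα : 0 < α) (hq₀ : 0 < q₀)
    {q : ℕ → ℕ → ℝ} (hq_pos : ∀ N l, l < N + ν → 0 < q N l)
    (hq_deg : ∀ N l, m ≤ l → l < N + ν → q N l = q₀) {θ : Fin m → ℝ}
    (hθ : ∀ k : Fin m,
      Tendsto (fun N : ℕ => (1 - q N k / q₀) / (N : ℝ)) atTop (𝓝 (θ k)))
    {r c R : ℕ → ℝ} (hcont : ∀ N, AdmissibleContours α (q N) (N + ν) (r N) (c N) (R N))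
    {Θ X b : ℝ} (hΘ0 : 0 < Θ) (hΘ : ∀ k, |θ k| < Θ) (hΘX : Θ < X) (hXb : X < b) {x y : ℝ}
    (hx : 0 < x) (hy : 0 < y) :
    Tendsto (fun N : ℕ => ((1 / (α * q₀ * N) : ℝ) : ℂ) *
        kernelIndep κ N (N + ν) α (q N) (r N) (c N) (R N)
          (x / (α * q₀ * N)) (y / (α * q₀ * N)) * ((x / y : ℝ) : ℂ) ^ (-(κ : ℤ)))
      atTop (𝓝 (xiKernel κ ν θ b X x y)) := by
  have hX : 0 < X := hΘ0.trans hΘX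
  set w : ℕ → ℕ → ℝ := fun N l => q N l / (q₀ * N) with hw_def
  have hw : ∀ N l, m ≤ l → l < N + ν → w N l = 1 / N := by
    intro N l h1 h2
    simp only [hw_def, hq_deg N l h1 h2]
    rw [← div_div, div_self hq₀.ne']
  -- w_k = 1/N - (1 - q_k/q₀)/N, which also shows where the sign of θ_k comes from.
  have hwθ : ∀ k : Fin m, Tendsto (fun N => w N k) atTop (𝓝 (-θ k)) := by
    intro k
    have h1 := tendsto_one_div_atTop_nhds_zero_nat.sub (hθ k)
    rw [zero_sub] at h1
    refine h1.congr fun N => ?_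
    simp only [hw_def]
    rw [← div_div]
    ring
  have hwΘ : ∀ᶠ N : ℕ in atTop, ∀ l, l < N + ν → w N l ∈ Icc 0 Θ := by
    have h1 : ∀ᶠ N : ℕ in atTop, ∀ k : Fin m, w N k < Θ := eventually_all.2 fun k =>
      (hwθ k).eventually (gt_mem_nhds ((neg_le_abs _).trans_lt (hΘ k)))
    have h2 : ∀ᶠ N : ℕ in atTop, (1 / N : ℝ) < Θ :=
      tendsto_one_div_atTop_nhds_zero_nat.eventually (gt_mem_nhds hΘ0)
    filter_upwards [h1, h2] with N hN1 hN2 l hl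
    refine ⟨div_nonneg (hq_pos N l hl).le (by positivity), ?_⟩
    rcases lt_or_ge l m with h | h
    · exact (hN1 ⟨l, h⟩).le
    · rw [hw N l h hl]
      exact hN2.le
  refine Tendsto.congr' ?_ (tendsto_prelimit_xiInt κ hX hΘ0 hΘX hXb hw hwθ hwΘ hy)
  filter_upwards [hwΘ, eventually_ge_atTop 1] with N hN hN1
  obtain ⟨hr, hR, hRc, hin, hsep⟩ := hcont N
  have hN0 : (0 : ℝ) < N := by exact_mod_cast hN1
  have hlam : 0 < α * q₀ * N := by positivity
  have hqw : ∀ l, l < N + ν → α * q N l = α * q₀ * N * w N l := by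
    intro l _
    simp only [hw_def]
    field_simp
  have hne : (Finset.range (N + ν)).Nonempty := Finset.nonempty_range_iff.2 (by omega)
  obtain ⟨l₀, hl₀, hmin⟩ := Finset.exists_min_image _ (w N) hne
  obtain ⟨l₁, hl₁, hmax⟩ := Finset.exists_max_image _ (w N) hne
  rw [Finset.mem_range] at hl₀ hl₁
  have hwI : ∀ l, l < N + ν → w N l ∈ Icc (w N l₀) (w N l₁) := fun l hl =>
    ⟨hmin l (Finset.mem_range.2 hl), hmax l (Finset.mem_range.2 hl)⟩
  have hin₀ := abs_lt.1 (hin l₀ hl₀)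
  have hin₁ := abs_lt.1 (hin l₁ hl₁)
  rw [hqw l₀ hl₀] at hin₀
  rw [hqw l₁ hl₁] at hin₁
  rw [rescaled_kernelIndep_eq κ N (N + ν) hx hy hlam hr hR hRc hqw,
    contourInt_contourInt_eq_xiInt (E := fun u => besselF κ (u * x)) (X := X) (b := b)
      (lo := w N l₀) (hi := w N l₁) κ hy _ (differentiableOn_inv_prelimitWeight N (N + ν) hwI)
      (differentiable_besselF_mul κ x)]
  · intro z hz hzs
    rw [mul_assoc, mul_inv_cancel₀ (prelimitWeight_ne_zero N (N + ν) hwI hz hzs), mul_one]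
  · exact div_pos (hq_pos N l₀ hl₀) (by positivity)
  · exact hX
  · exact (hN l₁ hl₁).2.trans_lt hΘX
  · exact hXb
  · exact div_pos hr hlam
  · exact div_pos hR hlam
  · exact div_lt_div_of_pos_right hRc hlam
  · rw [← sub_div, div_lt_iff₀ hlam]
    linarith
  · rw [← add_div, lt_div_iff₀ hlam]
    linarith
  · rw [← sub_div, ← add_div]
    exact hsep.imp (fun h => div_lt_div_of_pos_right h hlam)
      fun h => div_lt_div_of_pos_right h hlam
  · exact (differentiable_besselF_mul κ x).differentiableOn.mul
      (differentiableOn_prelimitWeight _ _ _)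

/-! ### The transform of K_III with the regularising factor -/

theorem continuousOn_contourInt {E : Type*} [TopologicalSpace E] [FirstCountableTopology E]
    {S : Set E} (hS : IsCompact S) {c : ℂ} {R : ℝ} (hR : 0 < R) {f : E → ℂ → ℂ}
    (hf : ContinuousOn (Function.uncurry f) (S ×ˢ Metric.sphere c R)) :
    ContinuousOn (fun z => contourInt c R (f z)) S := by
  obtain ⟨C, hC⟩ := (hS.prod (isCompact_sphere c R)).exists_bound_of_continuousOn hf
  intro z hz
  refine tendsto_contourInt (p := c) (C := C) hR ?_ ?_ ?_
  · filter_upwards [self_mem_nhdsWithin] with z' hz'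
    exact hf.comp (f := fun w => (z', w)) (by fun_prop) fun w hw => ⟨hz', hw.1⟩
  · filter_upwards [self_mem_nhdsWithin] with z' hz' w hw
    exact hC (z', w) ⟨hz', hw.1⟩
  · intro w hw
    have h1 := hf (z, w) ⟨hz, hw.1⟩
    refine h1.tendsto.comp (f := fun z' => (z', w)) (tendsto_nhdsWithin_iff.2 ⟨?_, ?_⟩)
    · exact ((continuous_id.prodMk continuous_const).tendsto z).mono_left nhdsWithin_le_nhds
    · filter_upwards [self_mem_nhdsWithin] with z' hz' using ⟨hz', hw.1⟩

/-- The disc `‖z‖ < B` without the segment `[0, Θ]`. -/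
def cutDisc (Θ B : ℝ) : Set ℂ := {z | ‖z‖ < B ∧ ¬(z.im = 0 ∧ z.re ∈ Icc 0 Θ)}

theorem isOpen_cutDisc (Θ B : ℝ) : IsOpen (cutDisc Θ B) :=
  (isOpen_lt continuous_norm continuous_const).inter (isOpen_compl_segment 0 Θ)

theorem mem_cutDisc_of_circle {Θ B c R : ℝ} (hc : 0 ≤ c) (h1 : c < R) (h2 : Θ < c + R)
    (h3 : c + R < B) (θ : ℝ) : circleMap c R θ ∈ cutDisc Θ B := by
  have hR : 0 < R := hc.trans_lt h1
  have hnorm : ‖circleMap (c : ℂ) R θ - c‖ = R := by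
    rw [circleMap_sub_center, norm_circleMap_zero, abs_of_pos hR]
  refine ⟨?_, ?_⟩
  · have h4 := norm_sub_norm_le (circleMap (c : ℂ) R θ) c
    rw [hnorm, Complex.norm_real, Real.norm_of_nonneg hc] at h4
    linarith
  · rintro ⟨him, hre1, hre2⟩
    have h5 : (circleMap (c : ℂ) R θ - c) = (((circleMap (c : ℂ) R θ).re - c : ℝ) : ℂ) := by
      apply Complex.ext
      · rw [Complex.sub_re, Complex.ofReal_re, Complex.ofReal_re]
      · rw [Complex.sub_im, him, Complex.ofReal_im, Complex.ofReal_im, sub_zero]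
    rw [h5, Complex.norm_real, Real.norm_eq_abs] at hnorm
    rcases (abs_eq hR.le).1 hnorm with h | h <;> linarith

theorem sphere_subset_cutDisc {Θ B c R : ℝ} (hc : 0 ≤ c) (h1 : c < R) (h2 : Θ < c + R)
    (h3 : c + R < B) : Metric.sphere (c : ℂ) R ⊆ cutDisc Θ B := by
  intro v hv
  rw [← abs_of_pos (hc.trans_lt h1), ← range_circleMap] at hv
  obtain ⟨θ, rfl⟩ := hv
  exact mem_cutDisc_of_circle hc h1 h2 h3 θ

theorem contourInt_cutDisc_deform {f : ℂ → ℂ} {Θ B a c R : ℝ}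
    (hf : DifferentiableOn ℂ f (cutDisc Θ B)) (ha : 0 < a) (haΘ : Θ < a) (haB : a < B) (hc : 0 ≤ c)
    (h1 : c < R) (h2 : Θ < c + R) (h3 : c + R < B) : contourInt 0 a f = contourInt c R f := by
  refine contourInt_deform_circle (isOpen_cutDisc Θ B) hf fun τ hτ θ => ?_
  obtain ⟨hτ0, hτ1⟩ := hτ
  have e1 : ((0 : ℂ) + τ * (c - 0)) = ((τ * c : ℝ) : ℂ) := by
    push_cast
    ring
  rw [e1]
  have hcx : ∀ a b : ℝ, 0 < a → 0 < b → 0 < a + τ * (b - a) := by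
    intro a b ha hb
    rcases eq_or_lt_of_le hτ1 with h | h
    · rw [h]; linarith
    · nlinarith
  have k1 := hcx a (R - c) ha (by linarith)
  have k2 := hcx (a - Θ) (c + R - Θ) (by linarith) (by linarith)
  have k3 := hcx (B - a) (B - (c + R)) (by linarith) (by linarith)
  apply mem_cutDisc_of_circle <;> nlinarith

theorem cutDisc_ne_zero {Θ B : ℝ} (hΘ : 0 ≤ Θ) {v : ℂ} (hv : v ∈ cutDisc Θ B) : v ≠ 0 :=
  fun h => hv.2 (by simp [h, hΘ])

theorem differentiableOn_limitWeight (ν : ℕ) {m : ℕ} (θ : Fin m → ℝ) :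
    DifferentiableOn ℂ (limitWeight ν θ) {0}ᶜ := by
  refine DifferentiableOn.mul (DifferentiableOn.mul (DifferentiableOn.cexp ?_) ?_) (by fun_prop)
  · exact DifferentiableOn.div (by fun_prop) (by fun_prop) fun u hu => hu
  · exact DifferentiableOn.div (by fun_prop) (by fun_prop) fun u hu => pow_ne_zero m hu

theorem differentiableOn_inv_limitWeight {ν m : ℕ} {θ : Fin m → ℝ} {Θ : ℝ} (hΘ : 0 ≤ Θ)
    (hθ : ∀ k, -θ k ∈ Icc 0 Θ) :
    DifferentiableOn ℂ (fun v => (limitWeight ν θ v)⁻¹)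
      {z : ℂ | ¬(z.im = 0 ∧ z.re ∈ Icc 0 Θ)} := by
  refine DifferentiableOn.inv ((differentiableOn_limitWeight ν θ).mono fun v hv h0 => ?_)
    fun v hv => limitWeight_ne_zero hθ hv hΘ
  exact hv (by simp [mem_singleton_iff.1 h0, hΘ])

/-- Both variables are reflected; the two signs of the differentials cancel, θ_k becomes -θ_k, and
the exponentials with the powers and products form the quotient Φ(u)/Φ(w). The circles are disjoint,
so the integrals may be interchanged. -/
theorem kernelIII_eq {ν m : ℕ} {θ : Fin m → ℝ} {a b : ℝ} (ha : 0 < a) (hθa : ∀ k, |θ k| < a)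
    (hab : a < b) (X Y : ℂ) :
    kernelIII ν θ a b X Y = contourInt 0 a fun w => Complex.exp (-(Y * w)) *
      (cauchyTransform b (fun u => Complex.exp (X * u) * limitWeight ν θ u) w *
        (limitWeight ν θ w)⁻¹) := by
  have hb : 0 < b := ha.trans hab
  have hθ0 : ∀ w ∈ Metric.sphere (0 : ℂ) a, ∀ k, w + (θ k : ℂ) ≠ 0 := by
    intro w hw k h0
    have h1 : w = -(θ k : ℂ) := eq_neg_of_add_eq_zero_left h0
    rw [mem_sphere_zero_iff_norm, h1, norm_neg, Complex.norm_real, Real.norm_eq_abs] at hw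
    exact absurd hw (hθa k).ne
  have hw0 : ∀ s : ℝ, 0 < s → ∀ w ∈ Metric.sphere (0 : ℂ) s, w ≠ 0 := fun s hs w hw =>
    sphere_zero_subset_compl hs hw
  have hne : ∀ w ∈ Metric.sphere (0 : ℂ) a, limitWeight ν θ w ≠ 0 := by
    intro w hw
    have h0 := hw0 a ha w hw
    exact mul_ne_zero (mul_ne_zero (Complex.exp_ne_zero _)
      (div_ne_zero (pow_ne_zero _ h0) (pow_ne_zero _ h0)))
      (Finset.prod_ne_zero_iff.2 fun k _ => hθ0 w hw k)
  have huw : ∀ u ∈ Metric.sphere (0 : ℂ) b, ∀ w ∈ Metric.sphere (0 : ℂ) a, u - w ≠ 0 := by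
    intro u hu w hw h0
    rw [sub_eq_zero.1 h0, mem_sphere_zero_iff_norm] at hu
    rw [mem_sphere_zero_iff_norm] at hw
    exact absurd (hw.symm.trans hu) hab.ne
  have step : kernelIII ν θ a b X Y = contourInt 0 b fun u => contourInt 0 a fun w =>
      Complex.exp (-(Y * w)) * (Complex.exp (X * u) * limitWeight ν θ u / (u - w) *
        (limitWeight ν θ w)⁻¹) := by
    rw [kernelIII, contourInt_neg]
    have : ∀ u : ℂ, contourInt 0 a (fun w => Complex.exp (-X * -u + Y * w) / (w - -u) *
        Complex.exp (-1 / w + 1 / -u) * (-u / w) ^ ((ν : ℤ) - (m : ℤ)) *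
        ∏ k : Fin m, (-u - (θ k : ℂ)) / (w - (θ k : ℂ))) =
      -contourInt 0 a (fun w => Complex.exp (-X * -u + Y * -w) / (-w - -u) *
        Complex.exp (-1 / -w + 1 / -u) * (-u / -w) ^ ((ν : ℤ) - (m : ℤ)) *
        ∏ k : Fin m, (-u - (θ k : ℂ)) / (-w - (θ k : ℂ))) := fun u => contourInt_neg _ _
    simp only [this]
    have h2 : ∀ f : ℂ → ℂ, contourInt 0 b (fun u => -f u) = -contourInt 0 b f := fun f => by
      simpa using contourInt_const_mul (-1) 0 b f
    rw [h2, neg_neg]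
    refine contourInt_congr hb.le fun u hu => contourInt_congr ha.le fun w hw => ?_
    have hu0 := hw0 b hb u hu
    have hwz := hw0 a ha w hw
    have e1 : Complex.exp (-X * -u + Y * -w) = Complex.exp (-(Y * w)) * Complex.exp (X * u) := by
      rw [← Complex.exp_add]
      ring_nf
    have e2 : Complex.exp (-1 / -w + 1 / -u) = Complex.exp (-1 / u) * (Complex.exp (-1 / w))⁻¹ := by
      rw [← Complex.exp_neg, ← Complex.exp_add]
      congr 1
      field_simp
      ring
    have e3 : (-u / -w) ^ ((ν : ℤ) - (m : ℤ)) = (u ^ ν / u ^ m) * (w ^ ν / w ^ m)⁻¹ := by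
      rw [neg_div_neg_eq, div_zpow, zpow_sub₀ hu0, zpow_sub₀ hwz]
      simp only [zpow_natCast]
      rw [div_eq_mul_inv]
    have e4 : ∏ k : Fin m, (-u - (θ k : ℂ)) / (-w - (θ k : ℂ)) =
        (∏ k, (u + (θ k : ℂ))) * (∏ k, (w + (θ k : ℂ)))⁻¹ := by
      rw [← div_eq_mul_inv, ← Finset.prod_div_distrib]
      refine Finset.prod_congr rfl fun k _ => ?_
      rw [← neg_add', ← neg_add', neg_div_neg_eq]
    rw [e1, e2, e3, e4, limitWeight, limitWeight, neg_sub_neg, mul_inv, mul_inv]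
    simp only [div_eq_mul_inv]
    ring
  rw [step, contourInt_swap hb ha]
  · refine contourInt_congr ha.le fun w hw => ?_
    rw [contourInt_const_mul, contourInt_mul_const]
    rfl
  · have hΦ := (differentiableOn_limitWeight ν θ).continuousOn
    refine ContinuousOn.mul (by fun_prop) (ContinuousOn.mul (ContinuousOn.div (ContinuousOn.mul
      (by fun_prop) ?_) (by fun_prop) fun q hq => huw _ hq.1 _ hq.2) (ContinuousOn.inv₀ ?_
      fun q hq => hne _ hq.2))
    · exact hΦ.comp continuousOn_fst fun q hq => sphere_zero_subset_compl hb hq.1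
    · exact hΦ.comp continuousOn_snd fun q hq => sphere_zero_subset_compl ha hq.2

theorem differentiableOn_cauchyTransform_exp (ν : ℕ) {m : ℕ} (θ : Fin m → ℝ) {b : ℝ} (hb : 0 < b)
    (X : ℂ) : DifferentiableOn ℂ
      (cauchyTransform b fun u => Complex.exp (X * u) * limitWeight ν θ u) (Metric.ball 0 b) :=
  differentiableOn_cauchyTransform hb (ContinuousOn.mul (by fun_prop)
    ((differentiableOn_limitWeight ν θ).continuousOn.mono (sphere_zero_subset_compl hb)))

/-- The kernel `kernelIII` as a contour integral over any circle around `[0, Θ]`. -/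
theorem kernelIII_eq_circle {ν m : ℕ} {θ : Fin m → ℝ} {a b Θ c R : ℝ} (hΘ0 : 0 < Θ)
    (hθ : ∀ k, -θ k ∈ Icc 0 Θ) (hΘa : Θ < a) (hab : a < b) (hc : 0 ≤ c)
    (h1 : c < R) (h2 : Θ < c + R) (h3 : c + R < b) (X Y : ℂ) :
    kernelIII ν θ a b X Y = contourInt c R fun w => Complex.exp (-(Y * w)) *
      (cauchyTransform b (fun u => Complex.exp (X * u) * limitWeight ν θ u) w *
        (limitWeight ν θ w)⁻¹) := by
  have ha : 0 < a := hΘ0.trans hΘa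
  rw [kernelIII_eq ha (fun k => ?_) hab]
  · refine contourInt_cutDisc_deform ?_ ha hΘa hab hc h1 h2 h3
    refine DifferentiableOn.mul (by fun_prop) (DifferentiableOn.mul ?_ ?_)
    · exact (differentiableOn_cauchyTransform_exp ν θ (ha.trans hab) X).mono fun v hv =>
        mem_ball_zero_iff.2 hv.1
    · exact (differentiableOn_inv_limitWeight hΘ0.le hθ).mono fun v hv => hv.2
  · have := hθ k
    rw [← abs_neg, abs_of_nonneg this.1]
    exact this.2.trans_lt hΘa

theorem continuousOn_inv_limitWeight_sphere {ν m : ℕ} {θ : Fin m → ℝ} {Θ c R : ℝ} (hΘ0 : 0 < Θ)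
    (hθ : ∀ k, -θ k ∈ Icc 0 Θ) (hc : 0 ≤ c) (h1 : c < R) (h2 : Θ < c + R) :
    ContinuousOn (fun w => (limitWeight ν θ w)⁻¹) (Metric.sphere (c : ℂ) R) :=
  (differentiableOn_inv_limitWeight hΘ0.le hθ).continuousOn.mono fun _ hv =>
    (sphere_subset_cutDisc hc h1 h2 (lt_add_one (c + R)) hv).2

theorem neg_re_le_of_mem_sphere {c R : ℝ} {w : ℂ} (hw : w ∈ Metric.sphere (c : ℂ) R) :
    -(R - c) ≤ w.re := by
  have h4 := (Complex.abs_re_le_norm (w - c)).trans_eq (mem_sphere_iff_norm.1 hw)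
  rw [Complex.sub_re, Complex.ofReal_re, abs_le] at h4
  linarith

theorem continuousOn_cauchyTransform_exp_sphere {ν m : ℕ} (θ : Fin m → ℝ) {b c R ρ x : ℝ}
    (hρ : 0 < ρ) (hc : 0 ≤ c) (h1 : c < R) (h3 : c + R < b) :
    ContinuousOn (fun q : ℂ × ℂ => cauchyTransform b
      (fun u => Complex.exp ((x : ℂ) / q.1 * u) * limitWeight ν θ u) q.2)
      (Metric.sphere 0 ρ ×ˢ Metric.sphere (c : ℂ) R) := by
  have hb : 0 < b := by linarith
  refine continuousOn_contourInt ((isCompact_sphere _ _).prod (isCompact_sphere _ _)) hb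
    (f := fun (q : ℂ × ℂ) (u : ℂ) =>
      Complex.exp ((x : ℂ) / q.1 * u) * limitWeight ν θ u / (u - q.2)) ?_
  have hlw : ContinuousOn (fun p : (ℂ × ℂ) × ℂ => limitWeight ν θ p.2)
      ((Metric.sphere 0 ρ ×ˢ Metric.sphere (c : ℂ) R) ×ˢ Metric.sphere 0 b) :=
    (differentiableOn_limitWeight ν θ).continuousOn.comp continuousOn_snd fun p hp =>
      sphere_zero_subset_compl hb hp.2
  refine ContinuousOn.div (ContinuousOn.mul (ContinuousOn.cexp (ContinuousOn.mul
    (ContinuousOn.div (by fun_prop) (by fun_prop) fun p hp =>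
      sphere_zero_subset_compl hρ hp.1.1) (by fun_prop))) hlw) (by fun_prop) fun p hp h0 => ?_
  have h4 := (sphere_subset_cutDisc (Θ := 0) hc h1 (by linarith) h3 hp.1.2).1
  rw [← sub_eq_zero.1 h0, mem_sphere_zero_iff_norm.1 hp.2] at h4
  exact lt_irrefl _ h4

theorem besselH_regularized_integrand (κ : ℕ) {ε y t : ℝ} (ht : 0 < t) (w : ℂ) :
    (t : ℂ) ^ ((κ : ℤ) - 1) * Complex.exp (-(t : ℂ)) * Complex.exp (-(ε : ℂ) / (t : ℂ)) *
      Complex.exp (-((y : ℂ) / (t : ℂ) * w)) =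
    (t : ℂ) ^ ((κ : ℤ) - 1) * Complex.exp (-(t : ℂ)) *
      Complex.exp (-(w * y + ε) / (t : ℂ)) := by
  rw [mul_assoc _ (Complex.exp (-(ε : ℂ) / (t : ℂ))), ← Complex.exp_add]
  congr 2
  have : (t : ℂ) ≠ 0 := by exact_mod_cast ht.ne'
  field_simp
  ring

theorem continuousOn_besselH_integrand_uncurry (n : ℤ) (ε y : ℝ) (S : Set ℂ) :
    ContinuousOn (fun q : ℂ × ℝ => (q.2 : ℂ) ^ n * Complex.exp (-(q.2 : ℂ)) *
      Complex.exp (-(q.1 * y + ε) / (q.2 : ℂ))) (S ×ˢ Ioi 0) := by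
  have hne : ∀ q ∈ S ×ˢ Ioi (0 : ℝ), (q.2 : ℂ) ≠ 0 := fun q hq => by
    have : (0 : ℝ) < q.2 := hq.2
    exact_mod_cast this.ne'
  refine ContinuousOn.mul (ContinuousOn.mul ?_ (by fun_prop)) (ContinuousOn.cexp
    (ContinuousOn.div (by fun_prop) (by fun_prop) hne))
  exact ContinuousOn.zpow₀ (by fun_prop) n fun q hq => Or.inl (hne q hq)

/-- The data of a circle `|w - c| = R` around `[0, Θ]` that reaches less than `ε / y` to the left of
the origin. -/
theorem integrandI_eq_circle {κ ν m : ℕ} {θ : Fin m → ℝ} {a b Θ c R ε x y t : ℝ} (hΘ0 : 0 < Θ)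
    (hθ : ∀ k, -θ k ∈ Icc 0 Θ) (hΘa : Θ < a) (hab : a < b) (hc : 0 ≤ c)
    (h1 : c < R) (h2 : Θ < c + R) (h3 : c + R < b) (s : ℂ) (ht : 0 < t) :
    integrandI κ ν θ a b ε x y s t = contourInt c R fun w =>
      ((t : ℂ) ^ ((κ : ℤ) - 1) * Complex.exp (-(t : ℂ)) *
        Complex.exp (-(w * y + ε) / (t : ℂ))) *
      (cauchyTransform b (fun u => Complex.exp ((x : ℂ) / s * u) * limitWeight ν θ u) w *
        (limitWeight ν θ w)⁻¹) := by
  rw [integrandI, kernelIII_eq_circle hΘ0 hθ hΘa hab hc h1 h2 h3, ← contourInt_const_mul]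
  congr 1
  ext w
  rw [← mul_assoc, besselH_regularized_integrand κ ht]

theorem norm_regularized_integrand_le {κ : ℕ} {ε y t c R : ℝ} (hy : 0 < y) (ht : 0 < t) {w : ℂ}
    (hw : w ∈ Metric.sphere (c : ℂ) R) :
    ‖(t : ℂ) ^ ((κ : ℤ) - 1) * Complex.exp (-(t : ℂ)) * Complex.exp (-(w * y + ε) / (t : ℂ))‖ ≤
      t ^ ((κ : ℤ) - 1) * Real.exp (-t) * Real.exp (-(ε - (R - c) * y) / t) := by
  rw [norm_besselH_integrand ht]
  have hre : ε - (R - c) * y ≤ (w * y + ε).re := by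
    rw [Complex.add_re, Complex.re_mul_ofReal, Complex.ofReal_re]
    nlinarith [neg_re_le_of_mem_sphere hw]
  gcongr

theorem continuousOn_cauchyTransform_mul_inv_sphere {ν m : ℕ} {θ : Fin m → ℝ} {b Θ c R : ℝ}
    (hΘ0 : 0 < Θ) (hθ : ∀ k, -θ k ∈ Icc 0 Θ) (hc : 0 ≤ c) (h1 : c < R) (h2 : Θ < c + R)
    (h3 : c + R < b) (X : ℂ) :
    ContinuousOn (fun w => cauchyTransform b
      (fun u => Complex.exp (X * u) * limitWeight ν θ u) w * (limitWeight ν θ w)⁻¹)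
      (Metric.sphere (c : ℂ) R) :=
  ((differentiableOn_cauchyTransform_exp ν θ (by linarith) X).continuousOn.mono fun _ hv =>
    mem_ball_zero_iff.2 (sphere_subset_cutDisc hc h1 h2 h3 hv).1).mul
    (continuousOn_inv_limitWeight_sphere hΘ0 hθ hc h1 h2)

/-- The circle reaches only R - c to the left of 0, so Re(wy + ε) ≥ ε - (R - c)y > 0 on it. The
factor e^(-(wy+ε)/t) therefore decays as t → 0, Fubini applies, and the inner t-integral is H(wy +
ε). -/
theorem integral_integrandI {κ ν m : ℕ} {θ : Fin m → ℝ} {a b Θ c R ε x y : ℝ} (hΘ0 : 0 < Θ)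
    (hθ : ∀ k, -θ k ∈ Icc 0 Θ) (hΘa : Θ < a) (hab : a < b) (hc : 0 ≤ c)
    (h1 : c < R) (h2 : Θ < c + R) (h3 : c + R < b) (hy : 0 < y) (hε : (R - c) * y < ε) (s : ℂ) :
    IntegrableOn (integrandI κ ν θ a b ε x y s) (Ioi 0) ∧
    ∫ t in Ioi (0 : ℝ), integrandI κ ν θ a b ε x y s t = contourInt c R fun w =>
      besselH κ (w * y + ε) *
      (cauchyTransform b (fun u => Complex.exp ((x : ℂ) / s * u) * limitWeight ν θ u) w *
        (limitWeight ν θ w)⁻¹) := by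
  have hR : 0 < R := hc.trans_lt h1
  set g : ℂ → ℂ := fun w =>
    cauchyTransform b (fun u => Complex.exp ((x : ℂ) / s * u) * limitWeight ν θ u) w *
      (limitWeight ν θ w)⁻¹ with hg
  have hgc : ContinuousOn g (Metric.sphere (c : ℂ) R) :=
    continuousOn_cauchyTransform_mul_inv_sphere hΘ0 hθ hc h1 h2 h3 _
  obtain ⟨C, hC⟩ := (isCompact_sphere (c : ℂ) R).exists_bound_of_continuousOn hgc
  set h : ℝ → ℝ := fun t => t ^ ((κ : ℤ) - 1) * Real.exp (-t) *
    Real.exp (-(ε - (R - c) * y) / t) with hh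
  have hint : IntegrableOn h (Ioi 0) := integrableOn_zpow_mul_exp _ (by linarith)
  have hcont : ContinuousOn (Function.uncurry fun (w : ℂ) (t : ℝ) =>
      ((t : ℂ) ^ ((κ : ℤ) - 1) * Complex.exp (-(t : ℂ)) *
        Complex.exp (-(w * y + ε) / (t : ℂ))) * g w) (Metric.sphere (c : ℂ) R ×ˢ Ioi 0) :=
    (continuousOn_besselH_integrand_uncurry _ ε y _).mul
      (hgc.comp continuousOn_fst fun q hq => hq.1)
  have hbound : ∀ w ∈ Metric.sphere (c : ℂ) R, ∀ t ∈ Ioi (0 : ℝ),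
      ‖((t : ℂ) ^ ((κ : ℤ) - 1) * Complex.exp (-(t : ℂ)) *
        Complex.exp (-(w * y + ε) / (t : ℂ))) * g w‖ ≤ C * h t := by
    intro w hw t ht
    rw [norm_mul, mul_comm]
    have h5 := hC w hw
    exact mul_le_mul h5 (norm_regularized_integrand_le hy ht hw) (norm_nonneg _)
      ((norm_nonneg _).trans h5)
  have heq : ∀ t ∈ Ioi (0 : ℝ), integrandI κ ν θ a b ε x y s t = contourInt c R fun w =>
      ((t : ℂ) ^ ((κ : ℤ) - 1) * Complex.exp (-(t : ℂ)) *
        Complex.exp (-(w * y + ε) / (t : ℂ))) * g w := fun t ht =>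
    integrandI_eq_circle hΘ0 hθ hΘa hab hc h1 h2 h3 s ht
  constructor
  · have hm : ContinuousOn (fun t : ℝ => contourInt c R fun w =>
        ((t : ℂ) ^ ((κ : ℤ) - 1) * Complex.exp (-(t : ℂ)) *
        Complex.exp (-(w * y + ε) / (t : ℂ))) * g w) (Ioi 0) := by
      intro t ht
      -- Continuity at t is local; the compact neighbourhood serves the compactness requirement on
      -- the parameter set.
      have hK : Icc (t / 2) (t + 1) ⊆ Ioi (0 : ℝ) := fun z hz =>
        lt_of_lt_of_le (by have : (0 : ℝ) < t := ht; positivity) hz.1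
      have h6 := continuousOn_contourInt (S := Icc (t / 2) (t + 1)) isCompact_Icc (c := c) hR
        (f := fun (t : ℝ) (w : ℂ) => ((t : ℂ) ^ ((κ : ℤ) - 1) * Complex.exp (-(t : ℂ)) *
        Complex.exp (-(w * y + ε) / (t : ℂ))) * g w)
        (hcont.comp (f := Prod.swap) (by fun_prop) fun q hq => ⟨hq.2, hK hq.1⟩)
      refine (h6.continuousAt (Icc_mem_nhds ?_ (by linarith))).continuousWithinAt
      have : (0 : ℝ) < t := ht
      linarith
    refine IntegrableOn.congr_fun (Integrable.mono' (hint.const_mul (R * C))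
      (hm.aestronglyMeasurable measurableSet_Ioi) ?_) (fun t ht => (heq t ht).symm)
      measurableSet_Ioi
    refine (ae_restrict_iff' measurableSet_Ioi).2 (Eventually.of_forall fun t ht => ?_)
    refine (norm_contourInt_le hR.le fun w hw => hbound w hw t ht).trans_eq ?_
    ring
  · rw [setIntegral_congr_fun measurableSet_Ioi heq,
      ← contourInt_integral_swap (p := c) (g := fun t => C * h t) hR measurableSet_Ioi
        (f := fun (w : ℂ) (t : ℝ) => ((t : ℂ) ^ ((κ : ℤ) - 1) * Complex.exp (-(t : ℂ)) *
        Complex.exp (-(w * y + ε) / (t : ℂ))) * g w)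
        (hcont.mono (prod_mono sdiff_subset le_rfl)) (hint.const_mul C)
        fun w hw t ht => hbound w hw.1 t ht]
    refine contourInt_congr hR.le fun w _ => ?_
    rw [integral_mul_const]
    rfl

theorem contourInt_finsetSum {ι : Type*} (s : Finset ι) {c : ℂ} {R : ℝ} {f : ι → ℂ → ℂ}
    (hf : ∀ i ∈ s, CircleIntegrable (f i) c R) :
    contourInt c R (fun z => ∑ i ∈ s, f i z) = ∑ i ∈ s, contourInt c R (f i) := by
  classical
  induction s using Finset.induction_on with
  | empty => simp [contourInt_eq_intervalIntegral]
  | insert i s hi ih =>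
    simp only [Finset.sum_insert hi]
    rw [contourInt_add (hf i (Finset.mem_insert_self i s))
      (CircleIntegrable.fun_sum s fun j hj => hf j (Finset.mem_insert_of_mem hj)),
      ih fun j hj => hf j (Finset.mem_insert_of_mem hj)]

theorem contourInt_exp_div_pow {ρ : ℝ} (hρ : 0 < ρ) (n : ℕ) :
    contourInt 0 ρ (fun s => (s ^ (n + 1))⁻¹ * Complex.exp s) = ((n.factorial : ℕ) : ℂ)⁻¹ := by
  have h := (Complex.differentiable_exp.diffContOnCl (s := Metric.ball 0
    ρ)).circleIntegral_one_div_sub_center_pow_smul hρ n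
  simp only [sub_zero, one_div, smul_eq_mul, iteratedDeriv_eq_iterate, Complex.iter_deriv_exp,
    Complex.exp_zero, mul_one] at h
  rw [contourInt, h, div_eq_mul_inv, inv_mul_cancel_left₀ Complex.two_pi_I_ne_zero]

/-- The Schläfli-type integral of the entire function `besselF`. -/
theorem contourInt_exp_add_div {ρ : ℝ} (hρ : 0 < ρ) (κ : ℕ) (z : ℂ) :
    contourInt 0 ρ (fun s => s ^ (-(κ : ℤ) - 1) * Complex.exp s * Complex.exp (z / s)) =
      besselF κ z := by
  have hs0 : ∀ s ∈ Metric.sphere (0 : ℂ) ρ, s ≠ 0 := fun s hs => sphere_zero_subset_compl hρ hs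
  have hterm : ∀ k : ℕ, ContinuousOn (fun s : ℂ => s ^ (-(κ : ℤ) - 1) * Complex.exp s *
      ((z / s) ^ k / (k.factorial : ℂ))) (Metric.sphere 0 ρ) := by
    intro k
    refine ContinuousOn.mul (ContinuousOn.mul (ContinuousOn.zpow₀ (by fun_prop) _
      fun s hs => Or.inl (hs0 s hs)) (by fun_prop)) (ContinuousOn.div_const (ContinuousOn.pow
      (ContinuousOn.div (by fun_prop) (by fun_prop) hs0) _) _)
  -- Termwise, the residue of e^s s^(-(k+κ+1)) contributes 1/(k+κ)!, so partial sums go to partial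
  -- sums.
  have hval : ∀ n : ℕ, contourInt 0 ρ (fun s => ∑ k ∈ Finset.range n, s ^ (-(κ : ℤ) - 1) *
      Complex.exp s * ((z / s) ^ k / (k.factorial : ℂ))) =
      ∑ k ∈ Finset.range n, z ^ k / ((k.factorial : ℂ) * ((k + κ).factorial : ℂ)) := by
    intro n
    rw [contourInt_finsetSum _ fun k _ => (hterm k).circleIntegrable hρ.le]
    refine Finset.sum_congr rfl fun k _ => ?_
    rw [div_mul_eq_div_div, div_eq_mul_inv (_ / _) ((k + κ).factorial : ℂ),
      ← contourInt_exp_div_pow hρ (k + κ), ← contourInt_const_mul]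
    refine contourInt_congr hρ.le fun s hs => ?_
    have := hs0 s hs
    rw [show -(κ : ℤ) - 1 = -((κ + 1 : ℕ) : ℤ) by push_cast; ring, zpow_neg, zpow_natCast,
      div_pow, add_assoc k, pow_add s k]
    field_simp
  have hsum : ∀ s : ℂ, HasSum (fun k : ℕ => (z / s) ^ k / (k.factorial : ℂ)) (Complex.exp (z / s)) :=
    fun s => by
      rw [Complex.exp_eq_exp_ℂ]
      exact NormedSpace.expSeries_div_hasSum_exp (z / s)
  have h1 : Tendsto (fun n : ℕ => contourInt 0 ρ (fun s => ∑ k ∈ Finset.range n,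
      s ^ (-(κ : ℤ) - 1) * Complex.exp s * ((z / s) ^ k / (k.factorial : ℂ)))) atTop
      (𝓝 (contourInt 0 ρ (fun s => s ^ (-(κ : ℤ) - 1) * Complex.exp s * Complex.exp (z / s)))) := by
    refine tendsto_contourInt (p := 0)
      (C := ρ ^ (-(κ : ℤ) - 1) * Real.exp ρ * Real.exp (‖z‖ / ρ)) hρ ?_ ?_ ?_
    · exact Eventually.of_forall fun n => (continuousOn_finsetSum _ fun k _ => hterm k).mono
        sdiff_subset
    · refine Eventually.of_forall fun n s hs => ?_
      have hsρ : ‖s‖ = ρ := mem_sphere_zero_iff_norm.1 hs.1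
      rw [← Finset.mul_sum, norm_mul, norm_mul, norm_zpow, hsρ]
      have e1 : ‖Complex.exp s‖ ≤ Real.exp ρ := by
        rw [← hsρ]
        exact Complex.norm_exp_le_exp_norm s
      have e2 : ‖∑ k ∈ Finset.range n, (z / s) ^ k / (k.factorial : ℂ)‖ ≤ Real.exp (‖z‖ / ρ) := by
        refine (norm_sum_le _ _).trans (le_trans (le_of_eq ?_)
          (Real.sum_le_exp_of_nonneg (by positivity) n))
        refine Finset.sum_congr rfl fun k _ => ?_
        rw [norm_div, norm_pow, norm_div, hsρ, Complex.norm_natCast]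
      gcongr
    · intro s hs
      simp only [← Finset.mul_sum]
      exact (hsum s).tendsto_sum_nat.const_mul _
  refine tendsto_nhds_unique h1 ?_
  simp only [hval]
  exact (hasSum_besselF κ z).tendsto_sum_nat

/-- The s-integral acts only on e^(xu/s) inside the Cauchy transform, where the Schläfli-type
formula turns it into F(ux). -/
theorem contourInt_cauchyTransform_exp {κ ν m : ℕ} (θ : Fin m → ℝ) {b ρ x : ℝ}
    (hρ : 0 < ρ) {w : ℂ} (hw : ‖w‖ < b) :
    contourInt 0 ρ (fun s => s ^ (-(κ : ℤ) - 1) * Complex.exp s * cauchyTransform b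
      (fun u => Complex.exp ((x : ℂ) / s * u) * limitWeight ν θ u) w) =
    cauchyTransform b (fun u => besselF κ (u * x) * limitWeight ν θ u) w := by
  have hb : 0 < b := (norm_nonneg w).trans_lt hw
  have hs0 : ∀ s ∈ Metric.sphere (0 : ℂ) ρ, s ≠ 0 := fun s hs => sphere_zero_subset_compl hρ hs
  have hu0 : ∀ s ∈ Metric.sphere (0 : ℂ) b, s - w ≠ 0 := fun s hs h => by
    rw [← sub_eq_zero.1 h, mem_sphere_zero_iff_norm.1 hs] at hw
    exact lt_irrefl _ hw
  have e1 : ∀ s, s ^ (-(κ : ℤ) - 1) * Complex.exp s * cauchyTransform b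
      (fun u => Complex.exp ((x : ℂ) / s * u) * limitWeight ν θ u) w =
      contourInt 0 b fun u => (s ^ (-(κ : ℤ) - 1) * Complex.exp s * Complex.exp (u * x / s)) *
        (limitWeight ν θ u / (u - w)) := by
    intro s
    rw [cauchyTransform, ← contourInt_const_mul]
    congr 1
    ext u
    rw [show (x : ℂ) / s * u = u * x / s by ring]
    ring
  simp only [e1]
  rw [contourInt_swap hρ hb]
  · simp only [contourInt_mul_const, contourInt_exp_add_div hρ]
    rw [cauchyTransform]
    congr 1
    ext u
    ring
  · refine ContinuousOn.mul (ContinuousOn.mul (ContinuousOn.mul (ContinuousOn.zpow₀ (by fun_prop) _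
      fun q hq => Or.inl (hs0 _ hq.1)) (by fun_prop)) (ContinuousOn.cexp (ContinuousOn.div
      (by fun_prop) (by fun_prop) fun q hq => hs0 _ hq.1))) (ContinuousOn.div ?_ (by fun_prop)
      fun q hq => hu0 _ hq.2)
    exact (differentiableOn_limitWeight ν θ).continuousOn.comp continuousOn_snd
      fun q hq => sphere_zero_subset_compl hb hq.2

theorem transformI_eq {κ ν m : ℕ} {θ : Fin m → ℝ} {a b Θ c R ε ρ x y : ℝ} (hρ : 0 < ρ) (hΘ0 : 0 < Θ)
    (hθ : ∀ k, -θ k ∈ Icc 0 Θ) (hΘa : Θ < a) (hab : a < b) (hc : 0 ≤ c)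
    (h1 : c < R) (h2 : Θ < c + R) (h3 : c + R < b) (hy : 0 < y) (hε : (R - c) * y < ε) :
    transformI κ ν θ ρ a b ε x y = contourInt c R fun w => besselH κ (w * y + ε) *
      (cauchyTransform b (fun u => besselF κ (u * x) * limitWeight ν θ u) w *
        (limitWeight ν θ w)⁻¹) := by
  have hR : 0 < R := hc.trans_lt h1
  have e1 : ∀ s : ℂ, s ^ (-(κ : ℤ) - 1) * Complex.exp s *
      (∫ t in Ioi (0 : ℝ), integrandI κ ν θ a b ε x y s t) = contourInt c R fun w =>
        (besselH κ (w * y + ε) * (limitWeight ν θ w)⁻¹) * (s ^ (-(κ : ℤ) - 1) * Complex.exp s *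
          cauchyTransform b (fun u => Complex.exp ((x : ℂ) / s * u) * limitWeight ν θ u) w) := by
    intro s
    rw [(integral_integrandI hΘ0 hθ hΘa hab hc h1 h2 h3 hy hε s).2, ← contourInt_const_mul]
    congr 1
    ext w
    ring
  unfold transformI
  simp only [e1]
  rw [contourInt_swap hρ hR]
  · refine contourInt_congr hR.le fun w hw => ?_
    rw [contourInt_const_mul, contourInt_cauchyTransform_exp θ hρ
      (sphere_subset_cutDisc hc h1 h2 h3 hw).1]
    ring
  · have hs0 : ∀ s ∈ Metric.sphere (0 : ℂ) ρ, s ≠ 0 := fun s hs => sphere_zero_subset_compl hρ hs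
    refine ContinuousOn.mul (ContinuousOn.mul ?_ ?_) (ContinuousOn.mul (ContinuousOn.mul
      (ContinuousOn.zpow₀ (by fun_prop) _ fun q hq => Or.inl (hs0 _ hq.1)) (by fun_prop))
      (continuousOn_cauchyTransform_exp_sphere θ hρ hc h1 h3))
    · refine (differentiableOn_besselH κ).continuousOn.comp (by fun_prop) fun q hq => ?_
      rw [mem_ofPred_eq, Complex.add_re, Complex.re_mul_ofReal, Complex.ofReal_re]
      nlinarith [neg_re_le_of_mem_sphere hq.2]
    · exact (continuousOn_inv_limitWeight_sphere hΘ0 hθ hc h1 h2).comp continuousOn_snd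
        fun q hq => hq.2

/-- Here |e^(1/z)| ≤ e^(-1/(2|z|)), which beats |z|^(-ν). The powers |z|^m are cancelled by the
factors |z + θ_k| ≥ |z|, valid because -θ_k ≥ 0. -/
theorem exists_inv_limitWeight_bound_left (ν : ℕ) {m : ℕ} {θ : Fin m → ℝ} (hθ : ∀ k, θ k ≤ 0) :
    ∀ z : ℂ, z ≠ 0 → z.re ≤ -(‖z‖ / 2) →
      ‖(limitWeight ν θ z)⁻¹‖ ≤ ν.factorial * 2 ^ ν := by
  intro z hz hre
  have hs : 0 < ‖z‖ := norm_pos_iff.2 hz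
  have h1 : ‖(Complex.exp (-1 / z))⁻¹‖ ≤ Real.exp (-(1 / 2) / ‖z‖) := by
    rw [← Complex.exp_neg, Complex.norm_exp, neg_div, neg_neg, one_div, Complex.inv_re,
      Complex.normSq_eq_norm_sq]
    refine Real.exp_le_exp.2 ?_
    rw [div_le_div_iff₀ (by positivity) hs]
    nlinarith
  have h2 : ∏ k, ‖(z + (θ k : ℂ))‖⁻¹ ≤ (‖z‖⁻¹) ^ m := by
    calc _ ≤ ∏ _k : Fin m, ‖z‖⁻¹ := by
          refine Finset.prod_le_prod (fun _ _ => by positivity) fun k _ => ?_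
          have := norm_le_norm_sub_of_re_nonpos (v := z) (by linarith) (neg_nonneg.2 (hθ k))
          rw [Complex.ofReal_neg, sub_neg_eq_add] at this
          exact inv_anti₀ hs this
      _ = _ := by simp
  rw [limitWeight, mul_inv, mul_inv, inv_div, norm_mul, norm_mul, norm_div, norm_pow, norm_pow,
    norm_inv (∏ k, _), norm_prod, ← Finset.prod_inv_distrib]
  calc _ ≤ Real.exp (-(1 / 2) / ‖z‖) * (‖z‖ ^ m / ‖z‖ ^ ν) * (‖z‖⁻¹) ^ m := by gcongr
    _ ≤ (ν.factorial * ((1 / 2 : ℝ)⁻¹ ^ ν * ‖z‖ ^ ν)) * (‖z‖ ^ m / ‖z‖ ^ ν) * (‖z‖⁻¹) ^ m := by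
        gcongr
        exact exp_neg_div_le (by norm_num) hs ν
    _ = _ := by
        rw [inv_pow]
        field_simp
        rw [← mul_pow, ← mul_pow, mul_one_div_cancel hs.ne']
        norm_num

theorem norm_inv_limitWeight_le_right (ν : ℕ) {m : ℕ} {θ : Fin m → ℝ} {D X : ℝ} (hD : 0 < D) {z : ℂ}
    (hz : D ≤ ‖z‖) (hzX : ‖z‖ ≤ X) (hθ : ∀ k, D ≤ ‖z + (θ k : ℂ)‖) :
    ‖(limitWeight ν θ z)⁻¹‖ ≤ Real.exp (1 / D) * (X ^ m / D ^ ν) * (D⁻¹) ^ m := by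
  have hs : 0 < ‖z‖ := hD.trans_le hz
  have h1 : ‖(Complex.exp (-1 / z))⁻¹‖ ≤ Real.exp (1 / D) := by
    rw [← Complex.exp_neg]
    refine (Complex.norm_exp_le_exp_norm _).trans (Real.exp_le_exp.2 ?_)
    rw [norm_neg, norm_div, norm_neg, norm_one]
    exact one_div_le_one_div_of_le hD hz
  have h2 : ∏ k, ‖(z + (θ k : ℂ))‖⁻¹ ≤ (D⁻¹) ^ m := by
    calc _ ≤ ∏ _k : Fin m, D⁻¹ := Finset.prod_le_prod (fun _ _ => by positivity) fun k _ =>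
          inv_anti₀ hD (hθ k)
      _ = _ := by simp
  rw [limitWeight, mul_inv, mul_inv, inv_div, norm_mul, norm_mul, norm_div, norm_pow, norm_pow,
    norm_inv (∏ k, _), norm_prod, ← Finset.prod_inv_distrib]
  have hX : 0 ≤ X := hs.le.trans hzX
  gcongr

theorem eventually_nhdsGT_zero_of_continuousAt {f : ℝ → ℝ} (hf : ContinuousAt f 0) {c : ℝ}
    (h : f 0 < c) : ∀ᶠ ε in 𝓝[>] (0 : ℝ), f ε < c :=
  nhdsWithin_le_nhds (hf.eventually (gt_mem_nhds h))

/-- With ε = dy the substitution v = w + d turns H(wy + ε) into H(vy) and moves the singular segment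
to [d, Θ + d], inside the right half-plane. The passage to the curve through the origin is then
available. -/
theorem transformI_eq_xiInt {κ ν m : ℕ} {θ : Fin m → ℝ} {a b Θ X d ρ x y : ℝ} (hρ : 0 < ρ)
    (hΘ0 : 0 < Θ) (hθ : ∀ k, -θ k ∈ Icc 0 Θ) (hΘX : Θ < X) (hXa : X < a) (hab : a < b)
    (hy : 0 < y) (hd : 0 < d) (h1 : Θ + d < X) (h2 : X + 3 * d < b) :
    transformI κ ν θ ρ a b (d * y) x y = xiInt X fun v => mellinH (1 / 4) κ (v * y) *
      (cauchyTransform b (fun u => besselF κ (u * x) * limitWeight ν θ u) (v - d) *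
        (limitWeight ν θ (v - d))⁻¹) := by
  have hX : 0 < X := hΘ0.trans hΘX
  have hb : 0 < b := by linarith
  -- This circle reaches d/2 to the left of the origin: less than d as convergence requires, and
  -- after the translation its leftmost point d/2 is positive.
  rw [transformI_eq (c := X / 2) (R := X / 2 + d / 2) hρ hΘ0 hθ (hΘX.trans hXa) hab (by linarith)
    (by linarith) (by linarith) (by linarith) hy (by nlinarith)]
  have e1 : (fun w : ℂ => besselH κ (w * y + ((d * y : ℝ) : ℂ)) *
      (cauchyTransform b (fun u => besselF κ (u * x) * limitWeight ν θ u) w *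
        (limitWeight ν θ w)⁻¹)) = fun w => (fun v : ℂ => besselH κ (v * y) *
      (cauchyTransform b (fun u => besselF κ (u * x) * limitWeight ν θ u) (v - d) *
        (limitWeight ν θ (v - d))⁻¹)) (w + (d : ℂ)) := by
    ext w
    simp only
    rw [add_sub_cancel_right, add_mul]
    push_cast
    rfl
  rw [e1, ← contourInt_translate _ _ _ fun v : ℂ => besselH κ (v * y) *
      (cauchyTransform b (fun u => besselF κ (u * x) * limitWeight ν θ u) (v - d) *
        (limitWeight ν θ (v - d))⁻¹), ← Complex.ofReal_add]
  have hsub : ∀ v : ℂ, ¬(v.im = 0 ∧ v.re ∈ Icc d (Θ + d)) →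
      ¬((v - d).im = 0 ∧ (v - d).re ∈ Icc 0 Θ) := by
    rintro v hv ⟨h3, h4, h5⟩
    rw [Complex.sub_im, Complex.ofReal_im, sub_zero] at h3
    rw [Complex.sub_re, Complex.ofReal_re] at h4 h5
    exact hv ⟨h3, by linarith, by linarith⟩
  have hA : DifferentiableOn ℂ (fun v : ℂ =>
      cauchyTransform b (fun u => besselF κ (u * x) * limitWeight ν θ u) (v - d))
      (Metric.ball 0 (b - d)) := by
    refine (differentiableOn_cauchyTransform hb ?_).comp (by fun_prop) fun v hv => ?_
    · exact (differentiable_besselF_mul κ x).continuous.continuousOn.mul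
        ((differentiableOn_limitWeight ν θ).continuousOn.mono (sphere_zero_subset_compl hb))
    · rw [mem_ball_zero_iff] at hv ⊢
      have := norm_sub_le v (d : ℂ)
      rw [Complex.norm_real, Real.norm_of_nonneg hd.le] at this
      linarith
  have hΦ : DifferentiableOn ℂ (fun v : ℂ => (limitWeight ν θ (v - d))⁻¹)
      {v | ¬(v.im = 0 ∧ v.re ∈ Icc d (Θ + d))} :=
    (differentiableOn_inv_limitWeight hΘ0.le hθ).comp (by fun_prop) hsub
  refine contourInt_besselH_mul_eq_xiInt κ hy (lo := d) (hi := Θ + d) (B := b - d) ?_ ?_ hd hX h1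
    (by linarith) (by linarith) (by linarith) (by linarith) (by linarith) (by linarith)
  · exact (hA.mono fun v hv => mem_ball_zero_iff.2 hv.2.1).mul (hΦ.mono fun v hv => hv.2.2)
  · refine ContinuousAt.mul ?_ ?_
    · exact (hA.differentiableAt (Metric.isOpen_ball.mem_nhds (by simp; linarith))).continuousAt
    · refine (hΦ.differentiableAt ((isOpen_compl_segment _ _).mem_nhds ?_)).continuousAt
      rintro ⟨-, h5, -⟩
      simp at h5
      linarith

/-- Only the argument v - ε/y of the Cauchy transform and of the weight still depends on ε, and
bounds uniform in small ε allow dominated convergence over the curve. -/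
theorem tendsto_transformI {κ ν m : ℕ} {θ : Fin m → ℝ} {a b Θ X ρ x y : ℝ} (hρ : 0 < ρ)
    (hΘ0 : 0 < Θ) (hθ : ∀ k, -θ k ∈ Icc 0 Θ) (hΘX : Θ < X) (hXa : X < a) (hab : a < b)
    (hy : 0 < y) :
    Tendsto (fun ε : ℝ => transformI κ ν θ ρ a b ε x y) (𝓝[>] 0)
      (𝓝 (xiKernel κ ν θ b X x y)) := by
  have hX : 0 < X := hΘ0.trans hΘX
  have hb : 0 < b := by linarith
  have hXb : X < b := by linarith
  -- Intermediate values that leave room for the translation: the shifted segment stays in [0, Θ₂]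
  -- with Θ₂ < X, the shifted curve in |z| ≤ X₂ with X₂ < b.
  set Θ₂ := (Θ + X) / 2 with hΘ₂
  set X₂ := (X + b) / 2 with hX₂
  have ev1 : ∀ᶠ ε in 𝓝[>] (0 : ℝ), Θ + ε / y < Θ₂ :=
    eventually_nhdsGT_zero_of_continuousAt (by fun_prop) (by simp [hΘ₂]; linarith)
  have ev2 : ∀ᶠ ε in 𝓝[>] (0 : ℝ), X + 3 * (ε / y) < X₂ :=
    eventually_nhdsGT_zero_of_continuousAt (by fun_prop) (by simp [hX₂]; linarith)
  have ev3 : ∀ᶠ ε in 𝓝[>] (0 : ℝ), 0 < ε := self_mem_nhdsWithin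
  obtain ⟨D, hD0, hD⟩ := exists_xiCurve_dichotomy hX (by simp only [hΘ₂]; linarith : Θ₂ < X)
  obtain ⟨C₃, hC₃0, hC₃⟩ := exists_mellinH_bound_xiCurve κ hX hy
  have hPc : ContinuousOn (fun u => besselF κ (u * x) * limitWeight ν θ u) (Metric.sphere 0 b) :=
    (differentiable_besselF_mul κ x).continuous.continuousOn.mul
      ((differentiableOn_limitWeight ν θ).continuousOn.mono (sphere_zero_subset_compl hb))
  obtain ⟨C₄, hC₄⟩ := (isCompact_sphere (0 : ℂ) b).exists_bound_of_continuousOn hPc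
  have hA := differentiableOn_cauchyTransform hb hPc
  set C₂ : ℝ := max (ν.factorial * 2 ^ ν) (Real.exp (1 / D) * (X₂ ^ m / D ^ ν) * (D⁻¹) ^ m)
    with hC₂
  have hnormsub : ∀ v ∈ xiCurve X, ∀ d : ℝ, 0 < d → X + 3 * d < X₂ → ‖v - (d : ℂ)‖ ≤ X₂ := by
    intro v hv d hd h2
    have := norm_sub_le v (d : ℂ)
    rw [Complex.norm_real, Real.norm_of_nonneg hd.le] at this
    linarith [norm_le_of_mem_xiCurve hX hv]
  have hΦb : ∀ v ∈ xiCurve X, ∀ d : ℝ, 0 < d → Θ + d < Θ₂ → X + 3 * d < X₂ →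
      ‖(limitWeight ν θ (v - d))⁻¹‖ ≤ C₂ := by
    intro v hv d hd h1 h2
    rcases hD v hv with h | h
    -- The sector survives the shift: Re(v - d) ≤ -|v|/2 - d ≤ -|v - d|/2.
    · refine le_trans ?_ (le_max_left _ _)
      have hv0 : 0 < ‖v‖ := norm_pos_iff.2 (xiCurve_ne_zero hX hv)
      have h3 := norm_sub_le v (d : ℂ)
      rw [Complex.norm_real, Real.norm_of_nonneg hd.le] at h3
      have h4 : (v - (d : ℂ)).re = v.re - d := by simp
      refine exists_inv_limitWeight_bound_left ν (fun k => by linarith [(hθ k).1]) _ ?_ ?_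
      · intro h0
        rw [h0, Complex.zero_re] at h4
        linarith
      · rw [h4]
        linarith
    · refine le_trans ?_ (le_max_right _ _)
      refine norm_inv_limitWeight_le_right ν hD0 (h d ⟨hd.le, by linarith⟩)
        (hnormsub v hv d hd h2) fun k => ?_
      -- v - d + θ_k is the difference of v and the point d - θ_k of [0, Θ₂], so the distance bound
      -- for the curve applies.
      have := h (d + -θ k) ⟨by linarith [(hθ k).1], by linarith [(hθ k).2]⟩
      push_cast at this
      rwa [← sub_sub, sub_neg_eq_add] at this
  have hseg : ∀ v ∈ xiCurve X, ¬(v.im = 0 ∧ v.re ∈ Icc 0 Θ₂) := fun v hv =>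
    (mem_slitRegion_of_mem_xiCurve hX (by simp only [hΘ₂]; linarith) hXb hv).2.2
  have hmaps : ∀ d : ℝ, 0 < d → Θ + d < Θ₂ → ∀ v ∈ xiCurve X,
      ¬((v - (d : ℂ)).im = 0 ∧ (v - (d : ℂ)).re ∈ Icc 0 Θ) := by
    rintro d hd h1 v hv ⟨h3, h4, h5⟩
    rw [Complex.sub_im, Complex.ofReal_im, sub_zero] at h3
    rw [Complex.sub_re, Complex.ofReal_re] at h4 h5
    exact hseg v hv ⟨h3, by linarith, by linarith⟩
  have hA' : ∀ v, ‖v‖ ≤ X₂ → v ∈ Metric.ball (0 : ℂ) b := fun v hv =>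
    mem_ball_zero_iff.2 (hv.trans_lt (by simp only [hX₂]; linarith))
  have main : Tendsto (fun ε : ℝ => xiInt X fun v => mellinH (1 / 4) κ (v * y) *
      (cauchyTransform b (fun u => besselF κ (u * x) * limitWeight ν θ u) (v - ((ε / y : ℝ) : ℂ)) *
        (limitWeight ν θ (v - ((ε / y : ℝ) : ℂ)))⁻¹)) (𝓝[>] 0) (𝓝 (xiKernel κ ν θ b X x y)) := by
    refine tendsto_xiInt (p := 1 / 4) (C := C₃ * (b * (C₄ / (b - X₂)) * C₂)) hX (by norm_num)
      ?_ ?_ ?_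
    · filter_upwards [ev1, ev2, ev3] with ε h1 h2 h3
      have hd : 0 < ε / y := div_pos h3 hy
      refine ContinuousOn.mul ?_ (ContinuousOn.mul ?_ ?_)
      · exact (differentiableOn_mellinH_mul (by norm_num) κ hy).continuousOn.mono fun v hv =>
          mem_slitPlane_of_mem_xiCurve hX hv
      · exact hA.continuousOn.comp (by fun_prop) fun v hv => hA' _ (hnormsub v hv _ hd h2)
      · exact (differentiableOn_inv_limitWeight hΘ0.le hθ).continuousOn.comp (by fun_prop)
          fun v hv => hmaps _ hd h1 v hv
    · filter_upwards [ev1, ev2, ev3] with ε h1 h2 h3 v hv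
      have hd : 0 < ε / y := div_pos h3 hy
      rw [norm_mul, norm_mul]
      have h4 := norm_cauchyTransform_le hb hC₄ (by simp only [hX₂]; linarith : X₂ < b)
        (hnormsub v hv _ hd h2)
      calc _ ≤ (C₃ * ‖v‖ ^ (-(1 / 4) : ℝ)) * (b * (C₄ / (b - X₂)) * C₂) := by
            refine mul_le_mul (hC₃ v hv) (mul_le_mul h4 (hΦb v hv _ hd h1 h2) (norm_nonneg _)
              ((norm_nonneg _).trans h4)) (by positivity) (by positivity)
        _ = _ := by ring
    · intro v hv
      have hlim : Tendsto (fun ε : ℝ => v - ((ε / y : ℝ) : ℂ)) (𝓝[>] 0) (𝓝 v) := by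
        have hc : Continuous fun ε : ℝ => v - ((ε / y : ℝ) : ℂ) := by fun_prop
        have := hc.tendsto 0
        simp only [zero_div, Complex.ofReal_zero, sub_zero] at this
        exact this.mono_left nhdsWithin_le_nhds
      refine Tendsto.const_mul _ (Tendsto.mul ?_ ?_)
      · refine ((hA.differentiableAt (Metric.isOpen_ball.mem_nhds (hA' v ?_))).continuousAt.tendsto.comp
          hlim)
        exact (norm_le_of_mem_xiCurve hX hv).trans (by simp only [hX₂]; linarith)
      · refine ((differentiableOn_inv_limitWeight hΘ0.le hθ).differentiableAt
          ((isOpen_compl_segment _ _).mem_nhds ?_)).continuousAt.tendsto.comp hlim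
        rintro ⟨h3, h4, h5⟩
        exact hseg v hv ⟨h3, h4, h5.trans (by simp only [hΘ₂]; linarith)⟩
  refine Tendsto.congr' ?_ main
  filter_upwards [ev1, ev2, ev3] with ε h1 h2 h3
  have e2 : ε = ε / y * y := by field_simp
  conv_rhs => rw [e2]
  refine (transformI_eq_xiInt hρ hΘ0 hθ hΘX hXa hab hy (div_pos h3 hy) ?_ ?_).symm
  · exact h1.trans (by simp only [hΘ₂]; linarith)
  · exact h2.trans (by simp only [hX₂]; linarith)

theorem integrableOn_integrandI_of_pos {κ ν m : ℕ} {θ : Fin m → ℝ} {a b Θ ε x y : ℝ} (hΘ0 : 0 < Θ)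
    (hθ : ∀ k, -θ k ∈ Icc 0 Θ) (hΘa : Θ < a) (hab : a < b) (hy : 0 < y) (hε : 0 < ε) (s : ℂ) :
    IntegrableOn (integrandI κ ν θ a b ε x y s) (Ioi 0) := by
  have hm : 0 < min (ε / y / 2) ((b - Θ) / 2) := lt_min (by positivity) (by linarith)
  have h1 := min_le_left (ε / y / 2) ((b - Θ) / 2)
  have h2 := min_le_right (ε / y / 2) ((b - Θ) / 2)
  refine (integral_integrandI (c := Θ / 2) (R := Θ / 2 + min (ε / y / 2) ((b - Θ) / 2)) hΘ0 hθ hΘa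
    hab (by linarith) (by linarith) (by linarith) (by linarith) hy ?_ s).1
  rw [add_sub_cancel_left, ← lt_div_iff₀ hy]
  have : 0 < ε / y := div_pos hε hy
  linarith

/-! ### Absolute convergence without the regularising factor -/

theorem intervalIntegrable_abs_rpow_neg_half (a b : ℝ) :
    IntervalIntegrable (fun x : ℝ => |x| ^ (-(1 / 2) : ℝ)) volume a b := by
  have h0 : ∀ c : ℝ, 0 ≤ c → IntervalIntegrable (fun x : ℝ => |x| ^ (-(1 / 2) : ℝ)) volume 0 c := by
    intro c hc
    refine (intervalIntegral.intervalIntegrable_rpow' (a := 0) (b := c)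
      (r := -(1 / 2)) (by norm_num)).congr fun x hx => ?_
    rw [uIoc_of_le hc] at hx
    rw [abs_of_pos hx.1]
  have h1 : ∀ c : ℝ, IntervalIntegrable (fun x : ℝ => |x| ^ (-(1 / 2) : ℝ)) volume 0 c := by
    intro c
    rcases le_total 0 c with h | h
    · exact h0 c h
    · have := (h0 (-c) (by linarith)).comp_sub_left 0
      simpa using this
  exact (h1 a).symm.trans (h1 b)

theorem two_div_pi_mul_le_norm_exp_sub_one {ψ : ℝ} (hψ : |ψ| ≤ Real.pi) :
    2 / Real.pi * |ψ| ≤ ‖Complex.exp (Complex.I * ψ) - 1‖ := by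
  rw [Complex.norm_exp_I_mul_ofReal_sub_one, norm_mul, Real.norm_eq_abs, Real.norm_eq_abs, abs_two]
  have h := Real.mul_abs_le_abs_sin (x := ψ / 2) (by rw [abs_div, abs_two]; linarith)
  rw [abs_div, abs_two] at h
  linarith

/-- By Jordan's inequality a chord is at least 2/π times its arc, so the singularity is no worse
than |ψ|^(-1/2). -/
theorem intervalIntegrable_norm_sub_rpow {p : ℂ} (hp : ‖p‖ = 1) :
    IntervalIntegrable (fun φ : ℝ => ‖circleMap 0 1 φ - p‖ ^ (-(1 / 2) : ℝ)) volume 0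
      (2 * Real.pi) := by
  have hpi := Real.pi_pos
  set g : ℝ → ℝ := fun ψ => ‖Complex.exp (Complex.I * ψ) - 1‖ ^ (-(1 / 2) : ℝ) with hg
  have hper : Function.Periodic g (2 * Real.pi) := by
    intro ψ
    simp only [hg]
    congr 3
    push_cast
    rw [mul_add, show Complex.I * (2 * Real.pi) = 2 * Real.pi * Complex.I by ring,
      Complex.exp_add, Complex.exp_two_pi_mul_I, mul_one]
  have h1 : IntervalIntegrable g volume (-Real.pi) (-Real.pi + 2 * Real.pi) := by
    refine ((intervalIntegrable_abs_rpow_neg_half _ _).const_mul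
      ((2 / Real.pi) ^ (-(1 / 2) : ℝ))).mono_fun ?_ ?_
    · refine Measurable.aestronglyMeasurable ?_
      simp only [hg]
      fun_prop
    · refine (ae_restrict_iff' measurableSet_uIoc).2 ?_
      filter_upwards [compl_mem_ae_iff.2 (measure_singleton (0 : ℝ))] with ψ hψ0 hψ
      rw [uIoc_of_le (by linarith)] at hψ
      have hψ0' : 0 < |ψ| := abs_pos.2 hψ0
      have h3 := two_div_pi_mul_le_norm_exp_sub_one (ψ := ψ)
        (abs_le.2 ⟨by linarith [hψ.1], by linarith [hψ.2]⟩)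
      simp only [hg]
      rw [Real.norm_of_nonneg (by positivity), Real.norm_of_nonneg (by positivity),
        ← Real.mul_rpow (by positivity) hψ0'.le]
      exact Real.rpow_le_rpow_of_nonpos (by positivity) h3 (by norm_num)
  have h2 : IntervalIntegrable g volume (0 - p.arg) (2 * Real.pi - p.arg) :=
    hper.intervalIntegrable (by positivity) h1 _ _
  refine ((h2.comp_sub_right p.arg).congr fun φ _ => ?_).mono_set (by simp)
  simp only [hg]
  congr 1
  have hpe : p = Complex.exp (Complex.I * p.arg) := by
    conv_lhs => rw [← Complex.norm_mul_exp_arg_mul_I p, hp]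
    rw [mul_comm Complex.I]
    simp
  have e1 : circleMap 0 1 φ - p =
      (Complex.exp (Complex.I * ((φ - p.arg : ℝ) : ℂ)) - 1) * Complex.exp (Complex.I * p.arg) := by
    rw [sub_mul, ← Complex.exp_add, one_mul, ← hpe]
    simp only [circleMap, zero_add, Complex.ofReal_one, one_mul]
    congr 2
    push_cast
    ring
  rw [e1, norm_mul, ← hpe, hp, mul_one]

/-- The mean of `‖z - p‖ ^ (-1 / 2)` over the unit circle. -/
noncomputable def circleMean (p : ℂ) : ℝ :=
  (2 * Real.pi)⁻¹ * ∫ φ in (0 : ℝ)..2 * Real.pi, ‖circleMap 0 1 φ - p‖ ^ (-(1 / 2) : ℝ)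

/-- The estimates below produce integrable singularities at the points of the circle where
exponential decay is lost; two such points are allowed. -/
theorem norm_contourInt_le_circleMean {c : ℂ} {R C : ℝ} (hR : 0 ≤ R) {p₁ p₂ : ℂ}
    (h₁ : ‖p₁‖ = 1) (h₂ : ‖p₂‖ = 1) {f : ℂ → ℂ}
    (hf : ∀ z : ℂ, ‖z‖ = 1 → z ≠ p₁ → z ≠ p₂ →
      ‖f (c + R * z)‖ ≤ C * (‖z - p₁‖ ^ (-(1 / 2) : ℝ) + ‖z - p₂‖ ^ (-(1 / 2) : ℝ))) :
    ‖contourInt c R f‖ ≤ R * (C * (circleMean p₁ + circleMean p₂)) := by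
  have hpi := Real.pi_pos
  have i₁ := intervalIntegrable_norm_sub_rpow h₁
  have i₂ := intervalIntegrable_norm_sub_rpow h₂
  rw [contourInt_eq_intervalIntegral, norm_mul]
  have e1 : ‖(2 * Real.pi : ℂ)⁻¹‖ = (2 * Real.pi)⁻¹ := by
    rw [norm_inv, norm_mul, Complex.norm_real, Real.norm_of_nonneg hpi.le]
    norm_num
  have h3 := intervalIntegral.norm_integral_le_of_norm_le (a := 0) (b := 2 * Real.pi)
    (f := fun θ => circleMap 0 R θ * f (circleMap c R θ))
    (g := fun φ => R * (C * (‖circleMap 0 1 φ - p₁‖ ^ (-(1 / 2) : ℝ) +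
      ‖circleMap 0 1 φ - p₂‖ ^ (-(1 / 2) : ℝ)))) (μ := volume) (by positivity) (by
    filter_upwards [ae_circleMap_ne (c := 0) (p := p₁) one_ne_zero,
      ae_circleMap_ne (c := 0) (p := p₂) one_ne_zero] with φ hφ₁ hφ₂ _
    rw [norm_mul, norm_circleMap_zero, abs_of_nonneg hR]
    refine mul_le_mul_of_nonneg_left ?_ hR
    have := hf (circleMap 0 1 φ) (by simp) hφ₁ hφ₂
    rwa [show c + R * circleMap 0 1 φ = circleMap c R φ by simp [circleMap]] at this)
    (((i₁.add i₂).const_mul C).const_mul R)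
  rw [intervalIntegral.integral_const_mul, intervalIntegral.integral_const_mul,
    intervalIntegral.integral_add i₁ i₂] at h3
  rw [e1]
  refine (mul_le_mul_of_nonneg_left h3 (by positivity)).trans_eq ?_
  rw [circleMean, circleMean]
  ring

/-- On the circle `|w - c|² = c² + δ²` the two exponentials combine into a Gaussian-type factor. -/
theorem norm_exp_circle {c δ : ℝ} (hc : 0 < c) (hδ : 0 < δ) {w : ℂ} (hw0 : w ≠ 0)
    (hw : ‖w - c‖ ^ 2 = c ^ 2 + δ ^ 2) :
    ‖Complex.exp (-(w / (δ ^ 2 : ℝ))) * (Complex.exp (-1 / w))⁻¹‖ =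
      Real.exp (-((‖w‖ ^ 2 - δ ^ 2) ^ 2 / (2 * c * δ ^ 2 * ‖w‖ ^ 2))) := by
  have hs : 0 < ‖w‖ := norm_pos_iff.2 hw0
  have hre : ‖w‖ ^ 2 - δ ^ 2 = 2 * c * w.re := by
    rw [← Complex.normSq_eq_norm_sq, Complex.normSq_apply] at hw ⊢
    simp at hw
    linarith
  rw [← Complex.exp_neg, ← Complex.exp_add, Complex.norm_exp]
  congr 1
  rw [Complex.add_re, Complex.neg_re, Complex.div_ofReal_re, neg_div, neg_neg, one_div,
    Complex.inv_re, Complex.normSq_eq_norm_sq]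
  have h1 : w.re = (‖w‖ ^ 2 - δ ^ 2) / (2 * c) := by
    rw [hre]
    field_simp
  rw [h1]
  field_simp
  ring

/-- Here r stands for |w|/δ. Expanding the square gives the exponent -r²/(2c) + 1/c - 1/(2cr²): for
r ≤ 1 the last term kills r^(-2κ), for r ≥ 1 the first gives the decay. -/
theorem exists_gaussian_bound (κ : ℕ) {c : ℝ} (hc : 0 < c) :
    ∃ C : ℝ, 0 < C ∧ ∀ r : ℝ, 0 < r →
      (r ^ (2 * κ))⁻¹ * Real.exp (-((r ^ 2 - 1) ^ 2 / (2 * c * r ^ 2))) ≤ C * r ^ (-(1 / 2) : ℝ) := by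
  refine ⟨Real.exp (1 / c) * (κ.factorial * ((1 / (2 * c))⁻¹ ^ κ)) + Real.exp (1 / c) * (2 * c),
    by positivity, fun r hr => ?_⟩
  have e1 : Real.exp (-((r ^ 2 - 1) ^ 2 / (2 * c * r ^ 2))) =
      Real.exp (1 / c) * (Real.exp (-(r ^ 2 / (2 * c))) * Real.exp (-(1 / (2 * c)) / r ^ 2)) := by
    rw [← Real.exp_add, ← Real.exp_add]
    congr 1
    field_simp
    ring
  rw [e1, add_mul]
  rcases le_total r 1 with h | h
  · refine le_trans ?_ (le_add_of_nonneg_right (by positivity))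
    have h1 := exp_neg_div_le (δ := 1 / (2 * c)) (t := r ^ 2) (by positivity) (by positivity) κ
    have h2 : Real.exp (-(r ^ 2 / (2 * c))) ≤ 1 := Real.exp_le_one_iff.2 (by
      have : 0 ≤ r ^ 2 / (2 * c) := by positivity
      linarith)
    have h3 : 1 ≤ r ^ (-(1 / 2) : ℝ) := Real.one_le_rpow_of_pos_of_le_one_of_nonpos hr h (by norm_num)
    calc _ ≤ (r ^ (2 * κ))⁻¹ * (Real.exp (1 / c) *
          (1 * (κ.factorial * ((1 / (2 * c))⁻¹ ^ κ * (r ^ 2) ^ κ)))) := by gcongr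
      _ = Real.exp (1 / c) * (κ.factorial * ((1 / (2 * c))⁻¹ ^ κ)) * 1 := by
          rw [pow_mul]
          have : (r ^ 2) ^ κ ≠ 0 := by positivity
          generalize (1 / (2 * c))⁻¹ = z
          field_simp
      _ ≤ _ := by gcongr
  · refine le_trans ?_ (le_add_of_nonneg_left (by positivity))
    have h1 : Real.exp (-(r ^ 2 / (2 * c))) ≤ 2 * c / r ^ 2 := by
      rw [Real.exp_neg, ← inv_div (r ^ 2) (2 * c)]
      refine inv_anti₀ (by positivity) ?_
      linarith [Real.add_one_le_exp (r ^ 2 / (2 * c))]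
    have h2 : Real.exp (-(1 / (2 * c)) / r ^ 2) ≤ 1 := Real.exp_le_one_iff.2 (by
      rw [neg_div]
      have : 0 ≤ 1 / (2 * c) / r ^ 2 := by positivity
      linarith)
    have h3 : (r ^ (2 * κ))⁻¹ ≤ 1 := inv_le_one_of_one_le₀ (one_le_pow₀ h)
    have h4 : (r ^ 2)⁻¹ ≤ r ^ (-(1 / 2) : ℝ) := by
      rw [← Real.rpow_natCast, ← Real.rpow_neg hr.le]
      exact Real.rpow_le_rpow_of_exponent_le h (by norm_num)
    calc _ ≤ 1 * (Real.exp (1 / c) * (2 * c / r ^ 2 * 1)) := by gcongr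
      _ = Real.exp (1 / c) * (2 * c) * (r ^ 2)⁻¹ := by ring
      _ ≤ _ := by gcongr

/-- A weak power is deliberately chosen: applied to a squared distance product over δ, it gives a
small power of δ at the price of integrable singularities. -/
theorem exp_neg_le_rpow {z : ℝ} (hz : 0 < z) : Real.exp (-z) ≤ z ^ (-(1 / 8) : ℝ) := by
  have h1 : z ^ (1 / 8 : ℝ) ≤ Real.exp z := by
    rcases le_total z 1 with h | h
    · exact (Real.rpow_le_one hz.le h (by norm_num)).trans (Real.one_le_exp hz.le)
    · calc z ^ (1 / 8 : ℝ) ≤ z ^ (1 : ℝ) := Real.rpow_le_rpow_of_exponent_le h (by norm_num)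
        _ = z := Real.rpow_one z
        _ ≤ _ := by linarith [Real.add_one_le_exp z]
  rw [Real.exp_neg, Real.rpow_neg hz.le]
  exact inv_anti₀ (by positivity) h1

/-- The points of the unit circle with real part `-1 / √2`. -/
theorem exists_unit_points : ∃ p₁ p₂ : ℂ, ‖p₁‖ = 1 ∧ ‖p₂‖ = 1 ∧
    ∀ z : ℂ, ‖z‖ = 1 → ‖z - p₁‖ * ‖z - p₂‖ = Real.sqrt 2 * |1 + Real.sqrt 2 * z.re| := by
  have h2 : Real.sqrt 2 ^ 2 = 2 := Real.sq_sqrt (by norm_num)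
  have hpos : 0 < Real.sqrt 2 := by positivity
  have hn : ∀ s : ℝ, s ^ 2 = 1 → ∀ z : ℂ, ‖z‖ = 1 →
      ‖z - ⟨-(Real.sqrt 2 / 2), s * (Real.sqrt 2 / 2)⟩‖ ^ 2 =
        2 + Real.sqrt 2 * z.re - s * Real.sqrt 2 * z.im := by
    intro s hs z hz
    have h3 : ‖z‖ ^ 2 = 1 := by rw [hz, one_pow]
    rw [← Complex.normSq_eq_norm_sq, Complex.normSq_apply] at h3 ⊢
    simp
    nlinarith
  have hu : ∀ s : ℝ, s ^ 2 = 1 → ‖(⟨-(Real.sqrt 2 / 2), s * (Real.sqrt 2 / 2)⟩ : ℂ)‖ = 1 := by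
    intro s hs
    rw [← sq_eq_sq₀ (norm_nonneg _) zero_le_one, ← Complex.normSq_eq_norm_sq, Complex.normSq_apply]
    simp
    nlinarith
  refine ⟨⟨-(Real.sqrt 2 / 2), 1 * (Real.sqrt 2 / 2)⟩, ⟨-(Real.sqrt 2 / 2), -1 * (Real.sqrt 2 / 2)⟩,
    hu 1 (by norm_num), hu (-1) (by norm_num), fun z hz => ?_⟩
  rw [← sq_eq_sq₀ (by positivity) (by positivity), mul_pow, hn 1 (by norm_num) z hz,
    hn (-1) (by norm_num) z hz, mul_pow, sq_abs, h2]
  have h3 : ‖z‖ ^ 2 = 1 := by rw [hz, one_pow]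
  rw [← Complex.normSq_eq_norm_sq, Complex.normSq_apply] at h3
  nlinarith

/-- The Gaussian-type estimate on circles around `[0, 2 c]` that pass close to the origin. -/
theorem exists_circle_integral_bound (κ : ℕ) {c : ℝ} (hc : 0 < c) :
    ∃ C : ℝ, 0 < C ∧ ∀ δ R G : ℝ, 0 < δ → c < R → R ≤ 2 * c → R ^ 2 = c ^ 2 + δ ^ 2 → 0 ≤ G →
      ∀ g : ℂ → ℂ, (∀ w ∈ Metric.sphere (c : ℂ) R, ‖g w‖ ≤ G * ‖w‖) →
      ‖contourInt c R fun w => Complex.exp (-(w / (δ ^ 2 : ℝ))) * (Complex.exp (-1 / w))⁻¹ *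
        (w ^ (2 * κ + 1))⁻¹ * g w‖ ≤ G * (C * ((δ ^ (2 * κ))⁻¹ * δ ^ (1 / 2 : ℝ))) := by
  obtain ⟨C₁, hC₁0, hC₁⟩ := exists_gaussian_bound κ hc
  have hm : 0 ≤ circleMean (-1) := by
    refine mul_nonneg (by positivity) (intervalIntegral.integral_nonneg (by positivity)
      fun φ _ => by positivity)
  refine ⟨2 * c * (C₁ * c ^ (-(1 / 2) : ℝ) * (2 * circleMean (-1))) + 1, by positivity, ?_⟩
  intro δ R G hδ hcR hR2 hRsq hG g hg
  have hR : 0 < R := hc.trans hcR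
  -- The only degenerate direction is z = -1, where the circle passes nearest to the origin; it is
  -- listed twice to fit the two-point estimate.
  have key : ∀ z : ℂ, ‖z‖ = 1 → z ≠ -1 → z ≠ -1 →
      ‖Complex.exp (-(((c : ℂ) + R * z) / (δ ^ 2 : ℝ))) * (Complex.exp (-1 / (c + R * z)))⁻¹ *
        ((c + R * z) ^ (2 * κ + 1))⁻¹ * g (c + R * z)‖ ≤
      (G * ((δ ^ (2 * κ))⁻¹ * δ ^ (1 / 2 : ℝ)) * (C₁ * c ^ (-(1 / 2) : ℝ))) *
        (‖z - -1‖ ^ (-(1 / 2) : ℝ) + ‖z - -1‖ ^ (-(1 / 2) : ℝ)) := by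
    intro z hz hz1 _
    set w : ℂ := c + R * z with hw
    have hws : w ∈ Metric.sphere (c : ℂ) R := by
      rw [mem_sphere_iff_norm, hw, add_sub_cancel_left, norm_mul, hz, Complex.norm_real,
        Real.norm_of_nonneg hR.le, mul_one]
    have hwc : ‖w - c‖ ^ 2 = c ^ 2 + δ ^ 2 := by rw [mem_sphere_iff_norm.1 hws, hRsq]
    have hz1' : 0 < ‖z - -1‖ := norm_pos_iff.2 (sub_ne_zero.2 hz1)
    -- |c + Rz|² - c²|z + 1|² = (R - c)(R + c + 2c Re z), and both factors are nonnegative because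
    -- Re z ≥ -1 and R > c.
    have hlow : c * ‖z - -1‖ ≤ ‖w‖ := by
      rw [← sq_le_sq₀ (by positivity) (norm_nonneg _), mul_pow, ← Complex.normSq_eq_norm_sq,
        ← Complex.normSq_eq_norm_sq, Complex.normSq_apply, Complex.normSq_apply]
      have h3 : ‖z‖ ^ 2 = 1 := by rw [hz, one_pow]
      have h4 := abs_le.1 ((Complex.abs_re_le_norm z).trans_eq hz)
      rw [← Complex.normSq_eq_norm_sq, Complex.normSq_apply] at h3
      simp [hw]
      nlinarith [mul_nonneg (sub_nonneg.2 hcR.le)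
        (by nlinarith : 0 ≤ R + c + 2 * c * z.re)]
    have hs : 0 < ‖w‖ := lt_of_lt_of_le (by positivity) hlow
    have hr : 0 < ‖w‖ / δ := div_pos hs hδ
    have e1 : Real.exp (-((‖w‖ ^ 2 - δ ^ 2) ^ 2 / (2 * c * δ ^ 2 * ‖w‖ ^ 2))) =
        Real.exp (-(((‖w‖ / δ) ^ 2 - 1) ^ 2 / (2 * c * (‖w‖ / δ) ^ 2))) := by
      congr 2
      field_simp
    rw [norm_mul, norm_mul, norm_exp_circle hc hδ (norm_pos_iff.1 hs) hwc, e1, norm_inv, norm_pow]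
    calc _ ≤ Real.exp (-(((‖w‖ / δ) ^ 2 - 1) ^ 2 / (2 * c * (‖w‖ / δ) ^ 2))) *
          (‖w‖ ^ (2 * κ + 1))⁻¹ * (G * ‖w‖) := by gcongr; exact hg w hws
      _ = G * (δ ^ (2 * κ))⁻¹ * ((((‖w‖ / δ) ^ (2 * κ))⁻¹) *
          Real.exp (-(((‖w‖ / δ) ^ 2 - 1) ^ 2 / (2 * c * (‖w‖ / δ) ^ 2)))) := by
          have e2 : (δ ^ (2 * κ))⁻¹ * ((‖w‖ / δ) ^ (2 * κ))⁻¹ = (‖w‖ ^ (2 * κ))⁻¹ := by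
            rw [← mul_inv, ← mul_pow, mul_div_cancel₀ _ hδ.ne']
          have e3 : (‖w‖ ^ (2 * κ + 1))⁻¹ * ‖w‖ = (‖w‖ ^ (2 * κ))⁻¹ := by
            rw [pow_succ]
            field_simp
          rw [← e2] at e3
          linear_combination G * Real.exp (-(((‖w‖ / δ) ^ 2 - 1) ^ 2 / (2 * c * (‖w‖ / δ) ^ 2))) * e3
      _ ≤ G * (δ ^ (2 * κ))⁻¹ * (C₁ * (‖w‖ / δ) ^ (-(1 / 2) : ℝ)) := by
          exact mul_le_mul_of_nonneg_left (hC₁ _ hr) (by positivity)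
      _ = (G * (δ ^ (2 * κ))⁻¹ * δ ^ (1 / 2 : ℝ) * C₁) * ‖w‖ ^ (-(1 / 2) : ℝ) := by
          rw [Real.div_rpow hs.le hδ.le, Real.rpow_neg hδ.le, div_inv_eq_mul]
          ring
      _ ≤ (G * (δ ^ (2 * κ))⁻¹ * δ ^ (1 / 2 : ℝ) * C₁) *
          (c ^ (-(1 / 2) : ℝ) * ‖z - -1‖ ^ (-(1 / 2) : ℝ)) := by
          gcongr
          rw [← Real.mul_rpow hc.le hz1'.le]
          exact Real.rpow_le_rpow_of_nonpos (by positivity) hlow (by norm_num)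
      _ = (G * ((δ ^ (2 * κ))⁻¹ * δ ^ (1 / 2 : ℝ)) * (C₁ * c ^ (-(1 / 2) : ℝ))) *
          ‖z - -1‖ ^ (-(1 / 2) : ℝ) := by ring
      _ ≤ _ := by
          gcongr
          have : 0 ≤ ‖z - -1‖ ^ (-(1 / 2) : ℝ) := by positivity
          linarith
  refine (norm_contourInt_le_circleMean hR.le (by simp) (by simp) key).trans ?_
  calc _ ≤ 2 * c * ((G * ((δ ^ (2 * κ))⁻¹ * δ ^ (1 / 2 : ℝ)) * (C₁ * c ^ (-(1 / 2) : ℝ))) *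
        (circleMean (-1) + circleMean (-1))) := by
        gcongr
    _ = G * ((2 * c * (C₁ * c ^ (-(1 / 2) : ℝ) * (2 * circleMean (-1)))) *
        ((δ ^ (2 * κ))⁻¹ * δ ^ (1 / 2 : ℝ))) := by ring
    _ ≤ _ := by
        gcongr
        linarith

/-- The stationary phase gain for the singular term, on the circle `|w - δ| = √2 δ`. -/
theorem exists_small_circle_bound (κ : ℕ) :
    ∃ C : ℝ, 0 < C ∧ ∀ δ : ℝ, 0 < δ →
      ‖contourInt δ (Real.sqrt 2 * δ) fun w => Complex.exp (-(w / (δ ^ 2 : ℝ))) *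
        (Complex.exp (-1 / w))⁻¹ * (w ^ (2 * κ + 1))⁻¹‖ ≤
        C * ((δ ^ (2 * κ))⁻¹ * δ ^ (1 / 8 : ℝ)) := by
  obtain ⟨p₁, p₂, hp₁, hp₂, hp⟩ := exists_unit_points
  have h2 : Real.sqrt 2 ^ 2 = 2 := Real.sq_sqrt (by norm_num)
  have h20 : 0 < Real.sqrt 2 := by positivity
  have h21 : Real.sqrt 2 < 3 / 2 := by nlinarith
  have h22 : 4 / 3 < Real.sqrt 2 := by
    by_contra! h
    nlinarith
  have hm : ∀ p, 0 ≤ circleMean p := fun p =>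
    mul_nonneg (by positivity) (intervalIntegral.integral_nonneg (by positivity)
      fun φ _ => by positivity)
  have hm₁ := hm p₁
  have hm₂ := hm p₂
  refine ⟨Real.sqrt 2 * (3 ^ (2 * κ + 1) * 6 ^ (1 / 8 : ℝ) * (circleMean p₁ + circleMean p₂)) + 1,
    by positivity, fun δ hδ => ?_⟩
  have key : ∀ z : ℂ, ‖z‖ = 1 → z ≠ p₁ → z ≠ p₂ →
      ‖Complex.exp (-(((δ : ℂ) + ((Real.sqrt 2 * δ : ℝ) : ℂ) * z) / (δ ^ 2 : ℝ))) *
        (Complex.exp (-1 / (δ + ((Real.sqrt 2 * δ : ℝ) : ℂ) * z)))⁻¹ *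
        ((δ + ((Real.sqrt 2 * δ : ℝ) : ℂ) * z) ^ (2 * κ + 1))⁻¹‖ ≤
      ((3 / δ) ^ (2 * κ + 1) * (6 * δ) ^ (1 / 8 : ℝ)) *
        (‖z - p₁‖ ^ (-(1 / 2) : ℝ) + ‖z - p₂‖ ^ (-(1 / 2) : ℝ)) := by
    intro z hz hz₁ hz₂
    set w : ℂ := δ + ((Real.sqrt 2 * δ : ℝ) : ℂ) * z with hw
    have hz3 : ‖z‖ ^ 2 = 1 := by rw [hz, one_pow]
    rw [← Complex.normSq_eq_norm_sq, Complex.normSq_apply] at hz3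
    have hx := abs_le.1 ((Complex.abs_re_le_norm z).trans_eq hz)
    have hwc : ‖w - δ‖ ^ 2 = δ ^ 2 + δ ^ 2 := by
      rw [hw, add_sub_cancel_left, norm_mul, hz, Complex.norm_real,
        Real.norm_of_nonneg (by positivity), mul_one, mul_pow, h2]
      ring
    have hwsq : ‖w‖ ^ 2 = δ ^ 2 * (3 + 2 * (Real.sqrt 2 * z.re)) := by
      rw [← Complex.normSq_eq_norm_sq, Complex.normSq_apply]
      simp [hw]
      linear_combination δ ^ 2 * Real.sqrt 2 ^ 2 * hz3 + δ ^ 2 * h2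
    have hlow : δ / 3 ≤ ‖w‖ := by
      rw [← sq_le_sq₀ (by positivity) (norm_nonneg _), hwsq]
      have : -(3 / 2) ≤ Real.sqrt 2 * z.re := by nlinarith
      -- The circle of radius √2 δ about δ keeps the distance (√2 - 1)δ from the origin, and √2 >
      -- 4/3.
      have h5 : Real.sqrt 2 * δ - δ ≤ ‖w‖ := by
        have := norm_sub_norm_le (((Real.sqrt 2 * δ : ℝ) : ℂ) * z) (-(δ : ℂ))
        rw [norm_mul, hz, norm_neg, Complex.norm_real, Complex.norm_real,
          Real.norm_of_nonneg (by positivity), Real.norm_of_nonneg hδ.le, mul_one,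
          sub_neg_eq_add, add_comm (_ * z)] at this
        exact this
      rw [← hwsq]
      gcongr
      nlinarith
    have hup : ‖w‖ ^ 2 ≤ 6 * δ ^ 2 := by
      rw [hwsq]
      nlinarith [sq_nonneg δ, mul_nonneg h20.le (by linarith : 0 ≤ 1 - z.re)]
    have hs : 0 < ‖w‖ := lt_of_lt_of_le (by positivity) hlow
    set A := ‖z - p₁‖ with hA
    set B := ‖z - p₂‖ with hB
    have hA0 : 0 < A := norm_pos_iff.2 (sub_ne_zero.2 hz₁)
    have hB0 : 0 < B := norm_pos_iff.2 (sub_ne_zero.2 hz₂)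
    have hAB : (A * B) ^ 2 = 2 * (1 + Real.sqrt 2 * z.re) ^ 2 := by
      rw [hA, hB, hp z hz, mul_pow, sq_abs, h2]
    -- The exponent vanishes where |w| = δ, that is at p₁ and p₂. Since (|w|² - δ²)² = 2δ⁴(AB)² and
    -- |w|² ≤ 6δ², it is at most -(AB)²/(6δ). The power -1/8 leaves δ^(1/8) (AB)^(-1/4), and the
    -- mixed product is split by 2ab ≤ a² + b².
    have hexp : Real.exp (-((‖w‖ ^ 2 - δ ^ 2) ^ 2 / (2 * δ * δ ^ 2 * ‖w‖ ^ 2))) ≤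
        (6 * δ) ^ (1 / 8 : ℝ) * (A ^ (-(1 / 2) : ℝ) + B ^ (-(1 / 2) : ℝ)) := by
      have h6 : (A * B) ^ 2 / (6 * δ) ≤ (‖w‖ ^ 2 - δ ^ 2) ^ 2 / (2 * δ * δ ^ 2 * ‖w‖ ^ 2) := by
        have e2 : (‖w‖ ^ 2 - δ ^ 2) ^ 2 = 2 * δ ^ 4 * (A * B) ^ 2 := by
          rw [hAB, hwsq]
          ring
        rw [e2, div_le_div_iff₀ (by positivity) (by positivity)]
        have : 0 ≤ 2 * δ ^ 3 * (A * B) ^ 2 := by positivity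
        nlinarith
      have hpos : 0 < (A * B) ^ 2 / (6 * δ) := by positivity
      calc _ ≤ Real.exp (-((A * B) ^ 2 / (6 * δ))) := Real.exp_le_exp.2 (neg_le_neg h6)
        _ ≤ ((A * B) ^ 2 / (6 * δ)) ^ (-(1 / 8) : ℝ) := exp_neg_le_rpow hpos
        _ = (6 * δ) ^ (1 / 8 : ℝ) * (A ^ (-(1 / 4) : ℝ) * B ^ (-(1 / 4) : ℝ)) := by
            rw [Real.div_rpow (by positivity) (by positivity), Real.rpow_neg (by positivity : 0 ≤ 6 * δ),
              div_inv_eq_mul, ← Real.rpow_natCast (A * B), ← Real.rpow_mul (by positivity),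
              Real.mul_rpow hA0.le hB0.le, mul_comm]
            norm_num
        _ ≤ _ := by
            gcongr
            have e3 : ∀ a : ℝ, 0 < a → a ^ (-(1 / 2) : ℝ) = (a ^ (-(1 / 4) : ℝ)) ^ 2 := by
              intro a ha
              rw [← Real.rpow_natCast, ← Real.rpow_mul ha.le]
              norm_num
            rw [e3 A hA0, e3 B hB0]
            nlinarith [sq_nonneg (A ^ (-(1 / 4) : ℝ) - B ^ (-(1 / 4) : ℝ)),
              sq_nonneg (A ^ (-(1 / 4) : ℝ)), sq_nonneg (B ^ (-(1 / 4) : ℝ))]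
    rw [norm_mul, norm_exp_circle hδ hδ (norm_pos_iff.1 hs) hwc, norm_inv, norm_pow]
    have hinv : (‖w‖ ^ (2 * κ + 1))⁻¹ ≤ (3 / δ) ^ (2 * κ + 1) := by
      rw [← inv_pow]
      gcongr
      rw [← inv_div]
      exact inv_anti₀ (by positivity) hlow
    calc _ ≤ ((6 * δ) ^ (1 / 8 : ℝ) * (A ^ (-(1 / 2) : ℝ) + B ^ (-(1 / 2) : ℝ))) *
          (3 / δ) ^ (2 * κ + 1) := by gcongr
      _ = _ := by ring
  refine (norm_contourInt_le_circleMean (by positivity) hp₁ hp₂ key).trans ?_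
  calc _ = (Real.sqrt 2 * (3 ^ (2 * κ + 1) * 6 ^ (1 / 8 : ℝ) * (circleMean p₁ + circleMean p₂))) *
        ((δ ^ (2 * κ))⁻¹ * δ ^ (1 / 8 : ℝ)) := by
        rw [Real.mul_rpow (by norm_num) hδ.le, div_pow, pow_succ δ]
        field_simp
    _ ≤ _ := by
        gcongr
        linarith

/-- The difference of the Cauchy kernels at v and 0 is v / (u (u - v)); the factor |v| lowers the
order of the singularity at the origin by one. -/
theorem norm_cauchyTransform_sub_zero_le {b C : ℝ} (hb : 0 < b) {P : ℂ → ℂ}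
    (hPc : ContinuousOn P (Metric.sphere 0 b))
    (hP : ∀ u ∈ Metric.sphere (0 : ℂ) b, ‖P u‖ ≤ C) {X : ℝ} (hX : X < b) {v : ℂ} (hv : ‖v‖ ≤ X) :
    ‖cauchyTransform b P v - cauchyTransform b P 0‖ ≤ C / (b - X) * ‖v‖ := by
  have hvu : ∀ u ∈ Metric.sphere (0 : ℂ) b, b - X ≤ ‖u - v‖ := by
    intro u hu
    have h1 := norm_sub_norm_le u v
    rw [mem_sphere_zero_iff_norm.1 hu] at h1
    linarith
  have hu0 : ∀ u ∈ Metric.sphere (0 : ℂ) b, u ≠ 0 := fun u hu => sphere_zero_subset_compl hb hu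
  have huv : ∀ u ∈ Metric.sphere (0 : ℂ) b, u - v ≠ 0 := fun u hu =>
    norm_pos_iff.1 ((sub_pos.2 hX).trans_le (hvu u hu))
  rw [cauchyTransform, cauchyTransform, ← contourInt_sub]
  · refine (norm_contourInt_le (C := C / (b - X) * ‖v‖ / b) hb.le fun u hu => ?_).trans_eq
      (mul_div_cancel₀ _ hb.ne')
    have h0 := hu0 u hu
    have h1 := huv u hu
    have e1 : P u / (u - v) - P u / (u - 0) = P u / (u - v) * v / u := by
      rw [sub_zero]
      field_simp
      ring
    rw [e1, norm_div, norm_mul, norm_div, mem_sphere_zero_iff_norm.1 hu]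
    have h2 := hP u hu
    have h3 := (norm_nonneg _).trans h2
    have := sub_pos.2 hX
    gcongr
    exact hvu u hu
  · exact (hPc.div (by fun_prop) huv).circleIntegrable hb.le
  · exact (hPc.div (by fun_prop) fun u hu => by simpa using hu0 u hu).circleIntegrable hb.le

/-- The weight with its singularity at the origin made explicit. -/
theorem exists_inv_limitWeight_factor {κ ν m : ℕ} {θ : Fin m → ℝ} {Θ : ℝ}
    (hθ : ∀ k, -θ k ∈ Icc 0 Θ) (hn : ν + Nat.card {k : Fin m // θ k = 0} ≤ 2 * κ + 1 + m) :
    ∃ (q : ℂ → ℂ) (lo : ℝ), 0 < lo ∧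
      DifferentiableOn ℂ q {z : ℂ | ¬(z.im = 0 ∧ z.re ∈ Icc lo Θ)} ∧
      ∀ w : ℂ, w ≠ 0 → (limitWeight ν θ w)⁻¹ =
        (Complex.exp (-1 / w))⁻¹ * (w ^ (2 * κ + 1))⁻¹ * q w := by
  classical
  have hcard : Nat.card {k : Fin m // θ k = 0} = (Finset.univ.filter fun k => θ k = 0).card := by
    rw [Nat.card_eq_fintype_card, Fintype.card_subtype]
  rw [hcard] at hn
  -- The hypothesis says that the pole order at 0 is at most 2κ + 1; the excess j is the order of
  -- vanishing given to q.
  obtain ⟨j, hj⟩ := Nat.exists_eq_add_of_le hn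
  obtain ⟨lo, hlo0, hlo⟩ : ∃ lo : ℝ, 0 < lo ∧ ∀ k, θ k ≠ 0 → lo ≤ -θ k := by
    have h : ∀ᶠ lo in 𝓝[>] (0 : ℝ), ∀ k, θ k ≠ 0 → lo ≤ -θ k := by
      refine eventually_all.2 fun k => ?_
      rcases eq_or_ne (θ k) 0 with h0 | h0
      · exact Eventually.of_forall fun _ h => absurd h0 h
      · have : 0 < -θ k := lt_of_le_of_ne (hθ k).1 (neg_ne_zero.2 h0).symm
        filter_upwards [nhdsWithin_le_nhds (gt_mem_nhds this)] with lo h _ using le_of_lt h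
    obtain ⟨lo, h1, h2⟩ := (h.and self_mem_nhdsWithin).exists
    exact ⟨lo, h2, h1⟩
  refine ⟨fun w => w ^ j * (∏ k ∈ Finset.univ.filter fun k => θ k ≠ 0, (w + (θ k : ℂ)))⁻¹, lo, hlo0,
    ?_, ?_⟩
  · refine DifferentiableOn.mul (by fun_prop) (DifferentiableOn.inv (by fun_prop) fun v hv h0 => ?_)
    obtain ⟨k, hk, hk0⟩ := Finset.prod_eq_zero_iff.1 h0
    refine hv (ofReal_mem_segment_of_sub_eq_zero
      ⟨hlo k (Finset.mem_filter.1 hk).2, (hθ k).2⟩ ?_)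
    push_cast
    rwa [sub_neg_eq_add]
  · intro w hw
    have e1 : ∏ k, (w + (θ k : ℂ)) = w ^ (Finset.univ.filter fun k => θ k = 0).card *
        ∏ k ∈ Finset.univ.filter fun k => θ k ≠ 0, (w + (θ k : ℂ)) := by
      rw [← Finset.prod_filter_mul_prod_filter_not Finset.univ (fun k => θ k = 0)]
      congr 1
      rw [← Finset.prod_const]
      refine Finset.prod_congr rfl fun k hk => ?_
      rw [(Finset.mem_filter.1 hk).2, Complex.ofReal_zero, add_zero]
    set n₀ := (Finset.univ.filter fun k => θ k = 0).card
    have e2 : w ^ (2 * κ + 1) * w ^ m = w ^ ν * w ^ n₀ * w ^ j := by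
      rw [← pow_add, ← pow_add, ← pow_add, hj]
    have e3 : (w ^ ν / w ^ m * w ^ n₀)⁻¹ = (w ^ (2 * κ + 1))⁻¹ * w ^ j := by
      rw [inv_eq_iff_eq_inv, mul_inv, inv_inv, ← div_eq_mul_inv, div_mul_eq_mul_div,
        div_eq_div_iff (pow_ne_zero _ hw) (pow_ne_zero _ hw), ← e2, mul_comm]
    rw [limitWeight, e1, mul_inv, mul_inv, mul_inv]
    rw [mul_inv] at e3
    linear_combination (Complex.exp (-1 / w))⁻¹ *
      (∏ k ∈ Finset.univ.filter fun k => θ k ≠ 0, (w + (θ k : ℂ)))⁻¹ * e3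

theorem exists_bound_near_circle {q : ℂ → ℂ} {lo Θ c δ₀ : ℝ} (hlo : 0 < lo)
    (hΘ : Θ < 2 * c)
    (hq : DifferentiableOn ℂ q {z : ℂ | ¬(z.im = 0 ∧ z.re ∈ Icc lo Θ)}) :
    ∃ Q : ℝ, 0 ≤ Q ∧ ∀ w : ℂ, c ≤ ‖w - c‖ → ‖w - c‖ ≤ c + δ₀ →
      ‖q w‖ ≤ Q ∧ ‖q w - q 0‖ ≤ Q * ‖w‖ := by
  set U : Set ℂ := {z : ℂ | ¬(z.im = 0 ∧ z.re ∈ Icc lo Θ)} with hU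
  have hUo : IsOpen U := isOpen_compl_segment lo Θ
  have h0 : (0 : ℂ) ∈ U := by
    rintro ⟨-, h, -⟩
    simp at h
    linarith
  set S : Set ℂ := {w | c ≤ ‖w - c‖ ∧ ‖w - c‖ ≤ c + δ₀} with hS
  have hSc : IsCompact S := by
    have : S = Metric.closedBall (c : ℂ) (c + δ₀) ∩ {ω : ℂ | c ≤ ‖ω - c‖} := by
      ext ω
      simp [hS, dist_eq_norm, and_comm]
    rw [this]
    exact (isCompact_closedBall _ _).inter_right (isClosed_le continuous_const (by fun_prop))
  have hSU : S ⊆ U := by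
    rintro w ⟨hw, -⟩ ⟨him, h1, h2⟩
    have h5 : (w - c) = ((w.re - c : ℝ) : ℂ) := by
      apply Complex.ext
      · rw [Complex.sub_re, Complex.ofReal_re, Complex.ofReal_re]
      · rw [Complex.sub_im, him, Complex.ofReal_im, Complex.ofReal_im, sub_zero]
    rw [h5, Complex.norm_real, Real.norm_eq_abs] at hw
    rcases le_abs.1 hw with h | h <;> linarith
  obtain ⟨Q₁, hQ₁⟩ := hSc.exists_bound_of_continuousOn (hq.continuousOn.mono hSU)
  have hds : DifferentiableOn ℂ (dslope q 0) U :=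
    (Complex.differentiableOn_dslope (hUo.mem_nhds h0)).2 hq
  obtain ⟨Q₂, hQ₂⟩ := hSc.exists_bound_of_continuousOn (hds.continuousOn.mono hSU)
  refine ⟨max 0 (max Q₁ Q₂), le_max_left _ _, fun w hw1 hw2 => ⟨?_, ?_⟩⟩
  · exact (hQ₁ w ⟨hw1, hw2⟩).trans ((le_max_left _ _).trans (le_max_right _ _))
  · have h6 : q w - q 0 = w * dslope q 0 w := by
      have := sub_smul_dslope q 0 w
      rw [sub_zero, smul_eq_mul] at this
      exact this.symm
    rw [h6, norm_mul, mul_comm]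
    gcongr
    exact (hQ₂ w ⟨hw1, hw2⟩).trans ((le_max_right _ _).trans (le_max_right _ _))

theorem differentiableOn_singular_term (κ : ℕ) (δ : ℝ) :
    DifferentiableOn ℂ (fun w : ℂ => Complex.exp (-(w / (δ ^ 2 : ℝ))) *
      (Complex.exp (-1 / w))⁻¹ * (w ^ (2 * κ + 1))⁻¹) {0}ᶜ := by
  refine DifferentiableOn.mul (DifferentiableOn.mul (by fun_prop) (DifferentiableOn.inv
    (DifferentiableOn.cexp (DifferentiableOn.div (by fun_prop) (by fun_prop) fun u hu => hu))
    fun u _ => Complex.exp_ne_zero _)) (DifferentiableOn.inv (by fun_prop)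
      fun u hu => pow_ne_zero _ hu)

theorem contourInt_congr_around_zero {f : ℂ → ℂ} (hf : DifferentiableOn ℂ f {0}ᶜ) {c c' R R' : ℝ}
    (hc : 0 ≤ c) (hR : c < R) (hc' : 0 ≤ c') (hR' : c' < R') :
    contourInt c R f = contourInt c' R' f := by
  have hd : ∀ B, DifferentiableOn ℂ f (cutDisc 0 B) := fun B =>
    hf.mono fun v hv => cutDisc_ne_zero le_rfl hv
  have h1 : contourInt 0 1 f = contourInt c R f := contourInt_cutDisc_deform (Θ := 0)
    (B := c + R + 2) (hd _) one_pos one_pos (by linarith) hc hR (by linarith) (by linarith)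
  have h2 : contourInt 0 1 f = contourInt c' R' f := contourInt_cutDisc_deform (Θ := 0)
    (B := c' + R' + 2) (hd _) one_pos one_pos (by linarith) hc' hR' (by linarith) (by linarith)
  rw [← h1, h2]

/-- The decay of the kernel that makes the transform absolutely convergent. -/
theorem exists_kernelIII_bound {κ ν m : ℕ} {θ : Fin m → ℝ} {a b Θ : ℝ} (hΘ0 : 0 < Θ)
    (hθ : ∀ k, -θ k ∈ Icc 0 Θ) (hΘa : Θ < a) (hab : a < b)
    (hn : ν + Nat.card {k : Fin m // θ k = 0} ≤ 2 * κ + 1 + m) {ρ : ℝ} (hρ : 0 < ρ) (x : ℝ) :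
    ∃ C δ₀ : ℝ, 0 ≤ C ∧ 0 < δ₀ ∧ ∀ s : ℂ, ‖s‖ = ρ →
      (∀ δ : ℝ, 0 < δ → δ ≤ δ₀ → ‖kernelIII ν θ a b ((x : ℂ) / s) ((δ ^ 2 : ℝ) : ℂ)⁻¹‖ ≤
        C * ((δ ^ (2 * κ))⁻¹ * δ ^ (1 / 8 : ℝ))) ∧
      (∀ δ : ℝ, δ₀ ≤ δ → ‖kernelIII ν θ a b ((x : ℂ) / s) ((δ ^ 2 : ℝ) : ℂ)⁻¹‖ ≤ C) := by
  have ha : 0 < a := hΘ0.trans hΘa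
  have hb : 0 < b := ha.trans hab
  obtain ⟨q, lo, hlo0, hq, hfac⟩ := exists_inv_limitWeight_factor (κ := κ) (ν := ν) hθ hn
  -- Then 2c lies between Θ and a, so circles about c through points near 0 enclose [0, Θ].
  set c : ℝ := (Θ + a) / 4 with hc
  have hc0 : 0 < c := by positivity
  set X₁ : ℝ := (a + b) / 2 with hX₁
  -- The three entries ensure δ^(1/2) ≤ δ^(1/8), R ≤ 2c, and that the circle stays in |w| ≤ (a +
  -- b)/2.
  set δ₀ : ℝ := min (min 1 c) ((b - a) / 2) with hδ₀
  have hδ₀0 : 0 < δ₀ := lt_min (lt_min one_pos hc0) (by linarith)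
  have hδ₀1 : δ₀ ≤ 1 := (min_le_left _ _).trans (min_le_left _ _)
  have hδ₀c : δ₀ ≤ c := (min_le_left _ _).trans (min_le_right _ _)
  have hδ₀b : δ₀ ≤ (b - a) / 2 := min_le_right _ _
  obtain ⟨Q, hQ0, hQ⟩ := exists_bound_near_circle (δ₀ := δ₀) hlo0 (by linarith : Θ < 2 * c) hq
  obtain ⟨C₁, hC₁0, hC₁⟩ := exists_circle_integral_bound κ hc0
  obtain ⟨C₂, hC₂0, hC₂⟩ := exists_small_circle_bound κ
  have hΦc : ContinuousOn (limitWeight ν θ) (Metric.sphere 0 b) :=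
    (differentiableOn_limitWeight ν θ).continuousOn.mono (sphere_zero_subset_compl hb)
  obtain ⟨CΦ, hCΦ⟩ := (isCompact_sphere (0 : ℂ) b).exists_bound_of_continuousOn hΦc
  have hinvc : ContinuousOn (fun w => (limitWeight ν θ w)⁻¹) (Metric.sphere ((0 : ℝ) : ℂ) a) :=
    continuousOn_inv_limitWeight_sphere hΘ0 hθ le_rfl ha (by linarith)
  obtain ⟨CI, hCI⟩ := (isCompact_sphere ((0 : ℝ) : ℂ) a).exists_bound_of_continuousOn hinvc
  set CP : ℝ := Real.exp (|x| / ρ * b) * CΦ with hCP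
  set CB : ℝ := max (b * (CP / (b - X₁))) (CP / (b - X₁)) with hCB
  set B : ℂ → ℂ → ℂ := fun s w =>
    cauchyTransform b (fun u => Complex.exp ((x : ℂ) / s * u) * limitWeight ν θ u) w with hB
  have hPb : ∀ s : ℂ, ‖s‖ = ρ → ∀ u ∈ Metric.sphere (0 : ℂ) b,
      ‖Complex.exp ((x : ℂ) / s * u) * limitWeight ν θ u‖ ≤ CP := by
    intro s hs u hu
    rw [norm_mul, hCP]
    refine mul_le_mul ?_ (hCΦ u hu) (norm_nonneg _) (Real.exp_pos _).le
    refine (Complex.norm_exp_le_exp_norm _).trans (Real.exp_le_exp.2 ?_)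
    rw [norm_mul, norm_div, hs, mem_sphere_zero_iff_norm.1 hu, Complex.norm_real, Real.norm_eq_abs]
  have hX₁b : X₁ < b := by linarith
  have hPc : ∀ s : ℂ, ContinuousOn (fun u => Complex.exp ((x : ℂ) / s * u) * limitWeight ν θ u)
      (Metric.sphere 0 b) := fun s => ContinuousOn.mul (by fun_prop) hΦc
  have hB1 : ∀ s : ℂ, ‖s‖ = ρ → ∀ w : ℂ, ‖w‖ ≤ X₁ → ‖B s w‖ ≤ CB := fun s hs w hw =>
    (norm_cauchyTransform_le hb (hPb s hs) hX₁b hw).trans (le_max_left _ _)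
  have hB2 : ∀ s : ℂ, ‖s‖ = ρ → ∀ w : ℂ, ‖w‖ ≤ X₁ → ‖B s w - B s 0‖ ≤ CB * ‖w‖ :=
    fun s hs w hw => (norm_cauchyTransform_sub_zero_le hb (hPc s) (hPb s hs) hX₁b hw).trans
      (mul_le_mul_of_nonneg_right (le_max_right _ _) (norm_nonneg _))
  have hCB0 : 0 ≤ CB := (norm_nonneg _).trans
    (hB1 (ρ : ℂ) (by rw [Complex.norm_real, Real.norm_of_nonneg hρ.le]) 0 (by simp; linarith))
  refine ⟨max (2 * CB * Q * C₁ + CB * Q * C₂) (a * (Real.exp (a / δ₀ ^ 2) * (CB * CI))), δ₀,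
    le_trans (by positivity) (le_max_left _ _), hδ₀0, fun s hs => ⟨fun δ hδ hδδ₀ => ?_,
    fun δ hδ => ?_⟩⟩
  · set R : ℝ := Real.sqrt (c ^ 2 + δ ^ 2) with hR
    have hRsq : R ^ 2 = c ^ 2 + δ ^ 2 := Real.sq_sqrt (by positivity)
    have hR0 : 0 ≤ R := Real.sqrt_nonneg _
    have hcR : c < R := by
      rw [← sq_lt_sq₀ hc0.le hR0, hRsq]
      nlinarith
    have hRc : R ≤ c + δ := by
      rw [← sq_le_sq₀ hR0 (by positivity), hRsq]
      nlinarith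
    have hw1 : ∀ w ∈ Metric.sphere (c : ℂ) R, ‖w‖ ≤ X₁ := by
      intro w hw
      have h4 := norm_sub_norm_le w c
      rw [mem_sphere_iff_norm.1 hw, Complex.norm_real, Real.norm_of_nonneg hc0.le] at h4
      linarith
    have hws : ∀ w ∈ Metric.sphere (c : ℂ) R, w ≠ 0 := fun w hw =>
      cutDisc_ne_zero (Θ := 0) (B := c + R + 1) le_rfl
        (sphere_subset_cutDisc hc0.le hcR (by linarith) (by linarith) hw)
    have hwQ : ∀ w ∈ Metric.sphere (c : ℂ) R, ‖q w‖ ≤ Q ∧ ‖q w - q 0‖ ≤ Q * ‖w‖ := by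
      intro w hw
      have := mem_sphere_iff_norm.1 hw
      exact hQ w (by linarith) (by linarith)
    have hq0 : ‖q 0‖ ≤ Q := (hQ 0 (by simp [abs_of_pos hc0])
      (by simp [abs_of_pos hc0]; linarith)).1
    set T : ℂ → ℂ := fun w => Complex.exp (-(w / (δ ^ 2 : ℝ))) *
      (Complex.exp (-1 / w))⁻¹ * (w ^ (2 * κ + 1))⁻¹ with hT
    have hTd : DifferentiableOn ℂ T {0}ᶜ := differentiableOn_singular_term κ δ
    have hTc : ContinuousOn T (Metric.sphere (c : ℂ) R) :=
      hTd.continuousOn.mono fun w hw => hws w hw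
    have hqc : ContinuousOn q (Metric.sphere (c : ℂ) R) := by
      refine hq.continuousOn.mono fun w hw => ?_
      have h3 := (sphere_subset_cutDisc (Θ := Θ) (B := c + R + 1) hc0.le hcR (by linarith)
        (by linarith) hw).2
      exact fun h => h3 ⟨h.1, hlo0.le.trans h.2.1, h.2.2⟩
    have hBc : ContinuousOn (B s) (Metric.sphere (c : ℂ) R) :=
      (differentiableOn_cauchyTransform hb (hPc s)).continuousOn.mono fun w hw =>
        mem_ball_zero_iff.2 ((hw1 w hw).trans_lt hX₁b)
    -- The value at the origin is subtracted. The difference is O(|w|) and is estimated on the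
    -- circle about c. The constant multiplies a term singular only at 0, whose circle may be shrunk
    -- to |w - δ| = √2 δ for the stationary phase gain.
    have e1 : kernelIII ν θ a b ((x : ℂ) / s) ((δ ^ 2 : ℝ) : ℂ)⁻¹ =
        contourInt c R (fun w => T w * (B s w * q w - B s 0 * q 0)) +
          contourInt δ (Real.sqrt 2 * δ) T * (B s 0 * q 0) := by
      have h21 : 1 < Real.sqrt 2 := by
        rw [Real.lt_sqrt (by norm_num)]
        norm_num
      rw [contourInt_congr_around_zero (c := δ) (R := Real.sqrt 2 * δ) (c' := c) (R' := R) hTd hδ.le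
        (by nlinarith) hc0.le hcR, ← contourInt_mul_const, ← contourInt_add,
        kernelIII_eq_circle hΘ0 hθ hΘa hab hc0.le hcR (by linarith) (by linarith)]
      · refine contourInt_congr hR0 fun w hw => ?_
        rw [hfac w (hws w hw), div_eq_mul_inv] at *
        simp only [hT, hB, div_eq_mul_inv]
        rw [mul_comm _ w]
        ring
      · exact (hTc.mul ((hBc.mul hqc).sub continuousOn_const)).circleIntegrable hR0
      · exact (hTc.mul continuousOn_const).circleIntegrable hR0
    have hg : ∀ w ∈ Metric.sphere (c : ℂ) R,
        ‖B s w * q w - B s 0 * q 0‖ ≤ 2 * CB * Q * ‖w‖ := by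
      intro w hw
      have h5 : B s w * q w - B s 0 * q 0 = (B s w - B s 0) * q w + B s 0 * (q w - q 0) := by ring
      rw [h5]
      refine (norm_add_le _ _).trans ?_
      rw [norm_mul, norm_mul]
      have h6 := hB2 s hs w (hw1 w hw)
      have h7 := hB1 s hs 0 (by simp; linarith)
      have h8 := hwQ w hw
      calc _ ≤ CB * ‖w‖ * Q + CB * (Q * ‖w‖) := by
            gcongr
            · exact h8.1
            · exact h8.2
        _ = _ := by ring
    have hA1 := hC₁ δ R (2 * CB * Q) hδ hcR (by linarith) hRsq (by positivity) _ hg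
    have hA2 := hC₂ δ hδ
    rw [e1]
    refine (norm_add_le _ _).trans ?_
    rw [norm_mul, norm_mul]
    have h7 := hB1 s hs 0 (by simp; linarith)
    have h9 : δ ^ (1 / 2 : ℝ) ≤ δ ^ (1 / 8 : ℝ) :=
      Real.rpow_le_rpow_of_exponent_ge hδ (hδδ₀.trans hδ₀1) (by norm_num)
    calc _ ≤ 2 * CB * Q * (C₁ * ((δ ^ (2 * κ))⁻¹ * δ ^ (1 / 8 : ℝ))) +
          (C₂ * ((δ ^ (2 * κ))⁻¹ * δ ^ (1 / 8 : ℝ))) * (CB * Q) := by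
          refine add_le_add (hA1.trans ?_) ?_
          · gcongr
          · exact mul_le_mul hA2 (mul_le_mul h7 hq0 (norm_nonneg _) hCB0) (by positivity)
              (by positivity)
      _ = (2 * CB * Q * C₁ + CB * Q * C₂) * ((δ ^ (2 * κ))⁻¹ * δ ^ (1 / 8 : ℝ)) := by ring
      _ ≤ _ := by
          gcongr
          exact le_max_left _ _
  -- For δ bounded below, Y = δ^(-2) is bounded and a crude estimate on |w| = a suffices.
  · have hδ0 : 0 < δ := hδ₀0.trans_le hδ
    rw [kernelIII_eq ha (fun k => by
      rw [← abs_neg, abs_of_nonneg (hθ k).1]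
      exact (hθ k).2.trans_lt hΘa) hab]
    refine (norm_contourInt_le ha.le fun w hw => ?_).trans (le_max_right _ _)
    have hwa : ‖w‖ = a := mem_sphere_zero_iff_norm.1 hw
    rw [norm_mul, norm_mul]
    refine mul_le_mul ?_ (mul_le_mul (hB1 s hs w (by linarith)) (hCI w (by simpa using hwa))
      (norm_nonneg _) hCB0) (by positivity) (Real.exp_pos _).le
    refine (Complex.norm_exp_le_exp_norm _).trans (Real.exp_le_exp.2 ?_)
    rw [norm_neg, norm_mul, norm_inv, hwa, Complex.norm_real, Real.norm_of_nonneg (by positivity),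
      inv_mul_eq_div]
    gcongr

theorem integrandI_eq_mul {κ ν m : ℕ} {θ : Fin m → ℝ} {a b x y : ℝ} (ε : ℝ) (s : ℂ) (t : ℝ) :
    integrandI κ ν θ a b ε x y s t =
      integrandI κ ν θ a b 0 x y s t * Complex.exp (-(ε : ℂ) / (t : ℂ)) := by
  simp only [integrandI, Complex.ofReal_zero, neg_zero, zero_div, Complex.exp_zero]
  ring

theorem norm_exp_neg_div_le_one {ε t : ℝ} (hε : 0 ≤ ε) (ht : 0 < t) :
    ‖Complex.exp (-(ε : ℂ) / (t : ℂ))‖ ≤ 1 := by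
  rw [Complex.norm_exp, Complex.div_ofReal_re, Complex.neg_re, Complex.ofReal_re]
  refine Real.exp_le_one_iff.2 ?_
  rw [neg_div]
  have : 0 ≤ ε / t := by positivity
  linarith

/-- With δ² = t/y the kernel is evaluated at Y = δ^(-2), and t^(κ-1) δ^(-2κ+1/8) is a multiple of
t^(1/16-1), integrable at 0. -/
theorem exists_integrandI_dominated {κ ν m : ℕ} {θ : Fin m → ℝ} {a b Θ : ℝ} (hΘ0 : 0 < Θ)
    (hθ : ∀ k, -θ k ∈ Icc 0 Θ) (hΘa : Θ < a) (hab : a < b)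
    (hn : ν + Nat.card {k : Fin m // θ k = 0} ≤ 2 * κ + 1 + m) {ρ : ℝ} (hρ : 0 < ρ) (x : ℝ)
    {y : ℝ} (hy : 0 < y) :
    ∃ G : ℝ → ℝ, IntegrableOn G (Ioi 0) ∧ ∀ s : ℂ, ‖s‖ = ρ → ∀ t ∈ Ioi (0 : ℝ),
      ‖integrandI κ ν θ a b 0 x y s t‖ ≤ G t := by
  obtain ⟨C, δ₀, hC0, hδ₀, hC⟩ := exists_kernelIII_bound hΘ0 hθ hΘa hab hn hρ x
  have ht₀ : 0 < δ₀ ^ 2 * y := by positivity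
  refine ⟨fun t => C * (y ^ κ * y ^ (-(1 / 16) : ℝ)) * (t ^ ((1 / 16 : ℝ) - 1) * Real.exp (-(1 * t))) +
    C * Real.exp 1 * (t ^ ((κ : ℤ) - 1) * Real.exp (-t) * Real.exp (-(δ₀ ^ 2 * y) / t)), ?_, ?_⟩
  · exact ((integrableOn_rpow_mul_exp_neg_mul (by norm_num) one_pos).const_mul _).add
      ((integrableOn_zpow_mul_exp _ ht₀).const_mul _)
  · intro s hs t ht
    have ht0 : (0 : ℝ) < t := ht
    have htc : (t : ℂ) ≠ 0 := by exact_mod_cast ht0.ne'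
    have hty : 0 < t / y := div_pos ht0 hy
    set δ : ℝ := Real.sqrt (t / y) with hδ
    have hδ0 : 0 < δ := Real.sqrt_pos.2 hty
    have hδsq : δ ^ 2 = t / y := Real.sq_sqrt hty.le
    have e1 : (y : ℂ) / (t : ℂ) = ((δ ^ 2 : ℝ) : ℂ)⁻¹ := by
      rw [hδsq]
      push_cast
      rw [inv_div]
    have e2 : ‖integrandI κ ν θ a b 0 x y s t‖ = t ^ ((κ : ℤ) - 1) * Real.exp (-t) *
        ‖kernelIII ν θ a b ((x : ℂ) / s) ((δ ^ 2 : ℝ) : ℂ)⁻¹‖ := by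
      rw [integrandI, e1, norm_mul, Complex.ofReal_zero, neg_zero, zero_div, Complex.exp_zero, mul_one,
        norm_mul, norm_zpow, Complex.norm_real, Real.norm_of_nonneg ht0.le, Complex.norm_exp,
        Complex.neg_re, Complex.ofReal_re]
    rw [e2]
    rcases le_total δ δ₀ with h | h
    · refine le_trans ?_ (le_add_of_nonneg_right (by positivity))
      have h1 := (hC s hs).1 δ hδ0 h
      have e3 : t ^ ((κ : ℤ) - 1) * ((δ ^ (2 * κ))⁻¹ * δ ^ (1 / 8 : ℝ)) =
          (y ^ κ * y ^ (-(1 / 16) : ℝ)) * t ^ ((1 / 16 : ℝ) - 1) := by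
        have e4 : δ ^ (1 / 8 : ℝ) = t ^ (1 / 16 : ℝ) * y ^ (-(1 / 16) : ℝ) := by
          rw [hδ, Real.sqrt_eq_rpow, ← Real.rpow_mul hty.le, Real.div_rpow ht0.le hy.le,
            Real.rpow_neg hy.le, div_eq_mul_inv]
          norm_num
        rw [pow_mul, hδsq, e4, Real.rpow_sub ht0, Real.rpow_one, zpow_sub_one₀ ht0.ne',
          zpow_natCast, div_pow, inv_div]
        field_simp
      calc _ ≤ t ^ ((κ : ℤ) - 1) * Real.exp (-t) * (C * ((δ ^ (2 * κ))⁻¹ * δ ^ (1 / 8 : ℝ))) := by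
            gcongr
        _ = C * Real.exp (-t) * (t ^ ((κ : ℤ) - 1) * ((δ ^ (2 * κ))⁻¹ * δ ^ (1 / 8 : ℝ))) := by ring
        _ = _ := by
            rw [e3, one_mul]
            ring
    · refine le_trans ?_ (le_add_of_nonneg_left (by positivity))
      have h1 := (hC s hs).2 δ h
      -- For t ≥ δ₀²y this product is at least 1. Inserting it keeps the dominating function
      -- integrable at 0 even when κ = 0, without splitting the half-line.
      have h2 : 1 ≤ Real.exp 1 * Real.exp (-(δ₀ ^ 2 * y) / t) := by
        rw [← Real.exp_add]
        refine Real.one_le_exp ?_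
        have h3 : δ₀ ^ 2 ≤ t / y := by
          rw [← hδsq]
          gcongr
        rw [le_div_iff₀ hy] at h3
        have h4 : δ₀ ^ 2 * y / t ≤ 1 := (div_le_one ht0).2 h3
        rw [neg_div]
        linarith
      calc _ ≤ t ^ ((κ : ℤ) - 1) * Real.exp (-t) * C * 1 := by
            rw [mul_one]
            gcongr
        _ ≤ t ^ ((κ : ℤ) - 1) * Real.exp (-t) * C *
            (Real.exp 1 * Real.exp (-(δ₀ ^ 2 * y) / t)) := by gcongr
        _ = _ := by ring

theorem exists_circle_left_of_zero {Θ b y ε : ℝ} (hΘ0 : 0 < Θ) (hΘb : Θ < b) (hy : 0 < y)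
    (hε : 0 < ε) : ∃ c R : ℝ, 0 ≤ c ∧ c < R ∧ Θ < c + R ∧ c + R < b ∧ (R - c) * y < ε := by
  have hm : 0 < min (ε / y / 2) ((b - Θ) / 2) := lt_min (by positivity) (by linarith)
  have h1 := min_le_left (ε / y / 2) ((b - Θ) / 2)
  have h2 := min_le_right (ε / y / 2) ((b - Θ) / 2)
  refine ⟨Θ / 2, Θ / 2 + min (ε / y / 2) ((b - Θ) / 2), by linarith, by linarith, by linarith,
    by linarith, ?_⟩
  rw [add_sub_cancel_left, ← lt_div_iff₀ hy]
  have : 0 < ε / y := div_pos hε hy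
  linarith

theorem continuousOn_integral_integrandI {κ ν m : ℕ} {θ : Fin m → ℝ} {a b Θ ε ρ x y : ℝ}
    (hρ : 0 < ρ) (hΘ0 : 0 < Θ) (hθ : ∀ k, -θ k ∈ Icc 0 Θ) (hΘa : Θ < a) (hab : a < b) (hy : 0 < y)
    (hε : 0 < ε) :
    ContinuousOn (fun s => ∫ t in Ioi (0 : ℝ), integrandI κ ν θ a b ε x y s t)
      (Metric.sphere 0 ρ) := by
  obtain ⟨c, R, hc, h1, h2, h3, h4⟩ := exists_circle_left_of_zero hΘ0 (hΘa.trans hab) hy hε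
  have e1 : ∀ s, ∫ t in Ioi (0 : ℝ), integrandI κ ν θ a b ε x y s t = _ := fun s =>
    (integral_integrandI (κ := κ) (x := x) hΘ0 hθ hΘa hab hc h1 h2 h3 hy h4 s).2
  simp only [e1]
  refine continuousOn_contourInt (isCompact_sphere _ _) (hc.trans_lt h1) (ContinuousOn.mul ?_
    (ContinuousOn.mul (continuousOn_cauchyTransform_exp_sphere θ hρ hc h1 h3) ?_))
  · refine (differentiableOn_besselH κ).continuousOn.comp (by fun_prop) fun q hq => ?_
    rw [mem_ofPred_eq, Complex.add_re, Complex.re_mul_ofReal, Complex.ofReal_re]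
    nlinarith [neg_re_le_of_mem_sphere hq.2]
  · exact (continuousOn_inv_limitWeight_sphere hΘ0 hθ hc h1 h2).comp continuousOn_snd
      fun q hq => hq.2

/-- Under the condition on the parameters the regularising factor may be dropped. -/
theorem integrandI_zero_spec {κ ν m : ℕ} {θ : Fin m → ℝ} {a b Θ ρ x y : ℝ}
    (hρ : 0 < ρ) (hΘ0 : 0 < Θ) (hθ : ∀ k, -θ k ∈ Icc 0 Θ) (hΘa : Θ < a) (hab : a < b) (hy : 0 < y)
    (hn : ν + Nat.card {k : Fin m // θ k = 0} ≤ 2 * κ + 1 + m) :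
    (∀ s : ℂ, ‖s‖ = ρ → IntegrableOn (integrandI κ ν θ a b 0 x y s) (Ioi 0)) ∧
    Tendsto (fun ε : ℝ => transformI κ ν θ ρ a b ε x y) (𝓝[>] 0)
      (𝓝 (transformI κ ν θ ρ a b 0 x y)) := by
  obtain ⟨G, hGi, hG⟩ := exists_integrandI_dominated hΘ0 hθ hΘa hab hn hρ x hy
  -- Measurability is inherited from the regularised integrand with ε = 1 by multiplying back
  -- e^(1/t).
  have hmeas : ∀ s : ℂ, AEStronglyMeasurable (integrandI κ ν θ a b 0 x y s)
      (volume.restrict (Ioi 0)) := by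
    intro s
    have h1 := (integrableOn_integrandI_of_pos (κ := κ) (ν := ν) (x := x) hΘ0 hθ hΘa hab hy one_pos
      s).aestronglyMeasurable
    have h2 : AEStronglyMeasurable (fun t : ℝ => Complex.exp (((1 : ℝ) : ℂ) / (t : ℂ)))
        (volume.restrict (Ioi 0)) := by
      refine Measurable.aestronglyMeasurable ?_
      fun_prop
    refine (h1.mul h2).congr (Eventually.of_forall fun t => ?_)
    simp only [Pi.mul_apply]
    rw [integrandI_eq_mul 1 s t, mul_assoc, ← Complex.exp_add, neg_div, neg_add_cancel,
      Complex.exp_zero, mul_one]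
  have hnorm : ∀ ε : ℝ, 0 ≤ ε → ∀ s : ℂ, ‖s‖ = ρ → ∀ t ∈ Ioi (0 : ℝ),
      ‖integrandI κ ν θ a b ε x y s t‖ ≤ G t := by
    intro ε hε s hs t ht
    rw [integrandI_eq_mul, norm_mul]
    refine (mul_le_of_le_one_right (norm_nonneg _) (norm_exp_neg_div_le_one hε ht)).trans ?_
    exact hG s hs t ht
  have hpos : ∀ᶠ ε in 𝓝[>] (0 : ℝ), 0 < ε := self_mem_nhdsWithin
  refine ⟨fun s hs => Integrable.mono' hGi (hmeas s)
    ((ae_restrict_iff' measurableSet_Ioi).2 (Eventually.of_forall fun t ht => hG s hs t ht)), ?_⟩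
  have hs0 : ∀ s ∈ Metric.sphere (0 : ℂ) ρ, s ≠ 0 := fun s hs => sphere_zero_subset_compl hρ hs
  unfold transformI
  refine tendsto_contourInt (p := 0) (C := ρ ^ (-(κ : ℤ) - 1) * Real.exp ρ * ∫ t in Ioi 0, G t)
    hρ ?_ ?_ ?_
  · filter_upwards [hpos] with ε hε
    refine ContinuousOn.mul (ContinuousOn.mul (ContinuousOn.zpow₀ (by fun_prop) _
      fun s hs => Or.inl (hs0 s hs.1)) (by fun_prop)) ?_
    exact (continuousOn_integral_integrandI hρ hΘ0 hθ hΘa hab hy hε).mono sdiff_subset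
  · filter_upwards [hpos] with ε hε s hs
    have hsρ : ‖s‖ = ρ := mem_sphere_zero_iff_norm.1 hs.1
    rw [norm_mul, norm_mul, norm_zpow, hsρ]
    have e1 : ‖Complex.exp s‖ ≤ Real.exp ρ := by
      rw [← hsρ]
      exact Complex.norm_exp_le_exp_norm s
    have e2 : ‖∫ t in Ioi (0 : ℝ), integrandI κ ν θ a b ε x y s t‖ ≤ ∫ t in Ioi 0, G t :=
      norm_integral_le_of_norm_le hGi ((ae_restrict_iff' measurableSet_Ioi).2
        (Eventually.of_forall fun t ht => hnorm ε hε.le s hsρ t ht))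
    gcongr
  · intro s hs
    have hsρ : ‖s‖ = ρ := mem_sphere_zero_iff_norm.1 hs.1
    refine Tendsto.const_mul _ ?_
    refine tendsto_integral_filter_of_dominated_convergence G ?_ ?_ hGi ?_
    · filter_upwards [hpos] with ε hε
      exact (integrableOn_integrandI_of_pos hΘ0 hθ hΘa hab hy hε s).aestronglyMeasurable
    · filter_upwards [hpos] with ε hε
      exact (ae_restrict_iff' measurableSet_Ioi).2
        (Eventually.of_forall fun t ht => hnorm ε hε.le s hsρ t ht)
    · refine Eventually.of_forall fun t => ?_
      have e3 : (fun ε : ℝ => integrandI κ ν θ a b ε x y s t) = fun ε : ℝ =>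
          integrandI κ ν θ a b 0 x y s t * Complex.exp (-(ε : ℂ) / (t : ℂ)) := by
        ext ε
        exact integrandI_eq_mul ε s t
      rw [e3]
      have hc : Continuous fun ε : ℝ => integrandI κ ν θ a b 0 x y s t *
          Complex.exp (-(ε : ℂ) / (t : ℂ)) := by fun_prop
      have := hc.tendsto 0
      simp only [Complex.ofReal_zero, neg_zero, zero_div, Complex.exp_zero, mul_one] at this
      exact this.mono_left nhdsWithin_le_nhds

/-! ### Finite rank perturbations -/

theorem exists_inv_limitWeight_bound_xiCurve (ν : ℕ) {m : ℕ} {θ : Fin m → ℝ} {Θ X : ℝ} (hΘ0 : 0 < Θ)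
    (hθ : ∀ k, -θ k ∈ Icc 0 Θ) (hΘX : Θ < X) :
    ∃ C : ℝ, ∀ v ∈ xiCurve X, ‖(limitWeight ν θ v)⁻¹‖ ≤ C := by
  have hX : 0 < X := hΘ0.trans hΘX
  obtain ⟨d, hd, h⟩ := exists_xiCurve_dichotomy hX hΘX
  refine ⟨max (ν.factorial * 2 ^ ν) (Real.exp (1 / d) * (X ^ m / d ^ ν) * (d⁻¹) ^ m),
    fun v hv => ?_⟩
  rcases h v hv with h1 | h1
  · exact (exists_inv_limitWeight_bound_left ν (fun k => by linarith [(hθ k).1]) v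
      (xiCurve_ne_zero hX hv) h1).trans (le_max_left _ _)
  · refine (norm_inv_limitWeight_le_right ν hd ?_ (norm_le_of_mem_xiCurve hX hv)
      fun k => ?_).trans (le_max_right _ _)
    · simpa using h1 0 ⟨le_rfl, hΘ0.le⟩
    · simpa using h1 _ (hθ k)

theorem xiCurve_subset_compl_segment {Θ X : ℝ} (hX : 0 < X) (hΘX : Θ < X) :
    xiCurve X ⊆ {z : ℂ | ¬(z.im = 0 ∧ z.re ∈ Icc 0 Θ)} := fun _ hv =>
  (mem_slitRegion_of_mem_xiCurve (lo := 0) hX hΘX (lt_add_one X) hv).2.2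

theorem limitWeight_castSucc (ν : ℕ) {m : ℕ} (θ : Fin (m + 1) → ℝ) (u : ℂ) :
    limitWeight ν θ u =
      limitWeight ν (fun k : Fin m => θ k.castSucc) u * ((u + (θ (Fin.last m) : ℂ)) / u) := by
  simp only [limitWeight, Fin.prod_univ_castSucc, pow_succ u m]
  ring

theorem limitWeight_succ_left (ν : ℕ) {m : ℕ} (θ : Fin m → ℝ) (u : ℂ) :
    limitWeight (ν + 1) θ u = u * limitWeight ν θ u := by
  simp only [limitWeight, pow_succ u ν]
  ring

theorem continuousOn_besselF_mul_limitWeight (κ ν : ℕ) {m : ℕ} (θ : Fin m → ℝ) (x : ℝ) {b : ℝ}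
    (hb : 0 < b) :
    ContinuousOn (fun u : ℂ => besselF κ (u * x) * limitWeight ν θ u) (Metric.sphere 0 b) :=
  (differentiable_besselF_mul κ x).continuous.continuousOn.mul
    ((differentiableOn_limitWeight ν θ).continuousOn.mono (sphere_zero_subset_compl hb))

theorem circleIntegrable_cauchy {b : ℝ} (hb : 0 < b) {P : ℂ → ℂ}
    (hP : ContinuousOn P (Metric.sphere 0 b)) {v : ℂ} (hv : ‖v‖ < b) :
    CircleIntegrable (fun u => P u / (u - v)) 0 b := by
  refine ContinuousOn.circleIntegrable hb.le (hP.div (by fun_prop) fun u hu h0 => ?_)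
  rw [sub_eq_zero] at h0
  rw [mem_sphere_zero_iff_norm] at hu
  rw [h0] at hu
  exact hv.ne hu

/-- Adding one parameter changes the quotient of weights by a product. -/
theorem cauchyTransform_castSucc (κ ν : ℕ) {m : ℕ} (θ : Fin (m + 1) → ℝ) {b : ℝ} (hb : 0 < b)
    (x : ℝ) {v : ℂ} (hv : ‖v‖ < b) (hv0 : v ≠ 0) (hvθ : v + (θ (Fin.last m) : ℂ) ≠ 0) :
    cauchyTransform b (fun u => besselF κ (u * x) * limitWeight ν θ u) v * (limitWeight ν θ v)⁻¹ =
      cauchyTransform b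
        (fun u => besselF κ (u * x) * limitWeight ν (fun k : Fin m => θ k.castSucc) u) v *
        (limitWeight ν (fun k : Fin m => θ k.castSucc) v)⁻¹ +
      contourInt 0 b
        (fun u => besselF κ (u * x) * limitWeight ν (fun k : Fin m => θ k.castSucc) u / u) *
        (-(θ (Fin.last m) : ℂ) * (limitWeight (ν + 1) θ v)⁻¹) := by
  set φ : ℂ → ℂ := limitWeight ν (fun k : Fin m => θ k.castSucc) with hφ
  have hc := continuousOn_besselF_mul_limitWeight κ ν (fun k : Fin m => θ k.castSucc) x hb
  rw [← hφ] at hc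
  have hu0 : ∀ u ∈ Metric.sphere (0 : ℂ) b, u ≠ 0 := fun u hu => sphere_zero_subset_compl hb hu
  have hi1 : CircleIntegrable (fun u => besselF κ (u * x) * φ u / (u - v) * (φ v)⁻¹) 0 b :=
    (circleIntegrable_cauchy hb hc hv).mul_const (φ v)⁻¹
  have hi2 : CircleIntegrable (fun u => (besselF κ (u * x) * φ u / u) *
      (-(θ (Fin.last m) : ℂ) * (limitWeight (ν + 1) θ v)⁻¹)) 0 b :=
    ContinuousOn.circleIntegrable hb.le ((hc.div continuousOn_id hu0).mul continuousOn_const)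
  rw [cauchyTransform, cauchyTransform, ← contourInt_mul_const, ← contourInt_mul_const,
    ← contourInt_mul_const, ← contourInt_add hi1 hi2]
  refine contourInt_congr hb.le fun u hu => ?_
  have hu1 := hu0 u hu
  have huv : u - v ≠ 0 := fun h0 => by
    rw [mem_sphere_zero_iff_norm, sub_eq_zero.1 h0] at hu
    exact hv.ne hu
  -- The identity behind the step is (u + θ)v / (u(v + θ)) = 1 - θ(u - v) / (u(v + θ)).
  rw [limitWeight_succ_left, limitWeight_castSucc, limitWeight_castSucc, ← hφ]
  by_cases h : φ v = 0
  · simp [h]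
  field_simp
  ring

/-- The extra term has lost its denominator u - v, so the u- and v-integrals decouple. Its v-weight
is again the inverse of a limit weight, with ν + 1 for ν, and is therefore bounded on the curve. -/
theorem xiKernel_castSucc (κ ν : ℕ) {m : ℕ} (θ : Fin (m + 1) → ℝ) {Θ X b : ℝ} (hΘ0 : 0 < Θ)
    (hθ : ∀ k, -θ k ∈ Icc 0 Θ) (hΘX : Θ < X) (hXb : X < b) {x y : ℝ} (hy : 0 < y) :
    xiKernel κ ν θ b X x y = xiKernel κ ν (fun k : Fin m => θ k.castSucc) b X x y +
      contourInt 0 b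
        (fun u => besselF κ (u * x) * limitWeight ν (fun k : Fin m => θ k.castSucc) u / u) *
      xiInt X (fun v => mellinH (1 / 4) κ (v * y) *
        (-(θ (Fin.last m) : ℂ) * (limitWeight (ν + 1) θ v)⁻¹)) := by
  have hX : 0 < X := hΘ0.trans hΘX
  have hb : 0 < b := hX.trans hXb
  have hθ' : ∀ k : Fin m, -θ k.castSucc ∈ Icc 0 Θ := fun k => hθ _
  set ψ : Fin m → ℝ := fun k => θ k.castSucc with hψ
  set c := contourInt 0 b (fun u => besselF κ (u * x) * limitWeight ν ψ u / u) with hc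
  have hseg := xiCurve_subset_compl_segment hX hΘX
  have hmc : ContinuousOn (fun v : ℂ => mellinH (1 / 4) κ (v * y)) (xiCurve X) :=
    (differentiableOn_mellinH_mul (by norm_num) κ hy).continuousOn.mono
      fun v hv => mem_slitPlane_of_mem_xiCurve hX hv
  obtain ⟨C₀, hC₀, hmb⟩ := exists_mellinH_bound_xiCurve κ hX hy
  obtain ⟨C₁, hC₁⟩ := exists_inv_limitWeight_bound_xiCurve ν hΘ0 hθ' hΘX
  obtain ⟨C₂, hC₂⟩ := exists_inv_limitWeight_bound_xiCurve (ν + 1) hΘ0 hθ hΘX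
  have hPc := continuousOn_besselF_mul_limitWeight κ ν ψ x hb
  obtain ⟨C₃, hC₃⟩ := (isCompact_sphere (0 : ℂ) b).exists_bound_of_continuousOn hPc
  rw [← xiInt_const_mul, xiKernel, xiKernel, ← xiInt_add (p := 1 / 4) (C := C₀ * (b * (C₃ / (b - X)) * C₁))
    (C' := ‖c‖ * (C₀ * (‖(θ (Fin.last m) : ℂ)‖ * C₂))) hX (by norm_num)]
  · refine xiInt_congr fun v hv => ?_
    rw [cauchyTransform_castSucc κ ν θ hb x ((norm_le_of_mem_xiCurve hX hv).trans_lt hXb)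
      (xiCurve_ne_zero hX hv)]
    · ring
    · intro h0
      refine hseg hv (ofReal_mem_segment_of_sub_eq_zero (hθ (Fin.last m)) ?_)
      simpa using h0
  · refine hmc.mul (ContinuousOn.mul ?_ ?_)
    · exact (differentiableOn_cauchyTransform hb hPc).continuousOn.mono fun v hv => by
        simpa using (norm_le_of_mem_xiCurve hX hv).trans_lt hXb
    · exact (differentiableOn_inv_limitWeight hΘ0.le hθ').continuousOn.mono hseg
  · intro v hv
    have h1 := hmb v hv
    have h2 := norm_cauchyTransform_le hb hC₃ hXb (norm_le_of_mem_xiCurve hX hv)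
    rw [norm_mul, norm_mul, mul_right_comm]
    exact mul_le_mul h1 (mul_le_mul h2 (hC₁ v hv) (norm_nonneg _) ((norm_nonneg _).trans h2))
      (by positivity) ((norm_nonneg _).trans h1)
  · refine continuousOn_const.mul (hmc.mul (continuousOn_const.mul ?_))
    exact (differentiableOn_inv_limitWeight hΘ0.le hθ).continuousOn.mono hseg
  · intro v hv
    have h1 := hmb v hv
    rw [norm_mul, norm_mul, norm_mul, norm_neg, mul_assoc ‖c‖, mul_right_comm]
    refine mul_le_mul_of_nonneg_left ?_ (norm_nonneg _)
    exact mul_le_mul h1 (mul_le_mul_of_nonneg_left (hC₂ v hv) (norm_nonneg _)) (by positivity)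
      ((norm_nonneg _).trans h1)

/-- The parameters are removed one at a time from the end, each leaving one product; the base kernel
is the same throughout. -/
theorem exists_xiKernel_eq_add_sum (κ ν : ℕ) {Θ X b : ℝ} (hΘ0 : 0 < Θ) (hΘX : Θ < X)
    (hXb : X < b) {m : ℕ} (θ : Fin m → ℝ) (hθ : ∀ k, -θ k ∈ Icc 0 Θ) :
    ∃ f g : Fin m → ℝ → ℂ, ∀ x y : ℝ, 0 < y →
      xiKernel κ ν θ b X x y =
        xiKernel κ ν (Fin.elim0 : Fin 0 → ℝ) b X x y + ∑ i, f i x * g i y := by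
  induction m with
  | zero =>
    refine ⟨Fin.elim0, Fin.elim0, fun x y _ => ?_⟩
    rw [Subsingleton.elim θ Fin.elim0]
    simp
  | succ m ih =>
    obtain ⟨f, g, h⟩ := ih (fun k => θ k.castSucc) fun k => hθ _
    refine ⟨Fin.snoc (α := fun _ => ℝ → ℂ) f fun x => contourInt 0 b fun u =>
        besselF κ (u * x) * limitWeight ν (fun k : Fin m => θ k.castSucc) u / u,
      Fin.snoc (α := fun _ => ℝ → ℂ) g fun y => xiInt X fun v => mellinH (1 / 4) κ (v * y) *
        (-(θ (Fin.last m) : ℂ) * (limitWeight (ν + 1) θ v)⁻¹), fun x y hy => ?_⟩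
    rw [xiKernel_castSucc κ ν θ hΘ0 hθ hΘX hXb hy, h x y hy, Fin.sum_univ_castSucc]
    simp only [Fin.snoc_castSucc, Fin.snoc_last]
    rw [add_assoc]

/-! ### The kernel without parameters -/

theorem hasSum_contourInt {c : ℂ} {R : ℝ} (hR : 0 ≤ R) {f : ℕ → ℂ → ℂ} {g : ℂ → ℂ} {a : ℕ → ℝ}
    (hf : ∀ k, ContinuousOn (f k) (Metric.sphere c R)) (ha : Summable a)
    (hfa : ∀ k, ∀ z ∈ Metric.sphere c R, ‖f k z‖ ≤ a k)
    (hg : ∀ z ∈ Metric.sphere c R, HasSum (fun k => f k z) (g z)) :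
    HasSum (fun k => contourInt c R (f k)) (contourInt c R g) := by
  simp only [contourInt_eq_intervalIntegral]
  refine HasSum.mul_left _ ?_
  have hmem : ∀ θ, circleMap c R θ ∈ Metric.sphere c R := fun θ => circleMap_mem_sphere c hR θ
  refine intervalIntegral.hasSum_integral_of_dominated_convergence (fun k _ => R * a k) ?_ ?_ ?_ ?_ ?_
  · intro k
    refine Continuous.aestronglyMeasurable ?_
    exact (continuous_circleMap 0 R).mul ((hf k).comp_continuous (continuous_circleMap c R) hmem)
  · refine fun k => Eventually.of_forall fun θ _ => ?_
    rw [norm_mul, norm_circleMap_zero, abs_of_nonneg hR]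
    exact mul_le_mul_of_nonneg_left (hfa k _ (hmem θ)) hR
  · exact Eventually.of_forall fun _ _ => ha.mul_left R
  · exact intervalIntegrable_const
  · exact Eventually.of_forall fun θ _ => (hg _ (hmem θ)).mul_left _

theorem contourInt_zpow {b : ℝ} (hb : 0 < b) (n : ℤ) :
    contourInt 0 b (fun u => u ^ n) = if n = -1 then 1 else 0 := by
  rw [contourInt]
  split_ifs with h
  · have := circleIntegral.integral_sub_center_inv 0 hb.ne'
    simp only [sub_zero] at this
    simp only [h, zpow_neg_one, this, inv_mul_cancel₀ Complex.two_pi_I_ne_zero]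
  · have := circleIntegral.integral_sub_zpow_of_ne h 0 0 b
    simp only [sub_zero] at this
    rw [this, mul_zero]

theorem contourInt_pow_div_mul_exp {b : ℝ} (hb : 0 < b) (n : ℕ) (z : ℂ) :
    contourInt 0 b (fun u => u ^ n / u * Complex.exp (z / u)) = z ^ n / (n.factorial : ℂ) := by
  have hs0 : ∀ s ∈ Metric.sphere (0 : ℂ) b, s ≠ 0 := fun s hs => sphere_zero_subset_compl hb hs
  have h := hasSum_contourInt (c := 0) hb.le
    (f := fun k u => u ^ n / u * ((z / u) ^ k / (k.factorial : ℂ)))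
    (g := fun u => u ^ n / u * Complex.exp (z / u))
    (a := fun k => b ^ n / b * ((‖z‖ / b) ^ k / (k.factorial : ℝ)))
    (fun k => ContinuousOn.mul (ContinuousOn.div (by fun_prop) (by fun_prop) hs0)
      (ContinuousOn.div_const (ContinuousOn.pow
        (ContinuousOn.div (by fun_prop) (by fun_prop) hs0) _) _))
    ((Real.summable_pow_div_factorial _).mul_left _) ?_ ?_
  · refine h.unique ?_
    convert hasSum_single n ?_ using 1
    · have : ∀ u ∈ Metric.sphere (0 : ℂ) b, u ^ n / u * ((z / u) ^ n / (n.factorial : ℂ)) =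
          z ^ n / (n.factorial : ℂ) * u ^ (-1 : ℤ) := by
        intro u hu
        have := hs0 u hu
        rw [div_pow, zpow_neg_one]
        field_simp
      rw [contourInt_congr hb.le this, contourInt_const_mul, contourInt_zpow hb, if_pos rfl, mul_one]
    · intro k hk
      have : ∀ u ∈ Metric.sphere (0 : ℂ) b, u ^ n / u * ((z / u) ^ k / (k.factorial : ℂ)) =
          z ^ k / (k.factorial : ℂ) * u ^ ((n : ℤ) - 1 - k) := by
        intro u hu
        have := hs0 u hu
        rw [div_pow, zpow_sub₀ this, zpow_sub₀ this, zpow_one, zpow_natCast, zpow_natCast]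
        field_simp
      rw [contourInt_congr hb.le this, contourInt_const_mul, contourInt_zpow hb, if_neg (by omega),
        mul_zero]
  · intro k u hu
    rw [mem_sphere_zero_iff_norm] at hu
    simp [hu]
  · intro u _
    refine HasSum.mul_left _ ?_
    rw [Complex.exp_eq_exp_ℂ]
    exact NormedSpace.expSeries_div_hasSum_exp (z / u)

/-- The hypergeometric series `∑ (-z)^j / (j! (j+ν)! (j+κ)!)`. -/
noncomputable def hyperSeries (ν κ : ℕ) (z : ℂ) : ℂ :=
  ∑' j : ℕ, (-z) ^ j / ((j.factorial : ℂ) * ((j + κ).factorial : ℂ) * ((j + ν).factorial : ℂ))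

theorem norm_hyperSeries_term_le (ν κ j : ℕ) (z : ℂ) :
    ‖(-z) ^ j / ((j.factorial : ℂ) * ((j + κ).factorial : ℂ) * ((j + ν).factorial : ℂ))‖ ≤
      ‖z‖ ^ j / (j.factorial : ℝ) := by
  rw [norm_div, norm_mul, norm_mul, norm_pow, norm_neg, Complex.norm_natCast, Complex.norm_natCast,
    Complex.norm_natCast, mul_assoc]
  refine div_le_div_of_nonneg_left (by positivity) (by positivity) (le_mul_of_one_le_right
    (by positivity) (one_le_mul_of_one_le_of_one_le ?_ ?_)) <;>
  exact_mod_cast Nat.one_le_iff_ne_zero.2 (Nat.factorial_ne_zero _)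

theorem hasSum_hyperSeries (ν κ : ℕ) (z : ℂ) :
    HasSum (fun j : ℕ =>
      (-z) ^ j / ((j.factorial : ℂ) * ((j + κ).factorial : ℂ) * ((j + ν).factorial : ℂ)))
      (hyperSeries ν κ z) :=
  (Summable.of_norm_bounded (Real.summable_pow_div_factorial ‖z‖)
    fun j => norm_hyperSeries_term_le ν κ j z).hasSum

theorem norm_hyperSeries_le (ν κ : ℕ) (z : ℂ) : ‖hyperSeries ν κ z‖ ≤ Real.exp ‖z‖ := by
  rw [Real.exp_eq_exp_ℝ]
  exact tsum_of_norm_bounded (NormedSpace.expSeries_div_hasSum_exp ‖z‖)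
    fun j => norm_hyperSeries_term_le ν κ j z

/-- In the k-th term of F only the coefficient of order k + ν of the exponential has a residue; it
contributes (-w)^(k+ν)/(k+ν)!. -/
theorem contourInt_besselF_mul_exp (κ ν : ℕ) {b : ℝ} (hb : 0 < b) (x w : ℂ) :
    contourInt 0 b (fun u => besselF κ (u * x) * (u ^ ν / u * Complex.exp (-w / u))) =
      (-w) ^ ν * hyperSeries ν κ (w * x) := by
  have hs0 : ∀ s ∈ Metric.sphere (0 : ℂ) b, s ≠ 0 := fun s hs => sphere_zero_subset_compl hb hs
  have hce : ContinuousOn (fun u : ℂ => u ^ ν / u * Complex.exp (-w / u)) (Metric.sphere 0 b) :=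
    ContinuousOn.mul (ContinuousOn.div (by fun_prop) (by fun_prop) hs0)
      (ContinuousOn.cexp (ContinuousOn.div (by fun_prop) (by fun_prop) hs0))
  obtain ⟨C, hC⟩ := (isCompact_sphere (0 : ℂ) b).exists_bound_of_continuousOn hce
  have h := hasSum_contourInt (c := 0) hb.le
    (f := fun k u => (u * x) ^ k / ((k.factorial : ℂ) * ((k + κ).factorial : ℂ)) *
      (u ^ ν / u * Complex.exp (-w / u)))
    (g := fun u => besselF κ (u * x) * (u ^ ν / u * Complex.exp (-w / u)))
    (a := fun k => (b * ‖x‖) ^ k / (k.factorial : ℝ) * C)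
    (fun k => ContinuousOn.mul (by fun_prop) hce)
    ((Real.summable_pow_div_factorial _).mul_right _) ?_ ?_
  · have e : ∀ k : ℕ, contourInt 0 b (fun u => (u * x) ^ k / ((k.factorial : ℂ) *
        ((k + κ).factorial : ℂ)) * (u ^ ν / u * Complex.exp (-w / u))) = (-w) ^ ν *
        ((-(w * x)) ^ k / ((k.factorial : ℂ) * ((k + κ).factorial : ℂ) *
          ((k + ν).factorial : ℂ))) := by
      intro k
      have : ∀ u : ℂ, (u * x) ^ k / ((k.factorial : ℂ) * ((k + κ).factorial : ℂ)) *
          (u ^ ν / u * Complex.exp (-w / u)) =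
          x ^ k / ((k.factorial : ℂ) * ((k + κ).factorial : ℂ)) *
          (u ^ (k + ν) / u * Complex.exp (-w / u)) := by
        intro u
        rw [mul_pow, pow_add]
        ring
      simp only [this]
      rw [contourInt_const_mul, contourInt_pow_div_mul_exp hb, ← neg_mul, mul_pow, pow_add]
      field_simp
    simp only [e] at h
    exact h.unique ((hasSum_hyperSeries ν κ (w * x)).mul_left _)
  · intro k u hu
    have h1 := norm_besselF_term_le κ k (u * x)
    rw [norm_mul u, mem_sphere_zero_iff_norm.1 hu] at h1
    rw [norm_mul]
    exact mul_le_mul h1 (hC u hu) (norm_nonneg _) ((norm_nonneg _).trans h1)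
  · exact fun u _ => (hasSum_besselF κ (u * x)).mul_right _

theorem cauchyTransform_of_differentiable {g : ℂ → ℂ} (hg : Differentiable ℂ g) {b : ℝ} {v : ℂ}
    (hv : ‖v‖ < b) : cauchyTransform b g v = g v := by
  have h := (hg.diffContOnCl (s := Metric.ball 0 b)).circleIntegral_sub_inv_smul
    (w := v) (by simpa using hv)
  simp only [smul_eq_mul] at h
  simp only [cauchyTransform, contourInt, div_eq_inv_mul, h]
  rw [inv_mul_cancel_left₀ Complex.two_pi_I_ne_zero]

theorem limitWeight_elim0 (ν : ℕ) (u : ℂ) :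
    limitWeight ν (Fin.elim0 : Fin 0 → ℝ) u = Complex.exp (-1 / u) * u ^ ν := by
  simp [limitWeight]

/-- The integrand is e^(w(u-v)/(uv)). Integrated over [0, 1] it represents the Cauchy denominator as
a mixture of products of a function of u and a function of v. -/
theorem integral_exp_sub_inv {u v : ℂ} (hu : u ≠ 0) (hv : v ≠ 0) (huv : u - v ≠ 0) :
    ∫ w in Ioc (0 : ℝ) 1, Complex.exp (-(w : ℂ) / u) * Complex.exp ((w : ℂ) / v) =
      u * v / (u - v) * (Complex.exp (-1 / u) * Complex.exp (1 / v) - 1) := by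
  have hc : (u - v) / (u * v) ≠ 0 := div_ne_zero huv (mul_ne_zero hu hv)
  have h : ∀ w : ℝ, Complex.exp (-(w : ℂ) / u) * Complex.exp ((w : ℂ) / v) =
      Complex.exp ((u - v) / (u * v) * w) := by
    intro w
    rw [← Complex.exp_add]
    congr 1
    field_simp
    ring
  simp only [h]
  rw [← intervalIntegral.integral_of_le zero_le_one, integral_exp_mul_complex hc]
  have h1 := h 1
  simp only [Complex.ofReal_one] at h1
  rw [Complex.ofReal_zero, mul_zero, Complex.exp_zero, Complex.ofReal_one, ← h1]
  field_simp

/-- The Cauchy transform of the weight without parameters. -/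
theorem cauchyTransform_elim0 (κ ν : ℕ) {b : ℝ} (hb : 0 < b) (x : ℝ) {v : ℂ} (hv0 : v ≠ 0)
    (hv : ‖v‖ < b) :
    cauchyTransform b (fun u => besselF κ (u * x) * limitWeight ν (Fin.elim0 : Fin 0 → ℝ) u) v *
        (limitWeight ν (Fin.elim0 : Fin 0 → ℝ) v)⁻¹ =
      besselF κ (v * x) + ∫ w in Ioc (0 : ℝ) 1,
        (-(w : ℂ)) ^ ν * hyperSeries ν κ (w * x) * ((v ^ (ν + 1))⁻¹ * Complex.exp ((w : ℂ) / v)) := by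
  have hs0 : ∀ s ∈ Metric.sphere (0 : ℂ) b, s ≠ 0 := fun s hs => sphere_zero_subset_compl hb hs
  have hne : ∀ u ∈ Metric.sphere (0 : ℂ) b, u - v ≠ 0 := fun u hu h0 => by
    rw [mem_sphere_zero_iff_norm, sub_eq_zero.1 h0] at hu
    exact hv.ne hu
  set f : ℂ → ℝ → ℂ := fun u w => besselF κ (u * x) * (u ^ ν / u * Complex.exp (-(w : ℂ) / u)) *
    ((v ^ (ν + 1))⁻¹ * Complex.exp ((w : ℂ) / v)) with hf
  have hfc : ContinuousOn (Function.uncurry f) (Metric.sphere 0 b ×ˢ Icc 0 1) := by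
    have h1 : ∀ p ∈ Metric.sphere (0 : ℂ) b ×ˢ Icc (0 : ℝ) 1, p.1 ≠ 0 := fun p hp => hs0 _ hp.1
    refine ContinuousOn.mul (ContinuousOn.mul ?_ (ContinuousOn.mul ?_ ?_)) (by fun_prop)
    · exact ((differentiable_besselF_mul κ x).continuous.comp continuous_fst).continuousOn
    · exact ContinuousOn.div (by fun_prop) (by fun_prop) h1
    · exact ContinuousOn.cexp (ContinuousOn.div (by fun_prop) (by fun_prop) h1)
  obtain ⟨C, hC⟩ := ((isCompact_sphere (0 : ℂ) b).prod isCompact_Icc).exists_bound_of_continuousOn hfc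
  have hswap := contourInt_integral_swap (c := 0) (p := 0) (S := Ioc (0 : ℝ) 1) (f := f)
    (g := fun _ => C) hb measurableSet_Ioc
    (hfc.mono (prod_mono sdiff_subset Ioc_subset_Icc_self))
    (integrableOn_const (by simp)) fun z hz t ht => hC (z, t) ⟨hz.1, Ioc_subset_Icc_self ht⟩
  have hinner : ∀ w : ℝ, contourInt 0 b (fun u => f u w) =
      (-(w : ℂ)) ^ ν * hyperSeries ν κ (w * x) * ((v ^ (ν + 1))⁻¹ * Complex.exp ((w : ℂ) / v)) := by
    intro w
    rw [hf, contourInt_mul_const, contourInt_besselF_mul_exp κ ν hb]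
  simp only [hinner] at hswap
  have hd : Differentiable ℂ fun u : ℂ => besselF κ (u * x) * u ^ ν :=
    (differentiable_besselF_mul κ x).mul (by fun_prop)
  have hF := cauchyTransform_of_differentiable hd hv
  -- The term -1 left over by the w-integral is compensated by the Cauchy integral of the entire
  -- function F(ux) u^ν.
  have hF2 : besselF κ (v * x) = contourInt 0 b (fun u => besselF κ (u * x) * u ^ ν / (u - v) *
      (v ^ ν)⁻¹) := by
    rw [contourInt_mul_const]
    rw [cauchyTransform] at hF
    rw [hF, mul_inv_cancel_right₀ (pow_ne_zero _ hv0)]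
  have hi1 : CircleIntegrable (fun u => besselF κ (u * x) * u ^ ν / (u - v) * (v ^ ν)⁻¹) 0 b :=
    (circleIntegrable_cauchy hb hd.continuous.continuousOn hv).mul_const (v ^ ν)⁻¹
  have hval : ∀ u ∈ Metric.sphere (0 : ℂ) b, ∫ w in Ioc (0 : ℝ) 1, f u w =
      besselF κ (u * x) * (u ^ ν / u) * (v ^ (ν + 1))⁻¹ *
        (u * v / (u - v) * (Complex.exp (-1 / u) * Complex.exp (1 / v) - 1)) := by
    intro u hu
    rw [← integral_exp_sub_inv (hs0 u hu) hv0 (hne u hu), ← integral_const_mul]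
    refine integral_congr_ae (Eventually.of_forall fun w => ?_)
    simp only [hf]
    ring
  have hi2 : CircleIntegrable (fun u => ∫ w in Ioc (0 : ℝ) 1, f u w) 0 b := by
    refine ContinuousOn.circleIntegrable hb.le (ContinuousOn.congr ?_ hval)
    refine ContinuousOn.mul (ContinuousOn.mul (ContinuousOn.mul
      (differentiable_besselF_mul κ x).continuous.continuousOn ?_) (by fun_prop))
      (ContinuousOn.mul ?_ (ContinuousOn.sub (ContinuousOn.mul ?_ (by fun_prop)) (by fun_prop)))
    · exact ContinuousOn.div (by fun_prop) (by fun_prop) hs0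
    · exact ContinuousOn.div (by fun_prop) (by fun_prop) hne
    · exact ContinuousOn.cexp (ContinuousOn.div (by fun_prop) (by fun_prop) hs0)
  rw [← hswap, hF2, ← contourInt_add hi1 hi2, cauchyTransform, ← contourInt_mul_const]
  refine contourInt_congr hb.le fun u hu => ?_
  have h1 := hs0 u hu
  have h2 := hne u hu
  rw [hval u hu, limitWeight_elim0, limitWeight_elim0, mul_inv, ← Complex.exp_neg, ← neg_div, neg_neg]
  field_simp
  ring

/-- The integral is moved back to a circle inside the right half-plane, where H(vy) F(vx) has no
singularity. The excluded segment is the single point X/2, and any such point would do. -/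
theorem xiInt_mellinH_mul_besselF (κ : ℕ) {X x y : ℝ} (hX : 0 < X) (hy : 0 < y) :
    xiInt X (fun v => mellinH (1 / 4) κ (v * y) * besselF κ (v * x)) = 0 := by
  have hd := differentiable_besselF_mul κ x
  rw [← contourInt_besselH_mul_eq_xiInt (lo := X / 2) (hi := X / 2) (B := 2 * X) (c := X / 2)
    (R := X / 4) κ hy hd.differentiableOn hd.continuous.continuousAt (by linarith) hX (by linarith)
    (by linarith) (by linarith) (by linarith) (by linarith) (by linarith) (by linarith)]
  exact contourInt_eq_zero_of_re_pos ((differentiableOn_besselH_mul κ hy).mul hd.differentiableOn)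
    (by linarith) (by linarith)

theorem norm_exp_div_le_of_re_le {v : ℂ} (hv0 : v ≠ 0) (hv : v.re ≤ -(‖v‖ / 2)) {w : ℝ}
    (hw : 0 ≤ w) : ‖Complex.exp ((w : ℂ) / v)‖ ≤ Real.exp (-(w / ‖v‖ / 2)) := by
  have hs : 0 < ‖v‖ := norm_pos_iff.2 hv0
  rw [Complex.norm_exp, Real.exp_le_exp, div_eq_mul_inv, Complex.re_ofReal_mul, Complex.inv_re,
    Complex.normSq_eq_norm_sq, mul_div_assoc', div_le_iff₀ (by positivity)]
  have : -(w / ‖v‖ / 2) * ‖v‖ ^ 2 = w * (-(‖v‖ / 2)) := by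
    field_simp
  rw [this]
  gcongr

theorem rpow_mul_exp_neg_half_le (n : ℕ) {r : ℝ} (hr : 0 < r) :
    r ^ (n + 1) * Real.exp (-(r / 2)) ≤ (n + 1).factorial * 2 ^ (n + 1) * r ^ (1 / 12 : ℝ) := by
  have hf : (1 : ℝ) ≤ (n + 1).factorial * 2 ^ (n + 1) :=
    one_le_mul_of_one_le_of_one_le
      (by exact_mod_cast Nat.one_le_iff_ne_zero.2 (Nat.factorial_ne_zero (n + 1)))
      (one_le_pow₀ (by norm_num))
  rcases le_total r 1 with h | h
  · have h1 : r ^ (n + 1) ≤ r ^ (1 / 12 : ℝ) := by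
      rw [← Real.rpow_natCast]
      refine Real.rpow_le_rpow_of_exponent_ge hr h ?_
      push_cast
      have : (0 : ℝ) ≤ n := n.cast_nonneg
      linarith
    have h2 : Real.exp (-(r / 2)) ≤ 1 := Real.exp_le_one_iff.2 (by linarith)
    calc _ ≤ r ^ (1 / 12 : ℝ) * 1 := mul_le_mul h1 h2 (Real.exp_pos _).le (by positivity)
      _ = 1 * r ^ (1 / 12 : ℝ) := by ring
      _ ≤ _ := mul_le_mul_of_nonneg_right hf (by positivity)
  · have h1 : (1 : ℝ) ≤ r ^ (1 / 12 : ℝ) := Real.one_le_rpow h (by norm_num)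
    have h2 : (r / 2) ^ (n + 1) / (n + 1).factorial ≤ Real.exp (r / 2) :=
      Real.pow_div_factorial_le_exp _ (by positivity) _
    rw [Real.exp_neg, ← div_eq_mul_inv, div_le_iff₀ (Real.exp_pos _)]
    rw [div_le_iff₀ (by positivity), div_pow, div_le_iff₀ (by positivity)] at h2
    calc _ ≤ _ := h2
      _ = ((n + 1).factorial * 2 ^ (n + 1)) * 1 * Real.exp (r / 2) := by ring
      _ ≤ _ := by gcongr

/-- The exponents share one budget: |v|^(-1/12) together with the |v|^(-1/4) of H exhausts the
tolerance 1/3, and w^(-11/12) is still integrable at 0. In the sector the bound comes from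
(w/|v|)^(ν+1) e^(-w/(2|v|)) ≤ C (w/|v|)^(1/12). -/
theorem exists_exp_div_bound_xiCurve (ν : ℕ) {X : ℝ} (hX : 0 < X) :
    ∃ C : ℝ, 0 ≤ C ∧ ∀ w ∈ Ioc (0 : ℝ) 1, ∀ v ∈ xiCurve X,
      ‖(-(w : ℂ)) ^ ν * ((v ^ (ν + 1))⁻¹ * Complex.exp ((w : ℂ) / v))‖ ≤
        C * w ^ (-(11 / 12) : ℝ) * ‖v‖ ^ (-(1 / 12) : ℝ) := by
  obtain ⟨d, hd, h⟩ := exists_xiCurve_dichotomy hX hX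
  set C₁ : ℝ := (ν + 1).factorial * 2 ^ (ν + 1) with hC₁
  set C₂ : ℝ := (d ^ (ν + 1))⁻¹ * Real.exp (1 / d) * X ^ (1 / 12 : ℝ) with hC₂
  refine ⟨C₁ + C₂, by positivity, fun w hw v hv => ?_⟩
  have hw0 : 0 < w := hw.1
  have hv0 := xiCurve_ne_zero hX hv
  have hs : 0 < ‖v‖ := norm_pos_iff.2 hv0
  rw [norm_mul, norm_mul, norm_inv, norm_pow, norm_pow, norm_neg, Complex.norm_real,
    Real.norm_of_nonneg hw0.le]
  rcases h v hv with h1 | h1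
  · have e1 := norm_exp_div_le_of_re_le hv0 h1 hw0.le
    have hr : 0 < w / ‖v‖ := div_pos hw0 hs
    have e2 := rpow_mul_exp_neg_half_le ν hr
    rw [← hC₁] at e2
    have e3 : w⁻¹ * (w / ‖v‖) ^ (1 / 12 : ℝ) = w ^ (-(11 / 12) : ℝ) * ‖v‖ ^ (-(1 / 12) : ℝ) := by
      rw [Real.div_rpow hw0.le hs.le, ← Real.rpow_neg_one w, Real.rpow_neg hs.le, div_eq_mul_inv,
        ← mul_assoc, ← Real.rpow_add hw0]
      norm_num
    calc w ^ ν * ((‖v‖ ^ (ν + 1))⁻¹ * ‖Complex.exp ((w : ℂ) / v)‖)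
        ≤ w ^ ν * ((‖v‖ ^ (ν + 1))⁻¹ * Real.exp (-(w / ‖v‖ / 2))) := by gcongr
      _ = w⁻¹ * ((w / ‖v‖) ^ (ν + 1) * Real.exp (-(w / ‖v‖ / 2))) := by
        rw [div_pow, pow_succ w]
        field_simp
      _ ≤ w⁻¹ * (C₁ * (w / ‖v‖) ^ (1 / 12 : ℝ)) := by gcongr
      _ = C₁ * (w⁻¹ * (w / ‖v‖) ^ (1 / 12 : ℝ)) := by ring
      _ = C₁ * w ^ (-(11 / 12) : ℝ) * ‖v‖ ^ (-(1 / 12) : ℝ) := by rw [e3]; ring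
      _ ≤ _ := by
        gcongr
        exact le_add_of_nonneg_right (by positivity)
  · have hdv : d ≤ ‖v‖ := by simpa using h1 0 ⟨le_rfl, le_rfl⟩
    have e1 : ‖Complex.exp ((w : ℂ) / v)‖ ≤ Real.exp (1 / d) := by
      refine (Complex.norm_exp_le_exp_norm _).trans (Real.exp_le_exp.2 ?_)
      rw [norm_div, Complex.norm_real, Real.norm_of_nonneg hw0.le]
      exact div_le_div₀ zero_le_one hw.2 hd hdv
    have e2 : w ^ ν ≤ 1 := pow_le_one₀ hw0.le hw.2
    have e3 : 1 ≤ w ^ (-(11 / 12) : ℝ) :=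
      Real.one_le_rpow_of_pos_of_le_one_of_nonpos hw0 hw.2 (by norm_num)
    have e4 : 1 ≤ X ^ (1 / 12 : ℝ) * ‖v‖ ^ (-(1 / 12) : ℝ) := by
      rw [Real.rpow_neg hs.le, ← div_eq_mul_inv, one_le_div (by positivity)]
      exact Real.rpow_le_rpow hs.le (norm_le_of_mem_xiCurve hX hv) (by norm_num)
    calc w ^ ν * ((‖v‖ ^ (ν + 1))⁻¹ * ‖Complex.exp ((w : ℂ) / v)‖)
        ≤ 1 * ((d ^ (ν + 1))⁻¹ * Real.exp (1 / d)) := by gcongr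
      _ ≤ ((d ^ (ν + 1))⁻¹ * Real.exp (1 / d)) * (w ^ (-(11 / 12) : ℝ) *
          (X ^ (1 / 12 : ℝ) * ‖v‖ ^ (-(1 / 12) : ℝ))) := by
        rw [one_mul]
        exact le_mul_of_one_le_right (by positivity) (one_le_mul_of_one_le_of_one_le e3 e4)
      _ = C₂ * w ^ (-(11 / 12) : ℝ) * ‖v‖ ^ (-(1 / 12) : ℝ) := by rw [hC₂]; ring
      _ ≤ _ := by
        gcongr
        exact le_add_of_nonneg_left (by positivity)

theorem differentiable_hyperSeries (ν κ : ℕ) : Differentiable ℂ (hyperSeries ν κ) := by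
  intro z
  have h : DifferentiableOn ℂ (hyperSeries ν κ) (Metric.ball 0 (‖z‖ + 1)) := by
    refine Complex.differentiableOn_tsum_of_summable_norm
      (u := fun k : ℕ => (‖z‖ + 1) ^ k / (k.factorial : ℝ))
      (Real.summable_pow_div_factorial _) (fun k => ?_) Metric.isOpen_ball fun k w hw => ?_
    · exact ((differentiable_id.neg.pow k).div_const _).differentiableOn
    · refine (norm_hyperSeries_term_le ν κ k w).trans ?_
      have : ‖w‖ ≤ ‖z‖ + 1 := (mem_ball_zero_iff.1 hw).le
      gcongr
  exact h.differentiableAt (Metric.isOpen_ball.mem_nhds (by simp))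

/-- The kernel without parameters as a mixture over `w`. -/
theorem xiKernel_elim0 (κ ν : ℕ) {X b x y : ℝ} (hX : 0 < X) (hXb : X < b) (hy : 0 < y) :
    xiKernel κ ν (Fin.elim0 : Fin 0 → ℝ) b X x y = ∫ w in Ioc (0 : ℝ) 1,
      (-(w : ℂ)) ^ ν * hyperSeries ν κ (w * x) * xiInt X (fun v =>
        mellinH (1 / 4) κ (v * y) * ((v ^ (ν + 1))⁻¹ * Complex.exp ((w : ℂ) / v))) := by
  have hb : 0 < b := hX.trans hXb
  have hmc : ContinuousOn (fun v : ℂ => mellinH (1 / 4) κ (v * y)) (xiCurve X) :=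
    (differentiableOn_mellinH_mul (by norm_num) κ hy).continuousOn.mono
      fun v hv => mem_slitPlane_of_mem_xiCurve hX hv
  obtain ⟨C₀, hC₀, hmb⟩ := exists_mellinH_bound_xiCurve κ hX hy
  obtain ⟨C₁, hC₁, heb⟩ := exists_exp_div_bound_xiCurve ν hX
  set E : ℝ := Real.exp |x| with hE
  set f : ℂ → ℝ → ℂ := fun v w => mellinH (1 / 4) κ (v * y) * ((-(w : ℂ)) ^ ν *
    hyperSeries ν κ (w * x) * ((v ^ (ν + 1))⁻¹ * Complex.exp ((w : ℂ) / v))) with hf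
  have hfc : ContinuousOn (Function.uncurry f) (xiCurve X ×ˢ Ioc (0 : ℝ) 1) := by
    have h0 : ∀ p ∈ xiCurve X ×ˢ Ioc (0 : ℝ) 1, p.1 ≠ 0 := fun p hp => xiCurve_ne_zero hX hp.1
    refine ContinuousOn.mul (hmc.comp continuousOn_fst fun p hp => hp.1)
      (ContinuousOn.mul (ContinuousOn.mul (by fun_prop) ?_) (ContinuousOn.mul ?_ ?_))
    · exact ((differentiable_hyperSeries ν κ).continuous.comp (by fun_prop : Continuous fun p : ℂ × ℝ =>
        ((p.2 : ℂ) * (x : ℂ)))).continuousOn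
    · exact ContinuousOn.inv₀ (by fun_prop) fun p hp => pow_ne_zero _ (h0 p hp)
    · exact ContinuousOn.cexp (ContinuousOn.div (by fun_prop) (by fun_prop) h0)
  have hfb : ∀ v ∈ xiCurve X, ∀ w ∈ Ioc (0 : ℝ) 1,
      ‖f v w‖ ≤ C₀ * E * C₁ * w ^ (-(11 / 12) : ℝ) * ‖v‖ ^ (-(1 / 3) : ℝ) := by
    intro v hv w hw
    have h1 := hmb v hv
    have h2 := heb w hw v hv
    have h3 : ‖hyperSeries ν κ (w * x)‖ ≤ E := by
      refine (norm_hyperSeries_le ν κ _).trans (Real.exp_le_exp.2 ?_)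
      rw [norm_mul, Complex.norm_real, Complex.norm_real, Real.norm_of_nonneg hw.1.le]
      exact mul_le_of_le_one_left (abs_nonneg x) hw.2
    have hs : 0 < ‖v‖ := norm_pos_iff.2 (xiCurve_ne_zero hX hv)
    have e : f v w = mellinH (1 / 4) κ (v * y) * (hyperSeries ν κ (w * x) *
      ((-(w : ℂ)) ^ ν * ((v ^ (ν + 1))⁻¹ * Complex.exp ((w : ℂ) / v)))) := by
      simp only [hf]
      ring
    rw [e, norm_mul, norm_mul]
    calc _ ≤ C₀ * ‖v‖ ^ (-(1 / 4) : ℝ) * (E * (C₁ * w ^ (-(11 / 12) : ℝ) *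
          ‖v‖ ^ (-(1 / 12) : ℝ))) := by
          have := Real.rpow_nonneg hw.1.le (-(11 / 12))
          gcongr
      _ = C₀ * E * C₁ * w ^ (-(11 / 12) : ℝ) * (‖v‖ ^ (-(1 / 4) : ℝ) * ‖v‖ ^ (-(1 / 12) : ℝ)) := by
          ring
      _ = _ := by
          rw [← Real.rpow_add hs]
          norm_num
  have hgi : IntegrableOn (fun w : ℝ => w ^ (-(11 / 12) : ℝ)) (Ioc 0 1) := by
    have := intervalIntegral.intervalIntegrable_rpow' (a := 0) (b := 1)
      (r := (-(11 / 12) : ℝ)) (by norm_num)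
    rwa [intervalIntegrable_iff_integrableOn_Ioc_of_le zero_le_one] at this
  have hswap := xiInt_integral_swap (p := 1 / 3) hX le_rfl measurableSet_Ioc hfc hgi hfb (by positivity)
    fun w hw => Real.rpow_nonneg hw.1.le _
  have hFc : Continuous fun v : ℂ => besselF κ (v * x) := (differentiable_besselF_mul κ x).continuous
  obtain ⟨C₂, hC₂⟩ := (isCompact_closedBall (0 : ℂ) X).exists_bound_of_continuousOn hFc.continuousOn
  have hzero := xiInt_mellinH_mul_besselF κ (x := x) hX hy
  have hrhs : ∀ w : ℝ, (-(w : ℂ)) ^ ν * hyperSeries ν κ (w * x) * xiInt X (fun v =>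
        mellinH (1 / 4) κ (v * y) * ((v ^ (ν + 1))⁻¹ * Complex.exp ((w : ℂ) / v))) =
      xiInt X (fun v => f v w) := by
    intro w
    rw [← xiInt_const_mul]
    congr 1
    funext v
    simp only [hf]
    ring
  simp only [hrhs]
  rw [← hswap, ← zero_add (xiInt X _), ← hzero]
  set D : ℝ := ∫ w in Ioc (0 : ℝ) 1, w ^ (-(11 / 12) : ℝ) with hD
  have hval : ∀ v ∈ xiCurve X, mellinH (1 / 4) κ (v * y) *
      (cauchyTransform b (fun u => besselF κ (u * x) * limitWeight ν (Fin.elim0 : Fin 0 → ℝ) u) v *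
      (limitWeight ν (Fin.elim0 : Fin 0 → ℝ) v)⁻¹) =
      mellinH (1 / 4) κ (v * y) * besselF κ (v * x) + ∫ w in Ioc (0 : ℝ) 1, f v w := by
    intro v hv
    rw [cauchyTransform_elim0 κ ν hb x (xiCurve_ne_zero hX hv)
      ((norm_le_of_mem_xiCurve hX hv).trans_lt hXb), mul_add, ← integral_const_mul]
  have hPc := continuousOn_besselF_mul_limitWeight κ ν (Fin.elim0 : Fin 0 → ℝ) x hb
  rw [xiKernel, xiInt_congr hval]
  refine xiInt_add (p := 1 / 3) (C := C₀ * C₂ * X ^ (1 / 12 : ℝ)) (C' := C₀ * E * C₁ * D) hX le_rfl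
    (hmc.mul hFc.continuousOn) ?_ ?_ ?_
  · intro v hv
    have h1 := hmb v hv
    have hvX := norm_le_of_mem_xiCurve hX hv
    have h2 := hC₂ v (by simpa using hvX)
    have hs : 0 < ‖v‖ := norm_pos_iff.2 (xiCurve_ne_zero hX hv)
    have hC20 : 0 ≤ C₂ := (norm_nonneg _).trans h2
    have h3 : ‖v‖ ^ (-(1 / 4) : ℝ) ≤ X ^ (1 / 12 : ℝ) * ‖v‖ ^ (-(1 / 3) : ℝ) := by
      have : (-(1 / 4) : ℝ) = 1 / 12 + -(1 / 3) := by norm_num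
      rw [this, Real.rpow_add hs]
      gcongr
    rw [norm_mul]
    calc _ ≤ C₀ * ‖v‖ ^ (-(1 / 4) : ℝ) * C₂ := by gcongr
      _ ≤ C₀ * (X ^ (1 / 12 : ℝ) * ‖v‖ ^ (-(1 / 3) : ℝ)) * C₂ := by gcongr
      _ = _ := by ring
  -- Continuity of the w-integral in v is read off from the identity just proved, as a difference of
  -- two continuous functions.
  · have : ContinuousOn (fun v : ℂ => mellinH (1 / 4) κ (v * y) *
      (cauchyTransform b (fun u => besselF κ (u * x) * limitWeight ν (Fin.elim0 : Fin 0 → ℝ) u) v *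
      (limitWeight ν (Fin.elim0 : Fin 0 → ℝ) v)⁻¹) -
      mellinH (1 / 4) κ (v * y) * besselF κ (v * x)) (xiCurve X) := by
      refine ContinuousOn.sub (hmc.mul (ContinuousOn.mul ?_ ?_)) (hmc.mul hFc.continuousOn)
      · exact (differentiableOn_cauchyTransform hb hPc).continuousOn.mono fun v hv => by
          simpa using (norm_le_of_mem_xiCurve hX hv).trans_lt hXb
      · exact (differentiableOn_inv_limitWeight le_rfl fun k => k.elim0).continuousOn.mono
          (xiCurve_subset_compl_segment hX hX)
    refine this.congr fun v hv => ?_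
    simp only [hval v hv, add_sub_cancel_left]
  · intro v hv
    refine (norm_integral_le_of_norm_le (hgi.const_mul (C₀ * E * C₁ * ‖v‖ ^ (-(1 / 3) : ℝ)))
      ((ae_restrict_iff' measurableSet_Ioc).2 (Eventually.of_forall fun w hw =>
        (hfb v hv w hw).trans (le_of_eq (by ring))))).trans (le_of_eq ?_)
    rw [integral_const_mul, hD]
    ring

/-! ### Hankel's integral on the curve -/

theorem iteratedDeriv_cpow (a : ℂ) (n : ℕ) {z : ℂ} (hz : z ∈ Complex.slitPlane) :
    iteratedDeriv n (fun v : ℂ => v ^ a) z =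
      (∏ j ∈ Finset.range n, (a - j)) * z ^ (a - n) := by
  induction n generalizing z with
  | zero => simp
  | succ n ih =>
    have h : iteratedDeriv n (fun v : ℂ => v ^ a) =ᶠ[𝓝 z]
        fun v => (∏ j ∈ Finset.range n, (a - j)) * v ^ (a - n) := by
      filter_upwards [Complex.isOpen_slitPlane.mem_nhds hz] with v hv using ih hv
    rw [iteratedDeriv_succ, h.deriv_eq, deriv_const_mul_field, Complex.deriv_cpow_const hz,
      Finset.prod_range_succ]
    push_cast
    rw [mul_assoc, sub_sub]

/-- The prelimit of the Hankel integrand, integrated around its pole. -/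
theorem contourInt_cpow_mul_div_sub_pow (s : ℂ) (n : ℕ) :
    contourInt ((1 / (n + 1 : ℕ) : ℝ) : ℂ) (1 / (2 * (n + 1 : ℕ)) : ℝ)
      (fun v => v ^ (-s - 1) * (v / (v - ((1 / (n + 1 : ℕ) : ℝ) : ℂ))) ^ (n + 1)) =
    (∏ j ∈ Finset.range n, (1 - s + j)) / (n.factorial : ℂ) *
      (((1 / (n + 1 : ℕ) : ℝ) : ℂ) ^ (-s)) := by
  set c : ℝ := 1 / (n + 1 : ℕ) with hc
  set R : ℝ := 1 / (2 * (n + 1 : ℕ)) with hR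
  have hc0 : 0 < c := by positivity
  have hR0 : 0 < R := by positivity
  have hRc : R = c / 2 := by
    rw [hc, hR]
    field_simp
  have hre : ∀ v ∈ Metric.closedBall (c : ℂ) R, v ∈ Complex.slitPlane := fun v hv =>
    Or.inl (re_pos_of_mem_closedBall (by linarith) hv)
  have hd : DifferentiableOn ℂ (fun v : ℂ => v ^ ((n : ℂ) - s)) (Metric.closedBall (c : ℂ) R) :=
    fun v hv => (differentiableAt_id.cpow_const (hre v hv)).differentiableWithinAt
  have h := DiffContOnCl.circleIntegral_one_div_sub_center_pow_smul hR0 n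
    (hd.mono Metric.closure_ball_subset_closedBall).diffContOnCl
  rw [iteratedDeriv_cpow _ _ (hre _ (Metric.mem_closedBall_self hR0.le))] at h
  have e : ∀ v ∈ Metric.sphere (c : ℂ) R, v ^ (-s - 1) * (v / (v - (c : ℂ))) ^ (n + 1) =
      (1 / (v - (c : ℂ)) ^ (n + 1)) • v ^ ((n : ℂ) - s) := by
    intro v hv
    have hv0 : v ≠ 0 := Complex.slitPlane_ne_zero (hre v (Metric.sphere_subset_closedBall hv))
    have : v ^ ((n : ℂ) - s) = v ^ (-s - 1) * v ^ (n + 1) := by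
      rw [← Complex.cpow_natCast, ← Complex.cpow_add _ _ hv0]
      congr 1
      push_cast
      ring
    rw [this, smul_eq_mul, div_pow]
    ring
  have hprod : ∏ j ∈ Finset.range n, ((n : ℂ) - s - j) = ∏ j ∈ Finset.range n, (1 - s + j) := by
    rw [← Finset.prod_range_reflect]
    refine Finset.prod_congr rfl fun j hj => ?_
    have : j + 1 ≤ n := Finset.mem_range.1 hj
    rw [Nat.sub_sub, add_comm 1 j, Nat.cast_sub this]
    push_cast
    ring
  rw [contourInt_congr hR0.le e, contourInt, h, hprod, smul_eq_mul, sub_sub, add_comm s, ← sub_sub,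
    sub_self, zero_sub]
  have := Complex.two_pi_I_ne_zero
  field_simp

/-- This is Euler's limit for Γ(1 - s), inverted; the factors caused by n + 1 in place of n tend to
1. A nonzero imaginary part of s keeps all denominators away from 0. -/
theorem tendsto_hankel_prelimit {s : ℂ} (hs : s.im ≠ 0) :
    Tendsto (fun n : ℕ => (∏ j ∈ Finset.range n, (1 - s + j)) / (n.factorial : ℂ) *
      (((1 / (n + 1 : ℕ) : ℝ) : ℂ) ^ (-s))) atTop (𝓝 (Complex.Gamma (1 - s))⁻¹) := by
  have him : ∀ j : ℕ, 1 - s + j ≠ 0 := fun j h0 => by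
    have := congrArg Complex.im h0
    simp at this
    exact hs this
  have hG : Complex.Gamma (1 - s) ≠ 0 := Complex.Gamma_ne_zero fun k h0 => him k (by rw [h0]; ring)
  have h1 := (Complex.GammaSeq_tendsto_Gamma (1 - s)).inv₀ hG
  have hN : Tendsto (fun n : ℕ => (1 / (n : ℂ))) atTop (𝓝 0) := by
    simpa using tendsto_inv_natCast_ofReal
  have h2 : Tendsto (fun n : ℕ => (1 + (1 - s) * (1 / (n : ℂ)))⁻¹) atTop (𝓝 1) := by
    have := ((tendsto_const_nhds (x := (1 : ℂ))).add ((tendsto_const_nhds (x := 1 - s)).mul hN)).inv₀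
      (by simp)
    simpa using this
  have h3 : Tendsto (fun n : ℕ => (1 + 1 / (n : ℂ)) ^ s) atTop (𝓝 1) := by
    have h4 : Tendsto (fun n : ℕ => 1 + 1 / (n : ℂ)) atTop (𝓝 1) := by
      simpa using (tendsto_const_nhds (x := (1 : ℂ))).add hN
    have h5 := (continuousAt_cpow_const (b := s) Complex.one_mem_slitPlane).tendsto.comp h4
    simpa [Function.comp_def] using h5
  have h6 := (h2.mul h3).mul h1
  rw [one_mul, one_mul] at h6
  refine h6.congr' ?_
  filter_upwards [eventually_ge_atTop 1] with n hn
  have hn0 : (0 : ℝ) < n := by exact_mod_cast hn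
  have hnc : (n : ℂ) ≠ 0 := by exact_mod_cast hn0.ne'
  have hn1 : (1 + (1 - s) * (1 / (n : ℂ))) = (1 - s + n) / n := by
    field_simp
    ring
  have e1 : (1 + 1 / (n : ℂ)) ^ s = ((n + 1 : ℕ) : ℂ) ^ s * (n : ℂ) ^ (-s) := by
    have : (1 + 1 / (n : ℂ)) = (((n + 1 : ℕ) : ℝ) : ℂ) * (((n : ℝ)⁻¹ : ℝ) : ℂ) := by
      push_cast
      field_simp
    rw [this, Complex.mul_cpow_ofReal_nonneg (by positivity) (by positivity), Complex.ofReal_inv,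
      Complex.inv_cpow _ _ (by rw [Complex.ofReal_natCast, Complex.natCast_arg]; exact Real.pi_pos.ne),
      Complex.cpow_neg, Complex.ofReal_natCast, Complex.ofReal_natCast]
  have e2 : ((1 / (n + 1 : ℕ) : ℝ) : ℂ) ^ (-s) = ((n + 1 : ℕ) : ℂ) ^ s := by
    rw [one_div, Complex.ofReal_inv, Complex.ofReal_natCast, Complex.inv_cpow _ _
      (by rw [Complex.natCast_arg]; exact Real.pi_pos.ne), Complex.cpow_neg, inv_inv]
  have e3 : (n : ℂ) ^ (1 - s) = n * (n : ℂ) ^ (-s) := by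
    rw [sub_eq_add_neg, Complex.cpow_add _ _ hnc, Complex.cpow_one]
  have hne : (n : ℂ) ^ (-s) ≠ 0 := by simp [Complex.cpow_eq_zero_iff, hnc]
  have hfac : (n.factorial : ℂ) ≠ 0 := by exact_mod_cast Nat.factorial_ne_zero n
  rw [hn1, e1, e2, Complex.GammaSeq, e3, Finset.prod_range_succ]
  have := him n
  field_simp

theorem norm_cpow_neg_sub_one_le {v : ℂ} (hv : v ≠ 0) (s : ℂ) :
    ‖v ^ (-s - 1)‖ ≤ ‖v‖ ^ (-(s.re + 1)) * Real.exp (Real.pi * |s.im|) := by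
  rw [norm_cpow_eq hv]
  have e1 : (-s - 1).re = -(s.re + 1) := by simp; ring
  rw [e1]
  gcongr
  calc -(v.arg * (-s - 1).im) ≤ |v.arg * (-s - 1).im| := neg_le_abs _
    _ ≤ _ := by
      rw [abs_mul]
      have : (-s - 1).im = -s.im := by simp
      rw [this, abs_neg]
      exact mul_le_mul_of_nonneg_right (Complex.abs_arg_le_pi v) (abs_nonneg _)

/-- The integrand vanishes to order n + 1 at the origin through the N-th power, which outweighs
v^(-s-1) once n ≥ Re s + 1; the only other singularity is the pole at 1/(n + 1). -/
theorem eventually_contourInt_eq_xiInt {X : ℝ} (hX : 0 < X) (s : ℂ) :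
    ∀ᶠ n : ℕ in atTop, contourInt ((1 / (n + 1 : ℕ) : ℝ) : ℂ) (1 / (2 * (n + 1 : ℕ)) : ℝ)
      (fun v => v ^ (-s - 1) * (v / (v - ((1 / (n + 1 : ℕ) : ℝ) : ℂ))) ^ (n + 1)) =
      xiInt X (fun v => v ^ (-s - 1) * (v / (v - ((1 / (n + 1 : ℕ) : ℝ) : ℂ))) ^ (n + 1)) := by
  have h1 : ∀ᶠ n : ℕ in atTop, (1 / (n + 1 : ℕ) : ℝ) < X :=
    (tendsto_one_div_atTop_nhds_zero_nat.comp (tendsto_add_atTop_nat 1)).eventually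
      (gt_mem_nhds hX)
  filter_upwards [h1, eventually_ge_atTop ⌈s.re + 1⌉₊] with n hn hns
  set c : ℝ := 1 / (n + 1 : ℕ) with hc
  have hc0 : 0 < c := by positivity
  have hc1 : c ≤ 1 := by
    rw [hc, div_le_one (by positivity)]
    push_cast
    have : (0 : ℝ) ≤ n := n.cast_nonneg
    linarith
  have hRc : (1 / (2 * (n + 1 : ℕ)) : ℝ) = c / 2 := by
    rw [hc]
    field_simp
  rw [hRc]
  refine contourInt_eq_xiInt (lo := c) (hi := c) (B := 2 * X) (δ := c / 2)
    (C := Real.exp (Real.pi * |s.im|) * (2 / c) ^ (n + 1)) ?_ hc0 hX hn (by linarith) (by linarith)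
    (by linarith) (by linarith) (by linarith) (by linarith) (by linarith) ?_
  · refine DifferentiableOn.mul (fun v hv => ?_) (DifferentiableOn.pow (DifferentiableOn.div
      differentiableOn_id (by fun_prop) fun v hv h0 => ?_) _)
    · exact (differentiableAt_id.cpow_const hv.1).differentiableWithinAt
    · exact hv.2.2 (ofReal_mem_segment_of_sub_eq_zero ⟨le_rfl, le_rfl⟩ h0)
  · intro v hv0 hv _
    have hs : 0 < ‖v‖ := norm_pos_iff.2 hv0
    have hvc : c / 2 ≤ ‖v - (c : ℂ)‖ := by
      have := norm_sub_norm_le (c : ℂ) v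
      rw [Complex.norm_real, Real.norm_of_nonneg hc0.le, norm_sub_rev] at this
      linarith
    have h2 : ‖v / (v - (c : ℂ))‖ ^ (n + 1) ≤ (2 / c) ^ (n + 1) * ‖v‖ ^ (n + 1) := by
      rw [← mul_pow]
      gcongr
      rw [norm_div, div_le_iff₀ (by linarith)]
      calc ‖v‖ = 2 / c * ‖v‖ * (c / 2) := by field_simp
        _ ≤ _ := by gcongr
    have h3 : ‖v‖ ^ (-(s.re + 1)) * ‖v‖ ^ (n + 1) ≤ ‖v‖ ^ (-(1 / 4) : ℝ) := by
      rw [← Real.rpow_natCast, ← Real.rpow_add hs]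
      refine Real.rpow_le_rpow_of_exponent_ge hs (by linarith) ?_
      have := Nat.ceil_le.1 hns
      push_cast
      linarith
    rw [norm_mul, norm_pow]
    calc _ ≤ (‖v‖ ^ (-(s.re + 1)) * Real.exp (Real.pi * |s.im|)) *
          ((2 / c) ^ (n + 1) * ‖v‖ ^ (n + 1)) :=
          mul_le_mul (norm_cpow_neg_sub_one_le hv0 s) h2 (by positivity) (by positivity)
      _ = Real.exp (Real.pi * |s.im|) * (2 / c) ^ (n + 1) *
          (‖v‖ ^ (-(s.re + 1)) * ‖v‖ ^ (n + 1)) := by ring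
      _ ≤ _ := by gcongr

theorem tendsto_div_sub_pow {v : ℂ} (hv : v ≠ 0) :
    Tendsto (fun N : ℕ => (v / (v - ((1 / N : ℝ) : ℂ))) ^ N) atTop (𝓝 (Complex.exp (1 / v))) := by
  have h1 := (Complex.tendsto_one_add_div_pow_exp (-1 / v)).inv₀ (Complex.exp_ne_zero _)
  rw [← Complex.exp_neg, ← neg_div, neg_neg] at h1
  refine h1.congr fun N => ?_
  rw [← inv_pow]
  congr 1
  push_cast
  rcases eq_or_ne (N : ℂ) 0 with h | h
  · simp [h, hv]
  · rw [← inv_div (v - 1 / (N : ℂ)) v]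
    congr 1
    field_simp
    ring

/-- **Hankel's integral** for the reciprocal Gamma function. -/
theorem xiInt_cpow_mul_exp_inv {X : ℝ} (hX : 0 < X) {s : ℂ} (hs0 : 0 ≤ s.re) (hs : s.im ≠ 0) :
    xiInt X (fun v => v ^ (-s - 1) * Complex.exp (1 / v)) = (Complex.Gamma (1 - s))⁻¹ := by
  refine tendsto_nhds_unique ?_ (tendsto_hankel_prelimit hs)
  have hcongr : (fun n : ℕ => xiInt X (fun v => v ^ (-s - 1) *
      (v / (v - ((1 / (n + 1 : ℕ) : ℝ) : ℂ))) ^ (n + 1))) =ᶠ[atTop]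
      (fun n : ℕ => (∏ j ∈ Finset.range n, (1 - s + j)) / (n.factorial : ℂ) *
      (((1 / (n + 1 : ℕ) : ℝ) : ℂ) ^ (-s))) := by
    filter_upwards [eventually_contourInt_eq_xiInt hX s] with n hn
    rw [← hn, contourInt_cpow_mul_div_sub_pow]
  refine Tendsto.congr' hcongr ?_
  -- The same dichotomy and Bernoulli estimate as for the kernel dominate the prelimit; j = ⌈Re s⌉
  -- powers compensate v^(-s-1).
  obtain ⟨d, hd, hdich⟩ := exists_xiCurve_dichotomy hX (half_lt_self hX)
  set j : ℕ := ⌈s.re⌉₊ with hj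
  have hjs : s.re ≤ j := Nat.le_ceil _
  set E := Real.exp (Real.pi * |s.im|) with hE
  have hsmall : ∀ᶠ n : ℕ in atTop, (1 / (n + 1 : ℕ) : ℝ) ≤ X / 2 :=
    ((tendsto_one_div_atTop_nhds_zero_nat.comp (tendsto_add_atTop_nat 1)).eventually
      (gt_mem_nhds (half_pos hX))).mono fun n hn => hn.le
  have hne : ∀ n : ℕ, (1 / (n + 1 : ℕ) : ℝ) ≤ X / 2 → ∀ v ∈ xiCurve X,
      v - ((1 / (n + 1 : ℕ) : ℝ) : ℂ) ≠ 0 := by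
    intro n hn v hv h0
    exact xiCurve_subset_compl_segment hX (half_lt_self hX) hv
      (ofReal_mem_segment_of_sub_eq_zero ⟨by positivity, hn⟩ h0)
  refine tendsto_xiInt (p := 0) hX (by norm_num)
    (C := max (E * (2 * (j + 1)) ^ (j + 1) * X ^ (j - s.re)) (E * (d ^ (-(s.re + 1)) * Real.exp (1 / d))))
    ?_ ?_ ?_
  · filter_upwards [hsmall] with n hn
    refine ContinuousOn.mul (fun v hv => ?_) (ContinuousOn.pow (ContinuousOn.div
      continuousOn_id (by fun_prop) (hne n hn)) _)
    exact (continuousAt_cpow_const (mem_slitPlane_of_mem_xiCurve hX hv)).continuousWithinAt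
  · filter_upwards [hsmall, eventually_ge_atTop (2 * (j + 1))] with n hn hnj v hv
    have hv0 := xiCurve_ne_zero hX hv
    have hvn : 0 < ‖v‖ := norm_pos_iff.2 hv0
    have h1 := norm_cpow_neg_sub_one_le hv0 s
    rw [neg_zero, Real.rpow_zero, mul_one, norm_mul, norm_pow]
    rcases hdich v hv with h | h
    · refine le_trans ?_ (le_max_left _ _)
      have h2 := norm_div_sub_pow_le hv0 h j (N := n + 1) (by omega)
      calc _ ≤ (‖v‖ ^ (-(s.re + 1)) * E) * (2 * (j + 1) * ‖v‖) ^ (j + 1) :=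
            mul_le_mul h1 h2 (by positivity) (by positivity)
        _ = E * (2 * (j + 1)) ^ (j + 1) * (‖v‖ ^ (-(s.re + 1)) * ‖v‖ ^ (j + 1)) := by
            rw [mul_pow]
            ring
        _ = E * (2 * (j + 1)) ^ (j + 1) * ‖v‖ ^ (j - s.re) := by
            rw [← Real.rpow_natCast ‖v‖, ← Real.rpow_add hvn]
            congr 2
            push_cast
            ring
        _ ≤ _ := by
            gcongr
            exact norm_le_of_mem_xiCurve hX hv
    · refine le_trans ?_ (le_max_right _ _)
      have h2 := norm_div_sub_pow_le_exp hd (N := n + 1) (h _ ⟨by positivity, hn⟩)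
      have h3 : d ≤ ‖v‖ := by simpa using h 0 ⟨le_rfl, by linarith⟩
      calc _ ≤ (‖v‖ ^ (-(s.re + 1)) * E) * Real.exp (1 / d) :=
            mul_le_mul h1 h2 (by positivity) (by positivity)
        _ ≤ (d ^ (-(s.re + 1)) * E) * Real.exp (1 / d) := by
            gcongr ?_ * E * _
            exact Real.rpow_le_rpow_of_nonpos hd h3 (by linarith)
        _ = _ := by ring
  · exact fun v hv => ((tendsto_div_sub_pow (xiCurve_ne_zero hX hv)).comp
      (tendsto_add_atTop_nat 1)).const_mul _

theorem xiInt_scale {X w : ℝ} (hw : w ≠ 0) (f : ℂ → ℂ) :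
    xiInt X f = w * xiInt (X / w) (fun v => f (w * v)) := by
  rw [xiInt, xiInt, ← contourInt_const_mul]
  congr 1
  funext ω
  have h : (w : ℂ) ≠ 0 := Complex.ofReal_ne_zero.2 hw
  have e : (w : ℂ) * (((X / w : ℝ) : ℂ) * ω ^ (3 / 2 : ℂ)) = X * ω ^ (3 / 2 : ℂ) := by
    push_cast
    field_simp
  rw [e]
  push_cast
  field_simp

theorem xiInt_cpow_mul_exp {X w : ℝ} (hX : 0 < X) (hw : 0 < w) {s : ℂ} (hs0 : 0 ≤ s.re)
    (hs : s.im ≠ 0) :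
    xiInt X (fun v => v ^ (-s - 1) * Complex.exp (w / v)) =
      (w : ℂ) ^ (-s) * (Complex.Gamma (1 - s))⁻¹ := by
  have hwc : (w : ℂ) ≠ 0 := Complex.ofReal_ne_zero.2 hw.ne'
  have hXw : 0 < X / w := div_pos hX hw
  rw [xiInt_scale hw.ne', ← xiInt_cpow_mul_exp_inv hXw hs0 hs, ← xiInt_const_mul,
    ← xiInt_const_mul]
  refine xiInt_congr fun v hv => ?_
  have hv0 := xiCurve_ne_zero hXw hv
  rw [ofReal_mul_cpow hw hv0, Complex.cpow_sub _ _ hwc, Complex.cpow_one,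
    show (w : ℂ) / (w * v) = 1 / v by field_simp]
  field_simp

/-- The reflection formula at s and at s + ν, with sin π(s + ν) = (-1)^ν sin πs. -/
theorem Gamma_mul_inv_Gamma_one_sub_sub (ν : ℕ) {s : ℂ} (hs : s.im ≠ 0) :
    Complex.Gamma s * (Complex.Gamma (1 - (s + ν)))⁻¹ =
      (-1) ^ ν * (Complex.Gamma (ν + s) / Complex.Gamma (1 - s)) := by
  have hne : ∀ z : ℂ, z.im ≠ 0 → Complex.Gamma z ≠ 0 := fun z hz =>
    Complex.Gamma_ne_zero fun k h0 => hz (by simp [h0])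
  have h1 := Complex.Gamma_mul_Gamma_one_sub s
  have h2 := Complex.Gamma_mul_Gamma_one_sub (s + ν)
  have hsin : Complex.sin (Real.pi * (s + ν)) = (-1) ^ ν * Complex.sin (Real.pi * s) := by
    rw [mul_add, mul_comm (Real.pi : ℂ) ν]
    exact Complex.sin_antiperiodic.add_nat_mul_eq ν
  rw [hsin] at h2
  have g1 := hne (1 - s) (by simpa using hs)
  have g2 := hne (1 - (s + ν)) (by simpa using hs)
  rw [add_comm (ν : ℂ) s, ← div_eq_mul_inv, div_eq_iff g2, eq_comm, mul_div_assoc', div_mul_eq_mul_div,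
    div_eq_iff g1, h1, mul_assoc, h2]
  have h3 : ((-1 : ℂ) ^ ν) ≠ 0 := pow_ne_zero _ (by norm_num)
  field_simp

/-- In the sector e^(w/v) decays faster than any power of |v|, so with w > 0 fixed no singularity at
the origin remains. -/
theorem exists_rpow_mul_exp_div_bound (p : ℝ) {X w : ℝ} (hX : 0 < X) (hw : 0 < w) :
    ∃ C : ℝ, 0 ≤ C ∧ ∀ v ∈ xiCurve X, ‖v‖ ^ (-p) * ‖Complex.exp ((w : ℂ) / v)‖ ≤ C := by
  obtain ⟨d, hd, h⟩ := exists_xiCurve_dichotomy hX hX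
  set k : ℕ := ⌈p⌉₊ with hk
  have hkp : p ≤ k := Nat.le_ceil p
  refine ⟨max (k.factorial * (w / 2)⁻¹ ^ k * X ^ (k - p)) (max (d ^ (-p)) (X ^ (-p)) * Real.exp (w / d)),
    le_max_of_le_left (by positivity), fun v hv => ?_⟩
  have hv0 := xiCurve_ne_zero hX hv
  have hs : 0 < ‖v‖ := norm_pos_iff.2 hv0
  have hvX := norm_le_of_mem_xiCurve hX hv
  rcases h v hv with h1 | h1
  · refine le_trans ?_ (le_max_left _ _)
    have e1 := norm_exp_div_le_of_re_le hv0 h1 hw.le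
    have e2 := exp_neg_div_le (half_pos hw) hs k
    rw [show -(w / ‖v‖ / 2) = -(w / 2) / ‖v‖ by ring] at e1
    calc _ ≤ ‖v‖ ^ (-p) * (k.factorial * ((w / 2)⁻¹ ^ k * ‖v‖ ^ k)) := by
          gcongr
          exact e1.trans e2
      _ = k.factorial * (w / 2)⁻¹ ^ k * ‖v‖ ^ (k - p) := by
          rw [sub_eq_add_neg, Real.rpow_add hs, Real.rpow_natCast]
          ring
      _ ≤ _ := by gcongr
  · refine le_trans ?_ (le_max_right _ _)
    have hdv : d ≤ ‖v‖ := by simpa using h1 0 ⟨le_rfl, le_rfl⟩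
    refine mul_le_mul ?_ ?_ (norm_nonneg _) (le_max_of_le_left (by positivity))
    · rcases le_total 0 p with hp | hp
      · exact le_max_of_le_left (Real.rpow_le_rpow_of_nonpos hd hdv (by linarith))
      · exact le_max_of_le_right (Real.rpow_le_rpow hs.le hvX (by linarith))
    · refine (Complex.norm_exp_le_exp_norm _).trans (Real.exp_le_exp.2 ?_)
      rw [norm_div, Complex.norm_real, Real.norm_of_nonneg hw.le]
      gcongr

/-- The integral of `mellinH` against the Hankel kernel as an integral over a vertical line. -/
theorem xiInt_mellinH_mul_exp (ν κ : ℕ) {σ X w y : ℝ} (hσ : 0 < σ) (hX : 0 < X) (hw : 0 < w)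
    (hy : 0 < y) :
    xiInt X (fun v => mellinH (1 / 4) κ (v * y) * ((v ^ (ν + 1))⁻¹ * Complex.exp ((w : ℂ) / v))) =
      (-1) ^ ν * ((w : ℂ) ^ ν)⁻¹ * ((2 * Real.pi : ℂ)⁻¹ *
        ∫ t : ℝ, meijerIntegrand ![(ν : ℝ), (κ : ℝ)] ![0] (w * y) (σ + t * Complex.I)) := by
  set f : ℂ → ℝ → ℂ := fun v t => (Complex.Gamma (σ + t * Complex.I) *
    Complex.Gamma (σ + t * Complex.I + κ) * (v * y) ^ (-(σ + t * Complex.I))) *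
    ((v ^ (ν + 1))⁻¹ * Complex.exp ((w : ℂ) / v)) with hf
  have hyc : (y : ℂ) ≠ 0 := Complex.ofReal_ne_zero.2 hy.ne'
  have hwc : (w : ℂ) ≠ 0 := Complex.ofReal_ne_zero.2 hw.ne'
  have h1 : ∀ v ∈ xiCurve X, mellinH (1 / 4) κ (v * y) *
      ((v ^ (ν + 1))⁻¹ * Complex.exp ((w : ℂ) / v)) = (2 * Real.pi : ℂ)⁻¹ * ∫ t in univ, f v t := by
    intro v hv
    -- The line is moved from 1/4 to the abscissa σ, which will be that of the Meijer contour.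
    rw [mellinH_congr (by norm_num) hσ κ (mul_ofReal_mem_slitPlane
      (mem_slitPlane_of_mem_xiCurve hX hv) hy), mellinH, mul_assoc, ← integral_mul_const,
      Measure.restrict_univ]
  have hπ := Real.pi_pos
  obtain ⟨C₁, β, hC₁, hβ, hm⟩ := exists_norm_mellinH_integrand_le hσ κ (ψ := 3 * Real.pi / 4)
    (by positivity) (by linarith)
  obtain ⟨C₂, hC₂, he⟩ := exists_rpow_mul_exp_div_bound (σ + ν + 1) hX hw
  have hfc : ContinuousOn (Function.uncurry f) (xiCurve X ×ˢ univ) := by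
    have hG1 := continuous_Gamma_vertical hσ
    have hG2 := continuous_Gamma_vertical (show 0 < σ + κ by positivity)
    have hG3 : (fun y : ℝ => Complex.Gamma (((σ + κ : ℝ) : ℂ) + y * Complex.I)) =
        fun y : ℝ => Complex.Gamma (σ + y * Complex.I + κ) := by
      ext y
      congr 1
      push_cast
      ring
    rw [hG3] at hG2
    have h0 : ∀ p ∈ xiCurve X ×ˢ (univ : Set ℝ), p.1 ≠ 0 := fun p hp => xiCurve_ne_zero hX hp.1
    refine ContinuousOn.mul (ContinuousOn.mul ?_ fun p hp => ?_) (ContinuousOn.mul ?_ ?_)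
    · exact ((hG1.mul hG2).comp continuous_snd).continuousOn
    · refine ContinuousAt.continuousWithinAt (ContinuousAt.cpow (by fun_prop) (by fun_prop) ?_)
      exact mul_ofReal_mem_slitPlane (mem_slitPlane_of_mem_xiCurve hX hp.1) hy
    · exact ContinuousOn.inv₀ (by fun_prop) fun p hp => pow_ne_zero _ (h0 p hp)
    · exact ContinuousOn.cexp (ContinuousOn.div (by fun_prop) (by fun_prop) h0)
  have hfb : ∀ v ∈ xiCurve X, ∀ t ∈ (univ : Set ℝ),
      ‖f v t‖ ≤ y ^ (-σ) * C₁ * C₂ * Real.exp (-(β * |t|)) * ‖v‖ ^ (-(0 : ℝ)) := by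
    intro v hv t _
    have hv0 := xiCurve_ne_zero hX hv
    have hs : 0 < ‖v‖ := norm_pos_iff.2 hv0
    have harg : |(v * (y : ℂ)).arg| ≤ 3 * Real.pi / 4 := by
      rw [Complex.arg_mul_real hy]
      exact (abs_arg_lt_of_mem_xiCurve hX hv).le
    have e1 := hm (v * y) (mul_ne_zero hv0 hyc) harg t
    rw [norm_mul v, Complex.norm_real, Real.norm_of_nonneg hy.le,
      Real.mul_rpow hs.le hy.le] at e1
    have e2 := he v hv
    rw [neg_zero, Real.rpow_zero, mul_one, hf, norm_mul, norm_mul (v ^ (ν + 1))⁻¹, norm_inv, norm_pow]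
    calc _ ≤ ‖v‖ ^ (-σ) * y ^ (-σ) * (C₁ * Real.exp (-(β * |t|))) *
          ((‖v‖ ^ (ν + 1))⁻¹ * ‖Complex.exp ((w : ℂ) / v)‖) := by gcongr
      _ = y ^ (-σ) * C₁ * Real.exp (-(β * |t|)) *
          (‖v‖ ^ (-(σ + ν + 1)) * ‖Complex.exp ((w : ℂ) / v)‖) := by
          rw [show -(σ + ν + 1) = -σ + -((ν + 1 : ℕ) : ℝ) by push_cast; ring, Real.rpow_add hs,
            Real.rpow_neg hs.le ((ν + 1 : ℕ) : ℝ), Real.rpow_natCast]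
          ring
      _ ≤ y ^ (-σ) * C₁ * Real.exp (-(β * |t|)) * C₂ := by gcongr
      _ = _ := by ring
  have hswap := xiInt_integral_swap (p := 0) hX (by norm_num) MeasurableSet.univ hfc
    (integrable_exp_neg_mul_abs hβ).integrableOn hfb (by positivity) fun t _ => (Real.exp_pos _).le
  rw [xiInt_congr h1, xiInt_const_mul, hswap, Measure.restrict_univ, mul_left_comm]
  congr 1
  rw [← integral_const_mul]
  refine integral_congr_ae ?_
  -- Hankel's formula is available only for Im s ≠ 0, which excludes a single t.
  have hae : ∀ᵐ t : ℝ, t ≠ 0 := by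
    simp [ae_iff]
  filter_upwards [hae] with t ht
  set s : ℂ := σ + t * Complex.I with hs
  have hsim : s.im ≠ 0 := by simpa [hs] using ht
  have hsre : s.re = σ := by simp [hs]
  have e1 : ∀ v ∈ xiCurve X, f v t = Complex.Gamma s * Complex.Gamma (s + κ) * (y : ℂ) ^ (-s) *
      (v ^ (-(s + ν) - 1) * Complex.exp ((w : ℂ) / v)) := by
    intro v hv
    have hv0 := xiCurve_ne_zero hX hv
    simp only [hf, ← hs]
    rw [mul_comm v, ofReal_mul_cpow hy hv0, show -(s + ν) - 1 = -s + -((ν + 1 : ℕ) : ℂ) by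
      push_cast; ring, Complex.cpow_add _ _ hv0, Complex.cpow_neg v ((ν + 1 : ℕ) : ℂ),
      Complex.cpow_natCast]
    ring
  rw [xiInt_congr e1, xiInt_const_mul, xiInt_cpow_mul_exp hX hw
    (by simp only [Complex.add_re, hsre, Complex.natCast_re]; positivity) (by simpa using hsim)]
  have e2 := Gamma_mul_inv_Gamma_one_sub_sub ν hsim
  have e3 : (((w * y : ℝ) : ℂ)) ^ (-s) = (w : ℂ) ^ (-s) * (y : ℂ) ^ (-s) := by
    rw [Complex.ofReal_mul, ofReal_mul_cpow hw hyc]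
  have e4 : (w : ℂ) ^ (-(s + ν)) = (w : ℂ) ^ (-s) * ((w : ℂ) ^ ν)⁻¹ := by
    rw [neg_add, Complex.cpow_add _ _ hwc, Complex.cpow_neg _ (ν : ℂ), Complex.cpow_natCast]
  rw [meijerIntegrand, e3, e4]
  simp only [Fin.prod_univ_two, Fin.prod_univ_one, Matrix.cons_val_zero, Matrix.cons_val_one,
    Complex.ofReal_natCast, Complex.ofReal_zero, sub_zero, Matrix.cons_val_fin_one]
  rw [add_comm s (κ : ℂ)]
  calc _ = (Complex.Gamma s * (Complex.Gamma (1 - (s + ν)))⁻¹) * Complex.Gamma (κ + s) *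
        (y : ℂ) ^ (-s) * ((w : ℂ) ^ (-s) * ((w : ℂ) ^ ν)⁻¹) := by ring
    _ = _ := by
      rw [e2]
      ring

/-! ### The Meijer function with two upper Gamma factors -/

theorem exists_halving_bound {Z : ℝ} (hZ : 0 ≤ Z) (A : ℝ) :
    ∃ D : ℝ, 0 ≤ D ∧ ∀ u : ℕ → ℝ, (∀ n, 0 ≤ u n) → (∀ n, u (n + 1) ≤ 8 * Z * u n) →
      (∀ n : ℕ, (n - A) * u (n + 1) ≤ 4 * Z * u n) → ∀ n, u n ≤ D * (1 / 2) ^ n * u 0 := by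
  -- From index K on, n - A ≥ 8Z + 1, so each step at least halves u. The finitely many earlier
  -- steps cost a factor B each relative to halving.
  set K : ℕ := ⌈A + 8 * Z + 1⌉₊ with hK
  have hKA : A + 8 * Z + 1 ≤ K := Nat.le_ceil _
  set B : ℝ := max 1 (16 * Z) with hB
  have hB1 : 1 ≤ B := le_max_left _ _
  have hBZ : 16 * Z ≤ B := le_max_right _ _
  refine ⟨B ^ K, by positivity, fun u h0 h1 h2 n => ?_⟩
  have key : ∀ n, u n ≤ B ^ (min n K) * (1 / 2) ^ n * u 0 := by
    intro n
    induction n with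
    | zero => simp
    | succ n ih =>
      rcases lt_or_ge n K with h | h
      · rw [min_eq_left h.le] at ih
        rw [min_eq_left (by omega : n + 1 ≤ K), pow_succ, pow_succ]
        calc u (n + 1) ≤ 8 * Z * u n := h1 n
          _ ≤ B / 2 * u n := mul_le_mul_of_nonneg_right (by linarith) (h0 n)
          _ ≤ B / 2 * (B ^ n * (1 / 2) ^ n * u 0) := by gcongr
          _ = _ := by ring
      · rw [min_eq_right h] at ih
        rw [min_eq_right (by omega : K ≤ n + 1), pow_succ]
        have hnK : (K : ℝ) ≤ n := by exact_mod_cast h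
        have h3 : (8 * Z + 1) * u (n + 1) ≤ (8 * Z + 1) * (u n / 2) := by
          calc _ ≤ (n - A) * u (n + 1) := mul_le_mul_of_nonneg_right (by linarith) (h0 _)
            _ ≤ 4 * Z * u n := h2 n
            _ ≤ _ := by nlinarith [h0 n]
        have h4 := le_of_mul_le_mul_left h3 (by positivity)
        linarith
  refine (key n).trans ?_
  have := h0 0
  gcongr
  exact min_le_right _ _

/-- Geometric decay to the left, from a recursion in the variable. -/
theorem exists_shift_bound {f : ℂ → ℂ} {Z : ℝ} (hZ : 0 ≤ Z)
    (h1 : ∀ s : ℂ, (∀ k : ℤ, 1 / 2 ≤ ‖s - k‖) → ‖f (s - 1)‖ ≤ 8 * Z * ‖f s‖ ∧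
      (1 - s.re) * ‖f (s - 1)‖ ≤ 4 * Z * ‖f s‖) (A : ℝ) :
    ∃ D : ℝ, 0 ≤ D ∧ ∀ s : ℂ, (∀ k : ℤ, 1 / 2 ≤ ‖s - k‖) → s.re ≤ A → ∀ n : ℕ,
      ‖f (s - n)‖ ≤ D * (1 / 2) ^ n * ‖f s‖ := by
  obtain ⟨D, hD, h⟩ := exists_halving_bound hZ (A - 1)
  refine ⟨D, hD, fun s hs hA n => ?_⟩
  have hsep : ∀ n : ℕ, ∀ k : ℤ, 1 / 2 ≤ ‖s - n - k‖ := fun n k => by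
    have := hs (n + k)
    push_cast at this
    rwa [sub_sub]
  have e : ∀ n : ℕ, s - (n + 1 : ℕ) = s - n - 1 := fun n => by push_cast; ring
  have := h (fun n => ‖f (s - n)‖) (fun n => norm_nonneg _) (fun n => ?_) (fun n => ?_) n
  · simpa using this
  · simp only [e]
    exact (h1 _ (hsep n)).1
  · simp only [e]
    refine le_trans (mul_le_mul_of_nonneg_right ?_ (norm_nonneg _)) (h1 _ (hsep n)).2
    simp
    linarith

/-- Extracts both recursion bounds from a functional equation with three linear factors:
half-distance from the integers bounds each factor below, and the third one grows to the left. -/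
theorem bounds_of_mul_eq {a c Z p q r x : ℝ} (ha : 0 ≤ a) (h : a * (p * q * r) = Z * c)
    (hp : 1 / 2 ≤ p) (hq : 1 / 2 ≤ q) (hr : 1 / 2 ≤ r) (hx : x ≤ r) :
    a ≤ 8 * Z * c ∧ x * a ≤ 4 * Z * c := by
  have h1 : 1 / 4 ≤ p * q := by nlinarith
  have h2 : r * a ≤ 4 * Z * c := by
    have : 1 / 4 * (r * a) ≤ p * q * (r * a) := mul_le_mul_of_nonneg_right h1 (by positivity)
    linarith
  have h3 : x * a ≤ r * a := mul_le_mul_of_nonneg_right hx ha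
  have h4 : 1 / 2 * a ≤ r * a := mul_le_mul_of_nonneg_right hr ha
  exact ⟨by linarith, by linarith⟩

theorem tendsto_nat_mul_exp_neg {c : ℝ} (hc : 0 < c) :
    Tendsto (fun n : ℕ => (n : ℝ) * Real.exp (-(c * n))) atTop (𝓝 0) := by
  refine (tendsto_self_mul_const_pow_of_lt_one (Real.exp_pos (-c)).le
    (Real.exp_lt_one_iff.2 (by linarith))).congr fun n => ?_
  rw [← Real.exp_nat_mul]
  ring_nf

theorem integrableOn_horizontal {f : ℂ → ℂ} {σ τ C c : ℝ} (hc : 0 < c)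
    (hf : ∀ s : ℂ, s.re ≤ σ → s.im = τ → ContinuousAt f s)
    (hb : ∀ s : ℂ, s.re ≤ σ → s.im = τ → ‖f s‖ ≤ C * Real.exp (c * s.re)) :
    IntegrableOn (fun x : ℝ => f (x + τ * Complex.I)) (Iic σ) := by
  refine Integrable.mono' ((integrableOn_exp_mul_Iic hc σ).const_mul C)
    (ContinuousOn.aestronglyMeasurable (fun x hx => ?_) measurableSet_Iic) ?_
  · exact (ContinuousAt.comp (f := fun x : ℝ => (x + τ * Complex.I : ℂ))
      (hf _ (by simpa using hx) (by simp)) (by fun_prop)).continuousWithinAt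
  · refine (ae_restrict_iff' measurableSet_Iic).2 (Eventually.of_forall fun x hx => ?_)
    simpa using hb (x + τ * Complex.I) (by simpa using hx) (by simp)

/-- Cauchy's theorem in a quadrant open to the left (upper for `ε = 1`, lower for `ε = -1`). -/
theorem integral_quadrant {f : ℂ → ℂ} {σ C c c' ε : ℝ} (hε : ε * ε = 1) (hc : 0 < c) (hc' : 0 < c')
    (hC : 0 ≤ C) (hf : ∀ s : ℂ, s.re ≤ σ → 1 ≤ ε * s.im → DifferentiableAt ℂ f s)
    (hb : ∀ s : ℂ, s.re ≤ σ → 1 ≤ ε * s.im →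
      ‖f s‖ ≤ C * Real.exp (c * s.re) * Real.exp (-(c' * (ε * s.im)))) :
    IntegrableOn (fun y : ℝ => f (σ + (ε * y : ℝ) * Complex.I)) (Ioi 1) ∧
    (∫ x in Iic σ, f (x + ε * Complex.I)) +
      Complex.I * (ε * ∫ y in Ioi (1 : ℝ), f (σ + (ε * y : ℝ) * Complex.I)) = 0 := by
  have hb1 : ∀ s : ℂ, s.re ≤ σ → 1 ≤ ε * s.im → ‖f s‖ ≤ C * Real.exp (c * s.re) := fun s h1 h2 =>
    (hb s h1 h2).trans (mul_le_of_le_one_right (by positivity)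
      (Real.exp_le_one_iff.2 (by nlinarith)))
  have hih : IntegrableOn (fun x : ℝ => f (x + ε * Complex.I)) (Iic σ) :=
    integrableOn_horizontal hc (fun s h1 h2 => (hf s h1 (by rw [h2, hε])).continuousAt)
      fun s h1 h2 => hb1 s h1 (by rw [h2, hε])
  have hεy : ∀ y : ℝ, ε * (ε * y) = y := fun y => by rw [← mul_assoc, hε, one_mul]
  have hiv : IntegrableOn (fun y : ℝ => f (σ + (ε * y : ℝ) * Complex.I)) (Ioi 1) := by
    refine Integrable.mono' ((exp_neg_integrableOn_Ioi 1 hc').const_mul (C * Real.exp (c * σ)))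
      (ContinuousOn.aestronglyMeasurable (fun y hy => ?_) measurableSet_Ioi) ?_
    · refine (ContinuousAt.comp (f := fun y : ℝ => (σ + (ε * y : ℝ) * Complex.I : ℂ))
        (hf _ (by simp) ?_).continuousAt (by fun_prop)).continuousWithinAt
      simpa [hεy] using (mem_Ioi.1 hy).le
    · refine (ae_restrict_iff' measurableSet_Ioi).2 (Eventually.of_forall fun y hy => ?_)
      have := hb (σ + (ε * y : ℝ) * Complex.I) (by simp) (by simpa [hεy] using (mem_Ioi.1 hy).le)
      simpa [hεy] using this
  refine ⟨hiv, ?_⟩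
  set M : ℝ := C * Real.exp (c * σ) with hM
  have hrect : ∀ n : ℕ, (∫ x in (σ - n)..σ, f (x + ε * Complex.I)) -
      (∫ x in (σ - n)..σ, f (x + (ε * (1 + n) : ℝ) * Complex.I)) +
      Complex.I * (ε * ∫ y in (1 : ℝ)..(1 + n), f (σ + (ε * y : ℝ) * Complex.I)) -
      Complex.I * (ε * ∫ y in (1 : ℝ)..(1 + n), f ((σ - n : ℝ) + (ε * y : ℝ) * Complex.I)) = 0 := by
    intro n
    have h := Complex.integral_boundary_rect_eq_zero_of_differentiableOn f
      ((σ - n : ℝ) + ε * Complex.I) (σ + (ε * (1 + n) : ℝ) * Complex.I) ?_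
    · simp only [Complex.add_re, Complex.ofReal_re, Complex.mul_re, Complex.I_re, mul_zero,
        Complex.ofReal_im, Complex.I_im, mul_one, sub_self, add_zero, Complex.add_im,
        Complex.mul_im, zero_add, smul_eq_mul] at h
      -- The substitution y ↦ εy treats the upper and the lower quadrant at once; the factor ε
      -- records the orientation.
      have e : ∀ g : ℝ → ℂ, ∫ y in ε..(ε * (1 + n)), g y =
          ε * ∫ y in (1 : ℝ)..(1 + n), g (ε * y) := by
        intro g
        have := intervalIntegral.smul_integral_comp_mul_left (a := 1) (b := 1 + (n : ℝ)) g ε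
        rw [mul_one, Complex.real_smul] at this
        exact this.symm
      rw [e, e] at h
      exact h
    · intro s hs
      refine (hf s ?_ ?_).differentiableWithinAt
      · have h1 := hs.1
        simp only [mem_preimage, Complex.add_re, Complex.ofReal_re, Complex.mul_re, Complex.I_re,
          mul_zero, Complex.ofReal_im, Complex.I_im, mul_one, sub_self, add_zero] at h1
        rw [uIcc_of_le (by linarith [n.cast_nonneg (α := ℝ)])] at h1
        exact h1.2
      · have h2 := hs.2
        simp only [mem_preimage, Complex.add_im, Complex.ofReal_im, Complex.mul_im, Complex.I_re,
          mul_zero, Complex.ofReal_re, Complex.I_im, mul_one, zero_add, add_zero] at h2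
        have h3 : ε * s.im ∈ uIcc (1 : ℝ) (1 + n) := by
          have : s.im ∈ (fun x => ε * x) '' uIcc (1 : ℝ) (1 + n) := by
            rw [image_const_mul_uIcc, mul_one]
            exact h2
          obtain ⟨x, hx, hxs⟩ := this
          rw [← hxs]
          simpa only [hεy] using hx
        rw [uIcc_of_le (by linarith [n.cast_nonneg (α := ℝ)])] at h3
        exact h3.1
  have t1 : Tendsto (fun n : ℕ => ∫ x in (σ - n)..σ, f (x + ε * Complex.I)) atTop
      (𝓝 (∫ x in Iic σ, f (x + ε * Complex.I))) :=
    intervalIntegral_tendsto_integral_Iic σ hih (tendsto_atBot_add_const_left _ σ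
      (tendsto_neg_atTop_atBot.comp tendsto_natCast_atTop_atTop))
  -- The upper edge of the box has length n and height 1 + n, so the decay in |Im s| makes it O(n
  -- e^(-c'n)); the left edge is handled alike by the decay in Re s.
  have t2 : Tendsto (fun n : ℕ => ∫ x in (σ - n)..σ, f (x + (ε * (1 + n) : ℝ) * Complex.I)) atTop
      (𝓝 0) := by
    refine squeeze_zero_norm (a := fun n : ℕ => M * (n * Real.exp (-(c' * n)))) (fun n => ?_)
      (by simpa using (tendsto_nat_mul_exp_neg hc').const_mul M)
    have hn0 : (0 : ℝ) ≤ n := n.cast_nonneg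
    have := intervalIntegral.norm_integral_le_of_norm_le_const (a := σ - n) (b := σ)
      (C := M * Real.exp (-(c' * n)))
      (f := fun x : ℝ => f (x + (ε * (1 + n) : ℝ) * Complex.I)) fun x hx => ?_
    · rw [sub_sub_cancel, abs_of_nonneg hn0] at this
      refine this.trans (le_of_eq (by ring))
    · rw [uIoc_of_le (by linarith)] at hx
      refine (hb _ (by simpa using hx.2) (by simp [hεy])).trans ?_
      simp only [Complex.add_re, Complex.ofReal_re, Complex.mul_re, Complex.I_re,
          mul_zero, Complex.ofReal_im, Complex.I_im, mul_one, sub_self, add_zero, Complex.add_im,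
        Complex.mul_im, zero_add, hεy]
      rw [hM]
      gcongr
      · exact hx.2
      · linarith
  have t3 : Tendsto (fun n : ℕ => ∫ y in (1 : ℝ)..(1 + n), f (σ + (ε * y : ℝ) * Complex.I)) atTop
      (𝓝 (∫ y in Ioi (1 : ℝ), f (σ + (ε * y : ℝ) * Complex.I))) :=
    intervalIntegral_tendsto_integral_Ioi 1 hiv
      (tendsto_atTop_add_const_left _ 1 tendsto_natCast_atTop_atTop)
  have t4 : Tendsto (fun n : ℕ => ∫ y in (1 : ℝ)..(1 + n),
      f ((σ - n : ℝ) + (ε * y : ℝ) * Complex.I)) atTop (𝓝 0) := by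
    refine squeeze_zero_norm (a := fun n : ℕ => M * (n * Real.exp (-(c * n)))) (fun n => ?_)
      (by simpa using (tendsto_nat_mul_exp_neg hc).const_mul M)
    have hn0 : (0 : ℝ) ≤ n := n.cast_nonneg
    have := intervalIntegral.norm_integral_le_of_norm_le_const (a := 1) (b := 1 + (n : ℝ))
      (C := M * Real.exp (-(c * n)))
      (f := fun y : ℝ => f ((σ - n : ℝ) + (ε * y : ℝ) * Complex.I)) fun y hy => ?_
    · rw [add_sub_cancel_left, abs_of_nonneg hn0] at this
      refine this.trans (le_of_eq (by ring))
    · rw [uIoc_of_le (by linarith)] at hy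
      refine (hb1 _ (by simp) (by simpa [hεy] using hy.1.le)).trans (le_of_eq ?_)
      rw [hM, mul_assoc, ← Real.exp_add]
      congr 2
      simp
      ring
  have hlim := ((t1.sub t2).add ((t3.const_mul (ε : ℂ)).const_mul Complex.I)).sub
    ((t4.const_mul (ε : ℂ)).const_mul Complex.I)
  simp only [hrect, sub_zero, mul_zero] at hlim
  exact tendsto_nhds_unique hlim tendsto_const_nhds

/-- A vertical line bent to the left. -/
theorem integral_vertical_eq_loop {f : ℂ → ℂ} {σ C c c' : ℝ} (hc : 0 < c) (hc' : 0 < c') (hC : 0 ≤ C)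
    (hf : ∀ s : ℂ, s.re ≤ σ → 1 ≤ |s.im| → DifferentiableAt ℂ f s)
    (hfσ : ∀ t : ℝ, ContinuousAt f (σ + t * Complex.I))
    (hb : ∀ s : ℂ, s.re ≤ σ → 1 ≤ |s.im| →
      ‖f s‖ ≤ C * Real.exp (c * s.re) * Real.exp (-(c' * |s.im|))) :
    Complex.I * ∫ t : ℝ, f (σ + t * Complex.I) =
      (∫ x in Iic σ, f (x - Complex.I)) + Complex.I * (∫ t in (-1 : ℝ)..1, f (σ + t * Complex.I)) -
        ∫ x in Iic σ, f (x + Complex.I) := by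
  obtain ⟨hi1, h1⟩ := integral_quadrant (ε := 1) (by norm_num) hc hc' hC
    (fun s hs1 hs2 => hf s hs1 (hs2.trans (by rw [one_mul]; exact le_abs_self _)))
    (fun s hs1 hs2 => by
      have h0 : 0 ≤ s.im := by linarith
      have := hb s hs1 (by rw [abs_of_nonneg h0]; linarith)
      rwa [abs_of_nonneg h0, ← one_mul s.im] at this)
  obtain ⟨hi2, h2⟩ := integral_quadrant (ε := -1) (by norm_num) hc hc' hC
    (fun s hs1 hs2 => hf s hs1 (hs2.trans (by rw [neg_one_mul]; exact neg_le_abs _)))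
    (fun s hs1 hs2 => by
      have h0 : s.im ≤ 0 := by linarith
      have := hb s hs1 (by rw [abs_of_nonpos h0]; linarith)
      rwa [abs_of_nonpos h0, ← neg_one_mul s.im] at this)
  set g : ℝ → ℂ := fun t => f (σ + t * Complex.I) with hg
  have hgc : Continuous g := continuous_iff_continuousAt.2 fun t =>
    ContinuousAt.comp (f := fun t : ℝ => (σ + t * Complex.I : ℂ)) (hfσ t) (by fun_prop)
  have hi1' : IntegrableOn g (Ioi 1) := by simpa [hg] using hi1
  have hi2' : IntegrableOn (fun y => g (-y)) (Ioi 1) := by simpa [hg] using hi2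
  have hi3 : IntegrableOn g (Iic (-1)) := by
    have := (integrableOn_Iic_iff_integrableOn_Iio (f := g) (b := -1) (μ := volume)).2
    refine this ?_
    have h6 := (Measure.measurePreserving_neg (volume : Measure ℝ)).integrableOn_comp_preimage
      (Homeomorph.neg ℝ).measurableEmbedding (f := g) (s := Iio (-1))
    rw [← h6]
    simpa [Function.comp_def] using hi2'
  have hg1 : ∫ y in Ioi (1 : ℝ), g y = ∫ y in Ioi (1 : ℝ), f (σ + (1 * y : ℝ) * Complex.I) := by
    simp [hg]
  have hg2 : ∫ y in Iic (-1 : ℝ), g y = ∫ y in Ioi (1 : ℝ), f (σ + (-1 * y : ℝ) * Complex.I) := by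
    rw [← integral_comp_neg_Ioi]
    simp [hg]
  have hsplit : ∫ t : ℝ, g t = (∫ t in Iic (-1 : ℝ), g t) + (∫ t in (-1 : ℝ)..1, g t) +
      ∫ t in Ioi (1 : ℝ), g t := by
    have hic : IntegrableOn g (Ioc (-1) 1) := (hgc.integrableOn_Icc (a := -1) (b := 1)).mono_set
      Ioc_subset_Icc_self
    rw [intervalIntegral.integral_of_le (by norm_num), ← setIntegral_union (by
      rw [Set.disjoint_left]; intro x hx hx2; exact absurd hx2.1 (not_lt.2 hx)) measurableSet_Ioc hi3 hic,
      Iic_union_Ioc_eq_Iic (by norm_num), ← setIntegral_univ, ← Iic_union_Ioi (a := (1 : ℝ)),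
      setIntegral_union (Iic_disjoint_Ioi le_rfl) measurableSet_Ioi _ hi1']
    rw [← Iic_union_Ioc_eq_Iic (by norm_num : (-1 : ℝ) ≤ 1)]
    exact hi3.union hic
  rw [← hg1] at h1
  rw [← hg2] at h2
  push_cast at h1 h2
  simp only [one_mul, neg_mul, ← sub_eq_add_neg] at h1 h2
  rw [hsplit]
  linear_combination h1 - h2

theorem norm_sin_le_exp_abs_im (z : ℂ) : ‖Complex.sin z‖ ≤ Real.exp |z.im| := by
  have h1 : ‖Complex.exp (-z * Complex.I)‖ ≤ Real.exp |z.im| := by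
    rw [Complex.norm_exp]
    simpa using le_abs_self z.im
  have h2 : ‖Complex.exp (z * Complex.I)‖ ≤ Real.exp |z.im| := by
    rw [Complex.norm_exp]
    simpa using neg_le_abs z.im
  rw [Complex.sin, norm_div, norm_mul, Complex.norm_I, mul_one, Complex.norm_ofNat]
  have := norm_sub_le (Complex.exp (-z * Complex.I)) (Complex.exp (z * Complex.I))
  linarith

theorem meijerIntegrand_two_one (ν κ : ℕ) (Z : ℝ) (s : ℂ) :
    meijerIntegrand ![(ν : ℝ), (κ : ℝ)] ![0] Z s =
      Complex.Gamma (ν + s) * Complex.Gamma (κ + s) / Complex.Gamma (1 - s) * (Z : ℂ) ^ (-s) := by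
  simp [meijerIntegrand, Fin.prod_univ_two]

theorem meijerIntegrand_one_two (ν κ : ℕ) (Z : ℝ) (s : ℂ) :
    meijerIntegrand ![0] ![-(ν : ℝ), -(κ : ℝ)] Z s =
      Complex.Gamma s / (Complex.Gamma (1 + ν - s) * Complex.Gamma (1 + κ - s)) *
        (Z : ℂ) ^ (-s) := by
  simp [meijerIntegrand, Fin.prod_univ_two]

theorem differentiableAt_meijerIntegrand_two_one (ν κ : ℕ) {Z : ℝ} (hZ : 0 < Z) {s : ℂ}
    (hs : ∀ m : ℕ, s ≠ -m) :
    DifferentiableAt ℂ (meijerIntegrand ![(ν : ℝ), (κ : ℝ)] ![0] Z) s := by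
  have hZc : (Z : ℂ) ≠ 0 := Complex.ofReal_ne_zero.2 hZ.ne'
  have e : meijerIntegrand ![(ν : ℝ), (κ : ℝ)] ![0] Z = fun s =>
      Complex.Gamma (ν + s) * Complex.Gamma (κ + s) * (Complex.Gamma (1 - s))⁻¹ *
        (Z : ℂ) ^ (-s) := by
    funext s
    rw [meijerIntegrand_two_one, div_eq_mul_inv]
  have hG : ∀ n : ℕ, DifferentiableAt ℂ (fun s => Complex.Gamma (n + s)) s := fun n =>
    DifferentiableAt.comp (g := Complex.Gamma) s (Complex.differentiableAt_Gamma _ fun m hm =>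
      hs (m + n) (by push_cast; linear_combination hm)) (by fun_prop)
  have hI : DifferentiableAt ℂ (fun s => (Complex.Gamma (1 - s))⁻¹) s :=
    DifferentiableAt.comp (g := fun s => (Complex.Gamma s)⁻¹) s
      (Complex.differentiable_one_div_Gamma _) (by fun_prop)
  rw [e]
  exact (((hG ν).mul (hG κ)).mul hI).mul
    (DifferentiableAt.const_cpow (by fun_prop) (Or.inl hZc))

theorem meijerIntegrand_two_one_sub_one (ν κ : ℕ) {Z : ℝ} (hZ : 0 < Z) {s : ℂ}
    (hs : ∀ k : ℤ, s ≠ k) :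
    meijerIntegrand ![(ν : ℝ), (κ : ℝ)] ![0] Z (s - 1) *
      ((s - ((1 - ν : ℤ) : ℂ)) * (s - ((1 - κ : ℤ) : ℂ)) * (1 - s)) =
        Z * meijerIntegrand ![(ν : ℝ), (κ : ℝ)] ![0] Z s := by
  have hZc : (Z : ℂ) ≠ 0 := Complex.ofReal_ne_zero.2 hZ.ne'
  have hG : ∀ n : ℕ, Complex.Gamma (n + s) = (s - ((1 - n : ℤ) : ℂ)) * Complex.Gamma (n + (s - 1)) := by
    intro n
    have : (n : ℂ) + (s - 1) ≠ 0 := fun h0 => hs (1 - n) (by push_cast; linear_combination h0)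
    rw [show (n : ℂ) + s = (n + (s - 1)) + 1 by ring, Complex.Gamma_add_one _ this]
    push_cast
    ring
  have h1 : 1 - s ≠ 0 := fun h0 => hs 1 (by push_cast; linear_combination -h0)
  have hI : Complex.Gamma (1 - (s - 1)) = (1 - s) * Complex.Gamma (1 - s) := by
    rw [show 1 - (s - 1) = (1 - s) + 1 by ring, Complex.Gamma_add_one _ h1]
  have hp : (Z : ℂ) ^ (-(s - 1)) = Z * (Z : ℂ) ^ (-s) := by
    rw [neg_sub, sub_eq_add_neg, Complex.cpow_add _ _ hZc, Complex.cpow_one]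
  have h2 : Complex.Gamma (1 - s) ≠ 0 := Complex.Gamma_ne_zero fun m hm =>
    hs (m + 1) (by push_cast; linear_combination -hm)
  rw [meijerIntegrand_two_one, meijerIntegrand_two_one, hG ν, hG κ, hI, hp]
  field_simp

theorem ne_intCast_of_separated {s : ℂ} (hs : ∀ k : ℤ, 1 / 2 ≤ ‖s - k‖) (k : ℤ) : s ≠ k :=
  fun h0 => by
    have := hs k
    rw [h0, sub_self, norm_zero] at this
    norm_num at this

theorem exists_shift_bound_two_one (ν κ : ℕ) {Z : ℝ} (hZ : 0 < Z) (A : ℝ) :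
    ∃ D : ℝ, 0 ≤ D ∧ ∀ s : ℂ, (∀ k : ℤ, 1 / 2 ≤ ‖s - k‖) → s.re ≤ A → ∀ n : ℕ,
      ‖meijerIntegrand ![(ν : ℝ), (κ : ℝ)] ![0] Z (s - n)‖ ≤
        D * (1 / 2) ^ n * ‖meijerIntegrand ![(ν : ℝ), (κ : ℝ)] ![0] Z s‖ := by
  refine exists_shift_bound hZ.le (fun s hs => ?_) A
  have h := congrArg norm (meijerIntegrand_two_one_sub_one ν κ hZ (ne_intCast_of_separated hs))
  rw [norm_mul, norm_mul, norm_mul, norm_mul, Complex.norm_real, Real.norm_of_nonneg hZ.le] at h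
  have h1 := hs 1
  rw [Int.cast_one, norm_sub_rev] at h1
  refine bounds_of_mul_eq (norm_nonneg _) h (hs _) (hs _) h1 ?_
  have := Complex.re_le_norm (1 - s)
  simpa using this

/-- By reflection 1/Γ(1 - s) = Γ(s) sin(πs)/π. Three Gamma factors decay at rate φ each and the sine
grows at rate π; φ = 5π/12 leaves 3φ - π = π/4. -/
theorem exists_strip_bound_two_one (ν κ : ℕ) {Z : ℝ} (hZ : 0 < Z) {σ₀ : ℝ} (hσ₀ : 0 < σ₀) :
    ∃ C : ℝ, 0 ≤ C ∧ ∀ s : ℂ, s.re ∈ Icc σ₀ (σ₀ + 1) → s.im ≠ 0 →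
      ‖meijerIntegrand ![(ν : ℝ), (κ : ℝ)] ![0] Z s‖ ≤ C * Real.exp (-(Real.pi / 4 * |s.im|)) := by
  have hπ := Real.pi_pos
  set φ : ℝ := 5 * Real.pi / 12 with hφ
  have hφ0 : 0 ≤ φ := by positivity
  have hφ1 : φ < Real.pi / 2 := by rw [hφ]; linarith
  have hcos : 0 < Real.cos φ := Real.cos_pos_of_mem_Ioo ⟨by linarith, hφ1⟩
  set h : ℝ → ℝ := fun x => Real.cos φ ^ (-x) * Real.Gamma x with hh
  have hhc : ∀ n : ℕ, ContinuousOn (fun x : ℝ => h (n + x)) (Icc σ₀ (σ₀ + 1)) := by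
    intro n x hx
    have hx0 : 0 < n + x := by
      have := hx.1
      have := n.cast_nonneg (α := ℝ)
      linarith
    have hG : ContinuousAt Real.Gamma (n + x) :=
      (Real.differentiableAt_Gamma fun m hm => by
        have : (0 : ℝ) ≤ m := m.cast_nonneg
        linarith).continuousAt
    have hat : ContinuousAt h (n + x) := ContinuousAt.mul (ContinuousAt.rpow continuousAt_const
      continuousAt_neg (Or.inl hcos.ne')) hG
    exact (ContinuousAt.comp (f := fun x : ℝ => (n : ℝ) + x) hat (by fun_prop)).continuousWithinAt
  have hcont : ContinuousOn (fun x : ℝ => h (ν + x) * h (κ + x) * (h ((0 : ℕ) + x) / Real.pi) *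
      Z ^ (-x)) (Icc σ₀ (σ₀ + 1)) := by
    refine (((hhc ν).mul (hhc κ)).mul ((hhc 0).div_const _)).mul ?_
    exact ContinuousOn.rpow continuousOn_const continuousOn_neg fun x _ => Or.inl hZ.ne'
  obtain ⟨C, hC⟩ := isCompact_Icc.exists_bound_of_continuousOn hcont
  refine ⟨max C 0, le_max_right _ _, fun s hs him => ?_⟩
  have hs0 : 0 < s.re := hσ₀.trans_le hs.1
  have hΓ : ∀ n : ℕ, ‖Complex.Gamma (n + s)‖ ≤ h (n + s.re) * Real.exp (-(φ * |s.im|)) := by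
    intro n
    have := norm_Gamma_le_exp (s := n + s) (by simp; positivity) hφ0 hφ1
    simpa [hh] using this
  have hpos : ∀ n : ℕ, 0 ≤ h (n + s.re) := fun n => by
    have := Real.Gamma_pos_of_pos (show 0 < n + s.re by positivity)
    simp only [hh]
    positivity
  have hinv : (Complex.Gamma (1 - s))⁻¹ = Complex.Gamma s * Complex.sin (Real.pi * s) / Real.pi := by
    have h1 := Complex.Gamma_mul_Gamma_one_sub s
    have h2 : Complex.Gamma (1 - s) ≠ 0 := Complex.Gamma_ne_zero fun k h0 => him (by
      have := congrArg Complex.im h0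
      simpa using this)
    have h3 : Complex.sin (Real.pi * s) ≠ 0 := by
      intro h0
      rw [h0, div_zero] at h1
      refine (mul_ne_zero (Complex.Gamma_ne_zero fun k h0 => him ?_) h2) h1
      have := congrArg Complex.im h0
      simpa using this
    have hπc : (Real.pi : ℂ) ≠ 0 := Complex.ofReal_ne_zero.2 hπ.ne'
    rw [eq_div_iff h3] at h1
    rw [eq_div_iff hπc, inv_mul_eq_iff_eq_mul₀ h2, ← mul_assoc, mul_comm (Complex.Gamma (1 - s)), h1]
  have hinvn : ‖(Complex.Gamma (1 - s))⁻¹‖ ≤ h ((0 : ℕ) + s.re) / Real.pi *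
      (Real.exp (-(φ * |s.im|)) * Real.exp (Real.pi * |s.im|)) := by
    rw [hinv, norm_div, norm_mul, Complex.norm_real, Real.norm_of_nonneg hπ.le]
    have h1 := hΓ 0
    have h2 := norm_sin_le_exp_abs_im (Real.pi * s)
    rw [Complex.im_ofReal_mul, abs_mul, abs_of_pos hπ] at h2
    simp only [Nat.cast_zero, zero_add] at h1 ⊢
    calc _ ≤ (h s.re * Real.exp (-(φ * |s.im|))) * Real.exp (Real.pi * |s.im|) / Real.pi := by
          gcongr
      _ = _ := by ring
  rw [meijerIntegrand_two_one, div_eq_mul_inv, norm_mul, norm_mul, norm_mul,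
    Complex.norm_cpow_eq_rpow_re_of_pos hZ]
  have h0 := hpos 0
  have hν := hpos ν
  have hκ := hpos κ
  calc _ ≤ (h (ν + s.re) * Real.exp (-(φ * |s.im|))) * (h (κ + s.re) * Real.exp (-(φ * |s.im|))) *
        (h ((0 : ℕ) + s.re) / Real.pi * (Real.exp (-(φ * |s.im|)) * Real.exp (Real.pi * |s.im|))) *
        Z ^ (-s).re := by
        have := hΓ ν
        have := hΓ κ
        gcongr
    _ = (h (ν + s.re) * h (κ + s.re) * (h ((0 : ℕ) + s.re) / Real.pi) * Z ^ (-s.re)) *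
        (Real.exp (-(φ * |s.im|)) * Real.exp (-(φ * |s.im|)) * (Real.exp (-(φ * |s.im|)) *
          Real.exp (Real.pi * |s.im|))) := by
        rw [Complex.neg_re]
        ring
    _ ≤ max C 0 * (Real.exp (-(φ * |s.im|)) * Real.exp (-(φ * |s.im|)) * (Real.exp (-(φ * |s.im|)) *
          Real.exp (Real.pi * |s.im|))) := by
        gcongr
        exact (le_abs_self _).trans ((hC s.re hs).trans (le_max_left _ _))
    _ = _ := by
        rw [← Real.exp_add, ← Real.exp_add, ← Real.exp_add, hφ]
        congr 2
        ring

theorem separated_of_one_le_abs_im {s : ℂ} (hs : 1 ≤ |s.im|) (k : ℤ) : 1 / 2 ≤ ‖s - k‖ := by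
  have := Complex.abs_im_le_norm (s - k)
  simp only [Complex.sub_im, Complex.intCast_im, sub_zero] at this
  linarith

theorem half_pow_le_exp {n : ℕ} {x σ : ℝ} (h : σ - x ≤ n) :
    (1 / 2 : ℝ) ^ n ≤ Real.exp (-(Real.log 2 * σ)) * Real.exp (Real.log 2 * x) := by
  have hl : 0 < Real.log 2 := Real.log_pos (by norm_num)
  rw [← Real.exp_add, ← Real.exp_log (show (0 : ℝ) < 1 / 2 by norm_num), ← Real.exp_nat_mul, one_div,
    Real.log_inv]
  refine Real.exp_le_exp.2 ?_
  nlinarith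

/-- Shifting a point to the right into a strip of width one. -/
theorem exists_add_natCast_mem {x σ : ℝ} (h : x ≤ σ) :
    ∃ n : ℕ, x + n ∈ Icc σ (σ + 1) ∧ σ - x ≤ n := by
  refine ⟨⌈σ - x⌉₊, ⟨?_, ?_⟩, Nat.le_ceil _⟩
  · linarith [Nat.le_ceil (σ - x)]
  · linarith [Nat.ceil_lt_add_one (show 0 ≤ σ - x by linarith)]

/-- A point on the left is shifted by an integer into the strip, where Γ is estimated directly; the
recursion halves the integrand at each unit step, which gives the rate log 2. -/
theorem exists_bound_two_one (ν κ : ℕ) {Z : ℝ} (hZ : 0 < Z) {σ₀ : ℝ} (hσ₀ : 0 < σ₀) :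
    ∃ C : ℝ, 0 ≤ C ∧ ∀ s : ℂ, s.re ≤ σ₀ → 1 ≤ |s.im| →
      ‖meijerIntegrand ![(ν : ℝ), (κ : ℝ)] ![0] Z s‖ ≤
        C * Real.exp (Real.log 2 * s.re) * Real.exp (-(Real.pi / 4 * |s.im|)) := by
  obtain ⟨D, hD, hshift⟩ := exists_shift_bound_two_one ν κ hZ (σ₀ + 1)
  obtain ⟨C, hC, hstrip⟩ := exists_strip_bound_two_one ν κ hZ hσ₀
  refine ⟨D * Real.exp (-(Real.log 2 * σ₀)) * C, by positivity, fun s hs him => ?_⟩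
  obtain ⟨n, hn, hn2⟩ := exists_add_natCast_mem hs
  have hre : (s + n).re = s.re + n := by simp
  have him2 : (s + n).im = s.im := by simp
  have h1 := hshift (s + n) (separated_of_one_le_abs_im (by rwa [him2])) (by rw [hre]; exact hn.2) n
  have h2 := hstrip (s + n) (by rwa [hre]) (by rw [him2]; intro h0; simp [h0] at him; linarith)
  rw [add_sub_cancel_right] at h1
  rw [him2] at h2
  calc _ ≤ D * (1 / 2) ^ n * (C * Real.exp (-(Real.pi / 4 * |s.im|))) := h1.trans (by gcongr)
    _ ≤ D * (Real.exp (-(Real.log 2 * σ₀)) * Real.exp (Real.log 2 * s.re)) *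
        (C * Real.exp (-(Real.pi / 4 * |s.im|))) := by
        gcongr
        exact half_pow_le_exp hn2
    _ = _ := by ring

/-- The Meijer function `G^{2,0}_{0,3}` as an integral over a vertical line. -/
theorem meijerG_two_one_eq (ν κ : ℕ) {Z : ℝ} (hZ : 0 < Z) :
    meijerG ![(ν : ℝ), (κ : ℝ)] ![0] Z = (2 * Real.pi : ℂ)⁻¹ * ∫ t : ℝ,
      meijerIntegrand ![(ν : ℝ), (κ : ℝ)] ![0] Z
        ((1 + ∑ i, |![(ν : ℝ), (κ : ℝ)] i| : ℝ) + t * Complex.I) := by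
  rw [meijerG]
  set σ₀ : ℝ := 1 + ∑ i, |![(ν : ℝ), (κ : ℝ)] i| with hσ
  have hσ₀ : 0 < σ₀ := by
    have : 0 ≤ ∑ i, |![(ν : ℝ), (κ : ℝ)] i| := Finset.sum_nonneg fun i _ => abs_nonneg _
    linarith
  obtain ⟨C, hC, hb⟩ := exists_bound_two_one ν κ hZ hσ₀
  have hπ := Real.pi_pos
  rw [← integral_vertical_eq_loop (Real.log_pos one_lt_two) (by positivity : 0 < Real.pi / 4) hC
    (fun s _ him => ?_) (fun t => ?_) hb]
  · have := Complex.I_ne_zero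
    rw [mul_inv]
    field_simp
  · refine differentiableAt_meijerIntegrand_two_one ν κ hZ fun m h0 => ?_
    rw [h0] at him
    simp at him
    linarith
  · refine (differentiableAt_meijerIntegrand_two_one ν κ hZ fun m h0 => ?_).continuousAt
    have := congrArg Complex.re h0
    simp at this
    linarith [m.cast_nonneg (α := ℝ)]

/-! ### The Meijer function with one upper Gamma factor, by residues -/

theorem mul_integral_inv_affine {c d : ℂ} {l r : ℝ}
    (h : ∀ t ∈ uIcc l r, c + t * d ∈ Complex.slitPlane) :
    d * ∫ t in l..r, (c + t * d)⁻¹ = Complex.log (c + r * d) - Complex.log (c + l * d) := by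
  rw [← intervalIntegral.integral_const_mul]
  refine intervalIntegral.integral_eq_sub_of_hasDerivAt (f := fun t : ℝ => Complex.log (c + t * d))
    (fun t ht => ?_) ?_
  · have h1 : HasDerivAt (fun t : ℝ => c + t * d) d t := by
      simpa using ((hasDerivAt_id t).ofReal_comp.mul_const d).const_add c
    simpa [div_eq_mul_inv] using h1.clog_real (h t ht)
  · refine ContinuousOn.intervalIntegrable (continuousOn_const.mul (ContinuousOn.inv₀ (by fun_prop)
      fun t ht => Complex.slitPlane_ne_zero (h t ht)))

theorem log_sub_log_neg {z : ℂ} (hz : 0 < z.im) :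
    Complex.log z - Complex.log (-z) = Real.pi * Complex.I := by
  rw [Complex.log, Complex.log, Complex.arg_neg_eq_arg_sub_pi_of_im_pos hz, norm_neg]
  push_cast
  ring

/-- The boundary integral over `[a, β] × [-1, 1]`, counter-clockwise. -/
noncomputable def rectInt (a β : ℝ) (f : ℂ → ℂ) : ℂ :=
  (∫ x in a..β, f (x - Complex.I)) - (∫ x in a..β, f (x + Complex.I)) +
    Complex.I * (∫ y in (-1 : ℝ)..1, f (β + y * Complex.I)) -
    Complex.I * ∫ y in (-1 : ℝ)..1, f (a + y * Complex.I)

/-- Each edge contributes a difference of logarithms. On the left edge log(p - s) is used, because s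
- p crosses the cut there; the two changes of branch at the left corners contribute πi each. -/
theorem rectInt_inv_sub {a β p : ℝ} (hap : a < p) (hpβ : p < β) :
    rectInt a β (fun s => (s - p)⁻¹) = 2 * Real.pi * Complex.I := by
  have h1 := mul_integral_inv_affine (c := -Complex.I - p) (d := 1) (l := a) (r := β)
    fun t _ => Or.inr (by simp)
  have h2 := mul_integral_inv_affine (c := Complex.I - p) (d := 1) (l := a) (r := β)
    fun t _ => Or.inr (by simp)
  have h3 := mul_integral_inv_affine (c := β - p) (d := Complex.I) (l := -1) (r := 1)
    fun t _ => Or.inl (by simpa using hpβ)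
  have h4 := mul_integral_inv_affine (c := p - a) (d := -Complex.I) (l := -1) (r := 1)
    fun t _ => Or.inl (by simpa using hap)
  have e1 : ∀ x : ℝ, ((x : ℂ) - Complex.I - p)⁻¹ = (-Complex.I - p + x * 1)⁻¹ := fun x => by ring_nf
  have e2 : ∀ x : ℝ, ((x : ℂ) + Complex.I - p)⁻¹ = (Complex.I - p + x * 1)⁻¹ := fun x => by ring_nf
  have e3 : ∀ y : ℝ, ((β : ℂ) + y * Complex.I - p)⁻¹ = (β - p + y * Complex.I)⁻¹ :=
    fun y => by ring_nf
  have e4 : ∀ y : ℝ, ((a : ℂ) + y * Complex.I - p)⁻¹ = -(p - a + y * (-Complex.I))⁻¹ := fun y => by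
    rw [← inv_neg]
    ring_nf
  simp only [rectInt, e1, e2, e3, e4, intervalIntegral.integral_neg]
  rw [one_mul] at h1 h2
  have l1 := log_sub_log_neg (z := a - p + Complex.I) (by simp)
  have l2 := log_sub_log_neg (z := p - a + Complex.I) (by simp)
  rw [h1, h2, h3, mul_neg, ← neg_mul, h4]
  rw [show -Complex.I - (p : ℂ) + β * 1 = β - p + ((-1 : ℝ) : ℂ) * Complex.I by push_cast; ring,
    show Complex.I - (p : ℂ) + β * 1 = β - p + ((1 : ℝ) : ℂ) * Complex.I by push_cast; ring,
    show -Complex.I - (p : ℂ) + a * 1 = -(p - a + Complex.I) by ring,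
    show Complex.I - (p : ℂ) + a * 1 = a - p + Complex.I by ring,
    show (p : ℂ) - a + ((1 : ℝ) : ℂ) * -Complex.I = -(a - p + Complex.I) by push_cast; ring,
    show (p : ℂ) - a + ((-1 : ℝ) : ℂ) * -Complex.I = p - a + Complex.I by push_cast; ring]
  linear_combination l1 + l2

/-- The residue theorem for a rectangle and a simple pole. -/
theorem rectInt_div_sub {g : ℂ → ℂ} {a β p : ℝ} (hap : a < p) (hpβ : p < β)
    (hg : ∀ s : ℂ, s.re ∈ Icc a β → s.im ∈ Icc (-1) 1 → DifferentiableAt ℂ g s) :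
    rectInt a β (fun s => g s / (s - p)) = 2 * Real.pi * Complex.I * g p := by
  have hab : a < β := hap.trans hpβ
  -- The slope of g at p is holomorphic off p and continuous there, so its boundary integral
  -- vanishes; what remains is g(p) times the integral of 1/(s - p).
  set D : ℂ → ℂ := dslope g p with hD
  have hDc : ∀ s : ℂ, s.re ∈ Icc a β → s.im ∈ Icc (-1) 1 → ContinuousAt D s := by
    intro s h1 h2
    rcases eq_or_ne s p with h | h
    · rw [h]
      exact continuousAt_dslope_same.2 (hg p ⟨by simpa using hap.le, by simpa using hpβ.le⟩ (by simp))
    · exact (continuousAt_dslope_of_ne h).2 (hg s h1 h2).continuousAt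
  have hrect : rectInt a β D = 0 := by
    have h := Complex.integral_boundary_rect_eq_zero_of_differentiable_on_off_countable D
      (a - Complex.I) (β + Complex.I) {(p : ℂ)} (countable_singleton _) ?_ ?_
    · simpa [rectInt, ← sub_eq_add_neg] using h
    · intro s hs
      have h1 := hs.1
      have h2 := hs.2
      simp only [mem_preimage, Complex.sub_re, Complex.ofReal_re, Complex.I_re, sub_zero,
        Complex.add_re, add_zero, uIcc_of_le hab.le] at h1
      simp only [mem_preimage, Complex.sub_im, Complex.ofReal_im, Complex.I_im, zero_sub,
        Complex.add_im, zero_add, uIcc_of_le (show (-1 : ℝ) ≤ 1 by norm_num)] at h2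
      exact (hDc s h1 h2).continuousWithinAt
    · rintro s ⟨hs, hsp⟩
      have h1 := hs.1
      have h2 := hs.2
      simp only [mem_preimage, Complex.sub_re, Complex.ofReal_re, Complex.I_re, sub_zero,
        Complex.add_re, add_zero, min_eq_left hab.le, max_eq_right hab.le] at h1
      simp only [mem_preimage, Complex.sub_im, Complex.ofReal_im, Complex.I_im, zero_sub,
        Complex.add_im, zero_add, min_eq_left (show (-1 : ℝ) ≤ 1 by norm_num),
        max_eq_right (show (-1 : ℝ) ≤ 1 by norm_num)] at h2
      exact (differentiableAt_dslope_of_ne hsp).2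
        (hg s (Ioo_subset_Icc_self h1) (Ioo_subset_Icc_self h2))
  have hedge : ∀ (γ : ℝ → ℂ) (l r : ℝ), Continuous γ → (∀ t ∈ uIcc l r, (γ t).re ∈ Icc a β ∧
      (γ t).im ∈ Icc (-1) 1 ∧ γ t ≠ p) → ∫ t in l..r, g (γ t) / (γ t - p) =
      (∫ t in l..r, D (γ t)) + g p * ∫ t in l..r, (γ t - p)⁻¹ := by
    intro γ l r hγ hmem
    have hne : ∀ t ∈ uIcc l r, γ t - p ≠ 0 := fun t ht => sub_ne_zero.2 (hmem t ht).2.2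
    rw [← intervalIntegral.integral_const_mul, ← intervalIntegral.integral_add]
    · refine intervalIntegral.integral_congr fun t ht => ?_
      have := hne t ht
      simp only [hD]
      rw [dslope_of_ne _ (hmem t ht).2.2, slope_def_field]
      field_simp
      ring
    · refine ContinuousOn.intervalIntegrable fun t ht => ContinuousAt.continuousWithinAt ?_
      exact ContinuousAt.comp (f := γ) (hDc _ (hmem t ht).1 (hmem t ht).2.1) hγ.continuousAt
    · exact ContinuousOn.intervalIntegrable (continuousOn_const.mul
        (ContinuousOn.inv₀ (by fun_prop) hne))
  have him : ∀ z : ℂ, z.im ≠ 0 → z ≠ p := fun z hz h0 => hz (by simp [h0])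
  have hre : ∀ z : ℂ, z.re ≠ p → z ≠ p := fun z hz h0 => hz (by simp [h0])
  have h1 := hedge (fun x => x - Complex.I) a β (by fun_prop) fun t ht =>
    ⟨by simpa [uIcc_of_le hab.le] using ht, by simp, him _ (by simp)⟩
  have h2 := hedge (fun x => x + Complex.I) a β (by fun_prop) fun t ht =>
    ⟨by simpa [uIcc_of_le hab.le] using ht, by simp, him _ (by simp)⟩
  have h3 := hedge (fun y => β + y * Complex.I) (-1) 1 (by fun_prop) fun t ht =>
    ⟨by simpa using hab.le, by simpa [uIcc_of_le] using ht, hre _ (by simpa using hpβ.ne')⟩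
  have h4 := hedge (fun y => a + y * Complex.I) (-1) 1 (by fun_prop) fun t ht =>
    ⟨by simpa using hab.le, by simpa [uIcc_of_le] using ht, hre _ (by simpa using hap.ne)⟩
  have hinv := rectInt_inv_sub hap hpβ
  rw [rectInt] at hinv hrect ⊢
  rw [h1, h2, h3, h4]
  linear_combination hrect + g p * hinv

theorem rectInt_add {f : ℂ → ℂ} {a β β' : ℝ} (h1 : Continuous fun x : ℝ => f (x - Complex.I))
    (h2 : Continuous fun x : ℝ => f (x + Complex.I)) :
    rectInt a β f + rectInt β β' f = rectInt a β' f := by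
  simp only [rectInt]
  rw [← intervalIntegral.integral_add_adjacent_intervals (h1.intervalIntegrable a β)
    (h1.intervalIntegrable β β'), ← intervalIntegral.integral_add_adjacent_intervals
    (h2.intervalIntegrable a β) (h2.intervalIntegrable β β')]
  ring

theorem differentiableAt_meijerIntegrand_one_two (ν κ : ℕ) {Z : ℝ} (hZ : 0 < Z) {s : ℂ}
    (hs : ∀ m : ℕ, s ≠ -m) :
    DifferentiableAt ℂ (meijerIntegrand ![0] ![-(ν : ℝ), -(κ : ℝ)] Z) s := by
  have hZc : (Z : ℂ) ≠ 0 := Complex.ofReal_ne_zero.2 hZ.ne'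
  have e : meijerIntegrand ![0] ![-(ν : ℝ), -(κ : ℝ)] Z = fun s =>
      Complex.Gamma s * ((Complex.Gamma (1 + ν - s))⁻¹ * (Complex.Gamma (1 + κ - s))⁻¹) *
        (Z : ℂ) ^ (-s) := by
    funext s
    rw [meijerIntegrand_one_two, div_eq_mul_inv, mul_inv]
  have hI : ∀ n : ℕ, DifferentiableAt ℂ (fun s => (Complex.Gamma (1 + n - s))⁻¹) s := fun n =>
    DifferentiableAt.comp (g := fun s => (Complex.Gamma s)⁻¹) s
      (Complex.differentiable_one_div_Gamma _) (by fun_prop)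
  rw [e]
  exact ((Complex.differentiableAt_Gamma s hs).mul ((hI ν).mul (hI κ))).mul
    (DifferentiableAt.const_cpow (by fun_prop) (Or.inl hZc))

theorem meijerIntegrand_one_two_sub_one (ν κ : ℕ) {Z : ℝ} (hZ : 0 < Z) {s : ℂ}
    (hs : ∀ k : ℤ, s ≠ k) :
    meijerIntegrand ![0] ![-(ν : ℝ), -(κ : ℝ)] Z (s - 1) *
      ((s - ((1 + ν : ℤ) : ℂ)) * (s - ((1 + κ : ℤ) : ℂ)) * (s - ((1 : ℤ) : ℂ))) =
        Z * meijerIntegrand ![0] ![-(ν : ℝ), -(κ : ℝ)] Z s := by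
  have hZc : (Z : ℂ) ≠ 0 := Complex.ofReal_ne_zero.2 hZ.ne'
  have h1 : s - 1 ≠ 0 := fun h0 => hs 1 (by push_cast; linear_combination h0)
  have hG : Complex.Gamma s = (s - 1) * Complex.Gamma (s - 1) := by
    rw [← Complex.Gamma_add_one _ h1, sub_add_cancel]
  have hIn : ∀ n : ℕ, (1 + n - s ≠ 0) ∧ Complex.Gamma (1 + n - (s - 1)) =
      (1 + n - s) * Complex.Gamma (1 + n - s) ∧ Complex.Gamma (1 + n - s) ≠ 0 := by
    intro n
    have h2 : 1 + n - s ≠ 0 := fun h0 => hs (1 + n) (by push_cast; linear_combination -h0)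
    refine ⟨h2, ?_, Complex.Gamma_ne_zero fun m hm => hs (m + 1 + n) (by
      push_cast; linear_combination -hm)⟩
    rw [show 1 + (n : ℂ) - (s - 1) = (1 + n - s) + 1 by ring, Complex.Gamma_add_one _ h2]
  have hp : (Z : ℂ) ^ (-(s - 1)) = Z * (Z : ℂ) ^ (-s) := by
    rw [neg_sub, sub_eq_add_neg, Complex.cpow_add _ _ hZc, Complex.cpow_one]
  obtain ⟨a1, a2, a3⟩ := hIn ν
  obtain ⟨b1, b2, b3⟩ := hIn κ
  rw [meijerIntegrand_one_two, meijerIntegrand_one_two, hG, a2, b2, hp]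
  push_cast
  field_simp
  ring

theorem exists_shift_bound_one_two (ν κ : ℕ) {Z : ℝ} (hZ : 0 < Z) (A : ℝ) :
    ∃ D : ℝ, 0 ≤ D ∧ ∀ s : ℂ, (∀ k : ℤ, 1 / 2 ≤ ‖s - k‖) → s.re ≤ A → ∀ n : ℕ,
      ‖meijerIntegrand ![0] ![-(ν : ℝ), -(κ : ℝ)] Z (s - n)‖ ≤
        D * (1 / 2) ^ n * ‖meijerIntegrand ![0] ![-(ν : ℝ), -(κ : ℝ)] Z s‖ := by
  refine exists_shift_bound hZ.le (fun s hs => ?_) A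
  have h := congrArg norm (meijerIntegrand_one_two_sub_one ν κ hZ (ne_intCast_of_separated hs))
  rw [norm_mul, norm_mul, norm_mul, norm_mul, Complex.norm_real, Real.norm_of_nonneg hZ.le] at h
  refine bounds_of_mul_eq (norm_nonneg _) h (hs _) (hs _) (hs _) ?_
  rw [norm_sub_rev]
  simpa using Complex.re_le_norm (1 - s)

/-- Within the horizontal strip the recursion reduces everything to the compact rectangle [1, 2] ×
[-1, 1], where the integrand has no poles. -/
theorem exists_bound_one_two (ν κ : ℕ) {Z : ℝ} (hZ : 0 < Z) :
    ∃ C : ℝ, 0 ≤ C ∧ ∀ s : ℂ, (∀ k : ℤ, 1 / 2 ≤ ‖s - k‖) → s.re ≤ 1 → s.im ∈ Icc (-1) 1 →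
      ‖meijerIntegrand ![0] ![-(ν : ℝ), -(κ : ℝ)] Z s‖ ≤ C * Real.exp (Real.log 2 * s.re) := by
  obtain ⟨D, hD, hshift⟩ := exists_shift_bound_one_two ν κ hZ 2
  have hc : ContinuousOn (meijerIntegrand ![0] ![-(ν : ℝ), -(κ : ℝ)] Z)
      (Icc 1 2 ×ℂ Icc (-1) 1) := by
    intro s hs
    refine (differentiableAt_meijerIntegrand_one_two ν κ hZ fun m h0 => ?_).continuousAt.continuousWithinAt
    have h1 : 1 ≤ s.re := hs.1.1
    rw [h0] at h1
    simp at h1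
    linarith [m.cast_nonneg (α := ℝ)]
  obtain ⟨C, hC⟩ := (isCompact_Icc.reProdIm isCompact_Icc).exists_bound_of_continuousOn hc
  refine ⟨D * Real.exp (-(Real.log 2 * 1)) * max C 0, by positivity, fun s hsep hs him => ?_⟩
  obtain ⟨n, hn, hn2⟩ := exists_add_natCast_mem hs
  norm_num at hn
  have hre : (s + n).re = s.re + n := by simp
  have him2 : (s + n).im = s.im := by simp
  have h1 := hshift (s + n) (fun k => by
    have := hsep (k - n)
    push_cast at this
    rwa [sub_sub_eq_add_sub, add_sub_right_comm, ← add_sub_right_comm] at this)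
    (by rw [hre]; exact hn.2) n
  have h2 := hC (s + n) ⟨by simpa [hre] using hn, by simpa [him2] using him⟩
  rw [add_sub_cancel_right] at h1
  calc _ ≤ D * (1 / 2) ^ n * max C 0 := h1.trans (by
        gcongr
        exact h2.trans (le_max_left _ _))
    _ ≤ D * (Real.exp (-(Real.log 2 * 1)) * Real.exp (Real.log 2 * s.re)) * max C 0 := by
        gcongr
        exact half_pow_le_exp hn2
    _ = _ := by ring

theorem Gamma_add_natCast_add_one (n : ℕ) {s : ℂ} (hs : ∀ m : ℕ, s ≠ -m) :
    Complex.Gamma (s + n + 1) = (∏ k ∈ Finset.range n, (s + k)) * (s + n) * Complex.Gamma s := by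
  induction n with
  | zero =>
    have : s ≠ 0 := by simpa using hs 0
    simp [Complex.Gamma_add_one _ this]
  | succ n ih =>
    have h : s + (n + 1 : ℕ) ≠ 0 := fun h0 => hs (n + 1) (by linear_combination h0)
    rw [Complex.Gamma_add_one _ h, show s + ((n + 1 : ℕ) : ℂ) = s + n + 1 by push_cast; ring, ih,
      Finset.prod_range_succ]
    ring

theorem prod_range_neg_add (n : ℕ) :
    ∏ k ∈ Finset.range n, (-(n : ℂ) + k) = (-1) ^ n * (n.factorial : ℂ) := by
  rw [← Finset.prod_range_add_one_eq_factorial, Nat.cast_prod, ← Finset.prod_range_reflect]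
  rw [← Finset.card_range n, ← Finset.prod_const, Finset.card_range, ← Finset.prod_mul_distrib]
  refine Finset.prod_congr rfl fun j hj => ?_
  have : j + 1 ≤ n := Finset.mem_range.1 hj
  rw [Nat.sub_sub, add_comm 1 j, Nat.cast_sub this]
  push_cast
  ring

/-- The rectangle contains only the pole -n of Γ. The condition on β keeps out -n + 1, which is a
pole only for n ≥ 1. The functional equation writes Γ(s) as a function regular on the rectangle over
s + n. -/
theorem rectInt_meijerIntegrand_one_two (ν κ : ℕ) {Z : ℝ} (hZ : 0 < Z) (n : ℕ) {β : ℝ}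
    (hβ : -(n : ℝ) < β) (hβn : n = 0 ∨ β < -(n : ℝ) + 1) :
    rectInt (-(n : ℝ) - 1 / 2) β (meijerIntegrand ![0] ![-(ν : ℝ), -(κ : ℝ)] Z) =
      2 * Real.pi * Complex.I * ((-(Z : ℂ)) ^ n /
        ((n.factorial : ℂ) * ((n + κ).factorial : ℂ) * ((n + ν).factorial : ℂ))) := by
  have hZc : (Z : ℂ) ≠ 0 := Complex.ofReal_ne_zero.2 hZ.ne'
  set g : ℂ → ℂ := fun s => Complex.Gamma (s + n + 1) * (∏ k ∈ Finset.range n, (s + k))⁻¹ *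
    ((Complex.Gamma (1 + ν - s))⁻¹ * (Complex.Gamma (1 + κ - s))⁻¹) * (Z : ℂ) ^ (-s) with hg
  have hprod : ∀ s : ℂ, s.re ≤ β → (∏ k ∈ Finset.range n, (s + k)) ≠ 0 := by
    intro s hs
    refine Finset.prod_ne_zero_iff.2 fun k hk h0 => ?_
    have hk' : (k : ℝ) + 1 ≤ n := by exact_mod_cast Finset.mem_range.1 hk
    have h1 := congrArg Complex.re h0
    simp only [Complex.add_re, Complex.natCast_re, Complex.zero_re] at h1
    rcases hβn with h2 | h2
    · simp [h2] at hk
    · linarith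
  have hgd : ∀ s : ℂ, s.re ∈ Icc (-(n : ℝ) - 1 / 2) β → s.im ∈ Icc (-1) 1 →
      DifferentiableAt ℂ g s := by
    intro s hs _
    have hI : ∀ n : ℕ, DifferentiableAt ℂ (fun s => (Complex.Gamma (1 + n - s))⁻¹) s := fun n =>
      DifferentiableAt.comp (g := fun s => (Complex.Gamma s)⁻¹) s
        (Complex.differentiable_one_div_Gamma _) (by fun_prop)
    have hG : DifferentiableAt ℂ (fun s => Complex.Gamma (s + n + 1)) s :=
      DifferentiableAt.comp (g := Complex.Gamma) s (Complex.differentiableAt_Gamma _ fun m hm => by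
        have := congrArg Complex.re hm
        simp at this
        linarith [hs.1, m.cast_nonneg (α := ℝ)]) (by fun_prop)
    exact ((hG.mul (DifferentiableAt.inv (by fun_prop) (hprod s hs.2))).mul
      ((hI ν).mul (hI κ))).mul (DifferentiableAt.const_cpow (by fun_prop) (Or.inl hZc))
  have h := rectInt_div_sub (p := -(n : ℝ)) (by linarith) hβ hgd
  have hgval : g ((-(n : ℝ) : ℝ) : ℂ) = (-(Z : ℂ)) ^ n /
        ((n.factorial : ℂ) * ((n + κ).factorial : ℂ) * ((n + ν).factorial : ℂ)) := by
    have hf : ∀ j : ℕ, Complex.Gamma (1 + j - -(n : ℂ)) = ((n + j).factorial : ℂ) := by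
      intro j
      rw [← Complex.Gamma_nat_eq_factorial]
      congr 1
      push_cast
      ring
    have hs : ((-1 : ℂ) ^ n)⁻¹ = (-1) ^ n := by
      rw [← inv_pow]
      norm_num
    simp only [hg]
    push_cast
    rw [hf, hf, prod_range_neg_add, neg_add_cancel, zero_add, Complex.Gamma_one, neg_neg,
      Complex.cpow_natCast, neg_pow (Z : ℂ) n, mul_inv, hs]
    field_simp
  rw [hgval] at h
  rw [← h]
  have hfg : ∀ s : ℂ, (∀ m : ℕ, s ≠ -m) → meijerIntegrand ![0] ![-(ν : ℝ), -(κ : ℝ)] Z s =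
      g s / (s - ((-(n : ℝ) : ℝ) : ℂ)) := by
    intro s hs
    have h1 : (∏ k ∈ Finset.range n, (s + k)) ≠ 0 := Finset.prod_ne_zero_iff.2 fun k _ h0 =>
      hs k (by linear_combination h0)
    have h2 : s + n ≠ 0 := fun h0 => hs n (by linear_combination h0)
    rw [meijerIntegrand_one_two]
    simp only [hg]
    rw [Gamma_add_natCast_add_one n hs]
    push_cast
    rw [sub_neg_eq_add, div_eq_mul_inv (Complex.Gamma s), mul_inv]
    field_simp
  have him : ∀ z : ℂ, z.im ≠ 0 → ∀ m : ℕ, z ≠ -m := fun z hz m h0 => hz (by simp [h0])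
  have hrβ : ∀ z : ℂ, z.re = β → ∀ m : ℕ, z ≠ -m := by
    intro z hz m h0
    rw [h0] at hz
    simp only [Complex.neg_re, Complex.natCast_re] at hz
    have h1 : m < n := by
      have : (m : ℝ) < n := by linarith
      exact_mod_cast this
    rcases hβn with h2 | h2
    · omega
    · have : (m : ℝ) + 1 ≤ n := by exact_mod_cast h1
      linarith
  have hra : ∀ z : ℂ, z.re = -(n : ℝ) - 1 / 2 → ∀ m : ℕ, z ≠ -m := by
    intro z hz m h0
    rw [h0] at hz
    simp only [Complex.neg_re, Complex.natCast_re] at hz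
    have h1 : (2 * m : ℝ) = 2 * n + 1 := by linarith
    have h2 : 2 * m = 2 * n + 1 := by exact_mod_cast h1
    omega
  have e1 := fun x : ℝ => hfg (x - Complex.I) (him _ (by simp))
  have e2 := fun x : ℝ => hfg (x + Complex.I) (him _ (by simp))
  have e3 := fun y : ℝ => hfg (β + y * Complex.I) (hrβ _ (by simp))
  have e4 := fun y : ℝ => hfg ((-(n : ℝ) - 1 / 2 : ℝ) + y * Complex.I) (hra _ (by simp))
  simp only [rectInt, e1, e2, e3, e4]

/-- The Meijer function `G^{1,0}_{0,3}` as a hypergeometric series. -/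
theorem meijerG_one_two_eq (ν κ : ℕ) {Z : ℝ} (hZ : 0 < Z) :
    meijerG ![0] ![-(ν : ℝ), -(κ : ℝ)] Z = hyperSeries ν κ Z := by
  set f := meijerIntegrand ![0] ![-(ν : ℝ), -(κ : ℝ)] Z with hf
  have hσ : 1 + ∑ i : Fin 1, |(![0] : Fin 1 → ℝ) i| = 1 := by simp
  have him : ∀ z : ℂ, z.im ≠ 0 → ∀ m : ℕ, z ≠ -m := fun z hz m h0 => hz (by simp [h0])
  have hat : ∀ z : ℂ, z.im ≠ 0 → ContinuousAt f z := fun z hz =>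
    (differentiableAt_meijerIntegrand_one_two ν κ hZ (him z hz)).continuousAt
  have hc1 : Continuous fun x : ℝ => f (x - Complex.I) := continuous_iff_continuousAt.2 fun x =>
    ContinuousAt.comp (f := fun x : ℝ => (x - Complex.I : ℂ)) (hat _ (by simp)) (by fun_prop)
  have hc2 : Continuous fun x : ℝ => f (x + Complex.I) := continuous_iff_continuousAt.2 fun x =>
    ContinuousAt.comp (f := fun x : ℝ => (x + Complex.I : ℂ)) (hat _ (by simp)) (by fun_prop)
  -- Adjacent rectangles with left edges at negative half-integers are glued, each adding one term
  -- of the series.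
  have hsum : ∀ n : ℕ, rectInt (-(n : ℝ) - 1 / 2) 1 f = 2 * Real.pi * Complex.I *
      ∑ j ∈ Finset.range (n + 1), (-(Z : ℂ)) ^ j /
        ((j.factorial : ℂ) * ((j + κ).factorial : ℂ) * ((j + ν).factorial : ℂ)) := by
    intro n
    induction n with
    | zero =>
      rw [rectInt_meijerIntegrand_one_two ν κ hZ 0 (by norm_num) (Or.inl rfl)]
      simp
    | succ n ih =>
      rw [← rectInt_add (β := -(n : ℝ) - 1 / 2) hc1 hc2, ih, Finset.sum_range_succ _ (n + 1), mul_add,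
        add_comm, rectInt_meijerIntegrand_one_two ν κ hZ (n + 1) (by push_cast; linarith)
        (Or.inr (by push_cast; linarith))]
  obtain ⟨C, hC, hb⟩ := exists_bound_one_two ν κ hZ
  have hl : 0 < Real.log 2 := Real.log_pos one_lt_two
  have hi : ∀ τ : ℝ, |τ| = 1 → IntegrableOn (fun x : ℝ => f (x + τ * Complex.I)) (Iic 1) := by
    intro τ hτ
    refine integrableOn_horizontal hl (fun s _ h2 => hat s ?_) fun s h1 h2 =>
      hb s (separated_of_one_le_abs_im (by rw [h2, hτ])) h1 (by rw [h2]; exact abs_le.1 hτ.le)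
    rw [h2]
    intro h0
    simp [h0] at hτ
  have hi1 : IntegrableOn (fun x : ℝ => f (x - Complex.I)) (Iic 1) := by
    simpa [← sub_eq_add_neg] using hi (-1) (by simp)
  have hi2 : IntegrableOn (fun x : ℝ => f (x + Complex.I)) (Iic 1) := by
    simpa using hi 1 (by simp)
  have hat : Tendsto (fun n : ℕ => -(n : ℝ) - 1 / 2) atTop atBot :=
    tendsto_atBot_add_const_right _ _ (tendsto_neg_atTop_atBot.comp tendsto_natCast_atTop_atTop)
  -- Left edges at -n - 1/2 stay at distance 1/2 from all integers, so the exponential bound applies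
  -- and they vanish in the limit.
  have t4 : Tendsto (fun n : ℕ => ∫ y in (-1 : ℝ)..1,
      f ((-(n : ℝ) - 1 / 2 : ℝ) + y * Complex.I)) atTop (𝓝 0) := by
    have hexp : Tendsto (fun n : ℕ => C * Real.exp (Real.log 2 * (-(n : ℝ) - 1 / 2)) * |1 - -1|)
        atTop (𝓝 0) := by
      have := (Real.tendsto_exp_atBot.comp (hat.const_mul_atBot hl)).const_mul C
      simpa using this.mul_const |(1 : ℝ) - -1|
    refine squeeze_zero_norm (fun n => ?_) hexp
    refine intervalIntegral.norm_integral_le_of_norm_le_const fun y hy => ?_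
    rw [uIoc_of_le (by norm_num)] at hy
    refine (hb _ (fun k => ?_) ?_ ?_).trans (by simp)
    · refine le_trans ?_ (Complex.abs_re_le_norm _)
      simp only [Complex.sub_re, Complex.add_re, Complex.ofReal_re, Complex.mul_re, Complex.I_re,
        mul_zero, Complex.ofReal_im, Complex.I_im, mul_one, sub_self, add_zero, Complex.intCast_re]
      rcases le_or_gt 0 ((n : ℤ) + k) with h | h
      · have : (0 : ℝ) ≤ n + k := by exact_mod_cast h
        rw [abs_of_neg (by linarith)]
        linarith
      · have : (n : ℝ) + k ≤ -1 := by exact_mod_cast (by omega : (n : ℤ) + k ≤ -1)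
        rw [abs_of_nonneg (by linarith)]
        linarith
    · simp
      linarith [n.cast_nonneg (α := ℝ)]
    · simpa using Ioc_subset_Icc_self hy
  have hlim := (((intervalIntegral_tendsto_integral_Iic 1 hi1 hat).sub
    (intervalIntegral_tendsto_integral_Iic 1 hi2 hat)).add (tendsto_const_nhds
      (x := Complex.I * (∫ y in (-1 : ℝ)..1, f ((1 : ℝ) + y * Complex.I))))).sub
    (t4.const_mul Complex.I)
  have hlim2 : Tendsto (fun n : ℕ => rectInt (-(n : ℝ) - 1 / 2) 1 f) atTop
      (𝓝 (2 * Real.pi * Complex.I * hyperSeries ν κ Z)) := by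
    simp only [hsum]
    exact (((hasSum_hyperSeries ν κ Z).tendsto_sum_nat).comp (tendsto_add_atTop_nat 1)).const_mul _
  have heq := tendsto_nhds_unique hlim hlim2
  rw [meijerG, hσ, ← hf, inv_mul_eq_iff_eq_mul₀ Complex.two_pi_I_ne_zero, ← heq]
  ring

/-! ### Conclusion -/

/-- The kernel without parameters is the Meijer kernel. -/
theorem xiKernel_elim0_eq_kernelMeijer (κ ν : ℕ) {X b x y : ℝ} (hX : 0 < X) (hXb : X < b)
    (hx : 0 < x) (hy : 0 < y) :
    xiKernel κ ν (Fin.elim0 : Fin 0 → ℝ) b X x y = kernelMeijer ν κ x y := by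
  have hσ : 0 < 1 + ∑ i, |![(ν : ℝ), (κ : ℝ)] i| := by
    have : 0 ≤ ∑ i, |![(ν : ℝ), (κ : ℝ)] i| := Finset.sum_nonneg fun i _ => abs_nonneg _
    linarith
  rw [xiKernel_elim0 κ ν hX hXb hy, kernelMeijer, intervalIntegral.integral_of_le zero_le_one]
  refine setIntegral_congr_fun measurableSet_Ioc fun w hw => ?_
  have hw0 : 0 < w := hw.1
  have hwc : (w : ℂ) ^ ν ≠ 0 := pow_ne_zero _ (Complex.ofReal_ne_zero.2 hw0.ne')
  have hm : (-1 : ℂ) ^ ν * (-1) ^ ν = 1 := by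
    rw [← mul_pow]
    norm_num
  rw [xiInt_mellinH_mul_exp ν κ hσ hX hw0 hy, ← meijerG_two_one_eq ν κ (mul_pos hw0 hy),
    meijerG_one_two_eq ν κ (mul_pos hw0 hx), neg_pow (w : ℂ) ν, Complex.ofReal_mul]
  field_simp
  -- The signs (-1)^ν from the hypergeometric factor and from the reflection formula cancel.
  linear_combination (hyperSeries ν κ (w * x) * meijerG ![(ν : ℝ), (κ : ℝ)] ![0] (w * y)) * hm

theorem exists_xiKernel_eq_kernelMeijer_add (κ ν : ℕ) {m : ℕ} {θ : Fin m → ℝ} {Θ X b : ℝ}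
    (hΘ0 : 0 < Θ) (hθ : ∀ k, -θ k ∈ Icc 0 Θ) (hΘX : Θ < X) (hXb : X < b) :
    ∃ f g : Fin m → ℝ → ℂ, ∀ x y : ℝ, 0 < x → 0 < y →
      xiKernel κ ν θ b X x y = kernelMeijer ν κ x y + ∑ i, f i x * g i y := by
  obtain ⟨f, g, h⟩ := exists_xiKernel_eq_add_sum κ ν hΘ0 hΘX hXb θ hθ
  refine ⟨f, g, fun x y hx hy => ?_⟩
  rw [h x y hy, xiKernel_elim0_eq_kernelMeijer κ ν (hΘ0.trans hΘX) hXb hx hy]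

/-- Positivity of q bounds the quotient by 1/N, which tends to 0. Thus the singular points -θ_k lie
on [0, ∞), where the curve is built to enclose them. -/
theorem nonpos_of_tendsto_one_sub_div {q : ℕ → ℝ} {q₀ t : ℝ} (hq₀ : 0 < q₀)
    (hq : ∀ᶠ N in atTop, 0 < q N)
    (h : Tendsto (fun N : ℕ => (1 - q N / q₀) / (N : ℝ)) atTop (𝓝 t)) : t ≤ 0 := by
  refine le_of_tendsto_of_tendsto h tendsto_one_div_atTop_nhds_zero_nat ?_
  filter_upwards [hq] with N hN
  gcongr
  have : 0 < q N / q₀ := by positivity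
  linarith

theorem theorem8 (ν κ m : ℕ) (α q₀ : ℝ) (hα : 0 < α) (hq₀ : 0 < q₀)
    (q : ℕ → ℕ → ℝ)
    (hq_pos : ∀ N l, l < N + ν → 0 < q N l)
    (hq_deg : ∀ N l, m ≤ l → l < N + ν → q N l = q₀)
    (θ : Fin m → ℝ)
    (hθ : ∀ k : Fin m,
      Tendsto (fun N : ℕ => (1 - q N k / q₀) / (N : ℝ)) atTop (𝓝 (θ k)))
    (r c R : ℕ → ℝ)
    (hcont : ∀ N, AdmissibleContours α (q N) (N + ν) (r N) (c N) (R N))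
    (ρ a b : ℝ) (hρ : 0 < ρ) (ha : 0 < a) (haθ : ∀ k, |θ k| < a) (hab : a < b) :
    ∃ K : ℝ → ℝ → ℂ,
      (∀ x y : ℝ, 0 < x → 0 < y →
        Tendsto (fun N : ℕ => ((1 / (α * q₀ * N) : ℝ) : ℂ) *
            kernelIndep κ N (N + ν) α (q N) (r N) (c N) (R N)
              (x / (α * q₀ * N)) (y / (α * q₀ * N)) *
            ((x / y : ℝ) : ℂ) ^ (-(κ : ℤ)))
          atTop (𝓝 (K x y))) ∧
      (∀ x y : ℝ, 0 < x → 0 < y →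
        (∀ ε : ℝ, 0 < ε → ∀ s : ℂ, ‖s‖ = ρ →
          IntegrableOn (integrandI κ ν θ a b ε x y s) (Ioi 0)) ∧
        Tendsto (fun ε : ℝ => transformI κ ν θ ρ a b ε x y) (𝓝[>] 0) (𝓝 (K x y))) ∧
      (ν + Nat.card {k : Fin m // θ k = 0} ≤ 2 * κ + 1 + m →
        ∀ x y : ℝ, 0 < x → 0 < y →
          (∀ s : ℂ, ‖s‖ = ρ → IntegrableOn (integrandI κ ν θ a b 0 x y s) (Ioi 0)) ∧
          K x y = transformI κ ν θ ρ a b 0 x y) ∧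
      (∃ f g : Fin m → ℝ → ℂ, ∀ x y : ℝ, 0 < x → 0 < y →
        K x y = kernelMeijer ν κ x y + ∑ i, f i x * g i y) := by
  -- The whole proof lives in the gaps max |θ_k| < Θ < X < a < b; Θ also exists for m = 0 because a
  -- > 0.
  obtain ⟨Θ, hΘ0, hΘa, hΘ⟩ : ∃ Θ : ℝ, 0 < Θ ∧ Θ < a ∧ ∀ k, |θ k| < Θ := by
    have h1 : ∀ᶠ t in 𝓝[<] a, ∀ k, |θ k| < t := eventually_all.2 fun k =>
      (eventually_gt_nhds (haθ k)).filter_mono nhdsWithin_le_nhds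
    have h2 : ∀ᶠ t in 𝓝[<] a, 0 < t := (eventually_gt_nhds ha).filter_mono nhdsWithin_le_nhds
    obtain ⟨t, ht1, ht2, ht3⟩ := (h1.and (h2.and self_mem_nhdsWithin)).exists
    exact ⟨t, ht2, ht3, ht1⟩
  obtain ⟨X, hΘX, hXa⟩ := exists_between hΘa
  have hθ0 : ∀ k, -θ k ∈ Icc 0 Θ := by
    intro k
    have h1 : ∀ᶠ N : ℕ in atTop, 0 < q N k := by
      filter_upwards [eventually_ge_atTop m] with N hN
      exact hq_pos N k (by have := k.2; omega)
    exact ⟨by linarith [nonpos_of_tendsto_one_sub_div hq₀ h1 (hθ k)],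
      (neg_le_abs _).trans (hΘ k).le⟩
  have hlim := fun x y (hy : (0 : ℝ) < y) =>
    tendsto_transformI (κ := κ) (ν := ν) (x := x) hρ hΘ0 hθ0 hΘX hXa hab hy
  refine ⟨xiKernel κ ν θ b X, fun x y hx hy => ?_, fun x y _ hy => ⟨fun ε hε s _ => ?_, hlim x y hy⟩,
    fun hn x y _ hy => ?_, ?_⟩
  · exact tendsto_rescaled_kernelIndep ν κ m hα hq₀ hq_pos hq_deg hθ hcont hΘ0 hΘ hΘX
      (hXa.trans hab) hx hy
  · exact integrableOn_integrandI_of_pos hΘ0 hθ0 hΘa hab hy hε s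
  · obtain ⟨h1, h2⟩ := integrandI_zero_spec (κ := κ) (x := x) hρ hΘ0 hθ0 hΘa hab hy hn
    exact ⟨h1, tendsto_nhds_unique (hlim x y hy) h2⟩
  · exact exists_xiKernel_eq_kernelMeijer_add κ ν hΘ0 hθ0 hΘX (hXa.trans hab)
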